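/- **Theorem 1.3.** Let $V$ be a positive definite quadratic space over $\mathbb{Q}$ with quadratic form $Q$ and bilinear form $B$, $2B(x,y)=Q(x+y)-Q(x)-Q(y)$. Let $L=\mathbb{Z}e_0+\mathbb{Z}e_1$ be a lattice of rank $2$ on $V$ with $Q(xe_0+ye_1)=ax^2+bxy+cy^2$, $a,b,c\in\mathbb{Z}$, and let $d_L=\det(B(e_i,e_j))$. Suppose that $D=-4d_L=b^2-4ac$ is the discriminant of the imaginary quadratic field $F=\mathbb{Q}(\sqrt{D})=\mathbb{Q}(\sqrt d)$, where $d<0$ is a square-free integer. Let $R$ be the ring of integers of $F$, $\mathrm{Cl}_F$ its class group, $\zeta_F$ its Dedekind zeta function, and let the bar be complex conjugation. Write $O(V)$ for the orthogonal group, $O^+(V)=O(V)\cap \mathrm{SL}(V)$ and $O^-(V)=O(V)\setminus O^+(V)$. Let $\zeta_L(s)=\sum_{m\ge1}a_m m^{-s}$ and $\zeta_L^{+}(s)=\sum_{m\ge 1}a_m^+m^{-s}$, where $a_m$ (resp. $a_m^+$) is the number of $O(V)$-inequivalent (resp. $O^+(V)$-inequivalent) sublattices of index $m$ in $L$. For $\rho\in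 O(V)$ of finite order put $$Z_{L,\rho}(s)=\sum_{K\subseteq L,\ \rho(K)=K}\frac{|L:K|^{-s}}{\#\{\sigma\in O(V):\sigma(K)\subseteq L\}},$$ the sum being over sublattices $K$ of finite index, and let $$\mathrm{Rot}_L(s)=\sum_{\rho\in O^+(V),\ \rho\text{ of finite order}}Z_{L,\rho}(s),\qquad \mathrm{Refl}_L(s)=\sum_{\rho\in O^-(V)}Z_{L,\rho}(s).$$ Let $\zeta_{\mathbb{Z}^2}(s)=\sum_{K}|\mathbb{Z}^2:K|^{-s}$, over all subgroups $K\le\mathbb{Z}^2$ of finite index. Then $I=\mathbb{Z}a+\mathbb{Z}\frac{b-\sqrt{D}}{2}$ is an ideal of $R$, and for every complex $s$ with $\Re(s)>2$ the series $\zeta_L(s)$, $\zeta_L^+(s)$, $Z_{L,\rho}(s)$ ($\rho\in O(V)$ of finite order) and $\mathrm{Refl}_L(s)$ converge absolutely and $$\zeta_L(s)=\mathrm{Rot}_L(s)+\mathrm{Refl}_L(s).$$ In the formulas below $J$ runs over the nonzero ideals of $R$ contained in $I$, $[J]$ is the class of $J$ in $\mathrm{Cl}_F$, and all sets are sets of ideal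 classes. The rotational part is $$\mathrm{Rot}_L(s)=\tfrac12\zeta^+_L(s)+\frac{\zeta_{\mathbb{Z}^2}(s)}{2\zeta_F(s)}\sum_{n=1}^\infty\frac{\#\left(\{[J]:|I:J|=n\}\setminus\{[\overline J]:|I:J|=n\}\right)}{n^s}.$$ For the reflection part, let $P(s)=\prod_{r\mid D}(1+r^{-s})$, the product being over the primes $r$ ramified in $F$, let $\mathcal{R}\le\mathrm{Cl}_F$ be the subgroup generated by the classes of all prime ideals $\gamma$ with $\gamma^2=(r)$, $r$ a ramified prime, let $\mathcal{O}\le\mathcal{R}$ be the subgroup generated by those with $r\ne2$, and put $$S(s)=\frac{(1-2^{-s}+2\cdot2^{-2s})\zeta(s)^2}{2\zeta(2s)P(s)}\sum_{n=1}^\infty\frac{\#\{[J]:|I:J|=n,\ [J]=[\overline J]\}}{n^s}.$$ 1. If $d=-3$, then $\mathrm{Refl}_L(s)=\frac12(1-2^{-s}+2\cdot2^{-2s})\,\zeta(s)^2\prod_{p\equiv1\,(3)}(1+p^{-s})$. 2. If $d=-1$, then $\mathrm{Refl}_L(s)=\frac12(1+2^{-2s})\,\zeta(s)^2\prod_{p\equiv1\,(4)}(1+p^{-s})$.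 3. If $d\equiv1\pmod 4$ and $d\neq-3$, then $\mathrm{Refl}_L(s)=S(s)$. 4. If $d\equiv2\pmod 4$, then $$\mathrm{Refl}_L(s)=S(s)+\frac{(2^{-s}-2^{-2s})\zeta(s)^2}{\zeta(2s)P(s)}\sum_{n=1}^\infty\frac{\#\{[J]\in\mathcal{R}:|I:J|=n\}}{n^s}.$$ 5. If $d\equiv3\pmod 4$ and $d\ne-1$, then $$\mathrm{Refl}_L(s)=S(s)+\frac{2^{-s}\zeta(s)^2}{\zeta(2s)P(s)}\sum_{n=1}^\infty\frac{\#\{[J]\in\mathcal{O}:|I:J|=n\}}{n^s}-\frac{2^{-2s}\zeta(s)^2}{\zeta(2s)P(s)}\sum_{n=1}^\infty\frac{\#\{[J]\in\mathcal{R}\setminus\mathcal{O}:|I:J|=n\}}{n^s}.$$ Products over $p$ in 1 and 2 are over primes $p$. -/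

import Mathlib

open scoped NumberField nonZeroDivisors

noncomputable section

namespace SubformZeta

section Lattice

variable {V : Type*} [AddCommGroup V] [Module ℚ V]

/-- The bilinear form `B` of the quadratic form `Q`: `2 B(x, y) = Q(x + y) - Q(x) - Q(y)`. -/
def bil (Q : QuadraticForm ℚ V) (x y : V) : ℚ := QuadraticMap.polar Q x y / 2

/-- The Gram matrix `(B(eᵢ, eⱼ))` of a lattice with respect to a basis `e`. -/
def gramMatrix (Q : QuadraticForm ℚ V) (e : Fin 2 → V) : Matrix (Fin 2) (Fin 2) ℚ :=
  Matrix.of fun i j => bil Q (e i) (e j)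

/-- The orthogonal group `O(V)`. -/
def orthogonalGroup (Q : QuadraticForm ℚ V) : Subgroup (V ≃ₗ[ℚ] V) where
  carrier := {σ | ∀ x y, bil Q (σ x) (σ y) = bil Q x y}
  mul_mem' := fun {σ τ} hσ hτ x y => by
    simpa using (hσ (τ x) (τ y)).trans (hτ x y)
  one_mem' := fun x y => by simp
  inv_mem' := fun {σ} hσ x y => by
    have h := hσ (σ⁻¹ x) (σ⁻¹ y)
    have h1 : ∀ z, σ (σ⁻¹ z) = z := fun z => σ.apply_symm_apply z
    rw [h1, h1] at h
    exact h.symm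

/-- The group of rotations `O⁺(V) = O(V) ∩ SL(V)`. -/
def rotationGroup (Q : QuadraticForm ℚ V) : Subgroup (V ≃ₗ[ℚ] V) :=
  orthogonalGroup Q ⊓ (LinearEquiv.det : (V ≃ₗ[ℚ] V) →* ℚˣ).ker

/-- The set of reflections `O⁻(V) = O(V) ∖ O⁺(V)`. -/
def reflectionSet (Q : QuadraticForm ℚ V) : Set (V ≃ₗ[ℚ] V) :=
  (orthogonalGroup Q : Set (V ≃ₗ[ℚ] V)) \ (rotationGroup Q : Set (V ≃ₗ[ℚ] V))

/-- The image `σ(K)`. -/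
def image (σ : V ≃ₗ[ℚ] V) (K : AddSubgroup V) : AddSubgroup V :=
  K.map (σ : V →ₗ[ℚ] V).toAddMonoidHom

/-- The set of sublattices of `L` of index `m` (used for `m ≥ 1`). -/
def sublattices (L : AddSubgroup V) (m : ℕ) : Set (AddSubgroup V) :=
  {K | K ≤ L ∧ K.relIndex L = m}

/-- The class of `K` under a group `G` of linear automorphisms: all `σ(K)` with `σ ∈ G`. -/
def cls (G : Subgroup (V ≃ₗ[ℚ] V)) (K : AddSubgroup V) : Set (AddSubgroup V) :=
  {M | ∃ σ ∈ G, image σ K = M}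

/-- The number of `G`-inequivalent sublattices of `L` of index `m`. For `G = O(V)` this
is `a_m(L)`, for `G = O⁺(V)` it is `a_m⁺(L)`. -/
def numClasses (G : Subgroup (V ≃ₗ[ℚ] V)) (L : AddSubgroup V) (m : ℕ) : ℕ :=
  (cls G '' sublattices L m).ncard

/-- The zeta function of isometry classes of `L`. -/
def glZeta (Q : QuadraticForm ℚ V) (L : AddSubgroup V) (s : ℂ) : ℂ :=
  LSeries (fun m => (numClasses (orthogonalGroup Q) L m : ℂ)) s

/-- The zeta function of proper isometry classes of `L`. -/
def slZeta (Q : QuadraticForm ℚ V) (L : AddSubgroup V) (s : ℂ) : ℂ :=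
  LSeries (fun m => (numClasses (rotationGroup Q) L m : ℂ)) s

/-- The sublattices `K` of finite index in `L` with `ρ(K) = K`. -/
def invariantSublattices (L : AddSubgroup V) (ρ : V ≃ₗ[ℚ] V) : Set (AddSubgroup V) :=
  {K | K ≤ L ∧ K.relIndex L ≠ 0 ∧ image ρ K = K}

/-- The summand `|L : K|^{-s} / #{σ ∈ O(V) : σ(K) ⊆ L}`. -/
def zTerm (Q : QuadraticForm ℚ V) (L : AddSubgroup V) (s : ℂ) (K : AddSubgroup V) : ℂ :=
  (K.relIndex L : ℂ) ^ (-s) /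
    ({σ : V ≃ₗ[ℚ] V | σ ∈ orthogonalGroup Q ∧ image σ K ≤ L}.ncard : ℂ)

/-- The term `Z_{L,ρ}(s)`: a rotational term for `ρ ∈ O⁺(V)`, a reflection term for
`ρ ∈ O⁻(V)`. -/
def zSum (Q : QuadraticForm ℚ V) (L : AddSubgroup V) (ρ : V ≃ₗ[ℚ] V) (s : ℂ) : ℂ :=
  ∑' K : invariantSublattices L ρ, zTerm Q L s K

/-- `Rot_L(s)`, the sum of all rotational terms `Z_{L,ρ}(s)`, `ρ ∈ O⁺(V)` of finite order. -/
def rot (Q : QuadraticForm ℚ V) (L : AddSubgroup V) (s : ℂ) : ℂ :=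
  ∑' ρ : {ρ : V ≃ₗ[ℚ] V // ρ ∈ rotationGroup Q ∧ IsOfFinOrder ρ}, zSum Q L ρ s

/-- `Refl_L(s)`, the sum of all reflection terms `Z_{L,ρ}(s)`, `ρ ∈ O⁻(V)`. -/
def refl (Q : QuadraticForm ℚ V) (L : AddSubgroup V) (s : ℂ) : ℂ :=
  ∑' ρ : reflectionSet Q, zSum Q L ρ s

end Lattice

/-- `ζ_{ℤ²}(s)`, the sum of `|ℤ² : K|^{-s}` over all subgroups `K ≤ ℤ²` of finite index. -/
def zetaZ2 (s : ℂ) : ℂ :=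
  ∑' K : {K : AddSubgroup (Fin 2 → ℤ) // K.index ≠ 0}, (K.1.index : ℂ) ^ (-s)

section Field

variable {F : Type*} [Field F] [NumberField F]

/-- An ideal of the ring of integers, regarded as an additive subgroup of the field. -/
def toLattice (I : Ideal (𝓞 F)) : AddSubgroup F :=
  I.toAddSubgroup.map (algebraMap (𝓞 F) F).toAddMonoidHom

/-- The image `J̄` of an ideal under an automorphism `c` of the field. -/
def conjIdeal (c : F ≃ₐ[ℚ] F) (J : Ideal (𝓞 F)) : Ideal (𝓞 F) :=
  J.map (NumberField.RingOfIntegers.mapRingEquiv (c : F ≃+* F))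

/-- The (nonzero) ideals `J ≤ I` with `|I : J| = n`. -/
def idealsOfIndex (I : Ideal (𝓞 F)) (n : ℕ) : Set (Ideal (𝓞 F))⁰ :=
  {J | (J : Ideal (𝓞 F)) ≤ I ∧
    (J : Ideal (𝓞 F)).toAddSubgroup.relIndex I.toAddSubgroup = n}

/-- The set of ideal classes `{[J] : J ≤ I, |I : J| = n}`. -/
def classes (I : Ideal (𝓞 F)) (n : ℕ) : Set (ClassGroup (𝓞 F)) :=
  ClassGroup.mk0 '' idealsOfIndex I n

/-- The set of ideal classes `{[J̄] : J ≤ I, |I : J| = n}`. -/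
def conjClasses (c : F ≃ₐ[ℚ] F) (I : Ideal (𝓞 F)) (n : ℕ) : Set (ClassGroup (𝓞 F)) :=
  {g | ∃ J ∈ idealsOfIndex I n, ∃ J' : (Ideal (𝓞 F))⁰,
    (J' : Ideal (𝓞 F)) = conjIdeal c J ∧ g = ClassGroup.mk0 J'}

/-- The set of ideal classes `{[J] : J ≤ I, |I : J| = n, [J] = [J̄]}`. -/
def selfConjClasses (c : F ≃ₐ[ℚ] F) (I : Ideal (𝓞 F)) (n : ℕ) :
    Set (ClassGroup (𝓞 F)) :=
  {g | ∃ J ∈ idealsOfIndex I n, ∃ J' : (Ideal (𝓞 F))⁰,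
    (J' : Ideal (𝓞 F)) = conjIdeal c J ∧ g = ClassGroup.mk0 J ∧ g = ClassGroup.mk0 J'}

variable (F) in
/-- The rational primes that ramify in `F`, i.e. the primes dividing the discriminant. -/
def ramifiedPrimes : Finset ℕ := (NumberField.discr F).natAbs.primeFactors

variable (F) in
/-- The subgroup of the class group generated by the classes of the prime ideals `γ` with
`γ² = (r)`, for the ramified primes `r` in the set `S`. -/
def ramifiedSubgroup (S : Set ℕ) : Subgroup (ClassGroup (𝓞 F)) :=
  Subgroup.closure {g | ∃ r ∈ ramifiedPrimes F, r ∈ S ∧ ∃ γ : (Ideal (𝓞 F))⁰,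
    (γ : Ideal (𝓞 F)).IsPrime ∧ (γ : Ideal (𝓞 F)) ^ 2 = Ideal.span {(r : 𝓞 F)} ∧
      g = ClassGroup.mk0 γ}

variable (F) in
/-- `[𝓘_ram]`: the subgroup generated by the classes of all ramified prime ideals. -/
def ramGroup : Subgroup (ClassGroup (𝓞 F)) := ramifiedSubgroup F Set.univ

variable (F) in
/-- `[𝓘_ortho]` for `d ≡ 3 mod 4`: the subgroup generated by the classes of all ramified
prime ideals except the one above `2`. -/
def orthoGroup : Subgroup (ClassGroup (𝓞 F)) := ramifiedSubgroup F {r | r ≠ 2}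

variable (F) in
/-- The finite product of `1 + r^{-s}` over the ramified primes `r`. -/
def ramifiedProduct (s : ℂ) : ℂ := ∏ r ∈ ramifiedPrimes F, (1 + (r : ℂ) ^ (-s))

/-- The Dirichlet series of the cardinalities of a sequence of sets of ideal classes. -/
def classSeries (A : ℕ → Set (ClassGroup (𝓞 F))) (s : ℂ) : ℂ :=
  LSeries (fun n => ((A n).ncard : ℂ)) s

end Field

/-- The product of `1 + p^{-s}` over the primes `p ≡ 1 mod k`. -/
def oneModProduct (k : ℕ) (s : ℂ) : ℂ :=
  ∏' p : {p : ℕ // p.Prime ∧ p ≡ 1 [MOD k]}, (1 + (p : ℂ) ^ (-s))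

end SubformZeta

end

/-! Give each sublattice `K` of `L` the weight #{σ : σ(K) = K} / #{σ : σ(K) ⊆ L}, with σ in `O(V)`.
By orbit and stabilizer the weights of the lattices in one isometry class add up to 1, so the
weighted sum of `|L : K|^{-s}` is `ζ_L(s)` (`hasSum_numClasses`). Splitting the stabilizer into
rotations and reflections, and exchanging the sum over `K` with the sum over `ρ`, gives the
decomposition (`hasSum_zSum`).

Sending `e₀, e₁` to `a, (b - √D)/2` turns `V` into `F` with `aQ` as the norm, `L` into the ideal
`I`, and the isometries into `z ↦ uz` and `z ↦ u z̄` with `u` of norm one. Whether such a map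
carries `K` into `I` depends only on the ideal `J = RK` generated by `K` (`hull`). The number of
these `u` is `w ν([J])` for rotations and `w ν([J]⁻¹)` for reflections, where `w` is the number of
norm one elements of `R` and `ν(g)` counts the ideals in `I` of index `|I : J|` and class `g`
(`ncard_embRot`, `ncard_embRefl`).

So lattices are grouped by `RK`. The sum of `|J : K|^{-s}` over the `K` with `RK = J` does not
depend on `J`: all lattices in `J` together give `ζ_{ℤ²}(s)`, they split up according to `RK = JA`,
and this triangular system determines the parts recursively (`HullSystem.prim_eq`). Hence each part
equals `ζ_{ℤ²}(s) / ζ_F(s)`. Dividing by `ν` turns sums over ideals into sums over classes. In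
`Rot_L - ½ ζ_L⁺` the class `g` contributes `ν(g) / (ν(g) + ν(g⁻¹)) - ½`; the contributions of `g`
and `g⁻¹` cancel when both classes occur, and `½` remains when `g⁻¹` does not (`sum_div_add_inv`).

The reflection part repeats this with lattices invariant under one reflection of `J`. Then `A` is
self-conjugate, so `A = (q) ∏ γ_r` (`exists_eq_amb`), and `∑ N(A)^{-s} = ζ(2s) P(s)`. The total over
the invariant lattices in `J` now depends on whether `J` is rectangular or rhombic for the
reflection; Hermite normal forms give `(1 + 2^{-s}) ζ(s)²` and `(1 - 2^{-s} + 2·2^{-2s}) ζ(s)²`. By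
Hilbert 90 the ideal can be scaled to a self-conjugate one on which the reflection is complex
conjugation. Such an ideal is rhombic for `d ≡ 1`, rectangular for `d ≡ 2`, and for `d ≡ 3`
rectangular exactly when 2 occurs to an even power in its norm. In the last case the two types are
coupled by a system of two linear equations (`reflPrim_of_emod_eq_three`).

Only ideals whose class is its own inverse have reflections, and they have exactly `w` of them. For
`d ≡ 3`, `d ≠ -1`, membership of the class in `orthoGroup` decides the type
(`rect_iff_mem_orthoGroup`); for `d = -1` half of the reflections are of each type. For `d = -1` and
`d = -3` there is one ideal class, the class series counts which integers are norms of ideals, and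
these have a unique expression by a self-conjugate ideal and a set of primes `≡ 1`
(`classSeries_of_trivial`). -/

open scoped NumberField nonZeroDivisors

noncomputable section

namespace SubformZeta

/-! ### Hermite normal forms of subgroups of `ℤ²` and invariance under a reflection -/

section HermiteNormalForm

/-- The subgroup of `ℤ²` generated by `(α, 0)` and `(β, δ)`. -/
def hnf (α δ β : ℕ) : AddSubgroup (Fin 2 → ℤ) where
  carrier := {v | ∃ m n : ℤ, v 0 = m * α + n * β ∧ v 1 = n * δ}
  zero_mem' := ⟨0, 0, by simp⟩
  add_mem' := by
    rintro v w ⟨m, n, h1, h2⟩ ⟨m', n', h1', h2'⟩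
    exact ⟨m + m', n + n', by simp [h1, h1']; ring, by simp [h2, h2']; ring⟩
  neg_mem' := by
    rintro v ⟨m, n, h1, h2⟩
    exact ⟨-m, -n, by simp [h1]; ring, by simp [h2]⟩

lemma mem_hnf {α δ β : ℕ} {v : Fin 2 → ℤ} :
    v ∈ hnf α δ β ↔ ∃ m n : ℤ, v 0 = m * α + n * β ∧ v 1 = n * δ := Iff.rfl

/-- The coordinates on `hnf α δ β`. -/
def hnfEquiv {α δ : ℕ} (β : ℕ) (hα : α ≠ 0) (hδ : δ ≠ 0) :
    (Fin 2 → ℤ) ≃ₗ[ℤ] hnf α δ β := by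
  refine LinearEquiv.ofBijective
    { toFun := fun c => ⟨![c 0 * α + c 1 * β, c 1 * δ], c 0, c 1, by simp⟩
      map_add' := ?_
      map_smul' := ?_ } ⟨?_, ?_⟩
  · intro x y
    ext i
    fin_cases i <;> simp <;> ring
  · intro x y
    ext i
    fin_cases i <;> simp <;> ring
  · intro x y h
    have h' := congrArg Subtype.val h
    have h0 := congrFun h' 0
    have h1 := congrFun h' 1
    simp [hδ] at h0 h1
    rw [h1] at h0
    simp [hα] at h0
    ext i
    fin_cases i <;> simp [h0, h1]
  · rintro ⟨v, m, n, h0, h1⟩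
    refine ⟨![m, n], ?_⟩
    ext i
    fin_cases i <;> simp [h0, h1]

lemma hnfEquiv_apply {α δ : ℕ} (β : ℕ) (hα : α ≠ 0) (hδ : δ ≠ 0) (c : Fin 2 → ℤ) :
    (hnfEquiv β hα hδ c : Fin 2 → ℤ) = ![c 0 * α + c 1 * β, c 1 * δ] := rfl

lemma index_hnf {α δ : ℕ} (β : ℕ) (hα : α ≠ 0) (hδ : δ ≠ 0) : (hnf α δ β).index = α * δ := by
  rw [AddSubgroup.index_eq_natAbs_det (Pi.basisFun ℤ (Fin 2)) _
    (Module.Basis.ofEquivFun (hnfEquiv β hα hδ).symm)]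
  rw [Module.Basis.det_apply, Matrix.det_fin_two]
  simp [Module.Basis.toMatrix_apply, hnfEquiv_apply, Int.natAbs_mul]

lemma exists_nat_zmultiples (H : AddSubgroup ℤ) : ∃ n : ℕ, ∀ x, x ∈ H ↔ (n : ℤ) ∣ x := by
  obtain ⟨g, hg⟩ := Int.subgroup_cyclic H
  refine ⟨g.natAbs, fun x => ?_⟩
  rw [hg, ← AddSubgroup.zmultiples_eq_closure, Int.mem_zmultiples_iff, Int.natAbs_dvd]

/-- `α` generates the intersection of `H` with the first axis, `δ` generates the projection of `H`
to the second coordinate, and `β` is the first coordinate, reduced modulo `α`, of an element of `H`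
above `δ`. -/
lemma exists_eq_hnf (H : AddSubgroup (Fin 2 → ℤ)) (hH : H.index ≠ 0) :
    ∃ α δ β : ℕ, α ≠ 0 ∧ δ ≠ 0 ∧ β < α ∧ hnf α δ β = H := by
  obtain ⟨α, hα⟩ := exists_nat_zmultiples (H.comap
    { toFun := fun x => ![x, 0], map_zero' := by simp, map_add' := by simp } : AddSubgroup ℤ)
  obtain ⟨δ, hδ⟩ := exists_nat_zmultiples (H.map (Pi.evalAddMonoidHom (fun _ : Fin 2 => ℤ) 1))
  simp only [AddSubgroup.mem_comap, AddSubgroup.mem_map, AddMonoidHom.coe_mk, ZeroHom.coe_mk,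
    Pi.evalAddMonoidHom_apply] at hα hδ
  have hmul : ∀ v : Fin 2 → ℤ, H.index • v ∈ H := fun v => H.nsmul_index_mem v
  have hα0 : α ≠ 0 := by
    rintro rfl
    have h := (hα H.index).1 (by
      have := hmul ![1, 0]
      convert this using 1
      ext i; fin_cases i <;> simp)
    simp at h
    exact hH h
  have hδ0 : δ ≠ 0 := by
    rintro rfl
    have h := (hδ H.index).1 ⟨_, hmul ![0, 1], by simp⟩
    simp at h
    exact hH h
  obtain ⟨v, hv, hv1⟩ := (hδ δ).2 dvd_rfl
  have hαpos : (0 : ℤ) < α := by positivity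
  have hred : (v 0 % α).toNat = v 0 % α := Int.toNat_of_nonneg (Int.emod_nonneg _ hαpos.ne')
  have hmemα : ∀ m : ℤ, ![m * α, 0] ∈ H := fun m => (hα _).2 (Dvd.intro_left m rfl)
  refine ⟨α, δ, (v 0 % α).toNat, hα0, hδ0, ?_, ?_⟩
  · have := Int.emod_lt_of_pos (v 0) hαpos
    omega
  · have key : (v 0 : ℤ) = α * (v 0 / α) + v 0 % α := (Int.mul_ediv_add_emod _ _).symm
    ext w
    rw [mem_hnf]
    constructor
    · rintro ⟨m, n, h0, h1⟩
      have : w = ![(m - n * (v 0 / α)) * α, 0] + n • v := by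
        ext i
        fin_cases i
        · simp [h0, hred]
          linear_combination (-n) * key
        · simp [h1, hv1]
      rw [this]
      exact add_mem (hmemα _) (zsmul_mem hv _)
    · intro hw
      obtain ⟨n, hn⟩ := (hδ (w 1)).1 ⟨w, hw, rfl⟩
      have h2 : ![w 0 - n * v 0, 0] ∈ H := by
        have : w - n • v ∈ H := sub_mem hw (zsmul_mem hv _)
        convert this using 1
        ext i
        fin_cases i
        · simp
        · simp [hn, hv1]; ring
      obtain ⟨m, hm⟩ := (hα _).1 h2
      refine ⟨m + n * (v 0 / α), n, ?_, by rw [hn]; ring⟩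
      rw [hred]
      linear_combination hm + n * key

lemma hnf_injective {α δ β α' δ' β' : ℕ} (hδ : δ ≠ 0) (hβ : β < α)
    (hδ' : δ' ≠ 0) (hβ' : β' < α')
    (h : hnf α δ β = hnf α' δ' β') : α = α' ∧ δ = δ' ∧ β = β' := by
  have hmem : ∀ v : Fin 2 → ℤ, (∃ m n : ℤ, v 0 = m * α + n * β ∧ v 1 = n * δ) ↔
      ∃ m n : ℤ, v 0 = m * α' + n * β' ∧ v 1 = n * δ' := fun v => by
    rw [← mem_hnf, ← mem_hnf, h]
  have hα' : α' ≠ 0 := by omega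
  have h1 : α' ∣ α := by
    obtain ⟨m, n, h0, h1⟩ := (hmem ![α, 0]).1 ⟨1, 0, by simp⟩
    have : n = 0 := by simpa [hδ'] using h1
    subst this
    exact Int.natCast_dvd_natCast.1 ⟨m, by simpa [mul_comm] using h0⟩
  have h2 : α ∣ α' := by
    obtain ⟨m, n, h0, h1⟩ := (hmem ![α', 0]).2 ⟨1, 0, by simp⟩
    have : n = 0 := by simpa [hδ] using h1
    subst this
    exact Int.natCast_dvd_natCast.1 ⟨m, by simpa [mul_comm] using h0⟩
  have hαα := Nat.dvd_antisymm h2 h1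
  subst hαα
  obtain ⟨m, n, h0, h3⟩ := (hmem ![β, δ]).1 ⟨0, 1, by simp⟩
  obtain ⟨m', n', h0', h3'⟩ := (hmem ![β', δ']).2 ⟨0, 1, by simp⟩
  simp at h0 h3 h0' h3'
  have hδδ : δ = δ' := Nat.dvd_antisymm (Int.natCast_dvd_natCast.1 ⟨n', by rw [h3']; ring⟩)
    (Int.natCast_dvd_natCast.1 ⟨n, by rw [h3]; ring⟩)
  subst hδδ
  refine ⟨rfl, rfl, ?_⟩
  have hn : n = 1 := by
    have : (δ : ℤ) ≠ 0 := by exact_mod_cast hδ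
    exact mul_right_cancel₀ this (by rw [one_mul]; exact h3.symm)
  subst hn
  have : (β : ℤ) ≡ β' [ZMOD α] := (Int.modEq_iff_dvd.2 ⟨-m, by rw [h0]; ring⟩)
  have := Int.natCast_modEq_iff.1 this
  exact Nat.ModEq.eq_of_lt_of_lt this hβ hβ'

/-- The parametrization of the finite index subgroups of `ℤ²` by Hermite normal forms. -/
def hnfParam : (Σ p : ℕ+ × ℕ+, Fin p.1) ≃ {H : AddSubgroup (Fin 2 → ℤ) // H.index ≠ 0} := by
  refine Equiv.ofBijective (fun t => ⟨hnf t.1.1 t.1.2 t.2, ?_⟩) ⟨?_, ?_⟩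
  · rw [index_hnf _ t.1.1.ne_zero t.1.2.ne_zero]
    exact mul_ne_zero t.1.1.ne_zero t.1.2.ne_zero
  · rintro ⟨⟨α, δ⟩, β⟩ ⟨⟨α', δ'⟩, β'⟩ h
    obtain ⟨h1, h2, h3⟩ := hnf_injective δ.ne_zero β.2 δ'.ne_zero β'.2
      (congrArg Subtype.val h)
    obtain rfl := PNat.eq h1
    obtain rfl := PNat.eq h2
    obtain rfl := Fin.ext h3
    rfl
  · rintro ⟨H, hH⟩
    obtain ⟨α, δ, β, hα, hδ, hβ, rfl⟩ := exists_eq_hnf H hH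
    exact ⟨⟨(⟨α, Nat.pos_of_ne_zero hα⟩, ⟨δ, Nat.pos_of_ne_zero hδ⟩), ⟨β, hβ⟩⟩, rfl⟩

lemma index_hnfParam (t : Σ p : ℕ+ × ℕ+, Fin p.1) :
    (hnfParam t).1.index = t.1.1 * t.1.2 :=
  index_hnf _ t.1.1.ne_zero t.1.2.ne_zero

/-- The reflection `(x, y) ↦ (x + ε y, -y)` of `ℤ²`. -/
def shear (ε : ℤ) : (Fin 2 → ℤ) →+ (Fin 2 → ℤ) where
  toFun v := ![v 0 + ε * v 1, -v 1]
  map_zero' := by ext i; fin_cases i <;> simp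
  map_add' v w := by ext i; fin_cases i <;> simp <;> ring

lemma shear_shear (ε : ℤ) (v : Fin 2 → ℤ) : shear ε (shear ε v) = v := by
  ext i; fin_cases i <;> simp [shear]

/-- The shear is an involution, so it suffices that it maps the generators into the subgroup. It
fixes `(α, 0)` and sends `(β, δ)` to `(2β + εδ, 0) - (β, δ)`. -/
lemma map_shear_hnf_iff {α δ β : ℕ} (hδ : δ ≠ 0) (ε : ℤ) :
    (hnf α δ β).map (shear ε) = hnf α δ β ↔ (α : ℤ) ∣ 2 * β + ε * δ := by
  have hiff : (hnf α δ β).map (shear ε) = hnf α δ β ↔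
      ∀ v ∈ hnf α δ β, shear ε v ∈ hnf α δ β := by
    constructor
    · intro h v hv
      rw [← h]
      exact ⟨v, hv, rfl⟩
    · intro h
      ext v
      constructor
      · rintro ⟨w, hw, rfl⟩
        exact h w hw
      · intro hv
        exact ⟨_, h v hv, shear_shear ε v⟩
  rw [hiff]
  constructor
  · intro h
    obtain ⟨m, n, h0, h1⟩ := h ![β, δ] ⟨0, 1, by simp⟩
    simp [shear] at h0 h1
    have hn : n = -1 := by
      have : (δ : ℤ) ≠ 0 := by exact_mod_cast hδ
      exact mul_right_cancel₀ this (by linarith)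
    subst hn
    exact ⟨m, by linear_combination h0⟩
  · rintro ⟨k, hk⟩ v ⟨m, n, h0, h1⟩
    refine ⟨m + n * k, -n, ?_, ?_⟩
    · simp [shear, h0, h1]
      linear_combination n * hk
    · simp [shear, h1]

end HermiteNormalForm

/-! ### The number of Hermite normal forms invariant under a reflection -/

section Counting

/-- The number of `β < α` with `α ∣ 2 β + ε δ`. -/
def shearCount (ε : ℤ) (α δ : ℕ) : ℕ :=
  Fintype.card {β : Fin α // (α : ℤ) ∣ 2 * (β : ℕ) + ε * δ}

lemma shearCount_of_forall {ε : ℤ} {α δ : ℕ} (S : Finset ℕ)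
    (h : ∀ β, (β < α ∧ (α : ℤ) ∣ 2 * (β : ℕ) + ε * δ) ↔ β ∈ S) : shearCount ε α δ = S.card := by
  rw [shearCount, Fintype.card_subtype]
  refine Finset.card_bij (fun β _ => (β : ℕ)) ?_ ?_ ?_
  · intro β hβ
    exact (h β).1 ⟨β.2, by simpa using hβ⟩
  · intro β _ β' _ hh
    exact Fin.ext hh
  · intro β hβ
    have := (h β).2 hβ
    exact ⟨⟨β, this.1⟩, by simpa using this.2, rfl⟩

/-- The solutions of `2β ≡ 0` modulo `α` are `0` and, for even `α`, also `α / 2`. -/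
lemma shearCount_zero {α : ℕ} (hα : α ≠ 0) (δ : ℕ) :
    shearCount 0 α δ = 1 + if 2 ∣ α then 1 else 0 := by
  split_ifs with h
  · obtain ⟨k, rfl⟩ := h
    rw [shearCount_of_forall {0, k}]
    · rw [Finset.card_pair (by omega)]
    · intro β
      simp only [zero_mul, add_zero, Finset.mem_insert, Finset.mem_singleton]
      constructor
      · rintro ⟨h1, m, hm⟩
        push_cast at hm
        have hm2 : (β : ℤ) = k * m := by linarith
        have : m < 2 := by by_contra!; nlinarith
        have : -1 < m := by by_contra!; nlinarith
        interval_cases m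
        · left; omega
        · right; omega
      · rintro (rfl | rfl)
        · exact ⟨by omega, by simp⟩
        · exact ⟨by omega, by simp⟩
  · rw [shearCount_of_forall {0}]
    · simp
    · intro β
      simp only [zero_mul, add_zero, Finset.mem_singleton]
      constructor
      · rintro ⟨h1, h2⟩
        have h3 : α ∣ 2 * β := by exact_mod_cast h2
        have h4 : Nat.Coprime α 2 := by
          rw [Nat.coprime_comm]
          exact (Nat.prime_two.coprime_iff_not_dvd).2 h
        exact Nat.eq_zero_of_dvd_of_lt (h4.dvd_of_dvd_mul_left h3) h1
      · rintro rfl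
        exact ⟨by omega, by simp⟩

lemma exists_lt_iff_modEq {α : ℕ} (hα : α ≠ 0) (c : ℤ) :
    ∃ β₀ : ℕ, β₀ < α ∧ ∀ β : ℕ, (β < α ∧ (α : ℤ) ∣ β - c) ↔ β = β₀ := by
  have hpos : (0 : ℤ) < α := by positivity
  have h0 := Int.emod_nonneg c hpos.ne'
  have h1 := Int.emod_lt_of_pos c hpos
  refine ⟨(c % α).toNat, by omega, fun β => ?_⟩
  constructor
  · rintro ⟨h2, h3⟩
    have h4 : (β : ℤ) % α = c % α := (Int.modEq_iff_dvd.2 h3).symm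
    rw [Int.emod_eq_of_lt (by omega) (by omega)] at h4
    omega
  · rintro rfl
    refine ⟨by omega, ?_⟩
    rw [Int.toNat_of_nonneg h0]
    exact Int.ModEq.dvd (Int.mod_modEq c α).symm

/-- For odd `α` the number 2 is invertible modulo `α` and `β` is unique. For even `α` the number `δ`
has to be even, and the congruence then fixes `β` only modulo `α / 2`, which leaves two values. -/
lemma shearCount_one {α : ℕ} (hα : α ≠ 0) (δ : ℕ) :
    shearCount 1 α δ =
      (if 2 ∣ α then 0 else 1) + 2 * ((if 2 ∣ α then 1 else 0) * if 2 ∣ δ then 1 else 0) := by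
  by_cases h : 2 ∣ α
  · by_cases h' : 2 ∣ δ
    · simp only [h, h', if_true]
      obtain ⟨k, rfl⟩ := h
      obtain ⟨l, rfl⟩ := h'
      obtain ⟨β₁, h1, h2⟩ := exists_lt_iff_modEq (α := k) (by omega) (-l)
      rw [shearCount_of_forall {β₁, β₁ + k}]
      · rw [Finset.card_pair (by omega)]
      · intro β
        simp only [Finset.mem_insert, Finset.mem_singleton]
        have e1 : ((2 * k : ℕ) : ℤ) ∣ 2 * (β : ℕ) + 1 * (2 * l : ℕ) ↔ (k : ℤ) ∣ β - (-l : ℤ) := by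
          push_cast
          rw [show (2 * (β : ℤ) + 1 * (2 * l)) = 2 * (β - -l) by ring]
          exact mul_dvd_mul_iff_left two_ne_zero
        rw [e1]
        constructor
        · rintro ⟨h3, h4⟩
          rcases lt_or_ge β k with h5 | h5
          · left
            exact (h2 β).1 ⟨h5, h4⟩
          · right
            have := (h2 (β - k)).1 ⟨by omega, by
              rw [Nat.cast_sub h5]
              have := dvd_sub h4 (dvd_refl (k : ℤ))
              rwa [show (β : ℤ) - -l - k = β - k - -l by ring] at this⟩
            omega
        · have h3 := (h2 β₁).2 rfl
          rintro (rfl | rfl)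
          · exact ⟨by omega, h3.2⟩
          · refine ⟨by omega, ?_⟩
            push_cast
            have := dvd_add h3.2 (dvd_refl (k : ℤ))
            rwa [show (β₁ : ℤ) - -l + k = β₁ + k - -l by ring] at this
    · simp only [h, h', if_true, if_false]
      rw [shearCount_of_forall ∅]
      · simp
      · intro β
        simp only [Finset.notMem_empty, iff_false]
        rintro ⟨_, h3⟩
        have : (2 : ℤ) ∣ 2 * (β : ℕ) + 1 * δ := (Int.natCast_dvd_natCast.2 h).trans h3
        omega
  · simp only [h, if_false]
    have h4 : IsCoprime (α : ℤ) 2 := by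
      have : Nat.Coprime α 2 := by
        rw [Nat.coprime_comm]
        exact (Nat.prime_two.coprime_iff_not_dvd).2 h
      exact Nat.isCoprime_iff_coprime.2 this
    have hodd : ∃ k, α = 2 * k + 1 := ⟨α / 2, by omega⟩
    obtain ⟨k, hk⟩ := hodd
    -- Since `α = 2k + 1`, `2kδ ≡ -δ` modulo `α`, so the solution is `β ≡ kδ`.
    obtain ⟨β₀, h1, h2⟩ := exists_lt_iff_modEq hα (k * δ)
    rw [shearCount_of_forall {β₀}]
    · simp
    · intro β
      rw [Finset.mem_singleton, ← h2 β]
      refine and_congr_right fun _ => ?_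
      have e : (2 : ℤ) * (β - k * δ) = (2 * (β : ℕ) + 1 * δ) - α * δ := by
        rw [hk]; push_cast; ring
      constructor
      · intro h5
        refine h4.dvd_of_dvd_mul_left (?_ : (α : ℤ) ∣ 2 * (β - k * δ))
        rw [e]
        exact dvd_sub h5 (dvd_mul_right _ _)
      · intro h5
        have h6 := (h5.mul_left 2)
        rw [e] at h6
        have := dvd_add h6 (dvd_mul_right (α : ℤ) δ)
        simpa using this

end Counting

end SubformZeta

end


/-! ### Dirichlet series of subgroups of `ℤ²` -/

open scoped NumberField nonZeroDivisors

noncomputable section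

namespace SubformZeta

section ZetaSums

lemma hasSum_of_eq {ι : Type*} {f g : ι → ℂ} {a b : ℂ} (h : HasSum f a) (hfg : ∀ i, g i = f i)
    (hab : b = a) : HasSum g b := by
  rw [hab, funext hfg]
  exact h

/-- Reduces a sum over Hermite normal forms to a sum over `(α, δ)`, weighted by the number of
admissible `β`. -/
lemma hasSum_sigma_fintype {ι : Type*} {β : ι → Type*} [∀ i, Fintype (β i)] {f : ι → ℂ} {a : ℂ}
    (hf : HasSum (fun i => (Fintype.card (β i) : ℂ) * f i) a) :
    HasSum (fun t : Σ i, β i => f t.1) a := by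
  refine HasSum.sigma_of_hasSum hf (fun i => ?_) ?_
  · convert hasSum_fintype (fun _ : β i => f i) using 1
    simp
  · refine Summable.of_norm ?_
    refine (summable_sigma_of_nonneg (fun _ => norm_nonneg _)).2 ⟨fun i => ?_, ?_⟩
    · exact (hasSum_fintype _).summable
    · convert hf.summable.norm using 2 with i
      simp [tsum_fintype]

lemma summable_pnat_cpow {s : ℂ} (hs : 1 < s.re) : Summable (fun n : ℕ+ => (n : ℂ) ^ (-s)) := by
  have h := Complex.summable_one_div_nat_cpow.2 hs
  simp_rw [one_div, ← Complex.cpow_neg] at h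
  exact h.comp_injective (i := fun n : ℕ+ => (n : ℕ)) PNat.coe_injective

lemma hasSum_zeta {s : ℂ} (hs : 1 < s.re) :
    HasSum (fun n : ℕ+ => (n : ℂ) ^ (-s)) (riemannZeta s) := by
  convert (summable_pnat_cpow hs).hasSum using 1
  rw [zeta_eq_tsum_one_div_nat_add_one_cpow hs,
    tsum_pnat_eq_tsum_succ (f := fun n : ℕ => (n : ℂ) ^ (-s))]
  simp [Complex.cpow_neg]

lemma hasSum_zeta_even {s : ℂ} (hs : 1 < s.re) :
    HasSum (fun n : ℕ+ => if 2 ∣ (n : ℕ) then (n : ℂ) ^ (-s) else 0)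
      (2 ^ (-s) * riemannZeta s) := by
  have hinj : Function.Injective (fun n : ℕ+ => 2 * n) := mul_right_injective 2
  rw [← hinj.hasSum_iff]
  · refine hasSum_of_eq ((hasSum_zeta hs).mul_left (2 ^ (-s))) (fun n => ?_) rfl
    simp only [Function.comp, PNat.mul_coe, PNat.val_ofNat, dvd_mul_right, if_true]
    rw [Nat.cast_mul, Complex.natCast_mul_natCast_cpow]
    simp
  · intro n hn
    rw [if_neg]
    rintro ⟨k, hk⟩
    have hk0 : 0 < k := by
      rcases Nat.eq_zero_or_pos k with rfl | h
      · have := n.pos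
        omega
      · exact h
    exact hn ⟨⟨k, hk0⟩, PNat.eq (by rw [hk]; rfl)⟩

lemma hasSum_zeta_odd {s : ℂ} (hs : 1 < s.re) :
    HasSum (fun n : ℕ+ => if 2 ∣ (n : ℕ) then 0 else (n : ℂ) ^ (-s))
      ((1 - 2 ^ (-s)) * riemannZeta s) := by
  refine hasSum_of_eq ((hasSum_zeta hs).sub (hasSum_zeta_even hs)) (fun n => ?_) ?_
  · split_ifs <;> simp
  · ring

lemma hasSum_mul_pnat {f g : ℕ+ → ℂ} {a b : ℂ} (hf : HasSum f a) (hg : HasSum g b) :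
    HasSum (fun p : ℕ+ × ℕ+ => f p.1 * g p.2) (a * b) :=
  hf.mul hg (summable_mul_of_summable_norm hf.summable.norm hg.summable.norm)

lemma natCast_mul_cpow (m n : ℕ) (s : ℂ) :
    ((m * n : ℕ) : ℂ) ^ s = (m : ℂ) ^ s * (n : ℂ) ^ s := by
  rw [Nat.cast_mul, Complex.natCast_mul_natCast_cpow]

/-- The sum of `|ℤ² : K|^{-s}` over all subgroups of finite index. -/
lemma hasSum_index {s : ℂ} (hs : 2 < s.re) :
    HasSum (fun K : {K : AddSubgroup (Fin 2 → ℤ) // K.index ≠ 0} => (K.1.index : ℂ) ^ (-s))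
      (riemannZeta (s - 1) * riemannZeta s) := by
  rw [← hnfParam.hasSum_iff]
  simp only [Function.comp_def, index_hnfParam]
  refine hasSum_sigma_fintype (f := fun p : ℕ+ × ℕ+ => ((p.1 * p.2 : ℕ) : ℂ) ^ (-s)) ?_
  -- There are `α` choices for `β`; this factor shifts one zeta value to `ζ(s - 1)`.
  refine hasSum_of_eq (hasSum_mul_pnat (hasSum_zeta (s := s - 1) (by simp; linarith))
    (hasSum_zeta (s := s) (by linarith))) (fun p => ?_) rfl
  rw [natCast_mul_cpow, Fintype.card_fin, ← mul_assoc, neg_sub, sub_eq_add_neg, Complex.cpow_add _ _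
    (by exact_mod_cast p.1.ne_zero), Complex.cpow_one]

/-- The invariant subgroups of `ℤ²` in Hermite normal form. -/
def hnfShearParam (ε : ℤ) :
    (Σ p : ℕ+ × ℕ+, {β : Fin p.1 // ((p.1 : ℕ) : ℤ) ∣ 2 * (β : ℕ) + ε * (p.2 : ℕ)}) ≃
      {K : AddSubgroup (Fin 2 → ℤ) // K.index ≠ 0 ∧ K.map (shear ε) = K} where
  toFun t := ⟨(hnfParam ⟨t.1, t.2.1⟩).1, (hnfParam ⟨t.1, t.2.1⟩).2,
    (map_shear_hnf_iff t.1.2.ne_zero ε).2 t.2.2⟩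
  invFun K := ⟨(hnfParam.symm ⟨K.1, K.2.1⟩).1, (hnfParam.symm ⟨K.1, K.2.1⟩).2, by
    have h := K.2.2
    have h1 : K.1 = (hnfParam (hnfParam.symm ⟨K.1, K.2.1⟩)).1 := by simp
    rw [h1] at h
    exact (map_shear_hnf_iff (hnfParam.symm ⟨K.1, K.2.1⟩).1.2.ne_zero ε).1 h⟩
  left_inv t := by
    obtain ⟨p, β, h⟩ := t
    have : hnfParam.symm ⟨(hnfParam ⟨p, β⟩).1, (hnfParam ⟨p, β⟩).2⟩ = ⟨p, β⟩ := by simp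
    rw [Sigma.ext_iff] at this ⊢
    simp only at this ⊢
    obtain ⟨h1, h2⟩ := this
    refine ⟨h1, ?_⟩
    congr!
  right_inv K := by simp

lemma hasSum_index_shear {s : ℂ} (ε : ℤ) {a : ℂ}
    (h : HasSum (fun p : ℕ+ × ℕ+ =>
      (shearCount ε p.1 p.2 : ℂ) * ((p.1 : ℂ) ^ (-s) * (p.2 : ℂ) ^ (-s))) a) :
    HasSum (fun K : {K : AddSubgroup (Fin 2 → ℤ) // K.index ≠ 0 ∧ K.map (shear ε) = K} =>
      (K.1.index : ℂ) ^ (-s)) a := by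
  rw [← (hnfShearParam ε).hasSum_iff]
  have e : ∀ t, ((hnfShearParam ε) t).1.index = t.1.1 * t.1.2 := fun t => index_hnfParam _
  simp only [Function.comp_def, e]
  refine hasSum_sigma_fintype (f := fun p : ℕ+ × ℕ+ => ((p.1 * p.2 : ℕ) : ℂ) ^ (-s)) ?_
  refine hasSum_of_eq h (fun p => ?_) rfl
  rw [natCast_mul_cpow]
  rfl

/-- The sum of `|ℤ² : K|^{-s}` over the subgroups invariant under `(x, y) ↦ (x, -y)`. -/
lemma hasSum_index_shear_zero {s : ℂ} (hs : 1 < s.re) :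
    HasSum (fun K : {K : AddSubgroup (Fin 2 → ℤ) // K.index ≠ 0 ∧ K.map (shear 0) = K} =>
      (K.1.index : ℂ) ^ (-s)) ((1 + 2 ^ (-s)) * riemannZeta s ^ 2) := by
  refine hasSum_index_shear 0 ?_
  refine hasSum_of_eq (hasSum_mul_pnat ((hasSum_zeta hs).add (hasSum_zeta_even hs))
    (hasSum_zeta hs)) (fun p => ?_) ?_
  · rw [shearCount_zero p.1.ne_zero]
    split_ifs <;> push_cast <;> ring
  · ring

/-- The sum of `|ℤ² : K|^{-s}` over the subgroups invariant under `(x, y) ↦ (x + y, -y)`. -/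
lemma hasSum_index_shear_one {s : ℂ} (hs : 1 < s.re) :
    HasSum (fun K : {K : AddSubgroup (Fin 2 → ℤ) // K.index ≠ 0 ∧ K.map (shear 1) = K} =>
      (K.1.index : ℂ) ^ (-s))
        ((1 - 2 ^ (-s) + 2 * 2 ^ (-2 * s)) * riemannZeta s ^ 2) := by
  refine hasSum_index_shear 1 ?_
  -- Odd `α` count once with arbitrary `δ`; even `α` count twice, and only with even `δ`.
  refine hasSum_of_eq ((hasSum_mul_pnat (hasSum_zeta_odd hs) (hasSum_zeta hs)).add
    ((hasSum_mul_pnat (hasSum_zeta_even hs) (hasSum_zeta_even hs)).mul_left 2)) (fun p => ?_) ?_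
  · rw [shearCount_one p.1.ne_zero]
    split_ifs <;> push_cast <;> ring
  · rw [show -2 * s = (2 : ℕ) * (-s) by push_cast; ring, Complex.cpow_nat_mul]
    ring

lemma zetaZ2_eq {s : ℂ} (hs : 2 < s.re) :
    zetaZ2 s = riemannZeta (s - 1) * riemannZeta s :=
  (hasSum_index hs).tsum_eq

/-- This is what later allows division by `ζ_F(s)`, which divides `ζ_{ℤ²}(s)`. -/
lemma zetaZ2_ne_zero {s : ℂ} (hs : 2 < s.re) : zetaZ2 s ≠ 0 := by
  rw [zetaZ2_eq hs]
  exact mul_ne_zero (riemannZeta_ne_zero_of_one_le_re (by simp; linarith))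
    (riemannZeta_ne_zero_of_one_le_re (by linarith))

end ZetaSums

/-! ### Sums and cardinalities along the fibres of a map -/

section Fibers

/-- Grouping a sum of terms `f i * n(i)^{-s}` into a Dirichlet series. -/
lemma hasSum_fiberwise_term {ι : Type*} {n : ι → ℕ} (hn : ∀ i, n i ≠ 0) {f : ι → ℂ} {s : ℂ}
    (h : Summable fun i => (n i : ℂ) ^ (-s) * f i) {A : ℕ → ℂ}
    (hA : ∀ m ≠ 0, HasSum (fun i : {i // n i = m} => f i) (A m)) :
    LSeriesHasSum A s (∑' i, (n i : ℂ) ^ (-s) * f i) := by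
  have h1 := h.hasSum.tsum_fiberwise n
  unfold LSeriesHasSum
  refine hasSum_of_eq h1 (fun m => ?_) rfl
  rcases eq_or_ne m 0 with rfl | hm
  · have : IsEmpty (n ⁻¹' {0} : Set ι) := ⟨fun i => hn i.1 i.2⟩
    simp
  · rw [LSeries.term_of_ne_zero hm]
    have h2 : ∀ i : (n ⁻¹' {m} : Set ι), (n i : ℂ) ^ (-s) * f i = (m : ℂ) ^ (-s) * f i := by
      rintro ⟨i, hi⟩
      have : n i = m := hi
      simp only [this]
    simp only [h2]
    have h3 : ∑' i : (n ⁻¹' {m} : Set ι), (m : ℂ) ^ (-s) * f i = (m : ℂ) ^ (-s) * A m :=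
      ((hA m hm).mul_left _).tsum_eq
    rw [h3, Complex.cpow_neg]
    ring

lemma ncard_eq_ncard_image_mul {α β : Type*} {A : Set α} (hA : A.Finite) (f : α → β) {c : ℕ}
    (hc : ∀ a ∈ A, {a' ∈ A | f a' = f a}.ncard = c) : A.ncard = (f '' A).ncard * c := by
  classical
  lift A to Finset α using hA
  rw [Set.ncard_coe_finset, Finset.card_eq_sum_card_image f A]
  rw [← Finset.coe_image, Set.ncard_coe_finset, Finset.sum_const_nat]
  intro b hb
  obtain ⟨a, ha, rfl⟩ := Finset.mem_image.1 hb
  rw [← hc a ha, ← Set.ncard_coe_finset]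
  congr 1
  ext; simp

/-- Weighting a point by the inverse size of its fibre counts every image point once. This is how
lattices become isometry classes and ideals become ideal classes. -/
lemma sum_div_ncard_fiber {α β : Type*} (A : Finset α) (q : α → β) (f : β → ℂ) :
    ∑ a ∈ A, f (q a) / ({a' | a' ∈ A ∧ q a' = q a}.ncard : ℂ) =
      ∑ b ∈ (A.finite_toSet.image q).toFinset, f b := by
  classical
  have e : (A.finite_toSet.image q).toFinset = A.image q := by ext; simp
  rw [e, Finset.sum_comp (fun b => f b / ({a' | a' ∈ A ∧ q a' = b}.ncard : ℂ)) q]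
  refine Finset.sum_congr rfl fun b hb => ?_
  have h1 : {a' | a' ∈ A ∧ q a' = b}.ncard = (A.filter (q · = b)).card := by
    rw [← Set.ncard_coe_finset]
    congr 1
    ext; simp
  rw [h1]
  obtain ⟨a, ha, rfl⟩ := Finset.mem_image.1 hb
  have : (A.filter (q · = q a)).card ≠ 0 :=
    Finset.card_ne_zero_of_mem (Finset.mem_filter.2 ⟨ha, rfl⟩)
  rw [nsmul_eq_mul]
  field_simp

end Fibers

end SubformZeta

end


/-! ### Lattices in a rational plane -/

open scoped NumberField nonZeroDivisors

noncomputable section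

namespace SubformZeta

section Lattices

open Module

variable {E : Type*} [AddCommGroup E] [Module ℚ E]

/-- The lattice spanned by a basis of a rational plane. -/
def latticeOf (b : Basis (Fin 2) ℚ E) : AddSubgroup E := AddSubgroup.closure (Set.range b)

/-- The homomorphism `ℤ² → E` given by a basis. -/
def basisHom (b : Basis (Fin 2) ℚ E) : (Fin 2 → ℤ) →+ E where
  toFun v := v 0 • b 0 + v 1 • b 1
  map_zero' := by simp
  map_add' v w := by simp only [Pi.add_apply, add_smul]; abel

lemma basisHom_apply (b : Basis (Fin 2) ℚ E) (v : Fin 2 → ℤ) :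
    basisHom b v = v 0 • b 0 + v 1 • b 1 := rfl

lemma repr_basisHom (b : Basis (Fin 2) ℚ E) (v : Fin 2 → ℤ) (i : Fin 2) :
    b.repr (basisHom b v) i = v i := by
  rw [basisHom_apply, ← Int.cast_smul_eq_zsmul ℚ, ← Int.cast_smul_eq_zsmul ℚ]
  fin_cases i <;> simp

lemma basisHom_injective (b : Basis (Fin 2) ℚ E) : Function.Injective (basisHom b) := by
  intro v w h
  ext i
  have := congrArg (fun x => b.repr x i) h
  simpa only [repr_basisHom, Int.cast_inj] using this

lemma mem_latticeOf (b : Basis (Fin 2) ℚ E) {x : E} :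
    x ∈ latticeOf b ↔ ∃ m n : ℤ, x = m • b 0 + n • b 1 := by
  have : Set.range b = {b 0, b 1} := by
    ext y
    simp [Fin.exists_fin_two, eq_comm]
  rw [latticeOf, this, AddSubgroup.mem_closure_pair]
  simp only [eq_comm]

lemma map_basisHom_top (b : Basis (Fin 2) ℚ E) : (⊤ : AddSubgroup _).map (basisHom b) =
    latticeOf b := by
  ext x
  rw [mem_latticeOf]
  constructor
  · rintro ⟨v, -, rfl⟩
    exact ⟨v 0, v 1, rfl⟩
  · rintro ⟨m, n, rfl⟩
    exact ⟨![m, n], trivial, by simp [basisHom_apply]⟩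

lemma index_comap_basisHom (b : Basis (Fin 2) ℚ E) (K : AddSubgroup E) :
    (K.comap (basisHom b)).index = K.relIndex (latticeOf b) := by
  rw [← map_basisHom_top, ← AddSubgroup.relIndex_comap, AddSubgroup.relIndex_top_right]

lemma map_comap_basisHom (b : Basis (Fin 2) ℚ E) {K : AddSubgroup E} (h : K ≤ latticeOf b) :
    (K.comap (basisHom b)).map (basisHom b) = K := by
  rw [← map_basisHom_top] at h
  exact AddSubgroup.map_comap_eq_self (h.trans (AddSubgroup.map_le_range _ _))

lemma map_basisHom_le (b : Basis (Fin 2) ℚ E) (H : AddSubgroup (Fin 2 → ℤ)) :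
    H.map (basisHom b) ≤ latticeOf b := by
  rw [← map_basisHom_top]
  exact AddSubgroup.map_mono le_top

lemma comap_map_basisHom (b : Basis (Fin 2) ℚ E) (H : AddSubgroup (Fin 2 → ℤ)) :
    (H.map (basisHom b)).comap (basisHom b) = H :=
  AddSubgroup.comap_map_eq_self_of_injective (basisHom_injective b) H

/-- Finite index sublattices correspond to finite index subgroups of `ℤ²`. -/
def sublatticeEquiv (b : Basis (Fin 2) ℚ E) :
    {K : AddSubgroup E // K ≤ latticeOf b ∧ K.relIndex (latticeOf b) ≠ 0} ≃
      {H : AddSubgroup (Fin 2 → ℤ) // H.index ≠ 0} where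
  toFun K := ⟨K.1.comap (basisHom b), by rw [index_comap_basisHom]; exact K.2.2⟩
  invFun H := ⟨H.1.map (basisHom b), map_basisHom_le b _, by
    rw [← index_comap_basisHom, comap_map_basisHom]; exact H.2⟩
  left_inv K := Subtype.ext (map_comap_basisHom b K.2.1)
  right_inv H := Subtype.ext (comap_map_basisHom b _)

lemma hasSum_relIndex (b : Basis (Fin 2) ℚ E) {s : ℂ} (hs : 2 < s.re) :
    HasSum (fun K : {K : AddSubgroup E // K ≤ latticeOf b ∧ K.relIndex (latticeOf b) ≠ 0} =>
      (K.1.relIndex (latticeOf b) : ℂ) ^ (-s)) (zetaZ2 s) := by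
  rw [zetaZ2_eq hs, ← (sublatticeEquiv b).symm.hasSum_iff]
  refine hasSum_of_eq (hasSum_index hs) (fun H => ?_) rfl
  simp only [Function.comp_apply]
  rw [← index_comap_basisHom]
  simp only [sublatticeEquiv, Equiv.coe_fn_symm_mk, comap_map_basisHom]

/-- In the coordinates of `b` the map `ρ` is `shear ε`, so invariant lattices can be counted in
`ℤ²`. -/
lemma map_eq_iff_of_shear (b : Basis (Fin 2) ℚ E) {ρ : E →+ E} {ε : ℤ} (h0 : ρ (b 0) = b 0)
    (h1 : ρ (b 1) = ε • b 0 - b 1) (H : AddSubgroup (Fin 2 → ℤ)) :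
    (H.map (basisHom b)).map ρ = H.map (basisHom b) ↔ H.map (shear ε) = H := by
  have e : ρ.comp (basisHom b) = (basisHom b).comp (shear ε) := by
    ext v
    simp only [AddMonoidHom.comp_apply, basisHom_apply, map_add, map_zsmul, h0, h1, shear,
      AddMonoidHom.coe_mk, ZeroHom.coe_mk]
    simp only [Matrix.cons_val_zero, Matrix.cons_val_one, smul_sub, add_smul, mul_smul, neg_smul]
    rw [smul_comm ε]
    abel
  rw [AddSubgroup.map_map, e, ← AddSubgroup.map_map]
  exact (AddSubgroup.map_injective (basisHom_injective b)).eq_iff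

/-- The sublattices of finite index of `L` that satisfy `P`. -/
abbrev Lat (P : AddSubgroup E → Prop) (L : AddSubgroup E) :=
  {K : AddSubgroup E // (K ≤ L ∧ K.relIndex L ≠ 0) ∧ P K}

/-- Transport of the sublattices with a given property to `ℤ²`. -/
def latEquiv (b : Basis (Fin 2) ℚ E) {P : AddSubgroup E → Prop}
    {P' : AddSubgroup (Fin 2 → ℤ) → Prop} (hP : ∀ H, P (H.map (basisHom b)) ↔ P' H) :
    {H : AddSubgroup (Fin 2 → ℤ) // H.index ≠ 0 ∧ P' H} ≃ Lat P (latticeOf b) where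
  toFun H := ⟨H.1.map (basisHom b), ((sublatticeEquiv b).symm ⟨H.1, H.2.1⟩).2,
    (hP _).2 H.2.2⟩
  invFun K := ⟨K.1.comap (basisHom b), ((sublatticeEquiv b) ⟨K.1, K.2.1⟩).2, by
    rw [← hP, map_comap_basisHom b K.2.1.1]
    exact K.2.2⟩
  left_inv H := Subtype.ext (comap_map_basisHom b _)
  right_inv K := Subtype.ext (map_comap_basisHom b K.2.1.1)

lemma relIndex_latEquiv (b : Basis (Fin 2) ℚ E) {P : AddSubgroup E → Prop}
    {P' : AddSubgroup (Fin 2 → ℤ) → Prop} (hP : ∀ H, P (H.map (basisHom b)) ↔ P' H)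
    (H : {H : AddSubgroup (Fin 2 → ℤ) // H.index ≠ 0 ∧ P' H}) :
    (latEquiv b hP H).1.relIndex (latticeOf b) = H.1.index := by
  rw [← index_comap_basisHom]
  simp only [latEquiv, Equiv.coe_fn_mk, comap_map_basisHom]

lemma finite_sublattices (b : Basis (Fin 2) ℚ E) {m : ℕ} (hm : m ≠ 0) :
    (sublattices (latticeOf b) m).Finite := by
  -- Convergence at `s = 3` forces the terms to tend to zero, so only finitely many have absolute
  -- value at least `m^{-3}`.
  have h := (hasSum_relIndex b (s := 3) (by norm_num)).summable
  have h2 := (h.tendsto_cofinite_zero.norm).eventually_lt_const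
    (u := (m : ℝ) ^ (-3 : ℝ)) (by simp; positivity)
  rw [Filter.Eventually, Filter.mem_cofinite] at h2
  refine (h2.image Subtype.val).subset ?_
  rintro K ⟨h3, h4⟩
  refine ⟨⟨K, h3, by rw [h4]; exact hm⟩, ?_, rfl⟩
  simp only [Set.mem_compl_iff, Set.mem_ofPred_eq, h4, not_lt]
  rw [Complex.norm_natCast_cpow_of_pos (Nat.pos_of_ne_zero hm)]
  simp

/-- A basis from its triangular coordinates in another basis. -/
lemma exists_basis_triangular (b : Basis (Fin 2) ℚ E) {α β δ : ℚ} (hα : α ≠ 0) (hδ : δ ≠ 0) :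
    ∃ b' : Basis (Fin 2) ℚ E, b' 0 = α • b 0 ∧ b' 1 = β • b 0 + δ • b 1 := by
  have hli : LinearIndependent ℚ ![α • b 0, β • b 0 + δ • b 1] := by
    rw [LinearIndependent.pair_iff]
    intro x y hxy
    have h := b.linearIndependent
    have e : b = ![b 0, b 1] := by ext i; fin_cases i <;> rfl
    rw [e, LinearIndependent.pair_iff] at h
    obtain ⟨h1, h2⟩ := h (x * α + y * β) (y * δ) (by rw [← hxy]; module)
    have hy : y = 0 := by simpa [hδ] using h2
    subst hy
    simpa [hα] using h1
  have hfin : finrank ℚ E = 2 := by simpa using finrank_eq_card_basis b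
  refine ⟨basisOfLinearIndependentOfCardEqFinrank hli (by simp [hfin]), ?_, ?_⟩ <;> simp

/-- Hermite normal form moved to the plane: a sublattice of finite index is again spanned by a
basis. The bound `β < α` is kept for `exists_basis_reflection`. -/
lemma exists_basis_hnf (b : Basis (Fin 2) ℚ E) {K : AddSubgroup E} (hK : K ≤ latticeOf b)
    (hi : K.relIndex (latticeOf b) ≠ 0) : ∃ (α δ β : ℕ) (b' : Basis (Fin 2) ℚ E), β < α ∧
      K = latticeOf b' ∧ b' 0 = α • b 0 ∧ b' 1 = β • b 0 + δ • b 1 := by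
  obtain ⟨α, δ, β, hα, hδ, hβ, h⟩ := exists_eq_hnf (K.comap (basisHom b)) (by
    rwa [index_comap_basisHom])
  obtain ⟨b', h0, h1⟩ := exists_basis_triangular b (α := α) (β := β) (δ := δ)
    (by exact_mod_cast hα) (by exact_mod_cast hδ)
  simp only [Nat.cast_smul_eq_nsmul] at h0 h1
  refine ⟨α, δ, β, b', hβ, ?_, h0, h1⟩
  rw [← map_comap_basisHom b hK, ← h]
  ext x
  rw [mem_latticeOf]
  simp only [← natCast_zsmul] at h0 h1
  constructor
  · rintro ⟨v, ⟨m, n, h2, h3⟩, rfl⟩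
    refine ⟨m, n, ?_⟩
    rw [basisHom_apply, h2, h3, h0, h1]
    module
  · rintro ⟨m, n, rfl⟩
    refine ⟨![m * α + n * β, n * δ], ⟨m, n, by simp⟩, ?_⟩
    simp only [basisHom_apply, h0, h1, Matrix.cons_val_zero, Matrix.cons_val_one]
    module

/-- A lattice invariant under a reflection has a basis adapted to it. -/
lemma exists_basis_reflection (b : Basis (Fin 2) ℚ E) {ρ : E →+ E} (h0 : ρ (b 0) = b 0)
    (h1 : ρ (b 1) = -b 1) {K : AddSubgroup E} (hK : K ≤ latticeOf b)
    (hi : K.relIndex (latticeOf b) ≠ 0) (hρ : ∀ x ∈ K, ρ x ∈ K) :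
    ∃ (ε : ℤ) (b' : Basis (Fin 2) ℚ E), K = latticeOf b' ∧ ρ (b' 0) = b' 0 ∧
      ρ (b' 1) = ε • b' 0 - b' 1 ∧ (ε = 0 ∨ ε = 1) ∧
      (ε = 0 ↔ ∀ x ∈ K, ∃ y ∈ K, 2 • y = x + ρ x) := by
  obtain ⟨α, δ, β, b', hβ, rfl, e0, e1⟩ := exists_basis_hnf b hK hi
  have r0 : ρ (b' 0) = b' 0 := by rw [e0, map_nsmul, h0]
  have r1 : ρ (b' 1) + b' 1 = (2 * β) • b 0 := by
    rw [e1, map_add, map_nsmul, map_nsmul, h0, h1]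
    module
  obtain ⟨m, n, hmn⟩ := (mem_latticeOf b').1 (hρ (b' 1) ((mem_latticeOf b').2 ⟨0, 1, by simp⟩))
  have hb := LinearIndependent.pair_iff.1 (by
    have h := b.linearIndependent
    rwa [show (b : Fin 2 → E) = ![b 0, b 1] by ext i; fin_cases i <;> rfl] at h)
  have hδ : (δ : ℚ) ≠ 0 := by
    intro h
    have h' := b'.linearIndependent
    rw [show (b' : Fin 2 → E) = ![b' 0, b' 1] by ext i; fin_cases i <;> rfl,
      LinearIndependent.pair_iff] at h'
    have hδ : δ = 0 := by exact_mod_cast h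
    have := (h' β (-α) (by
      rw [e0, e1, hδ, ← Nat.cast_smul_eq_nsmul ℚ, ← Nat.cast_smul_eq_nsmul ℚ]; module)).2
    have : (α : ℚ) = 0 := by linarith
    have : α = 0 := by exact_mod_cast this
    omega
  -- `ρ (b' 1) + b' 1` equals `2β b 0` and also `m b' 0 + (n + 1) b' 1`; comparing coordinates gives
  -- `n = -1` and `mα = 2β`.
  have key := hb (m * α + (n + 1) * β - 2 * β) ((n + 1) * δ) (by
    have h2 := r1
    rw [hmn, e0, e1] at h2
    simp only [← Nat.cast_smul_eq_nsmul ℚ, ← Int.cast_smul_eq_zsmul ℚ] at h2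
    push_cast at h2
    rw [← sub_eq_zero] at h2
    rw [← h2]
    module)
  have hn : (n : ℚ) + 1 = 0 := by simpa [hδ] using key.2
  have hm : (m : ℚ) * α = 2 * β := by
    have := key.1
    rw [hn] at this
    linarith
  have hm' : m * α = 2 * β := by exact_mod_cast hm
  have hn' : n = -1 := by
    have : n + 1 = 0 := by exact_mod_cast hn
    omega
  have r1' : ρ (b' 1) = m • b' 0 - b' 1 := by rw [hmn, hn']; module
  -- `0 ≤ β < α` and `mα = 2β` leave only these two values.
  have hm01 : m = 0 ∨ m = 1 := by
    have : m < 2 := by by_contra!; nlinarith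
    have : -1 < m := by by_contra!; nlinarith
    omega
  refine ⟨m, b', rfl, r0, r1', hm01, ?_⟩
  constructor
  · rintro rfl x hx
    obtain ⟨p, q, rfl⟩ := (mem_latticeOf b').1 hx
    refine ⟨p • b' 0, (mem_latticeOf b').2 ⟨p, 0, by simp⟩, ?_⟩
    rw [map_add, map_zsmul, map_zsmul, r0, r1']
    module
  · intro h
    -- For `x = b' 1` the half-sum is `(m / 2) b' 0`, which is in the lattice only for even `m`.
    obtain ⟨y, hy, hy2⟩ := h (b' 1) ((mem_latticeOf b').2 ⟨0, 1, by simp⟩)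
    obtain ⟨p, q, rfl⟩ := (mem_latticeOf b').1 hy
    rw [r1'] at hy2
    have h3 : basisHom b' ![2 * p, 2 * q] = basisHom b' ![m, 0] := by
      simp only [basisHom_apply, Matrix.cons_val_zero, Matrix.cons_val_one]
      rw [show b' 1 + (m • b' 0 - b' 1) = m • b' 0 by abel] at hy2
      rw [zero_smul, add_zero, ← hy2]
      module
    have h4 := congrFun (basisHom_injective b' h3) 0
    simp at h4
    omega

/-- Linear maps of determinant `±1` preserve the index. -/
lemma relIndex_map_eq (b : Basis (Fin 2) ℚ E) {K : AddSubgroup E} (hK : K ≤ latticeOf b)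
    (hi : K.relIndex (latticeOf b) ≠ 0) (σ : E ≃ₗ[ℚ] E)
    (hσ : |LinearMap.det (σ : E →ₗ[ℚ] E)| = 1) (h : image σ K ≤ latticeOf b) :
    (image σ K).relIndex (latticeOf b) = K.relIndex (latticeOf b) := by
  obtain ⟨-, -, -, b', -, rfl, -, -⟩ := exists_basis_hnf b hK hi
  have e : image σ (latticeOf b') = AddSubgroup.closure (Set.range (b'.map σ)) := by
    rw [image, latticeOf, AddMonoidHom.map_closure, ← Set.range_comp]
    rfl
  have h1 := AddSubgroup.relIndex_eq_abs_det _ _ h (b'.map σ) b e rfl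
  have h2 := AddSubgroup.relIndex_eq_abs_det _ _ hK b' b rfl rfl
  have h3 : b.det (b'.map σ) = LinearMap.det (σ : E →ₗ[ℚ] E) * b.det b' := by
    rw [← Basis.det_comp]
    congr 1
  rw [h3, abs_mul, hσ, one_mul, ← h2] at h1
  exact_mod_cast h1

end Lattices

end SubformZeta

end


/-! ### Counting isometry classes by stabilizers and embeddings -/

open scoped NumberField nonZeroDivisors

noncomputable section

namespace SubformZeta

section Burnside

open Module

variable {V : Type*} [AddCommGroup V] [Module ℚ V]

lemma image_one (K : AddSubgroup V) : image 1 K = K := by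
  ext x
  constructor
  · rintro ⟨y, hy, rfl⟩
    exact hy
  · intro hx
    exact ⟨x, hx, rfl⟩

lemma image_mul (σ τ : V ≃ₗ[ℚ] V) (K : AddSubgroup V) :
    image (σ * τ) K = image σ (image τ K) := by
  rw [image, image, image, AddSubgroup.map_map]
  rfl

lemma image_inv_eq_iff (σ : V ≃ₗ[ℚ] V) (K M : AddSubgroup V) :
    image σ⁻¹ M = K ↔ M = image σ K := by
  constructor
  · rintro rfl
    rw [← image_mul, mul_inv_cancel, image_one]
  · rintro rfl
    rw [← image_mul, inv_mul_cancel, image_one]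

lemma cls_eq_iff (G : Subgroup (V ≃ₗ[ℚ] V)) (K M : AddSubgroup V) :
    cls G M = cls G K ↔ M ∈ cls G K := by
  constructor
  · intro h
    rw [← h]
    exact ⟨1, one_mem _, image_one M⟩
  · rintro ⟨σ, hσ, rfl⟩
    ext N
    constructor
    · rintro ⟨τ, hτ, rfl⟩
      exact ⟨τ * σ, mul_mem hτ hσ, image_mul _ _ _⟩
    · rintro ⟨τ, hτ, rfl⟩
      exact ⟨τ * σ⁻¹, mul_mem hτ (inv_mem hσ), by
        rw [image_mul, (image_inv_eq_iff _ _ _).2 rfl]⟩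

/-- The sublattices of finite index. -/
abbrev Sub (L : AddSubgroup V) := {K : AddSubgroup V // K ≤ L ∧ K.relIndex L ≠ 0}

/-- The isometries in `P` that map `K` into `L`. -/
def embSet (P : Set (V ≃ₗ[ℚ] V)) (L K : AddSubgroup V) : Set (V ≃ₗ[ℚ] V) :=
  {σ | σ ∈ P ∧ image σ K ≤ L}

/-- The isometries in `P` that preserve `K`. -/
def stabSet (P : Set (V ≃ₗ[ℚ] V)) (K : AddSubgroup V) : Set (V ≃ₗ[ℚ] V) :=
  {σ | σ ∈ P ∧ image σ K = K}

lemma stabSet_subset (P : Set (V ≃ₗ[ℚ] V)) {L K : AddSubgroup V} (h : K ≤ L) :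
    stabSet P K ⊆ embSet P L K := fun _ hσ => ⟨hσ.1, hσ.2.le.trans h⟩

/-- Orbit and stabilizer: `σ ↦ σ(K)` maps the embeddings onto the lattices in `L` equivalent to `K`,
and its fibres are left cosets of the stabilizer. -/
lemma embSet_ncard_eq (G : Subgroup (V ≃ₗ[ℚ] V)) {L K : AddSubgroup V} {m : ℕ}
    (hfin : (embSet G L K).Finite)
    (hG : ∀ σ ∈ G, image σ K ≤ L → (image σ K).relIndex L = m) :
    (embSet (G : Set (V ≃ₗ[ℚ] V)) L K).ncard =
      {M | M ∈ sublattices L m ∧ cls G M = cls G K}.ncard *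
        (stabSet (G : Set (V ≃ₗ[ℚ] V)) K).ncard := by
  rw [ncard_eq_ncard_image_mul hfin (fun σ => image σ K)
    (c := (stabSet (G : Set (V ≃ₗ[ℚ] V)) K).ncard)]
  · congr 2
    ext M
    constructor
    · rintro ⟨σ, ⟨hσ, hσL⟩, rfl⟩
      exact ⟨⟨hσL, hG σ hσ hσL⟩, (cls_eq_iff _ _ _).2 ⟨σ, hσ, rfl⟩⟩
    · rintro ⟨hM, hMK⟩
      obtain ⟨σ, hσ, rfl⟩ := (cls_eq_iff _ _ _).1 hMK
      exact ⟨σ, ⟨hσ, hM.1⟩, rfl⟩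
  · rintro σ ⟨hσ, hσL⟩
    symm
    refine Set.ncard_congr (fun τ _ => σ * τ) ?_ ?_ ?_
    · rintro τ ⟨hτ, hτK⟩
      have : image (σ * τ) K = image σ K := by rw [image_mul, hτK]
      exact ⟨⟨mul_mem hσ hτ, by rw [this]; exact hσL⟩, this⟩
    · intro τ τ' _ _ h
      exact mul_left_cancel h
    · rintro τ ⟨⟨hτ, hτL⟩, h⟩
      refine ⟨σ⁻¹ * τ, ⟨mul_mem (inv_mem hσ) hτ, ?_⟩, by simp⟩
      rw [image_mul, image_inv_eq_iff]
      exact h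

variable {L : AddSubgroup V}

/-- By `embSet_ncard_eq` the summand is the inverse of the number of lattices in `L` equivalent to
`K`, so every class contributes 1. -/
lemma hasSum_numClasses (G : Subgroup (V ≃ₗ[ℚ] V)) {m : ℕ} (hm : m ≠ 0)
    (hL : (sublattices L m).Finite)
    (hfin : ∀ K : Sub L, (embSet G L K.1).Finite)
    (hG : ∀ K : Sub L, ∀ σ ∈ G, image σ K.1 ≤ L → (image σ K.1).relIndex L = K.1.relIndex L) :
    HasSum (fun K : {K : Sub L // K.1.relIndex L = m} =>
      ((stabSet (G : Set (V ≃ₗ[ℚ] V)) K.1.1).ncard : ℂ) /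
        (embSet (G : Set (V ≃ₗ[ℚ] V)) L K.1.1).ncard) (numClasses G L m) := by
  classical
  let e : hL.toFinset ≃ {K : Sub L // K.1.relIndex L = m} :=
    { toFun := fun K => ⟨⟨K.1, (hL.mem_toFinset.1 K.2).1, by
        rw [(hL.mem_toFinset.1 K.2).2]; exact hm⟩, (hL.mem_toFinset.1 K.2).2⟩
      invFun := fun K => ⟨K.1.1, hL.mem_toFinset.2 ⟨K.1.2.1, K.2⟩⟩
      left_inv := fun K => rfl
      right_inv := fun K => rfl }
  rw [← e.hasSum_iff]
  have h1 := sum_div_ncard_fiber hL.toFinset (cls G) (fun _ => (1 : ℂ))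
  refine hasSum_of_eq (hasSum_fintype (fun K : hL.toFinset =>
    (1 : ℂ) / ({a' | a' ∈ hL.toFinset ∧ cls G a' = cls G K.1}.ncard : ℂ))) ?_ ?_
  · intro K
    have hK := hL.mem_toFinset.1 K.2
    let K' : Sub L := ⟨K.1, hK.1, by rw [hK.2]; exact hm⟩
    have h2 := embSet_ncard_eq G (m := m) (K := K.1) (hfin K') (fun σ hσ h => by rw [hG K' σ hσ h]; exact hK.2)
    have h3 : (stabSet (G : Set (V ≃ₗ[ℚ] V)) K.1).ncard ≠ 0 := by
      rw [Ne, Set.ncard_eq_zero ((hfin K').subset (stabSet_subset _ hK.1)),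
        ← Ne, ← Set.nonempty_iff_ne_empty]
      exact ⟨1, one_mem G, image_one _⟩
    simp only [Function.comp_apply, e, Equiv.coe_fn_mk, h2, Set.Finite.mem_toFinset]
    push_cast
    have h3' : ((stabSet (G : Set (V ≃ₗ[ℚ] V)) K.1).ncard : ℂ) ≠ 0 := by exact_mod_cast h3
    rw [div_mul_cancel_right₀ h3', one_div]
  · rw [Finset.univ_eq_attach, Finset.sum_attach hL.toFinset (fun K =>
      (1 : ℂ) / ({a' | a' ∈ hL.toFinset ∧ cls G a' = cls G K}.ncard : ℂ)), h1]
    simp only [Finset.sum_const, nsmul_eq_mul, mul_one]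
    rw [← Set.ncard_coe_finset]
    simp [numClasses]

lemma summable_weight_mul {V : Type*} [AddCommGroup V] {L : AddSubgroup V} {s : ℂ}
    (hs : Summable fun K : Sub L => (K.1.relIndex L : ℂ) ^ (-s)) {f : Sub L → ℂ} {C : ℝ}
    (hf : ∀ K, ‖f K‖ ≤ C) : Summable fun K : Sub L => (K.1.relIndex L : ℂ) ^ (-s) * f K := by
  refine Summable.of_norm_bounded (hs.norm.mul_right C) fun K => ?_
  rw [norm_mul]
  exact mul_le_mul_of_nonneg_left (hf K) (norm_nonneg _)

lemma norm_natCast_div_le_one {m n : ℕ} (h : m ≤ n) : ‖(m : ℂ) / n‖ ≤ 1 := by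
  rw [norm_div, Complex.norm_natCast, Complex.norm_natCast]
  exact div_le_one_of_le₀ (by exact_mod_cast h) (by positivity)

lemma hasSum_numClasses_LSeries (G : Subgroup (V ≃ₗ[ℚ] V))
    (hL : ∀ m ≠ 0, (sublattices L m).Finite)
    (hfin : ∀ K : Sub L, (embSet G L K.1).Finite)
    (hG : ∀ K : Sub L, ∀ σ ∈ G, image σ K.1 ≤ L → (image σ K.1).relIndex L = K.1.relIndex L)
    {s : ℂ} (hs : Summable fun K : Sub L => (K.1.relIndex L : ℂ) ^ (-s)) :
    LSeriesHasSum (fun m => (numClasses G L m : ℂ)) s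
      (∑' K : Sub L, (K.1.relIndex L : ℂ) ^ (-s) *
        (((stabSet (G : Set (V ≃ₗ[ℚ] V)) K.1).ncard : ℂ) /
          (embSet (G : Set (V ≃ₗ[ℚ] V)) L K.1).ncard)) :=
  hasSum_fiberwise_term (fun K => K.2.2)
    (summable_weight_mul hs (C := 1) fun K => norm_natCast_div_le_one
      (Set.ncard_le_ncard (stabSet_subset _ K.2.1) (hfin K)))
    fun m hm => hasSum_numClasses G hm (hL m hm) hfin hG

variable (Q : QuadraticForm ℚ V)

lemma zTerm_eq (s : ℂ) (K : AddSubgroup V) : zTerm Q L s K = (K.relIndex L : ℂ) ^ (-s) /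
    (embSet (orthogonalGroup Q : Set (V ≃ₗ[ℚ] V)) L K).ncard := rfl

lemma norm_zTerm_le (s : ℂ) (K : AddSubgroup V) :
    ‖zTerm Q L s K‖ ≤ ‖(K.relIndex L : ℂ) ^ (-s)‖ := by
  rw [zTerm_eq, norm_div, Complex.norm_natCast]
  rcases Nat.eq_zero_or_pos (embSet (orthogonalGroup Q : Set (V ≃ₗ[ℚ] V)) L K).ncard with h | h
  · simp [h]
  · exact div_le_self (norm_nonneg _) (by exact_mod_cast h)

lemma summable_zTerm {s : ℂ} (hs : Summable fun K : Sub L => (K.1.relIndex L : ℂ) ^ (-s))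
    (ρ : V ≃ₗ[ℚ] V) : Summable fun K : invariantSublattices L ρ => zTerm Q L s K := by
  refine Summable.of_norm_bounded (hs.norm.comp_injective
    (i := fun K : invariantSublattices L ρ => (⟨K.1, K.2.1, K.2.2.1⟩ : Sub L)) ?_)
    fun K => norm_zTerm_le Q s K
  intro K K' h
  exact Subtype.ext (Subtype.mk.inj h)

/-- Interchanging the sums over isometries `ρ` and over `ρ`-invariant sublattices. -/
lemma hasSum_zSum {s : ℂ} (hs : Summable fun K : Sub L => (K.1.relIndex L : ℂ) ^ (-s))
    (hfin : ∀ K : Sub L, (embSet (orthogonalGroup Q) L K.1).Finite)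
    {P : Set (V ≃ₗ[ℚ] V)} (hP : P ⊆ orthogonalGroup Q) :
    HasSum (fun ρ : P => zSum Q L ρ s) (∑' K : Sub L, (K.1.relIndex L : ℂ) ^ (-s) *
      (((stabSet P K.1).ncard : ℂ) /
        (embSet (orthogonalGroup Q : Set (V ≃ₗ[ℚ] V)) L K.1).ncard)) := by
  have hsub : ∀ K : Sub L, stabSet P K.1 ⊆ embSet (orthogonalGroup Q) L K.1 := fun K σ hσ =>
    ⟨hP hσ.1, hσ.2.le.trans K.2.1⟩
  have hfinP : ∀ K : Sub L, Finite (stabSet P K.1) := fun K => (hfin K).subset (hsub K)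
  -- Both double sums run over the pairs `(ρ, K)` with `ρ(K) = K`.
  let e : (Σ K : Sub L, stabSet P K.1) ≃ Σ ρ : P, invariantSublattices L (ρ : V ≃ₗ[ℚ] V) :=
    { toFun := fun t => ⟨⟨t.2.1, t.2.2.1⟩, ⟨t.1.1, t.1.2.1, t.1.2.2, t.2.2.2⟩⟩
      invFun := fun t => ⟨⟨t.2.1, t.2.2.1, t.2.2.2.1⟩, ⟨t.1.1, t.1.2, t.2.2.2.2⟩⟩
      left_inv := fun t => rfl
      right_inv := fun t => rfl }
  have hinner : ∀ K : Sub L, HasSum (fun _ : stabSet P K.1 => zTerm Q L s K.1)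
      ((K.1.relIndex L : ℂ) ^ (-s) * (((stabSet P K.1).ncard : ℂ) /
        (embSet (orthogonalGroup Q : Set (V ≃ₗ[ℚ] V)) L K.1).ncard)) := by
    intro K
    have := Fintype.ofFinite (stabSet P K.1)
    refine hasSum_of_eq (hasSum_fintype _) (fun _ => rfl) ?_
    rw [Finset.sum_const, zTerm_eq, Finset.card_univ, ← Nat.card_eq_fintype_card,
      Nat.card_coe_set_eq, nsmul_eq_mul]
    ring
  -- The maps preserving `K` are among those counted in the denominator, so the quotient is at most
  -- 1. The same bound gives absolute convergence over pairs.
  have hsum1 : Summable fun K : Sub L => (K.1.relIndex L : ℂ) ^ (-s) *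
      (((stabSet P K.1).ncard : ℂ) /
        (embSet (orthogonalGroup Q : Set (V ≃ₗ[ℚ] V)) L K.1).ncard) :=
    summable_weight_mul hs (C := 1) fun K => norm_natCast_div_le_one
      (Set.ncard_le_ncard (hsub K) (hfin K))
  have hsum : Summable fun t : Σ K : Sub L, stabSet P K.1 => zTerm Q L s t.1.1 := by
    refine Summable.of_norm ?_
    refine (summable_sigma_of_nonneg (fun _ => norm_nonneg _)).2 ⟨fun K => ?_, ?_⟩
    · exact (hinner K).summable.norm
    · convert hsum1.norm using 2 with K
      have := Fintype.ofFinite (stabSet P K.1)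
      simp only
      rw [tsum_fintype, Finset.sum_const, zTerm_eq, Finset.card_univ,
        ← Nat.card_eq_fintype_card, Nat.card_coe_set_eq, nsmul_eq_mul, norm_mul, norm_div, norm_div,
        Complex.norm_natCast, Complex.norm_natCast]
      ring
  have htot := HasSum.sigma_of_hasSum hsum1.hasSum hinner hsum
  rw [← e.symm.hasSum_iff] at htot
  exact htot.sigma fun ρ => (summable_zTerm Q hs ρ.1).hasSum

/-- Elements of a finite stabilizer have finite order. -/
lemma isOfFinOrder_of_finite_stab (G : Subgroup (V ≃ₗ[ℚ] V)) {K : AddSubgroup V}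
    (h : (stabSet (G : Set (V ≃ₗ[ℚ] V)) K).Finite) {σ : V ≃ₗ[ℚ] V} (hσ : σ ∈ G)
    (hσK : image σ K = K) : IsOfFinOrder σ := by
  by_contra hinf
  have hinj : Function.Injective fun n : ℕ => σ ^ n :=
    injective_pow_iff_not_isOfFinOrder.2 hinf
  refine (Set.infinite_range_of_injective hinj) (h.subset ?_)
  rintro _ ⟨n, rfl⟩
  refine ⟨pow_mem hσ n, ?_⟩
  induction n with
  | zero => exact image_one K
  | succ n ih =>
    simp only [pow_succ, image_mul, hσK]
    exact ih

lemma rotationGroup_le : rotationGroup Q ≤ orthogonalGroup Q := inf_le_left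

lemma ncard_stab_add (K : Sub L)
    (hfin : (embSet (orthogonalGroup Q : Set (V ≃ₗ[ℚ] V)) L K.1).Finite) :
    (stabSet (orthogonalGroup Q : Set (V ≃ₗ[ℚ] V)) K.1).ncard =
      (stabSet (rotationGroup Q : Set (V ≃ₗ[ℚ] V)) K.1).ncard +
        (stabSet (reflectionSet Q) K.1).ncard := by
  rw [← Set.ncard_union_eq ?_ ?_ ?_]
  · congr 1
    ext σ
    constructor
    · rintro ⟨h1, h2⟩
      by_cases h : σ ∈ rotationGroup Q
      · exact Or.inl ⟨h, h2⟩
      · exact Or.inr ⟨⟨h1, h⟩, h2⟩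
    · rintro (⟨h1, h2⟩ | ⟨h1, h2⟩)
      · exact ⟨rotationGroup_le Q h1, h2⟩
      · exact ⟨h1.1, h2⟩
  · exact Set.disjoint_left.2 fun σ h h' => h'.1.2 h.1
  · exact hfin.subset fun σ h => ⟨rotationGroup_le Q h.1, h.2.le.trans K.2.1⟩
  · exact hfin.subset fun σ h => ⟨h.1.1, h.2.le.trans K.2.1⟩

lemma ncard_emb_add (K : Sub L)
    (hfin : (embSet (orthogonalGroup Q : Set (V ≃ₗ[ℚ] V)) L K.1).Finite) :
    (embSet (orthogonalGroup Q : Set (V ≃ₗ[ℚ] V)) L K.1).ncard =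
      (embSet (rotationGroup Q : Set (V ≃ₗ[ℚ] V)) L K.1).ncard +
        (embSet (reflectionSet Q) L K.1).ncard := by
  rw [← Set.ncard_union_eq ?_ ?_ ?_]
  · congr 1
    ext σ
    constructor
    · rintro ⟨h1, h2⟩
      by_cases h : σ ∈ rotationGroup Q
      · exact Or.inl ⟨h, h2⟩
      · exact Or.inr ⟨⟨h1, h⟩, h2⟩
    · rintro (⟨h1, h2⟩ | ⟨h1, h2⟩)
      · exact ⟨rotationGroup_le Q h1, h2⟩
      · exact ⟨h1.1, h2⟩
  · exact Set.disjoint_left.2 fun σ h h' => h'.1.2 h.1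
  · exact hfin.subset fun σ h => ⟨rotationGroup_le Q h.1, h.2⟩
  · exact hfin.subset fun σ h => ⟨h.1.1, h.2⟩

end Burnside

end SubformZeta

end


/-! ### Integers, conjugation and discriminant of an imaginary quadratic field -/

open scoped NumberField nonZeroDivisors

noncomputable section

namespace SubformZeta

open Module

/-- An imaginary quadratic field `ℚ(θ)`, `θ² = d < 0` square-free, with its conjugation. -/
structure QuadData (F : Type*) [Field F] [NumberField F] where
  d : ℤ
  θ : F
  conj : F ≃ₐ[ℚ] F
  sqf : Squarefree d
  neg : d < 0
  sq : θ ^ 2 = (d : F)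
  finrank : Module.finrank ℚ F = 2
  conj_ne : conj ≠ AlgEquiv.refl

namespace QuadData

variable {F : Type*} [Field F] [NumberField F] (S : QuadData F)

lemma d_ne_zero : S.d ≠ 0 := S.neg.ne

lemma θ_ne_zero : S.θ ≠ 0 := by
  intro h
  have := S.sq
  rw [h] at this
  have h2 : (S.d : F) = 0 := by rw [← this]; ring
  exact S.d_ne_zero (by exact_mod_cast h2)

/-- Otherwise `θ` would be rational and the negative number `d` a rational square. -/
lemma eq_zero_of_add_eq_zero {p q : ℚ} (h : (p : F) + q * S.θ = 0) : p = 0 ∧ q = 0 := by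
  have hq : q = 0 := by
    by_contra hq
    have hq' : (q : F) ≠ 0 := by exact_mod_cast hq
    have h1 : S.θ = ((-p / q : ℚ) : F) := by
      push_cast
      field_simp
      linear_combination h
    have h2 := S.sq
    rw [h1] at h2
    have h3 : (-p / q) ^ 2 = (S.d : ℚ) := by exact_mod_cast h2
    have h4 : (S.d : ℚ) < 0 := by exact_mod_cast S.neg
    nlinarith [sq_nonneg (-p / q)]
  subst hq
  refine ⟨?_, rfl⟩
  simpa using h

lemma coord_inj {p q p' q' : ℚ} (h : (p : F) + q * S.θ = p' + q' * S.θ) : p = p' ∧ q = q' := by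
  have := S.eq_zero_of_add_eq_zero (p := p - p') (q := q - q') (by
    push_cast; linear_combination h)
  constructor <;> linarith [this.1, this.2]

lemma linearIndependent : LinearIndependent ℚ ![(1 : F), S.θ] := by
  rw [LinearIndependent.pair_iff]
  intro p q h
  refine S.eq_zero_of_add_eq_zero ?_
  rw [Rat.smul_def, Rat.smul_def, mul_one] at h
  exact h

/-- The basis `1, θ`. -/
def basis : Basis (Fin 2) ℚ F :=
  basisOfLinearIndependentOfCardEqFinrank S.linearIndependent (by simp [S.finrank])

lemma basis_zero : S.basis 0 = 1 := by simp [basis]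

lemma basis_one : S.basis 1 = S.θ := by simp [basis]

lemma exists_coord (x : F) : ∃ p q : ℚ, x = p + q * S.θ := by
  refine ⟨S.basis.repr x 0, S.basis.repr x 1, ?_⟩
  conv_lhs => rw [← S.basis.sum_repr x, Fin.sum_univ_two, basis_zero, basis_one]
  rw [Rat.smul_def, Rat.smul_def, mul_one]

/-- The image of `θ` is a square root of `d`; if it were `θ` itself, `conj` would be the identity.
-/
lemma conj_θ : S.conj S.θ = -S.θ := by
  have h1 : S.conj S.θ ^ 2 = S.θ ^ 2 := by rw [← map_pow, S.sq, map_intCast]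
  rcases sq_eq_sq_iff_eq_or_eq_neg.1 h1 with h | h
  · refine absurd (AlgEquiv.ext fun x => ?_) S.conj_ne
    obtain ⟨p, q, rfl⟩ := S.exists_coord x
    simp [h]
  · exact h

lemma conj_coord (p q : ℚ) : S.conj (p + q * S.θ) = p - q * S.θ := by
  rw [map_add, map_mul, map_ratCast, map_ratCast, conj_θ]
  ring

@[simp]
lemma conj_conj (x : F) : S.conj (S.conj x) = x := by
  obtain ⟨p, q, rfl⟩ := S.exists_coord x
  rw [conj_coord, map_sub, map_mul, map_ratCast, map_ratCast, conj_θ]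
  ring

lemma mul_conj_coord (p q : ℚ) :
    ((p : F) + q * S.θ) * S.conj (p + q * S.θ) = ((p ^ 2 - S.d * q ^ 2 : ℚ) : F) := by
  rw [conj_coord]
  push_cast
  linear_combination (-(q : F) ^ 2) * S.sq

lemma add_conj_coord (p q : ℚ) :
    ((p : F) + q * S.θ) + S.conj (p + q * S.θ) = ((2 * p : ℚ) : F) := by
  rw [conj_coord]
  push_cast
  ring

lemma eq_one_or_conj (g : F ≃ₐ[ℚ] F) : g = 1 ∨ g = S.conj := by
  have h1 : g S.θ ^ 2 = S.θ ^ 2 := by rw [← map_pow, S.sq, map_intCast]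
  rcases sq_eq_sq_iff_eq_or_eq_neg.1 h1 with h | h
  · left
    ext x
    obtain ⟨p, q, rfl⟩ := S.exists_coord x
    simp [h]
  · right
    ext x
    obtain ⟨p, q, rfl⟩ := S.exists_coord x
    rw [conj_coord]
    simp [h]
    ring

lemma isGalois (S : QuadData F) : IsGalois ℚ F := by
  have : Algebra.IsQuadraticExtension ℚ F := ⟨S.finrank⟩
  infer_instance

lemma univ_gal [DecidableEq (F ≃ₐ[ℚ] F)] :
    (Finset.univ : Finset (F ≃ₐ[ℚ] F)) = {1, S.conj} := by
  ext g
  simpa using S.eq_one_or_conj g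

lemma norm_eq (x : F) : ((Algebra.norm ℚ x : ℚ) : F) = x * S.conj x := by
  classical
  have := S.isGalois
  have h := Algebra.norm_eq_prod_automorphisms ℚ x
  rw [S.univ_gal, Finset.prod_pair (by exact S.conj_ne.symm)] at h
  exact h

lemma trace_eq (x : F) : ((Algebra.trace ℚ F x : ℚ) : F) = x + S.conj x := by
  classical
  have := S.isGalois
  have h := trace_eq_sum_automorphisms (K := ℚ) x
  rw [S.univ_gal, Finset.sum_pair (by exact S.conj_ne.symm)] at h
  exact h

lemma norm_coord (p q : ℚ) : Algebra.norm ℚ ((p : F) + q * S.θ) = p ^ 2 - S.d * q ^ 2 := by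
  have h := S.norm_eq ((p : F) + q * S.θ)
  rw [mul_conj_coord] at h
  exact_mod_cast h

lemma norm_nonneg (S : QuadData F) (x : F) : 0 ≤ Algebra.norm ℚ x := by
  obtain ⟨p, q, rfl⟩ := S.exists_coord x
  rw [norm_coord]
  have h4 : (S.d : ℚ) < 0 := by exact_mod_cast S.neg
  nlinarith [sq_nonneg p, sq_nonneg q]

lemma isIntegral_conj {x : F} (h : IsIntegral ℤ x) : IsIntegral ℤ (S.conj x) := by
  exact h.map (S.conj.toAlgHom.restrictScalars ℤ)

lemma exists_int_of_isIntegral {q : ℚ} (h : IsIntegral ℤ (q : F)) : ∃ n : ℤ, q = n := by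
  have h1 : IsIntegral ℤ q := by
    have : IsIntegral ℤ (algebraMap ℚ F q) := by simpa using h
    exact (isIntegral_algebraMap_iff (algebraMap ℚ F).injective).1 this
  obtain ⟨n, hn⟩ := IsIntegrallyClosed.isIntegral_iff.1 h1
  exact ⟨n, by rw [← hn]; simp⟩

lemma isIntegral_of_trace_norm {x : F} {m n : ℤ} (h1 : x + S.conj x = m)
    (h2 : x * S.conj x = n) : IsIntegral ℤ x := by
  refine ⟨Polynomial.X ^ 2 - Polynomial.C m * Polynomial.X + Polynomial.C n, ?_, ?_⟩
  · monicity!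
  · simp only [Polynomial.eval₂_add, Polynomial.eval₂_sub, Polynomial.eval₂_mul,
      Polynomial.eval₂_X_pow, Polynomial.eval₂_X, Polynomial.eval₂_C]
    simp only [eq_intCast, ← h1, ← h2]
    ring

lemma isIntegral_coord_iff (p q : ℚ) : IsIntegral ℤ ((p : F) + q * S.θ) ↔
    ∃ m n : ℤ, 2 * p = m ∧ p ^ 2 - S.d * q ^ 2 = n := by
  constructor
  · intro h
    have hc := S.isIntegral_conj h
    have h1 := h.add hc
    have h2 := h.mul hc
    rw [add_conj_coord] at h1
    rw [mul_conj_coord] at h2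
    obtain ⟨m, hm⟩ := exists_int_of_isIntegral h1
    obtain ⟨n, hn⟩ := exists_int_of_isIntegral h2
    exact ⟨m, n, hm, hn⟩
  · rintro ⟨m, n, h1, h2⟩
    refine S.isIntegral_of_trace_norm (m := m) (n := n) ?_ ?_
    · rw [add_conj_coord, h1]; simp
    · rw [mul_conj_coord, h2]; simp

/-- `1` if `d ≡ 1 mod 4` and `0` otherwise. -/
def t : ℤ := if S.d % 4 = 1 then 1 else 0

lemma t_eq : (S.t = 1 ∧ S.d % 4 = 1) ∨ (S.t = 0 ∧ S.d % 4 ≠ 1) := by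
  unfold t
  split_ifs with h
  · exact Or.inl ⟨rfl, h⟩
  · exact Or.inr ⟨rfl, h⟩

/-- The generator `θ` or `(1 + θ) / 2` of the ring of integers. -/
def ω : F := (S.t + S.θ) / (S.t + 1)

lemma d_not_four_dvd : ¬ (4 : ℤ) ∣ S.d := by
  intro h
  have := S.sqf 2 (by norm_num; exact h)
  rw [Int.isUnit_iff] at this
  omega

/-- `2p` is the trace, and `m² - d n²` is four times the norm. -/
lemma exists_int_eq_two_mul {p q : ℚ} (h : IsIntegral ℤ ((p : F) + q * S.θ)) :
    ∃ m n : ℤ, 2 * p = m ∧ 2 * q = n ∧ (4 : ℤ) ∣ m ^ 2 - S.d * n ^ 2 := by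
  obtain ⟨m, n, h1, h2⟩ := (S.isIntegral_coord_iff p q).1 h
  have h3 : (S.d : ℚ) * (2 * q) ^ 2 = ((m ^ 2 - 4 * n : ℤ) : ℚ) := by
    push_cast
    rw [← h1, ← h2]
    ring
  -- `2 q` is an integer because `d` is square-free
  have h4 : IsIntegral ℤ (2 * q) := by
    have hd : (S.d : ℚ) * (2 * q) ^ 2 = ((m ^ 2 - 4 * n : ℤ) : ℚ) := h3
    set r : ℚ := 2 * q with hr
    have hden : (r.den : ℤ) ^ 2 ∣ S.d := by
      have h5 : S.d * r.num ^ 2 = (m ^ 2 - 4 * n) * (r.den : ℤ) ^ 2 := by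
        have h6 : (r.den : ℚ) ≠ 0 := by exact_mod_cast r.den_ne_zero
        have h7 : r * r.den = r.num := Rat.mul_den_eq_num r
        have : (S.d : ℚ) * r.num ^ 2 = ((m ^ 2 - 4 * n : ℤ) : ℚ) * (r.den : ℚ) ^ 2 := by
          rw [← hd, ← h7]
          ring
        exact_mod_cast this
      have h8 : IsCoprime ((r.den : ℤ) ^ 2) (r.num ^ 2) := by
        refine IsCoprime.pow ?_
        have := r.reduced
        rw [isCoprime_comm, Int.isCoprime_iff_nat_coprime]
        simpa using this
      exact h8.dvd_of_dvd_mul_right ⟨m ^ 2 - 4 * n, by rw [h5]; ring⟩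
    have h9 : IsUnit (r.den : ℤ) := S.sqf _ (by rw [← pow_two]; exact hden)
    have h10 : r.den = 1 := by
      rw [Int.isUnit_iff] at h9
      omega
    have : r = r.num := by
      have h7 : r * r.den = r.num := Rat.mul_den_eq_num r
      rw [h10] at h7
      simpa using h7
    rw [this]
    exact isIntegral_algebraMap (R := ℤ) (A := ℚ) (x := r.num)
  obtain ⟨k, hk⟩ := IsIntegrallyClosed.isIntegral_iff.1 h4
  simp at hk
  refine ⟨m, k, h1, hk.symm, n, ?_⟩
  have : ((m ^ 2 - S.d * k ^ 2 : ℤ) : ℚ) = ((4 * n : ℤ) : ℚ) := by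
    push_cast
    rw [hk, h3]
    push_cast
    ring
  exact_mod_cast this

lemma t_add_one_ne_zero : (S.t : F) + 1 ≠ 0 := by
  rcases S.t_eq with ⟨h, _⟩ | ⟨h, _⟩ <;> rw [h] <;> norm_num

/-- `ω` in coordinates. -/
lemma ω_coord : S.ω = ((S.t / (S.t + 1) : ℚ) : F) + ((1 / (S.t + 1) : ℚ) : F) * S.θ := by
  have := S.t_add_one_ne_zero
  rw [ω]
  push_cast
  field_simp

lemma sq_emod_four (m : ℤ) : m ^ 2 % 4 = (m % 2) := by
  rcases Int.even_or_odd m with ⟨k, hk⟩ | ⟨k, hk⟩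
  · subst hk; ring_nf; omega
  · subst hk; ring_nf; omega

/-- Squares are 0 or 1 modulo 4. For odd `n` this gives `d ≡ m²`, and `4 ∤ d` then forces `m` odd
and `d ≡ 1`. -/
lemma parity_of_dvd {m n : ℤ} (h : (4 : ℤ) ∣ m ^ 2 - S.d * n ^ 2) :
    (S.t = 1 ∧ m % 2 = n % 2) ∨ (S.t = 0 ∧ m % 2 = 0 ∧ n % 2 = 0) := by
  have hm := sq_emod_four m
  have hn := sq_emod_four n
  have hd := S.d_not_four_dvd
  generalize hM : m ^ 2 = M at *
  rcases Int.emod_two_eq_zero_or_one n with h0 | h0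
  · have : ∃ k, n ^ 2 = 4 * k := ⟨n ^ 2 / 4, by omega⟩
    obtain ⟨k, hk⟩ := this
    have h1 : (4 : ℤ) ∣ M := by
      have h2 : (4 : ℤ) ∣ S.d * n ^ 2 := ⟨S.d * k, by rw [hk]; ring⟩
      have := dvd_add h h2
      simpa using this
    rcases S.t_eq with ⟨ht, _⟩ | ⟨ht, _⟩
    · left; exact ⟨ht, by omega⟩
    · right; exact ⟨ht, by omega, h0⟩
  · have : ∃ k, n ^ 2 = 4 * k + 1 := ⟨n ^ 2 / 4, by omega⟩
    obtain ⟨k, hk⟩ := this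
    have h1 : (4 : ℤ) ∣ M - S.d := by
      have h2 : (4 : ℤ) ∣ S.d * (4 * k) := ⟨S.d * k, by ring⟩
      have := dvd_add h h2
      rw [hk] at this
      rwa [show M - S.d * (4 * k + 1) + S.d * (4 * k) = M - S.d by ring] at this
    rcases S.t_eq with ⟨ht, h3⟩ | ⟨ht, h3⟩
    · left; exact ⟨ht, by omega⟩
    · exfalso; omega

lemma exists_ω_coord {x : F} (h : IsIntegral ℤ x) : ∃ m n : ℤ, x = m + n * S.ω := by
  obtain ⟨p, q, rfl⟩ := S.exists_coord x
  obtain ⟨m, n, hm, hn, h4⟩ := S.exists_int_eq_two_mul h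
  have hp : p = m / 2 := by linarith
  have hq : q = n / 2 := by linarith
  rw [ω_coord, hp, hq]
  rcases S.parity_of_dvd h4 with ⟨ht, h⟩ | ⟨ht, h, h'⟩
  · rw [ht]
    obtain ⟨k, hk⟩ : ∃ k, m = n + 2 * k := ⟨(m - n) / 2, by omega⟩
    refine ⟨k, n, ?_⟩
    rw [hk]
    push_cast
    field_simp
    ring
  · rw [ht]
    obtain ⟨k, rfl⟩ : ∃ k, m = 2 * k := ⟨m / 2, by omega⟩
    obtain ⟨l, rfl⟩ : ∃ l, n = 2 * l := ⟨n / 2, by omega⟩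
    refine ⟨k, l, ?_⟩
    push_cast
    field_simp
    ring

lemma isIntegral_ω : IsIntegral ℤ S.ω := by
  rw [ω_coord, isIntegral_coord_iff]
  rcases S.t_eq with ⟨ht, h⟩ | ⟨ht, _⟩ <;> rw [ht]
  · obtain ⟨k, hk⟩ : ∃ k, S.d = 1 + 4 * k := ⟨(S.d - 1) / 4, by omega⟩
    refine ⟨1, -k, by norm_num, ?_⟩
    rw [hk]
    push_cast
    ring
  · exact ⟨0, -S.d, by norm_num, by push_cast; ring⟩

lemma ω_coord_inj {m n m' n' : ℤ} (h : (m : F) + n * S.ω = m' + n' * S.ω) :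
    m = m' ∧ n = n' := by
  rw [ω_coord] at h
  have ht : (S.t : ℚ) + 1 ≠ 0 := by
    have := S.t_add_one_ne_zero
    intro h
    apply this
    exact_mod_cast congrArg (fun q : ℚ => (q : F)) h
  have h2 := S.coord_inj (p := m + n * (S.t / (S.t + 1))) (q := n * (1 / (S.t + 1)))
    (p' := m' + n' * (S.t / (S.t + 1))) (q' := n' * (1 / (S.t + 1))) (by
      push_cast at h ⊢
      linear_combination h)
  have h3 : n = n' := by
    have := h2.2
    field_simp at this
    exact_mod_cast this
  subst h3
  have := h2.1
  refine ⟨?_, rfl⟩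
  have h5 : (m : ℚ) = m' := by linarith
  exact_mod_cast h5

/-- `ω` as an element of the ring of integers. -/
def ωInt : 𝓞 F := ⟨S.ω, S.isIntegral_ω⟩

lemma coe_ωInt : algebraMap (𝓞 F) F S.ωInt = S.ω := rfl

/-- The coordinates with respect to `1, ω`. -/
def intEquiv : (Fin 2 → ℤ) ≃ₗ[ℤ] 𝓞 F := by
  refine LinearEquiv.ofBijective
    { toFun := fun c : Fin 2 → ℤ => (c 0 : 𝓞 F) + c 1 * S.ωInt
      map_add' := fun c c' => by simp; ring
      map_smul' := fun r c => by simp; ring } ⟨?_, ?_⟩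
  · intro c c' h
    have h1 := congrArg (algebraMap (𝓞 F) F) h
    simp only [LinearMap.coe_mk, AddHom.coe_mk, map_add, map_mul, map_intCast, coe_ωInt] at h1
    obtain ⟨h2, h3⟩ := S.ω_coord_inj h1
    ext i
    fin_cases i
    · exact h2
    · exact h3
  · intro x
    obtain ⟨m, n, h⟩ := S.exists_ω_coord x.2
    refine ⟨![m, n], NumberField.RingOfIntegers.ext ?_⟩
    simp only [LinearMap.coe_mk, AddHom.coe_mk, map_add, map_mul, map_intCast, coe_ωInt]
    exact h.symm

lemma intEquiv_apply (c : Fin 2 → ℤ) : S.intEquiv c = (c 0 : 𝓞 F) + c 1 * S.ωInt := rfl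

/-- The integral basis `1, ω`. -/
def intBasis : Basis (Fin 2) ℤ (𝓞 F) := Basis.ofEquivFun S.intEquiv.symm

lemma coe_intBasis (i : Fin 2) : algebraMap (𝓞 F) F (S.intBasis i) = ![1, S.ω] i := by
  fin_cases i <;> simp [intBasis, intEquiv_apply, coe_ωInt]

/-- The discriminant of the basis `1, ω` is `(ω - ω̄)² = 4d / (t + 1)²`. -/
lemma discr_eq : NumberField.discr F = if S.d % 4 = 1 then S.d else 4 * S.d := by
  have h1 : ((NumberField.discr F : ℤ) : ℚ) = Algebra.discr ℚ (fun i => algebraMap (𝓞 F) F (S.intBasis i)) := by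
    rw [← NumberField.discr_eq_discr F S.intBasis]
    have := Algebra.discr_localizationLocalization ℤ (nonZeroDivisors ℤ) (Rₘ := ℚ) F S.intBasis
    rw [← eq_intCast (algebraMap ℤ ℚ), ← this]
    congr 1
    ext i
    simp
  have h2 : ((NumberField.discr F : ℚ) : F) = (S.ω - S.conj S.ω) ^ 2 := by
    rw [h1, Algebra.discr_def, Matrix.det_fin_two]
    simp only [Algebra.traceMatrix_apply, Algebra.traceForm_apply, coe_intBasis]
    push_cast
    simp only [S.trace_eq]
    simp only [map_mul, map_one]
    ring
  have h3 : ((NumberField.discr F : ℚ) : F) = ((4 * S.d / (S.t + 1) ^ 2 : ℚ) : F) := by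
    rw [h2, ω_coord, conj_coord]
    push_cast
    have := S.t_add_one_ne_zero
    field_simp
    linear_combination 4 * S.sq
  have h4 : (NumberField.discr F : ℚ) = (4 * S.d / (S.t + 1) ^ 2 : ℚ) := by exact_mod_cast h3
  rcases S.t_eq with ⟨ht, h⟩ | ⟨ht, h⟩ <;> rw [ht] at h4
  · rw [if_pos h]
    have : (NumberField.discr F : ℚ) = S.d := by rw [h4]; push_cast; ring
    exact_mod_cast this
  · rw [if_neg h]
    have : (NumberField.discr F : ℚ) = 4 * S.d := by rw [h4]; push_cast; ring
    exact_mod_cast this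

end QuadData

end SubformZeta

end


/-! ### Ideals as lattices, conjugate ideals and elements of norm one -/

open scoped NumberField nonZeroDivisors

noncomputable section

namespace SubformZeta

open Module

section Lat

variable {F : Type*} [Field F]

lemma int_ext {x y : 𝓞 F} (h : algebraMap (𝓞 F) F x = algebraMap (𝓞 F) F y) : x = y :=
  NumberField.RingOfIntegers.coe_injective h

lemma exists_coe_eq {x : F} (h : IsIntegral ℤ x) : ∃ y : 𝓞 F, algebraMap (𝓞 F) F y = x :=
  ⟨⟨x, h⟩, rfl⟩

lemma mem_toLattice {J : Ideal (𝓞 F)} {x : F} :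
    x ∈ toLattice J ↔ ∃ y ∈ J, algebraMap (𝓞 F) F y = x := Iff.rfl

lemma coe_mem_toLattice {J : Ideal (𝓞 F)} {y : 𝓞 F} :
    algebraMap (𝓞 F) F y ∈ toLattice J ↔ y ∈ J := by
  rw [mem_toLattice]
  constructor
  · rintro ⟨z, hz, h⟩
    rwa [← int_ext h]
  · intro h
    exact ⟨y, h, rfl⟩

lemma toLattice_le_iff {J J' : Ideal (𝓞 F)} : toLattice J ≤ toLattice J' ↔ J ≤ J' := by
  constructor
  · intro h x hx
    exact coe_mem_toLattice.1 (h (coe_mem_toLattice.2 hx))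
  · rintro h _ ⟨y, hy, rfl⟩
    exact ⟨y, h hy, rfl⟩

lemma toLattice_injective : Function.Injective (toLattice (F := F)) := fun _ _ h =>
  le_antisymm (toLattice_le_iff.1 h.le) (toLattice_le_iff.1 h.ge)

lemma relIndex_toLattice (J J' : Ideal (𝓞 F)) :
    (toLattice J).relIndex (toLattice J') = J.toAddSubgroup.relIndex J'.toAddSubgroup :=
  AddSubgroup.relIndex_map_map_of_injective _ _ NumberField.RingOfIntegers.coe_injective

lemma toLattice_ne_bot_iff {J : Ideal (𝓞 F)} : toLattice J ≠ ⊥ ↔ J ≠ ⊥ := by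
  rw [not_iff_not]
  constructor
  · intro h
    rw [eq_bot_iff]
    intro x hx
    have := coe_mem_toLattice.2 hx
    rw [h, AddSubgroup.mem_bot] at this
    simpa using this
  · rintro rfl
    rw [eq_bot_iff]
    rintro _ ⟨y, hy, rfl⟩
    have : y = 0 := hy
    simp [this]

/-- The rotation `z ↦ u z`. -/
abbrev rotHom (u : F) : F →+ F := AddMonoidHom.mulLeft u

lemma mem_map_rotHom {u : F} (hu : u ≠ 0) {K : AddSubgroup F} {x : F} :
    x ∈ K.map (rotHom u) ↔ u⁻¹ * x ∈ K := by
  constructor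
  · rintro ⟨y, hy, rfl⟩
    simpa [hu] using hy
  · intro h
    exact ⟨_, h, by simp [hu]⟩

lemma toLattice_span_mul (w : 𝓞 F) (J : Ideal (𝓞 F)) :
    toLattice (Ideal.span {w} * J) = (toLattice J).map (rotHom (algebraMap (𝓞 F) F w)) := by
  ext x
  constructor
  · rintro ⟨y, hy, rfl⟩
    obtain ⟨z, hz, rfl⟩ := Ideal.mem_span_singleton_mul.1 hy
    exact ⟨_, coe_mem_toLattice.2 hz, by simp⟩
  · rintro ⟨_, ⟨z, hz, rfl⟩, rfl⟩
    exact ⟨w * z, Ideal.mem_span_singleton_mul.2 ⟨z, hz, rfl⟩, by simp⟩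

variable [NumberField F]

lemma relIndex_mul_absNorm {J J' : Ideal (𝓞 F)} (h : J ≤ J') :
    (toLattice J).relIndex (toLattice J') * J'.absNorm = J.absNorm := by
  rw [relIndex_toLattice, Ideal.absNorm_eq_index, Ideal.absNorm_eq_index]
  exact AddSubgroup.relIndex_mul_index h

lemma relIndex_toLattice_mul {J : Ideal (𝓞 F)} (hJ : J ≠ ⊥) (A : Ideal (𝓞 F)) :
    (toLattice (J * A)).relIndex (toLattice J) = A.absNorm := by
  have h := relIndex_mul_absNorm (J := J * A) (J' := J) Ideal.mul_le_left
  rw [map_mul, mul_comm J.absNorm] at h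
  exact mul_right_cancel₀ (by rwa [Ne, Ideal.absNorm_eq_zero_iff]) h

lemma relIndex_toLattice_ne_zero {J J' : Ideal (𝓞 F)} (hJ : J ≠ ⊥) (h : J ≤ J') :
    (toLattice J).relIndex (toLattice J') ≠ 0 := by
  have h1 := relIndex_mul_absNorm h
  have h2 : J.absNorm ≠ 0 := by rwa [Ne, Ideal.absNorm_eq_zero_iff]
  exact left_ne_zero_of_mul (h1.trans_ne h2)

end Lat

namespace QuadData

variable {F : Type*} [Field F] [NumberField F] (S : QuadData F)

/-- Conjugation on the ring of integers. -/
abbrev conjInt : 𝓞 F ≃+* 𝓞 F := NumberField.RingOfIntegers.mapRingEquiv (S.conj : F ≃+* F)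

lemma coe_conjInt (x : 𝓞 F) :
    algebraMap (𝓞 F) F (S.conjInt x) = S.conj (algebraMap (𝓞 F) F x) := rfl

@[simp]
lemma conjInt_conjInt (x : 𝓞 F) : S.conjInt (S.conjInt x) = x :=
  int_ext (by rw [coe_conjInt, coe_conjInt, conj_conj])

/-- The conjugate ideal. -/
abbrev cj (J : Ideal (𝓞 F)) : Ideal (𝓞 F) := conjIdeal S.conj J

lemma mem_cj {J : Ideal (𝓞 F)} {x : 𝓞 F} : x ∈ S.cj J ↔ S.conjInt x ∈ J := by
  rw [cj, conjIdeal, Ideal.mem_map_of_equiv]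
  constructor
  · rintro ⟨y, hy, rfl⟩
    rwa [conjInt_conjInt]
  · intro h
    exact ⟨_, h, S.conjInt_conjInt x⟩

@[simp]
lemma cj_cj (J : Ideal (𝓞 F)) : S.cj (S.cj J) = J := by
  ext x
  rw [mem_cj, mem_cj, conjInt_conjInt]

lemma cj_mul (J J' : Ideal (𝓞 F)) : S.cj (J * J') = S.cj J * S.cj J' := Ideal.map_mul _ _ _

lemma cj_bot : S.cj ⊥ = ⊥ := Ideal.map_bot

lemma cj_injective : Function.Injective S.cj := Function.LeftInverse.injective S.cj_cj

lemma cj_ne_bot {J : Ideal (𝓞 F)} (hJ : J ≠ ⊥) : S.cj J ≠ ⊥ := by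
  rw [← S.cj_bot]
  exact S.cj_injective.ne hJ

lemma cj_span_singleton (x : 𝓞 F) : S.cj (Ideal.span {x}) = Ideal.span {S.conjInt x} := by
  rw [cj, conjIdeal, Ideal.map_span, Set.image_singleton]

lemma cj_mono {J J' : Ideal (𝓞 F)} (h : J ≤ J') : S.cj J ≤ S.cj J' := Ideal.map_mono h

lemma absNorm_cj (J : Ideal (𝓞 F)) : (S.cj J).absNorm = J.absNorm := by
  rw [Ideal.absNorm_eq_index, Ideal.absNorm_eq_index]
  rw [← AddSubgroup.index_map_equiv J.toAddSubgroup S.conjInt.toAddEquiv]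
  congr 1
  ext x
  constructor
  · intro h
    exact ⟨_, S.mem_cj.1 h, S.conjInt_conjInt x⟩
  · rintro ⟨y, hy, rfl⟩
    exact S.mem_cj.2 (by simpa using hy)

lemma intNorm_eq (x : 𝓞 F) : ((Algebra.norm ℤ x : ℤ) : F) =
    algebraMap (𝓞 F) F x * S.conj (algebraMap (𝓞 F) F x) := by
  rw [← S.norm_eq, ← Algebra.coe_norm_int]
  simp

lemma intNorm_nonneg (S : QuadData F) (x : 𝓞 F) : 0 ≤ Algebra.norm ℤ x := by
  have h := S.norm_nonneg (algebraMap (𝓞 F) F x)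
  rw [← Algebra.coe_norm_int] at h
  exact_mod_cast h

lemma finrank_int (S : QuadData F) : Module.finrank ℤ (𝓞 F) = 2 := by
  rw [NumberField.RingOfIntegers.rank, S.finrank]

lemma absNorm_span_natCast (S : QuadData F) (n : ℕ) :
    (Ideal.span {(n : 𝓞 F)}).absNorm = n ^ 2 := by
  rw [Ideal.absNorm_span_natCast, S.finrank_int]

/-- The product of an ideal and its conjugate is generated by the norm. -/
lemma mul_cj {J : Ideal (𝓞 F)} (hJ : J ≠ ⊥) :
    J * S.cj J = Ideal.span {(J.absNorm : 𝓞 F)} := by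
  have hn : J.absNorm ≠ 0 := by rwa [Ne, Ideal.absNorm_eq_zero_iff]
  have hn' : (J.absNorm : F) ≠ 0 := by exact_mod_cast hn
  have hdvd : ∀ x ∈ J, ∃ k : ℤ, algebraMap (𝓞 F) F x * S.conj (algebraMap (𝓞 F) F x) =
      J.absNorm * k := by
    intro x hx
    obtain ⟨k, hk⟩ := Ideal.absNorm_dvd_norm_of_mem hx
    refine ⟨k, ?_⟩
    rw [← S.intNorm_eq, hk]
    push_cast
    ring
  have hle : J * S.cj J ≤ Ideal.span {(J.absNorm : 𝓞 F)} := by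
    rw [Ideal.mul_le]
    intro x hx y hy
    rw [Ideal.mem_span_singleton]
    -- Polarization: `N(J)` divides the norms of `x`, `ȳ` and `x + ȳ`, hence also the trace of `xy`.
    -- So `xy / N(J)` has integral trace and norm.
    obtain ⟨k, hk⟩ := hdvd x hx
    obtain ⟨l, hl⟩ := hdvd _ (S.mem_cj.1 hy)
    obtain ⟨m, hm⟩ := hdvd _ (J.add_mem hx (S.mem_cj.1 hy))
    rw [map_add, map_add, coe_conjInt, conj_conj] at hm
    rw [coe_conjInt, conj_conj] at hl
    set X := algebraMap (𝓞 F) F x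
    set Y := algebraMap (𝓞 F) F y
    have hint : IsIntegral ℤ (X * Y / J.absNorm) := by
      refine S.isIntegral_of_trace_norm (m := m - k - l) (n := k * l) ?_ ?_
      · rw [map_div₀, map_mul, map_natCast]
        push_cast
        field_simp
        linear_combination hm - hk - hl
      · rw [map_div₀, map_mul, map_natCast]
        push_cast
        field_simp
        linear_combination (Y * S.conj Y) * hk + (J.absNorm * k) * hl
    obtain ⟨z, hz⟩ := exists_coe_eq hint
    refine ⟨z, int_ext ?_⟩
    rw [map_mul, map_mul, map_natCast, hz]
    field_simp
    rfl
  -- Both ideals have norm `N(J)²`, so the inclusion is an equality.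
  obtain ⟨C, hC⟩ := Ideal.dvd_iff_le.2 hle
  have h1 := congrArg Ideal.absNorm hC
  rw [map_mul, map_mul, absNorm_cj, S.absNorm_span_natCast, ← pow_two] at h1
  have h2 : C.absNorm = 1 := by
    have : J.absNorm ^ 2 ≠ 0 := pow_ne_zero _ hn
    exact (mul_eq_left₀ this).1 h1.symm
  rw [Ideal.absNorm_eq_one_iff] at h2
  rw [hC, h2, Ideal.mul_top]

/-- The class of the conjugate ideal is the inverse class. -/
lemma mk0_eq_inv {J J' : (Ideal (𝓞 F))⁰} (h : (J' : Ideal (𝓞 F)) = S.cj J) :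
    ClassGroup.mk0 J' = (ClassGroup.mk0 J)⁻¹ := by
  rw [eq_inv_iff_mul_eq_one, mul_comm, ← map_mul, ClassGroup.mk0_eq_one_iff]
  rw [Submonoid.coe_mul, h, S.mul_cj (mem_nonZeroDivisors_iff_ne_zero.1 J.2)]
  exact ⟨⟨_, rfl⟩⟩

lemma cj_mem (J : (Ideal (𝓞 F))⁰) : S.cj J ∈ (Ideal (𝓞 F))⁰ :=
  mem_nonZeroDivisors_iff_ne_zero.2 (S.cj_ne_bot (mem_nonZeroDivisors_iff_ne_zero.1 J.2))

/-- The elements of norm one. -/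
def U : Set F := {u | u * S.conj u = 1}

lemma U_ne_zero {u : F} (hu : u ∈ S.U) : u ≠ 0 := left_ne_zero_of_mul_eq_one hu

lemma conj_eq_inv {u : F} (hu : u ∈ S.U) : S.conj u = u⁻¹ := eq_inv_of_mul_eq_one_right hu

lemma inv_mem_U {u : F} (hu : u ∈ S.U) : u⁻¹ ∈ S.U := by
  have h0 := S.U_ne_zero hu
  change u⁻¹ * S.conj u⁻¹ = 1
  rw [map_inv₀, S.conj_eq_inv hu]
  field_simp

lemma mul_mem_U {u v : F} (hu : u ∈ S.U) (hv : v ∈ S.U) : u * v ∈ S.U := by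
  change u * v * S.conj (u * v) = 1
  rw [map_mul]
  have h1 : u * S.conj u = 1 := hu
  have h2 : v * S.conj v = 1 := hv
  linear_combination (v * S.conj v) * h1 + h2

lemma one_mem_U : (1 : F) ∈ S.U := by simp [U]

lemma norm_U {u : F} (hu : u ∈ S.U) : Algebra.norm ℚ u = 1 := by
  have h := S.norm_eq u
  rw [(hu : u * S.conj u = 1)] at h
  exact_mod_cast h

/-- The reflection `z ↦ u z̄`. -/
def reflHom (u : F) : F →+ F :=
  (AddMonoidHom.mulLeft u).comp (S.conj : F →+* F).toAddMonoidHom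

lemma reflHom_apply (u x : F) : S.reflHom u x = u * S.conj x := rfl

lemma reflHom_reflHom {u : F} (hu : u ∈ S.U) (x : F) : S.reflHom u (S.reflHom u x) = x := by
  rw [reflHom_apply, reflHom_apply, map_mul, conj_conj, S.conj_eq_inv hu, ← mul_assoc,
    mul_inv_cancel₀ (S.U_ne_zero hu), one_mul]

/-- Conjugate subgroups. -/
def bar (K : AddSubgroup F) : AddSubgroup F := K.map (S.conj : F →+* F).toAddMonoidHom

lemma mem_bar {K : AddSubgroup F} {x : F} : x ∈ S.bar K ↔ S.conj x ∈ K := by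
  constructor
  · rintro ⟨y, hy, rfl⟩
    simpa using hy
  · intro h
    exact ⟨_, h, S.conj_conj x⟩

lemma map_reflHom (u : F) (K : AddSubgroup F) :
    K.map (S.reflHom u) = (S.bar K).map (rotHom u) := by
  rw [bar, AddSubgroup.map_map]
  rfl

lemma toLattice_cj (J : Ideal (𝓞 F)) : toLattice (S.cj J) = S.bar (toLattice J) := by
  ext x
  rw [mem_bar, mem_toLattice, mem_toLattice]
  constructor
  · rintro ⟨y, hy, rfl⟩
    exact ⟨_, S.mem_cj.1 hy, rfl⟩
  · rintro ⟨y, hy, h⟩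
    exact ⟨S.conjInt y, S.mem_cj.2 (by simpa using hy), by rw [coe_conjInt, h, conj_conj]⟩

/-- Ideals of the same norm are in the same class iff they differ by an element of norm one. -/
lemma mk0_eq_mk0_iff_exists_U {J J' : (Ideal (𝓞 F))⁰}
    (hn : (J : Ideal (𝓞 F)).absNorm = (J' : Ideal (𝓞 F)).absNorm) :
    ClassGroup.mk0 J = ClassGroup.mk0 J' ↔
      ∃ u ∈ S.U, (toLattice (J : Ideal (𝓞 F))).map (rotHom u) = toLattice J' := by
  rw [ClassGroup.mk0_eq_mk0_iff]
  constructor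
  · rintro ⟨x, y, hx, hy, h⟩
    have hx' : algebraMap (𝓞 F) F x ≠ 0 := by simpa using hx
    have hy' : algebraMap (𝓞 F) F y ≠ 0 := by simpa using hy
    refine ⟨algebraMap (𝓞 F) F x / algebraMap (𝓞 F) F y, ?_, ?_⟩
    -- Equality of the ideal norms gives `N(x) = N(y)` without a sign, as norms from an imaginary
    -- field are nonnegative.
    · have h1 := congrArg Ideal.absNorm h
      rw [map_mul, map_mul, hn, Ideal.absNorm_span_singleton, Ideal.absNorm_span_singleton] at h1
      have h2 := mul_right_cancel₀ (by
        rw [Ne, Ideal.absNorm_eq_zero_iff]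
        exact mem_nonZeroDivisors_iff_ne_zero.1 J'.2) h1
      have h3 : Algebra.norm ℤ x = Algebra.norm ℤ y := by
        have := S.intNorm_nonneg x
        have := S.intNorm_nonneg y
        omega
      have h4 := S.intNorm_eq x
      rw [h3, S.intNorm_eq y] at h4
      have hy2 : S.conj (algebraMap (𝓞 F) F y) ≠ 0 := by simpa using hy'
      change _ * _ = _
      rw [map_div₀]
      field_simp
      exact h4.symm
    · have h1 := congrArg toLattice h
      rw [toLattice_span_mul, toLattice_span_mul] at h1
      ext z
      rw [mem_map_rotHom (div_ne_zero hx' hy')]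
      have h2 : algebraMap (𝓞 F) F y * z ∈ (toLattice (J : Ideal (𝓞 F))).map
          (rotHom (algebraMap (𝓞 F) F x)) ↔ algebraMap (𝓞 F) F y * z ∈
          (toLattice (J' : Ideal (𝓞 F))).map (rotHom (algebraMap (𝓞 F) F y)) := by rw [h1]
      rw [mem_map_rotHom hx', mem_map_rotHom hy', inv_mul_cancel_left₀ hy'] at h2
      rw [← h2]
      congr! 1
      field_simp
  · rintro ⟨u, hu, h⟩
    obtain ⟨x, y, hy, rfl⟩ := IsFractionRing.div_surjective (A := 𝓞 F) u
    have hu0 := S.U_ne_zero hu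
    have hy0 : y ≠ 0 := mem_nonZeroDivisors_iff_ne_zero.1 hy
    have hx' : algebraMap (𝓞 F) F x ≠ 0 := fun h => hu0 (by rw [h, zero_div])
    have hy' : algebraMap (𝓞 F) F y ≠ 0 := by simpa using hy0
    refine ⟨x, y, by simpa using hx', hy0, toLattice_injective ?_⟩
    rw [toLattice_span_mul, toLattice_span_mul, ← h]
    ext z
    rw [mem_map_rotHom hx', mem_map_rotHom hy', mem_map_rotHom hu0]
    congr! 1
    field_simp

end QuadData

end SubformZeta

end


/-! ### Ramified primes and self-conjugate ideals -/

open scoped NumberField nonZeroDivisors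

noncomputable section

namespace SubformZeta

lemma hasSum_mul_complex {ι κ : Type*} {f : ι → ℂ} {g : κ → ℂ} {a b : ℂ} (hf : HasSum f a)
    (hg : HasSum g b) : HasSum (fun p : ι × κ => f p.1 * g p.2) (a * b) :=
  hf.mul hg (summable_mul_of_summable_norm hf.summable.norm hg.summable.norm)

lemma hasSum_pnat_mul {ι : Type*} {s b : ℂ} (hs : 1 < s.re) {h : ι → ℂ} (hh : HasSum h b) :
    HasSum (fun t : ℕ+ × ι => (t.1 : ℂ) ^ (-s) * h t.2) (riemannZeta s * b) := by
  have h := hasSum_mul_complex (hasSum_zeta hs) hh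
  exact h

lemma hasSum_fintype_complex {ι : Type*} [Fintype ι] (h : ι → ℂ) : HasSum h (∑ i, h i) :=
  hasSum_fintype h


open Module

section Nat

lemma factorization_sq_mul_prod {q : ℕ} (hq : q ≠ 0) {T : Finset ℕ} (hT : ∀ r ∈ T, r.Prime)
    (r : ℕ) :
    (q ^ 2 * ∏ p ∈ T, p).factorization r = 2 * q.factorization r + if r ∈ T then 1 else 0 := by
  have hprod : ∏ p ∈ T, p ≠ 0 := Finset.prod_ne_zero_iff.2 fun p hp => (hT p hp).ne_zero
  rw [Nat.factorization_mul (pow_ne_zero _ hq) hprod, Nat.factorization_pow,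
    Nat.factorization_prod fun p hp => (hT p hp).ne_zero]
  simp only [Finsupp.coe_add, Finsupp.coe_smul, Pi.add_apply, Pi.smul_apply, smul_eq_mul,
    Finset.sum_apply', add_right_inj]
  rw [Finset.sum_congr rfl fun p hp => by
    rw [(hT p hp).factorization, Finsupp.single_apply]]
  simp

/-- `T` is recovered as the set of primes that occur to an odd power. -/
lemma sq_mul_prod_injective {q q' : ℕ} (hq : q ≠ 0) (hq' : q' ≠ 0) {T T' : Finset ℕ}
    (hT : ∀ r ∈ T, r.Prime) (hT' : ∀ r ∈ T', r.Prime)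
    (h : q ^ 2 * ∏ p ∈ T, p = q' ^ 2 * ∏ p ∈ T', p) : q = q' ∧ T = T' := by
  have hTT : T = T' := by
    ext r
    by_cases hr : r.Prime
    · have h1 := factorization_sq_mul_prod hq hT r
      rw [h, factorization_sq_mul_prod hq' hT' r] at h1
      split_ifs at h1 with h2 h3 h3
      · exact ⟨fun _ => h2, fun _ => h3⟩
      · omega
      · omega
      · exact ⟨fun h => absurd h h3, fun h => absurd h h2⟩
    · exact ⟨fun h => absurd (hT r h) hr, fun h => absurd (hT' r h) hr⟩
  subst hTT
  have hprod : ∏ p ∈ T, p ≠ 0 := Finset.prod_ne_zero_iff.2 fun p hp => (hT p hp).ne_zero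
  refine ⟨?_, rfl⟩
  have := mul_right_cancel₀ hprod h
  exact Nat.pow_left_injective two_ne_zero this

end Nat

namespace QuadData

variable {F : Type*} [Field F] [NumberField F] (S : QuadData F)

lemma isIntegral_θ : IsIntegral ℤ S.θ := by
  have := (S.isIntegral_coord_iff 0 1).2 ⟨0, -S.d, by norm_num, by push_cast; ring⟩
  simpa using this

/-- `θ` as an algebraic integer. -/
def θInt : 𝓞 F := ⟨S.θ, S.isIntegral_θ⟩

lemma coe_θInt : algebraMap (𝓞 F) F S.θInt = S.θ := rfl

lemma θInt_sq : S.θInt ^ 2 = (S.d : 𝓞 F) := int_ext (by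
  rw [map_pow, coe_θInt, S.sq, map_intCast])

lemma discr_ne_zero' : (NumberField.discr F).natAbs ≠ 0 := by
  simpa using NumberField.discr_ne_zero F

lemma mem_ramifiedPrimes {r : ℕ} :
    r ∈ ramifiedPrimes F ↔ r.Prime ∧ (r : ℤ) ∣ NumberField.discr F := by
  rw [ramifiedPrimes, Nat.mem_primeFactors_of_ne_zero discr_ne_zero', ← Int.natCast_dvd]

lemma dvd_d_or (S : QuadData F) {r : ℕ} (hr : r ∈ ramifiedPrimes F) :
    ((r : ℤ) ∣ S.d) ∨ (r = 2 ∧ S.d % 4 = 3) := by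
  obtain ⟨hp, hd⟩ := mem_ramifiedPrimes.1 hr
  rw [S.discr_eq] at hd
  split_ifs at hd with h
  · exact Or.inl hd
  · have hp' := Nat.prime_iff_prime_int.1 hp
    rcases hp'.dvd_or_dvd hd with h1 | h1
    · have h2 : r ∣ 2 ^ 2 := by exact_mod_cast h1
      have h3 : r = 2 := (Nat.prime_dvd_prime_iff_eq hp Nat.prime_two).1 (hp.dvd_of_dvd_pow h2)
      subst h3
      by_cases h4 : (2 : ℤ) ∣ S.d
      · exact Or.inl h4
      · right
        refine ⟨rfl, ?_⟩
        omega
    · exact Or.inl h1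

/-- Explicitly `(r, θ)` when `r ∣ d`, and `(2, 1 + θ)` when `r = 2` and `d ≡ 3` modulo 4. -/
lemma exists_ramified (S : QuadData F) {r : ℕ} (hr : r ∈ ramifiedPrimes F) :
    ∃ γ : Ideal (𝓞 F), γ ^ 2 = Ideal.span {(r : 𝓞 F)} := by
  obtain ⟨hp, -⟩ := mem_ramifiedPrimes.1 hr
  rcases S.dvd_d_or hr with ⟨e, he⟩ | ⟨rfl, h4⟩
  -- As `d` is square-free, `r` is prime to `e = d / r`; hence `r` is an integral combination of
  -- `r²` and `θ² = re`.
  · have hcop : IsCoprime (r : ℤ) e := by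
      rw [Int.isCoprime_iff_gcd_eq_one]
      rw [← Int.isCoprime_iff_gcd_eq_one]
      rw [(Nat.prime_iff_prime_int.1 hp).coprime_iff_not_dvd]
      rintro ⟨k, hk⟩
      have h1 := S.sqf r ⟨k, by rw [he, hk]; ring⟩
      exact (Nat.prime_iff_prime_int.1 hp).not_isUnit h1
    obtain ⟨x, y, hxy⟩ := hcop
    have hθ : S.θInt * S.θInt = (r : 𝓞 F) * (e : 𝓞 F) := by
      rw [← pow_two, S.θInt_sq, he]; push_cast; ring
    refine ⟨Ideal.span {(r : 𝓞 F), S.θInt}, le_antisymm ?_ ?_⟩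
    · rw [pow_two, Ideal.span_pair_mul_span_pair, Ideal.span_le]
      rintro z hz
      simp only [Set.mem_insert_iff, Set.mem_singleton_iff] at hz
      simp only [SetLike.mem_coe, Ideal.mem_span_singleton]
      rcases hz with rfl | rfl | rfl | rfl
      · exact dvd_mul_right _ _
      · exact dvd_mul_right _ _
      · exact dvd_mul_left _ _
      · rw [hθ]; exact dvd_mul_right _ _
    · rw [Ideal.span_singleton_le_iff_mem, pow_two]
      have h1 : (r : 𝓞 F) ∈ Ideal.span {(r : 𝓞 F), S.θInt} := Ideal.subset_span (by simp)
      have h2 : S.θInt ∈ Ideal.span {(r : 𝓞 F), S.θInt} := Ideal.subset_span (by simp)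
      have h3 := Ideal.add_mem _ (Ideal.mul_mem_left _ (x : 𝓞 F) (Ideal.mul_mem_mul h1 h1))
        (Ideal.mul_mem_left _ (y : 𝓞 F) (Ideal.mul_mem_mul h2 h2))
      rw [hθ] at h3
      have h4 : (x : 𝓞 F) * r + y * e = 1 := by exact_mod_cast congrArg (Int.cast : ℤ → 𝓞 F) hxy
      convert h3 using 1
      linear_combination (-(r : 𝓞 F)) * h4
  · obtain ⟨k, hk⟩ : ∃ k, S.d = 4 * k + 3 := ⟨S.d / 4, by omega⟩
    have hθ : (1 + S.θInt) * (1 + S.θInt) = 2 * (1 + S.θInt) + (4 * k + 2) := by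
      have := S.θInt_sq
      rw [hk] at this
      push_cast at this
      linear_combination this
    refine ⟨Ideal.span {((2 : ℕ) : 𝓞 F), 1 + S.θInt}, le_antisymm ?_ ?_⟩
    · rw [pow_two, Ideal.span_pair_mul_span_pair, Ideal.span_le]
      rintro z hz
      simp only [Set.mem_insert_iff, Set.mem_singleton_iff] at hz
      simp only [SetLike.mem_coe, Ideal.mem_span_singleton]
      rcases hz with rfl | rfl | rfl | rfl
      · exact dvd_mul_right _ _
      · exact dvd_mul_right _ _
      · exact dvd_mul_left _ _
      · rw [hθ]
        exact ⟨(1 + S.θInt) + (2 * k + 1), by push_cast; ring⟩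
    · rw [Ideal.span_singleton_le_iff_mem, pow_two]
      set γ := Ideal.span {((2 : ℕ) : 𝓞 F), 1 + S.θInt}
      have h1 : ((2 : ℕ) : 𝓞 F) ∈ γ := Ideal.subset_span (by simp)
      have h2 : 1 + S.θInt ∈ γ := Ideal.subset_span (by simp)
      -- `2 = (1 + θ)² - 2(1 + θ) - 4k`.
      have h3 := Ideal.sub_mem _ (Ideal.sub_mem _ (Ideal.mul_mem_mul h2 h2)
        (Ideal.mul_mem_mul h1 h2)) (Ideal.mul_mem_left _ (k : 𝓞 F) (Ideal.mul_mem_mul h1 h1))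
      convert h3 using 1
      rw [hθ]
      push_cast
      ring

open Classical in
/-- The prime ideal above a ramified prime. -/
def gam {F : Type*} [Field F] (r : ℕ) : Ideal (𝓞 F) :=
  if h : ∃ γ : Ideal (𝓞 F), γ ^ 2 = Ideal.span {(r : 𝓞 F)} then h.choose else ⊤

lemma gam_sq (S : QuadData F) {r : ℕ} (hr : r ∈ ramifiedPrimes F) :
    (gam r : Ideal (𝓞 F)) ^ 2 = Ideal.span {(r : 𝓞 F)} := by
  have h := S.exists_ramified hr
  rw [gam, dif_pos h]
  exact h.choose_spec

lemma absNorm_of_sq_eq (S : QuadData F) {γ : Ideal (𝓞 F)} {r : ℕ}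
    (h : γ ^ 2 = Ideal.span {(r : 𝓞 F)}) : γ.absNorm = r := by
  have := congrArg Ideal.absNorm h
  rw [map_pow, S.absNorm_span_natCast] at this
  exact Nat.pow_left_injective two_ne_zero this

lemma absNorm_gam (S : QuadData F) {r : ℕ} (hr : r ∈ ramifiedPrimes F) :
    (gam r : Ideal (𝓞 F)).absNorm = r := S.absNorm_of_sq_eq (S.gam_sq hr)

lemma gam_isPrime (S : QuadData F) {r : ℕ} (hr : r ∈ ramifiedPrimes F) : (gam r : Ideal (𝓞 F)).IsPrime :=
  Ideal.isPrime_of_irreducible_absNorm (by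
    rw [S.absNorm_gam hr]; exact (mem_ramifiedPrimes.1 hr).1)

lemma eq_of_sq_eq_sq {F : Type*} [Field F] {γ γ' : Ideal (𝓞 F)} (h : γ.IsPrime) (h' : γ'.IsPrime)
    (hsq : γ ^ 2 = γ' ^ 2) : γ = γ' :=
  le_antisymm (h'.le_of_pow_le (hsq.le.trans (Ideal.pow_le_self two_ne_zero)))
    (h.le_of_pow_le (hsq.ge.trans (Ideal.pow_le_self two_ne_zero)))

lemma cj_isPrime {γ : Ideal (𝓞 F)} (h : γ.IsPrime) : (S.cj γ).IsPrime :=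
  Ideal.map_isPrime_of_equiv _

lemma cj_span_natCast (n : ℕ) : S.cj (Ideal.span {(n : 𝓞 F)}) = Ideal.span {(n : 𝓞 F)} := by
  rw [cj_span_singleton, map_natCast]

lemma cj_gam {r : ℕ} (hr : r ∈ ramifiedPrimes F) : S.cj (gam r) = gam r := by
  refine eq_of_sq_eq_sq (S.cj_isPrime (S.gam_isPrime hr)) (S.gam_isPrime hr) ?_
  rw [pow_two, ← cj_mul, ← pow_two, S.gam_sq hr, cj_span_natCast]

/-- A self-conjugate prime ideal of degree one is ramified. -/
lemma eq_gam_of_cj_eq {P : Ideal (𝓞 F)} (hP : P.IsPrime) (hcj : S.cj P = P) {p : ℕ}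
    (hp : p.Prime) (hn : P.absNorm = p) : p ∈ ramifiedPrimes F ∧ P = gam p := by
  have hP0 : P ≠ ⊥ := by
    rintro rfl
    rw [Ideal.absNorm_bot] at hn
    exact hp.ne_zero hn.symm
  have hsq : P ^ 2 = Ideal.span {(p : 𝓞 F)} := by
    have := S.mul_cj hP0
    rwa [hcj, hn, ← pow_two] at this
  have hram : p ∈ ramifiedPrimes F := by
    rw [mem_ramifiedPrimes]
    refine ⟨hp, ?_⟩
    -- The residue field has `p` elements, so `ω ≡ n` modulo `P` for an integer `n`. Since `P` is
    -- self-conjugate, `ω̄ ≡ n` as well, and the discriminant `(ω - ω̄)²` lies in `P`.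
    have hcard : Nat.card (𝓞 F ⧸ P.toAddSubgroup) = p := hn
    have : Fact p.Prime := ⟨hp⟩
    have h1 : (QuotientAddGroup.mk (1 : 𝓞 F) : 𝓞 F ⧸ P.toAddSubgroup) ≠ 0 := by
      rw [Ne, QuotientAddGroup.eq_zero_iff]
      exact fun h => hP.ne_top ((Ideal.eq_top_iff_one _).2 h)
    obtain ⟨n, h2⟩ := mem_zmultiples_of_prime_card hcard h1
      (g' := (QuotientAddGroup.mk S.ωInt : 𝓞 F ⧸ P.toAddSubgroup))
    have h3 : S.ωInt - n ∈ P := by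
      have h4 : (QuotientAddGroup.mk (n • (1 : 𝓞 F)) : 𝓞 F ⧸ P.toAddSubgroup) =
        QuotientAddGroup.mk S.ωInt := h2
      rw [QuotientAddGroup.eq] at h4
      have : -(n • (1 : 𝓞 F)) + S.ωInt ∈ P := h4
      rwa [show S.ωInt - n = -(n • (1 : 𝓞 F)) + S.ωInt by simp; ring]
    have h4 : S.conjInt S.ωInt - n ∈ P := by
      rw [← hcj, mem_cj, map_sub, conjInt_conjInt, map_intCast]
      exact h3
    have h5 := P.mul_mem_left (S.ωInt - S.conjInt S.ωInt) (P.sub_mem h3 h4)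
    have h6 : (S.ωInt - S.conjInt S.ωInt) * (S.ωInt - n - (S.conjInt S.ωInt - n)) =
        (NumberField.discr F : 𝓞 F) := by
      refine int_ext ?_
      have h7 : ((NumberField.discr F : ℤ) : F) = (S.ω - S.conj S.ω) ^ 2 := by
        rw [S.discr_eq, ω_coord, conj_coord]
        rcases S.t_eq with ⟨ht, h⟩ | ⟨ht, h⟩
        · rw [ht, if_pos h, ← S.sq]; push_cast; ring
        · rw [ht, if_neg h]; push_cast; rw [← S.sq]; ring
      simp only [map_mul, map_sub, map_intCast, coe_conjInt, coe_ωInt]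
      rw [h7]
      ring
    rw [h6] at h5
    have h8 := Ideal.absNorm_dvd_norm_of_mem h5
    rw [hn] at h8
    have h9 : Algebra.norm ℤ ((NumberField.discr F : ℤ) : 𝓞 F) = NumberField.discr F ^ 2 := by
      have := Algebra.norm_algebraMap (S := 𝓞 F) (NumberField.discr F)
      rw [S.finrank_int] at this
      simpa using this
    rw [h9] at h8
    exact (Nat.prime_iff_prime_int.1 hp).dvd_of_dvd_pow h8
  exact ⟨hram, eq_of_sq_eq_sq hP (S.gam_isPrime hram) (by rw [hsq, S.gam_sq hram])⟩

/-- The self-conjugate ideal `(q) ∏ γ_r`. -/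
def amb {F : Type*} [Field F] (q : ℕ) (T : Finset ℕ) : Ideal (𝓞 F) := Ideal.span {(q : 𝓞 F)} * ∏ r ∈ T, gam r

lemma absNorm_amb (S : QuadData F) {q : ℕ} {T : Finset ℕ} (hT : T ⊆ ramifiedPrimes F) :
    (amb q T : Ideal (𝓞 F)).absNorm = q ^ 2 * ∏ r ∈ T, r := by
  rw [amb, map_mul, S.absNorm_span_natCast, map_prod]
  congr 1
  exact Finset.prod_congr rfl fun r hr => S.absNorm_gam (hT hr)

lemma cj_prod_gam {T : Finset ℕ} (hT : T ⊆ ramifiedPrimes F) :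
    S.cj (∏ r ∈ T, gam r) = ∏ r ∈ T, gam r := by
  classical
  induction T using Finset.induction_on with
  | empty => simp [cj, conjIdeal, Ideal.map_top]
  | insert r T hr ih =>
    rw [Finset.prod_insert hr, cj_mul, S.cj_gam (hT (Finset.mem_insert_self _ _)),
      ih ((Finset.subset_insert _ _).trans hT)]

lemma cj_amb (q : ℕ) {T : Finset ℕ} (hT : T ⊆ ramifiedPrimes F) :
    S.cj (amb q T) = amb q T := by
  rw [amb, cj_mul, cj_span_natCast, S.cj_prod_gam hT]

lemma prime_of_ramified {T : Finset ℕ} (hT : T ⊆ ramifiedPrimes F) : ∀ r ∈ T, r.Prime :=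
  fun _ hr => (mem_ramifiedPrimes.1 (hT hr)).1

lemma amb_ne_bot (S : QuadData F) {q : ℕ} (hq : q ≠ 0) {T : Finset ℕ} (hT : T ⊆ ramifiedPrimes F) :
    (amb q T : Ideal (𝓞 F)) ≠ ⊥ := by
  rw [Ne, ← Ideal.absNorm_eq_zero_iff, S.absNorm_amb hT]
  exact mul_ne_zero (pow_ne_zero _ hq)
    (Finset.prod_ne_zero_iff.2 fun r hr => (prime_of_ramified hT r hr).ne_zero)

/-- The norm `q² ∏ r` alone determines `q` and `T`. -/
lemma amb_injective (S : QuadData F) {q q' : ℕ} (hq : q ≠ 0) (hq' : q' ≠ 0) {T T' : Finset ℕ}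
    (hT : T ⊆ ramifiedPrimes F) (hT' : T' ⊆ ramifiedPrimes F)
    (h : (amb q T : Ideal (𝓞 F)) = amb q' T') : q = q' ∧ T = T' := by
  have h1 := congrArg Ideal.absNorm h
  rw [S.absNorm_amb hT, S.absNorm_amb hT'] at h1
  exact sq_mul_prod_injective hq hq' (prime_of_ramified hT) (prime_of_ramified hT') h1

lemma span_mul_amb {F : Type*} [Field F] (p q : ℕ) (T : Finset ℕ) :
    Ideal.span {(p : 𝓞 F)} * amb q T = amb (p * q) T := by
  rw [amb, amb, ← mul_assoc, Ideal.span_singleton_mul_span_singleton, Nat.cast_mul]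

/-- Norms of prime ideals of a quadratic field. -/
lemma prime_cases (S : QuadData F) {P : Ideal (𝓞 F)} (hP : P.IsPrime) (hP0 : P ≠ ⊥) :
    ∃ p : ℕ, p.Prime ∧ (P.absNorm = p ∨ P = Ideal.span {(p : 𝓞 F)}) := by
  have hmax : P.IsMaximal := hP.isMaximal hP0
  obtain ⟨p, k, hk, hpP, hp, h⟩ := Ideal.exists_prime_and_absNorm_eq_pow P
  refine ⟨p, hp, ?_⟩
  obtain ⟨C, hC⟩ := Ideal.dvd_iff_le.2 ((Ideal.span_singleton_le_iff_mem _).2 hpP)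
  have h1 := congrArg Ideal.absNorm hC
  rw [S.absNorm_span_natCast, map_mul, h] at h1
  have h2 : k ≤ 2 := (Nat.pow_dvd_pow_iff_le_right hp.one_lt).1 ⟨_, h1⟩
  rcases (by omega : k = 1 ∨ k = 2) with rfl | rfl
  · left
    rw [h, pow_one]
  · right
    have h3 : C.absNorm = 1 := by
      have : p ^ 2 ≠ 0 := pow_ne_zero _ hp.ne_zero
      exact (mul_eq_left₀ this).1 h1.symm
    rw [Ideal.absNorm_eq_one_iff] at h3
    rw [hC, h3, Ideal.mul_top]

/-- Every self-conjugate ideal is of the form `(q) ∏ γ_r`. -/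
lemma exists_eq_amb {A : Ideal (𝓞 F)} (hA : A ≠ ⊥) (hcj : S.cj A = A) :
    ∃ (q : ℕ) (T : Finset ℕ), q ≠ 0 ∧ T ⊆ ramifiedPrimes F ∧ A = amb q T := by
  classical
  induction hN : A.absNorm using Nat.strong_induction_on generalizing A with
  | _ N ih =>
  subst hN
  by_cases htop : A = ⊤
  · exact ⟨1, ∅, one_ne_zero, Finset.empty_subset _, by simp [htop, amb]⟩
  obtain ⟨P, hPmax, hAP⟩ := Ideal.exists_le_maximal A htop
  have hP := hPmax.isPrime
  have hP0 : P ≠ ⊥ := fun h => hA (by rwa [h, le_bot_iff] at hAP)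
  obtain ⟨B, hB⟩ := Ideal.dvd_iff_le.2 hAP
  -- After cancelling a proper self-conjugate factor, the cofactor is self-conjugate and has smaller
  -- norm, so the induction applies to it.
  have hstep : ∀ P' B' : Ideal (𝓞 F), S.cj P' = P' → P' ≠ ⊥ → P' ≠ ⊤ → A = P' * B' →
      ∃ (q : ℕ) (T : Finset ℕ), q ≠ 0 ∧ T ⊆ ramifiedPrimes F ∧ B' = amb q T := by
    intro P' B' hP' hP'0 hP'1 h
    have hB'0 : B' ≠ ⊥ := by
      rintro rfl
      exact hA (by rw [h, Ideal.mul_bot])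
    have hcjB : S.cj B' = B' := by
      have h1 := hcj
      rw [h, cj_mul, hP'] at h1
      exact mul_left_cancel₀ hP'0 h1
    refine ih _ ?_ hB'0 hcjB rfl
    rw [h, map_mul]
    have h1 : P'.absNorm ≠ 0 := by rwa [Ne, Ideal.absNorm_eq_zero_iff]
    have h2 : P'.absNorm ≠ 1 := by rwa [Ne, Ideal.absNorm_eq_one_iff]
    have h3 : B'.absNorm ≠ 0 := by rwa [Ne, Ideal.absNorm_eq_zero_iff]
    exact lt_mul_of_one_lt_left (by omega) (by omega)
  have hint : ∀ (p : ℕ) (B' : Ideal (𝓞 F)), p.Prime → A = Ideal.span {(p : 𝓞 F)} * B' →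
      ∃ (q : ℕ) (T : Finset ℕ), q ≠ 0 ∧ T ⊆ ramifiedPrimes F ∧ A = amb q T := by
    intro p B' hp h
    obtain ⟨q, T, hq, hT, hB'⟩ := hstep _ B' (S.cj_span_natCast p) (by
      rw [Ne, ← Ideal.absNorm_eq_zero_iff, S.absNorm_span_natCast]
      exact pow_ne_zero _ hp.ne_zero) (by
      rw [Ne, ← Ideal.absNorm_eq_one_iff, S.absNorm_span_natCast]
      have := hp.one_lt
      intro h
      nlinarith) h
    exact ⟨p * q, T, mul_ne_zero hp.ne_zero hq, hT, by rw [h, hB', span_mul_amb]⟩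
  obtain ⟨p, hp, hn | hspan⟩ := S.prime_cases hP hP0
  · by_cases hPc : S.cj P = P
    · obtain ⟨hram, hPγ⟩ := S.eq_gam_of_cj_eq hP hPc hp hn
      obtain ⟨q, T, hq, hT, hB'⟩ := hstep P B hPc hP0 hP.ne_top hB
      -- If `γ_p` already occurs, the new factor completes `γ_p² = (p)`, which is absorbed into `q`.
      by_cases hpT : p ∈ T
      · refine ⟨p * q, T.erase p, mul_ne_zero hp.ne_zero hq,
          (Finset.erase_subset _ _).trans hT, ?_⟩
        rw [hB, hB', ← span_mul_amb, amb, amb, ← Finset.mul_prod_erase T _ hpT, hPγ,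
          ← S.gam_sq hram]
        ring
      · refine ⟨q, insert p T, hq, Finset.insert_subset hram hT, ?_⟩
        rw [hB, hB', amb, amb, Finset.prod_insert hpT, hPγ]
        ring
    -- If `P̄ ≠ P`, then `P̄` also divides `A`, so `P P̄ = (p)` divides `A`.
    · have h1 : S.cj P ∣ P * B := by
        rw [← hB, ← hcj]
        exact Ideal.dvd_iff_le.2 (S.cj_mono hAP)
      have hprime : Prime (S.cj P) :=
        Ideal.prime_of_isPrime (S.cj_ne_bot hP0) (S.cj_isPrime hP)
      rcases hprime.dvd_or_dvd h1 with h2 | ⟨C, hC⟩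
      · exact absurd (hPmax.eq_of_le (S.cj_isPrime hP).ne_top (Ideal.dvd_iff_le.1 h2)).symm hPc
      · refine hint p C hp ?_
        rw [hB, hC, ← mul_assoc, S.mul_cj hP0, hn]
  · exact hint p B hp (by rw [hB, hspan])

/-- The nonzero self-conjugate ideals. -/
abbrev Amb := {A : Ideal (𝓞 F) // A ≠ ⊥ ∧ S.cj A = A}

/-- The parametrization of the self-conjugate ideals. -/
def ambEquiv : (ℕ+ × {T // T ∈ (ramifiedPrimes F).powerset}) ≃ S.Amb := by
  refine Equiv.ofBijective (fun t => ⟨amb t.1 t.2.1,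
    S.amb_ne_bot t.1.ne_zero (Finset.mem_powerset.1 t.2.2),
    S.cj_amb _ (Finset.mem_powerset.1 t.2.2)⟩) ⟨?_, ?_⟩
  · intro t t' h
    obtain ⟨h2, h3⟩ := S.amb_injective t.1.ne_zero t'.1.ne_zero (Finset.mem_powerset.1 t.2.2)
      (Finset.mem_powerset.1 t'.2.2) (congrArg Subtype.val h)
    exact Prod.ext (PNat.eq h2) (Subtype.ext h3)
  · rintro ⟨A, hA, hcj⟩
    obtain ⟨q, T, hq, hT, rfl⟩ := S.exists_eq_amb hA hcj
    exact ⟨(⟨q, Nat.pos_of_ne_zero hq⟩, ⟨T, Finset.mem_powerset.2 hT⟩), rfl⟩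

lemma ambEquiv_apply (t : ℕ+ × {T // T ∈ (ramifiedPrimes F).powerset}) :
    (S.ambEquiv t).1 = amb t.1 t.2.1 := rfl

lemma prod_natCast_cpow {T : Finset ℕ} (s : ℂ) :
    ((∏ r ∈ T, r : ℕ) : ℂ) ^ s = ∏ r ∈ T, (r : ℂ) ^ s := by
  classical
  induction T using Finset.induction_on with
  | empty => simp
  | insert r T hr ih =>
    rw [Finset.prod_insert hr, Finset.prod_insert hr, natCast_mul_cpow, ih]

lemma absNorm_amb_cpow (S : QuadData F) (q : ℕ+) {T : Finset ℕ} (hT : T ⊆ ramifiedPrimes F)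
    (s : ℂ) : ((amb q T : Ideal (𝓞 F)).absNorm : ℂ) ^ (-s) =
      (q : ℂ) ^ (-(2 * s)) * ∏ r ∈ T, (r : ℂ) ^ (-s) := by
  rw [S.absNorm_amb hT, natCast_mul_cpow, prod_natCast_cpow, pow_two, natCast_mul_cpow,
    show -(2 * s) = (-s) + (-s) by ring, Complex.cpow_add _ _ (by exact_mod_cast q.ne_zero)]

/-- The norm of `(q) ∏ γ_r` is `q² ∏ r`: the sum over `q` gives `ζ(2s)`, and a finite sum over sets
of ramified primes remains. The weight `g` will record whether 2 is in the set. -/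
lemma hasSum_amb_aux {s : ℂ} (hs : 1 < (2 * s).re) (g : Finset ℕ → ℂ) (f : S.Amb → ℂ)
    (hf : ∀ t, f (S.ambEquiv t) = g t.2.1) :
    HasSum (fun A : S.Amb => (A.1.absNorm : ℂ) ^ (-s) * f A)
      (riemannZeta (2 * s) *
        ∑ T ∈ (ramifiedPrimes F).powerset, (∏ r ∈ T, (r : ℂ) ^ (-s)) * g T) := by
  rw [← S.ambEquiv.hasSum_iff]
  refine hasSum_of_eq (hasSum_pnat_mul hs (hasSum_fintype_complex
    fun T : {T // T ∈ (ramifiedPrimes F).powerset} => (∏ r ∈ T.1, (r : ℂ) ^ (-s)) * g T.1))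
    (fun t => ?_) ?_
  · rw [Function.comp_apply, hf, ambEquiv_apply,
      S.absNorm_amb_cpow _ (Finset.mem_powerset.1 t.2.2), mul_assoc]
  · exact congrArg _ (Finset.sum_coe_sort (ramifiedPrimes F).powerset
      fun T => (∏ r ∈ T, (r : ℂ) ^ (-s)) * g T).symm

end QuadData

end SubformZeta

end


/-! ### Rectangular and rhombic ideals -/

open scoped NumberField nonZeroDivisors

noncomputable section

namespace SubformZeta

open Module

namespace QuadData

variable {F : Type*} [Field F] [NumberField F] (S : QuadData F)

/-- A lattice is rectangular for a reflection `ρ` if it contains `(x + ρ x) / 2` for all its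
elements `x`. -/
def Rect (u : F) (K : AddSubgroup F) : Prop := ∀ x ∈ K, ∃ y ∈ K, 2 • y = x + S.reflHom u x

lemma mem_iff_of_map_reflHom_eq {u : F} (hu : u ∈ S.U) {K : AddSubgroup F}
    (h : K.map (S.reflHom u) = K) {x : F} : u * S.conj x ∈ K ↔ x ∈ K := by
  have key : ∀ y ∈ K, u * S.conj y ∈ K := fun y hy => by
    rw [← h]
    exact ⟨y, hy, rfl⟩
  refine ⟨fun hx => ?_, key x⟩
  have h2 := key _ hx
  rwa [← S.reflHom_apply, ← S.reflHom_apply, S.reflHom_reflHom hu] at h2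

lemma map_reflHom_eq_iff {u : F} (hu : u ∈ S.U) {K : AddSubgroup F} :
    K.map (S.reflHom u) = K ↔ ∀ x ∈ K, u * S.conj x ∈ K := by
  refine ⟨fun h x hx => (S.mem_iff_of_map_reflHom_eq hu h).2 hx, fun h => le_antisymm ?_ ?_⟩
  · rintro _ ⟨x, hx, rfl⟩
    exact h x hx
  · intro x hx
    exact ⟨S.reflHom u x, h x hx, S.reflHom_reflHom hu x⟩

/-- Hilbert 90: `w = 1 + ū` satisfies `w̄ = uw`, except for `u = -1`, where `θ` does. Multiplying `w
= x / y` by the rational number `y ȳ` makes it integral. -/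
lemma exists_conj_eq_mul {u : F} (hu : u ∈ S.U) :
    ∃ w : 𝓞 F, w ≠ 0 ∧ S.conj (algebraMap (𝓞 F) F w) = u * algebraMap (𝓞 F) F w := by
  have huu : u * S.conj u = 1 := hu
  obtain ⟨w, hw0, hw⟩ : ∃ w : F, w ≠ 0 ∧ S.conj w = u * w := by
    by_cases h : u = -1
    · exact ⟨S.θ, S.θ_ne_zero, by rw [S.conj_θ, h]; ring⟩
    · refine ⟨1 + S.conj u, fun h0 => h ?_, ?_⟩
      · have h1 := congrArg S.conj (eq_neg_of_add_eq_zero_right h0)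
        rwa [S.conj_conj, map_neg, map_one] at h1
      · rw [map_add, map_one, S.conj_conj, mul_add, huu]
        ring
  obtain ⟨x, y, hy, rfl⟩ := IsFractionRing.div_surjective (A := 𝓞 F) w
  have hy0 : algebraMap (𝓞 F) F y ≠ 0 :=
    (map_ne_zero_iff _ (FaithfulSMul.algebraMap_injective (𝓞 F) F)).2
      (nonZeroDivisors.ne_zero hy)
  have hx0 : algebraMap (𝓞 F) F x ≠ 0 := fun h => hw0 (by rw [h, zero_div])
  have hcy : S.conj (algebraMap (𝓞 F) F y) ≠ 0 := (map_ne_zero _).2 hy0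
  refine ⟨x * S.conjInt y, ?_, ?_⟩
  · intro h
    have h2 := congrArg (algebraMap (𝓞 F) F) h
    rw [map_mul, S.coe_conjInt, map_zero] at h2
    exact mul_ne_zero hx0 hcy h2
  · rw [map_mul, S.coe_conjInt, map_mul, S.conj_conj]
    rw [map_div₀] at hw
    field_simp at hw
    linear_combination hw

/-- Multiplication by `w` carries the reflection `z ↦ u z̄` to `z ↦ u' z̄`. -/
lemma rect_map_rotHom {u u' w : F} (hw : w ≠ 0) (h : u' * S.conj w = u * w)
    {K : AddSubgroup F} : S.Rect u' (K.map (rotHom w)) ↔ S.Rect u K := by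
  constructor
  · intro hR x hx
    obtain ⟨_, ⟨y, hy, rfl⟩, h2⟩ := hR (w * x) ⟨x, hx, rfl⟩
    refine ⟨y, hy, mul_left_cancel₀ hw ?_⟩
    rw [S.reflHom_apply, map_mul] at h2
    rw [S.reflHom_apply, nsmul_eq_mul] at *
    simp only [AddMonoidHom.coe_mulLeft] at h2
    linear_combination h2 + S.conj x * h
  · rintro hR _ ⟨x, hx, rfl⟩
    obtain ⟨y, hy, h2⟩ := hR x hx
    refine ⟨w * y, ⟨y, hy, rfl⟩, ?_⟩
    simp only [AddMonoidHom.coe_mulLeft]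
    rw [S.reflHom_apply, map_mul]
    rw [S.reflHom_apply, nsmul_eq_mul] at *
    linear_combination w * h2 - S.conj x * h

/-- `(x + ρx)/2` and `(x - ρx)/2` add up to `x`. -/
lemma rect_neg {u : F} {K : AddSubgroup F} : S.Rect (-u) K ↔ S.Rect u K := by
  have key : ∀ v : F, S.Rect v K → S.Rect (-v) K := by
    intro v h x hx
    obtain ⟨y, hy, h2⟩ := h x hx
    refine ⟨x - y, K.sub_mem hx hy, ?_⟩
    rw [S.reflHom_apply, nsmul_eq_mul] at *
    push_cast at *
    linear_combination -h2
  exact ⟨fun h => by simpa using key _ h, key u⟩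

lemma cj_span_mul_eq {u : F} (hu : u ∈ S.U) {J : Ideal (𝓞 F)}
    (hJ : (toLattice J).map (S.reflHom u) = toLattice J) {w : 𝓞 F} (hw0 : w ≠ 0)
    (hw : S.conj (algebraMap (𝓞 F) F w) = u * algebraMap (𝓞 F) F w) :
    S.cj (Ideal.span {w} * J) = Ideal.span {w} * J := by
  have hw' : algebraMap (𝓞 F) F w ≠ 0 :=
    (map_ne_zero_iff _ (FaithfulSMul.algebraMap_injective (𝓞 F) F)).2 hw0
  apply toLattice_injective
  ext x
  rw [S.toLattice_cj, S.mem_bar, toLattice_span_mul, mem_map_rotHom hw', mem_map_rotHom hw',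
    ← S.mem_iff_of_map_reflHom_eq hu hJ (x := _⁻¹ * x), map_mul, map_inv₀, hw, mul_inv,
    ← mul_assoc, ← mul_assoc, mul_inv_cancel₀ (S.U_ne_zero hu), one_mul]

lemma span_singleton_ne_bot {F : Type*} [Field F] {w : 𝓞 F} (hw : w ≠ 0) : (Ideal.span {w} : Ideal (𝓞 F)) ≠ ⊥ := by
  simpa using hw

/-- Every ideal invariant under a reflection is a multiple of a self-conjugate ideal. -/
lemma exists_amb_of_map_reflHom_eq {u : F} (hu : u ∈ S.U) {J : Ideal (𝓞 F)} (hJ0 : J ≠ ⊥)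
    (hJ : (toLattice J).map (S.reflHom u) = toLattice J) :
    ∃ w : 𝓞 F, w ≠ 0 ∧ Ideal.span {w} * J ≠ ⊥ ∧ S.cj (Ideal.span {w} * J) = Ideal.span {w} * J ∧
      ∀ A : Ideal (𝓞 F), S.Rect u (toLattice (J * A)) ↔
        S.Rect 1 (toLattice (Ideal.span {w} * J * A)) := by
  obtain ⟨w, hw0, hw⟩ := S.exists_conj_eq_mul hu
  refine ⟨w, hw0, mul_ne_zero (span_singleton_ne_bot hw0) hJ0, S.cj_span_mul_eq hu hJ hw0 hw,
    fun A => ?_⟩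
  rw [mul_assoc, toLattice_span_mul, S.rect_map_rotHom (u := u)]
  · exact (map_ne_zero_iff _ (FaithfulSMul.algebraMap_injective (𝓞 F) F)).2 hw0
  · rw [hw, one_mul]

/-- Since `ω + ω̄ = 1`, the half-sum of `ωm` is `m / 2`. In a rectangular ideal every rational
integer could be halved again and again, and `N(A)` would be divisible by all powers of 2. -/
lemma not_rect_one_of_emod_eq_one (hd : S.d % 4 = 1) {A : Ideal (𝓞 F)} (hA : A ≠ ⊥) :
    ¬ S.Rect 1 (toLattice A) := by
  intro hR
  have hn : (A.absNorm : 𝓞 F) ∈ A := A.absNorm_mem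
  have hω : S.ω + S.conj S.ω = 1 := by
    rcases S.t_eq with ⟨h, -⟩ | ⟨-, h⟩
    · rw [S.ω_coord, S.add_conj_coord, h]
      norm_num
    · exact absurd hd h
  have key : ∀ k : ℕ, ∃ m : ℤ, 2 ^ k * m = A.absNorm ∧ (m : F) ∈ toLattice A := by
    intro k
    induction k with
    | zero => exact ⟨A.absNorm, by simp, by
        rw [mem_toLattice]
        exact ⟨_, hn, by simp⟩⟩
    | succ k ih =>
      obtain ⟨m, h1, h2⟩ := ih
      obtain ⟨z, hz, hzm⟩ := mem_toLattice.1 h2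
      obtain ⟨y, hy, h3⟩ := hR (S.ω * m) (mem_toLattice.2 ⟨S.ωInt * z, A.mul_mem_left _ hz, by
        rw [map_mul, S.coe_ωInt, hzm]⟩)
      rw [S.reflHom_apply, map_mul, map_intCast, one_mul, nsmul_eq_mul] at h3
      have h4 : y = ((m / 2 : ℚ) : F) := by
        push_cast at *
        linear_combination 1 / 2 * h3 + (m : F) / 2 * hω
      obtain ⟨y', -, hy'⟩ := mem_toLattice.1 hy
      obtain ⟨m', hm'⟩ := exists_int_of_isIntegral (F := F) (q := m / 2) (by
        rw [← h4, ← hy']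
        exact y'.isIntegral_coe)
      refine ⟨m', ?_, ?_⟩
      · have : m = 2 * m' := by
          have : (m : ℚ) = 2 * m' := by linarith
          exact_mod_cast this
        rw [← h1, this]
        ring
      · rw [h4, hm'] at hy
        simpa using hy
  have hA0 : A.absNorm ≠ 0 := by rwa [Ne, Ideal.absNorm_eq_zero_iff]
  obtain ⟨m, h1, -⟩ := key A.absNorm
  have h5 : A.absNorm < 2 ^ A.absNorm := Nat.lt_two_pow_self
  have h6 : (2 : ℤ) ^ A.absNorm ∣ A.absNorm := ⟨m, h1.symm⟩
  have h7 := Int.le_of_dvd (by exact_mod_cast Nat.pos_of_ne_zero hA0) h6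
  have h8 : 2 ^ A.absNorm ≤ A.absNorm := by exact_mod_cast h7
  omega

lemma exists_θ_coord (hd : S.d % 4 ≠ 1) (x : 𝓞 F) :
    ∃ m n : ℤ, x = m + n * S.θInt ∧ Algebra.norm ℤ x = m ^ 2 - S.d * n ^ 2 := by
  obtain ⟨m, n, h⟩ := S.exists_ω_coord x.isIntegral_coe
  have hω : S.ω = S.θ := by
    rcases S.t_eq with ⟨-, h⟩ | ⟨h, -⟩
    · exact absurd h hd
    · rw [S.ω_coord, h]
      norm_num
  rw [hω] at h
  refine ⟨m, n, int_ext ?_, ?_⟩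
  · rw [map_add, map_mul, S.coe_θInt, map_intCast, map_intCast]
    exact h
  · have h2 := S.intNorm_eq x
    have h3 := S.mul_conj_coord m n
    push_cast at h3
    change (algebraMap (𝓞 F) F x) = _ at h
    rw [h, h3] at h2
    exact_mod_cast h2

lemma mem_span_natCast_mul {F : Type*} [Field F] {q : ℕ} {B : Ideal (𝓞 F)} {x : 𝓞 F} :
    x ∈ Ideal.span {(q : 𝓞 F)} * B ↔ ∃ y ∈ B, (q : 𝓞 F) * y = x := by
  rw [Ideal.mem_span_singleton_mul]

/-- The half-sum of `y = m + nθ` is `m`. If `y ∈ ∏ γ_r`, the square-free number `∏ r` divides `N(y)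
= m² - dn²` and `d`, hence `m`; being the norm of `∏ γ_r`, it lies in that ideal, and so does `m`.
-/
lemma rect_one_amb (hd : S.d % 4 ≠ 1) {q : ℕ} {T : Finset ℕ} (hT : T ⊆ ramifiedPrimes F)
    (hTd : ((∏ r ∈ T, r : ℕ) : ℤ) ∣ S.d) : S.Rect 1 (toLattice (amb q T)) := by
  intro x hx
  obtain ⟨x, hx', rfl⟩ := mem_toLattice.1 hx
  obtain ⟨y, hy, rfl⟩ : ∃ y ∈ (∏ r ∈ T, gam r : Ideal (𝓞 F)), (q : 𝓞 F) * y = x :=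
    mem_span_natCast_mul.1 (coe_mem_toLattice.1 hx)
  obtain ⟨m, n, hmn, hN⟩ := S.exists_θ_coord hd y
  have h1 : ((∏ r ∈ T, r : ℕ) : ℤ) ∣ m ^ 2 := by
    have h2 := Ideal.absNorm_dvd_norm_of_mem hy
    have h3 := S.absNorm_amb (q := 1) hT
    rw [amb, Nat.cast_one, Ideal.span_singleton_one, Ideal.top_mul, one_pow, one_mul] at h3
    rw [h3, hN] at h2
    exact (dvd_sub_left (Dvd.dvd.mul_right hTd _)).1 h2
  have h2 : ((∏ r ∈ T, r : ℕ) : ℤ) ∣ m :=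
    ((S.sqf.squarefree_of_dvd hTd).dvd_pow_iff_dvd two_ne_zero).1 h1
  obtain ⟨k, hk⟩ := h2
  refine ⟨algebraMap (𝓞 F) F (q * m), ?_, ?_⟩
  · rw [coe_mem_toLattice]
    refine mem_span_natCast_mul.2 ⟨m, ?_, rfl⟩
    have h3 := S.absNorm_amb (q := 1) hT
    rw [amb, Nat.cast_one, Ideal.span_singleton_one, Ideal.top_mul, one_pow, one_mul] at h3
    have h4 := Ideal.absNorm_mem (∏ r ∈ T, gam r : Ideal (𝓞 F))
    rw [h3] at h4
    rw [hk]
    have h5 := Ideal.mul_mem_right (k : 𝓞 F) _ h4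
    exact_mod_cast h5
  · rw [S.reflHom_apply, hmn]
    simp only [map_mul, map_add, map_natCast, map_intCast, S.coe_θInt, S.conj_θ, nsmul_eq_mul]
    push_cast
    ring

/-- If the lattice were rectangular, both coordinates of every `m + nθ` in `∏ γ_r` would be even.
Then `∏ γ_r ⊆ (2)`, and 4 would divide the square-free number `∏ r`. -/
lemma not_rect_one_amb (hd : S.d % 4 = 3) {q : ℕ} (hq : q ≠ 0) {T : Finset ℕ}
    (hT : T ⊆ ramifiedPrimes F) (h2T : 2 ∈ T) : ¬ S.Rect 1 (toLattice (amb q T)) := by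
  intro hR
  have hN1 := S.absNorm_amb (q := 1) hT
  have hN := hN1
  rw [amb, Nat.cast_one, Ideal.span_singleton_one, Ideal.top_mul, one_pow, one_mul] at hN
  have hq' : (q : F) ≠ 0 := by exact_mod_cast hq
  have hM2 : (2 : ℤ) ∣ (∏ r ∈ T, r : ℕ) := by
    exact_mod_cast Finset.dvd_prod_of_mem (fun r => r) h2T
  have hle : (∏ r ∈ T, gam r : Ideal (𝓞 F)) ≤ Ideal.span {((2 : ℕ) : 𝓞 F)} := by
    intro x hx
    obtain ⟨m, n, hmn, hNx⟩ := S.exists_θ_coord (by omega) x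
    obtain ⟨y, hy, h2⟩ := hR (algebraMap (𝓞 F) F (q * x))
      (coe_mem_toLattice.2 (mem_span_natCast_mul.2 ⟨x, hx, rfl⟩))
    obtain ⟨y, hy', rfl⟩ := mem_toLattice.1 hy
    obtain ⟨z, hz, rfl⟩ : ∃ z ∈ (∏ r ∈ T, gam r : Ideal (𝓞 F)), (q : 𝓞 F) * z = y :=
      mem_span_natCast_mul.1 (coe_mem_toLattice.1 hy)
    have hzm : z = m := by
      apply int_ext
      rw [S.reflHom_apply, hmn] at h2
      simp only [map_mul, map_add, map_natCast, map_intCast, S.coe_θInt, S.conj_θ,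
        nsmul_eq_mul] at h2
      rw [map_intCast]
      apply mul_left_cancel₀ hq'
      push_cast at h2
      linear_combination h2 / 2
    -- The half-sum `m` lies in `∏ γ_r`, so the even number `∏ r` divides its norm `m²`.
    have h3 : (2 : ℤ) ∣ m := by
      obtain ⟨m', n', h, hNz⟩ := S.exists_θ_coord (by omega) z
      have h4 := Ideal.absNorm_dvd_norm_of_mem hz
      have h5 : m = m' ∧ n' = 0 := by
        rw [hzm] at h
        have h6 := congrArg (algebraMap (𝓞 F) F) h
        simp only [map_add, map_mul, map_intCast, S.coe_θInt] at h6
        have := S.coord_inj (p := m) (q := 0) (p' := m') (q' := n') (by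
          push_cast
          rw [h6]
          ring)
        exact ⟨by exact_mod_cast this.1, by exact_mod_cast this.2.symm⟩
      rw [hN, hNz, ← h5.1, h5.2] at h4
      have h6 : (2 : ℤ) ∣ m ^ 2 := hM2.trans (by simpa using h4)
      exact Int.prime_two.dvd_of_dvd_pow h6
    have h4 : (2 : ℤ) ∣ n := by
      have h5 := Ideal.absNorm_dvd_norm_of_mem hx
      rw [hN, hNx] at h5
      have h6 : (2 : ℤ) ∣ S.d * n ^ 2 :=
        (dvd_sub_right (dvd_pow h3 two_ne_zero)).1 (hM2.trans h5)
      rcases Int.prime_two.dvd_or_dvd h6 with h | h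
      · omega
      · exact Int.prime_two.dvd_of_dvd_pow h
    obtain ⟨m', rfl⟩ := h3
    obtain ⟨n', rfl⟩ := h4
    rw [Ideal.mem_span_singleton]
    exact ⟨m' + n' * S.θInt, by rw [hmn]; push_cast; ring⟩
  have h4 := Ideal.absNorm_dvd_absNorm_of_le hle
  rw [hN, S.absNorm_span_natCast] at h4
  have h5 := factorization_sq_mul_prod one_ne_zero (prime_of_ramified hT) 2
  rw [one_pow, one_mul] at h5
  have h6 := (Nat.factorization_le_iff_dvd (by norm_num) (Finset.prod_ne_zero_iff.2
    fun r hr => (prime_of_ramified hT r hr).ne_zero)).2 h4 2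
  rw [h5, Nat.factorization_pow] at h6
  simp [h2T, Nat.prime_two.factorization] at h6

lemma prod_dvd_d {T : Finset ℕ} (hT : T ⊆ ramifiedPrimes F)
    (h : S.d % 4 = 2 ∨ 2 ∉ T) : ((∏ r ∈ T, r : ℕ) : ℤ) ∣ S.d := by
  rw [Int.natCast_dvd]
  refine Finset.prod_primes_dvd _ (fun r hr => (prime_of_ramified hT r hr).prime) fun r hr => ?_
  rw [← Int.natCast_dvd]
  rcases S.dvd_d_or (hT hr) with h1 | ⟨rfl, h2⟩
  · exact h1
  · rcases h with h | h
    · omega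
    · exact absurd hr h

lemma rect_one_of_emod_eq_two (hd : S.d % 4 = 2) {A : Ideal (𝓞 F)} (hA : A ≠ ⊥)
    (hcj : S.cj A = A) : S.Rect 1 (toLattice A) := by
  obtain ⟨q, T, -, hT, rfl⟩ := S.exists_eq_amb hA hcj
  exact S.rect_one_amb (by omega) hT (S.prod_dvd_d hT (Or.inl hd))

lemma even_factorization_absNorm_amb (S : QuadData F) {q : ℕ} (hq : q ≠ 0) {T : Finset ℕ}
    (hT : T ⊆ ramifiedPrimes F) :
    Even ((amb q T : Ideal (𝓞 F)).absNorm.factorization 2) ↔ 2 ∉ T := by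
  rw [S.absNorm_amb hT, factorization_sq_mul_prod hq (prime_of_ramified hT)]
  split_ifs with h <;> simp [h]

lemma rect_one_iff_of_emod_eq_three (hd : S.d % 4 = 3) {A : Ideal (𝓞 F)} (hA : A ≠ ⊥)
    (hcj : S.cj A = A) :
    S.Rect 1 (toLattice A) ↔ Even (A.absNorm.factorization 2) := by
  obtain ⟨q, T, hq, hT, rfl⟩ := S.exists_eq_amb hA hcj
  rw [S.even_factorization_absNorm_amb hq hT]
  exact ⟨fun h h2 => S.not_rect_one_amb hd hq hT h2 h,
    fun h => S.rect_one_amb (by omega) hT (S.prod_dvd_d hT (Or.inr h))⟩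


lemma not_rect_of_emod_eq_one {u : F} (hu : u ∈ S.U) {J : Ideal (𝓞 F)} (hJ0 : J ≠ ⊥)
    (hJ : (toLattice J).map (S.reflHom u) = toLattice J) 
    (hd : S.d % 4 = 1) : ¬ S.Rect u (toLattice J) := by
  obtain ⟨w, -, h0, -, h⟩ := S.exists_amb_of_map_reflHom_eq hu hJ0 hJ
  have h2 := h ⊤
  rw [Ideal.mul_top, Ideal.mul_top] at h2
  rw [h2]
  exact S.not_rect_one_of_emod_eq_one hd h0

lemma rect_of_emod_eq_two {u : F} (hu : u ∈ S.U) {J : Ideal (𝓞 F)} (hJ0 : J ≠ ⊥)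
    (hJ : (toLattice J).map (S.reflHom u) = toLattice J) 
    (hd : S.d % 4 = 2) : S.Rect u (toLattice J) := by
  obtain ⟨w, -, h0, hcj, h⟩ := S.exists_amb_of_map_reflHom_eq hu hJ0 hJ
  have h2 := h ⊤
  rw [Ideal.mul_top, Ideal.mul_top] at h2
  rw [h2]
  exact S.rect_one_of_emod_eq_two hd h0 hcj

/-- One `w` makes both `wJ` and `wJA` self-conjugate with conjugation as reflection. There the type
is the parity of the exponent of 2 in the norm, which is additive. -/
lemma rect_mul_iff_of_emod_eq_three {u : F} (hu : u ∈ S.U) {J : Ideal (𝓞 F)} (hJ0 : J ≠ ⊥)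
    (hJ : (toLattice J).map (S.reflHom u) = toLattice J) 
    (hd : S.d % 4 = 3) {A : Ideal (𝓞 F)} (hA : A ≠ ⊥)
    (hcjA : S.cj A = A) : S.Rect u (toLattice (J * A)) ↔
      (S.Rect u (toLattice J) ↔ Even (A.absNorm.factorization 2)) := by
  obtain ⟨w, -, h0, hcj, h⟩ := S.exists_amb_of_map_reflHom_eq hu hJ0 hJ
  have h2 := h ⊤
  rw [Ideal.mul_top, Ideal.mul_top] at h2
  rw [h, h2, S.rect_one_iff_of_emod_eq_three hd h0 hcj, S.rect_one_iff_of_emod_eq_three hd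
    (mul_ne_zero h0 hA) (by rw [S.cj_mul, hcj, hcjA]), map_mul,
    Nat.factorization_mul (by rwa [Ne, Ideal.absNorm_eq_zero_iff])
      (by rwa [Ne, Ideal.absNorm_eq_zero_iff]), Finsupp.add_apply, Nat.even_add]

end QuadData

end SubformZeta

end


/-! ### Reflections of an ideal, ramified classes and units -/

open scoped NumberField nonZeroDivisors

noncomputable section

namespace SubformZeta

open Module

namespace QuadData

variable {F : Type*} [Field F] [NumberField F] (S : QuadData F)

lemma even_factorization_mul {a b : ℕ} (ha : a ≠ 0) (hb : b ≠ 0) (p : ℕ) :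
    Even ((a * b).factorization p) ↔ (Even (a.factorization p) ↔ Even (b.factorization p)) := by
  rw [Nat.factorization_mul ha hb, Finsupp.add_apply, Nat.even_add]

lemma absNorm_ne_zero {J : Ideal (𝓞 F)} (hJ : J ≠ ⊥) : J.absNorm ≠ 0 := by
  rwa [Ne, Ideal.absNorm_eq_zero_iff]

lemma coe_ne_bot {F : Type*} [Field F] (J : (Ideal (𝓞 F))⁰) : (J : Ideal (𝓞 F)) ≠ ⊥ :=
  mem_nonZeroDivisors_iff_ne_zero.1 J.2

/-! ### Norm one units -/

/-- The integral elements of norm one. -/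
def E : Set F := {ε | ε ∈ S.U ∧ IsIntegral ℤ ε}

lemma rotHom_injective {F : Type*} [Field F] {w : F} (hw : w ≠ 0) : Function.Injective (rotHom w) :=
  fun _ _ h => mul_left_cancel₀ hw h

lemma map_rotHom_map_rotHom {F : Type*} [Field F] (v w : F) (K : AddSubgroup F) :
    (K.map (rotHom w)).map (rotHom v) = K.map (rotHom (v * w)) := by
  rw [AddSubgroup.map_map]
  congr 1
  ext x
  simp [mul_assoc]

lemma map_rotHom_one {F : Type*} [Field F] (K : AddSubgroup F) : K.map (rotHom 1) = K := by
  have : rotHom (1 : F) = AddMonoidHom.id F := by ext x; simp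
  rw [this, AddSubgroup.map_id]

lemma map_reflHom_map_rotHom (u v : F) (K : AddSubgroup F) :
    (K.map (S.reflHom u)).map (rotHom v) = K.map (S.reflHom (v * u)) := by
  rw [AddSubgroup.map_map]
  congr 1
  ext x
  simp [S.reflHom_apply, mul_assoc]

lemma map_rotHom_map_reflHom_eq_iff {u u' w : F} (hw : w ≠ 0) (h : u' * S.conj w = u * w)
    (K : AddSubgroup F) : (K.map (rotHom w)).map (S.reflHom u') = K.map (rotHom w) ↔
      K.map (S.reflHom u) = K := by
  have e : (S.reflHom u').comp (rotHom w) = (rotHom w).comp (S.reflHom u) := by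
    ext x
    simp only [AddMonoidHom.comp_apply, S.reflHom_apply, AddMonoidHom.coe_mulLeft, map_mul]
    linear_combination S.conj x * h
  rw [AddSubgroup.map_map, e, ← AddSubgroup.map_map]
  exact (AddSubgroup.map_injective (rotHom_injective hw)).eq_iff

/-- `K` is a nonzero finitely generated `ℤ`-module stable under multiplication by `u`. -/
lemma isIntegral_of_map_rotHom_le {J : Ideal (𝓞 F)} {K : AddSubgroup F} (hK : K ≤ toLattice J)
    (hK0 : K ≠ ⊥) {u : F} (h : K.map (rotHom u) ≤ K) : IsIntegral ℤ u := by
  refine isIntegral_of_smul_mem_submodule (AddSubgroup.toIntSubmodule K) ?_ ?_ u ?_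
  · simpa using hK0
  · let f : 𝓞 F →ₗ[ℤ] F := (algebraMap (𝓞 F) F).toAddMonoidHom.toIntLinearMap
    have h1 : AddSubgroup.toIntSubmodule K = ((AddSubgroup.toIntSubmodule K).comap f).map f := by
      rw [Submodule.map_comap_eq_of_le]
      intro x hx
      obtain ⟨y, -, rfl⟩ := mem_toLattice.1 (hK hx)
      exact ⟨y, rfl⟩
    rw [h1]
    exact (IsNoetherian.noetherian _).map f
  · intro x hx
    exact h ⟨x, hx, rfl⟩

lemma E_mul_mem {ε : F} (hε : ε ∈ S.E) {J : Ideal (𝓞 F)} {x : F} (hx : x ∈ toLattice J) :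
    ε * x ∈ toLattice J := by
  obtain ⟨e, rfl⟩ := exists_coe_eq hε.2
  obtain ⟨y, hy, rfl⟩ := mem_toLattice.1 hx
  exact mem_toLattice.2 ⟨e * y, J.mul_mem_left _ hy, map_mul _ _ _⟩

lemma inv_mem_E {ε : F} (hε : ε ∈ S.E) : ε⁻¹ ∈ S.E :=
  ⟨S.inv_mem_U hε.1, by rw [← S.conj_eq_inv hε.1]; exact S.isIntegral_conj hε.2⟩

lemma one_mem_E : (1 : F) ∈ S.E := ⟨S.one_mem_U, isIntegral_one⟩

lemma map_rotHom_eq_iff_mem_E {J : Ideal (𝓞 F)} (hJ : J ≠ ⊥) {u : F} (hu : u ∈ S.U) :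
    (toLattice J).map (rotHom u) = toLattice J ↔ u ∈ S.E := by
  refine ⟨fun h => ⟨hu, isIntegral_of_map_rotHom_le le_rfl (toLattice_ne_bot_iff.2 hJ) h.le⟩,
    fun h => le_antisymm ?_ ?_⟩
  · rintro _ ⟨x, hx, rfl⟩
    exact S.E_mul_mem h hx
  · intro x hx
    rw [mem_map_rotHom (S.U_ne_zero hu)]
    exact S.E_mul_mem (S.inv_mem_E h) hx

/-- The reflections that map the ideal `J` to itself. -/
def reflSet (J : Ideal (𝓞 F)) : Set F :=
  {u | u ∈ S.U ∧ (toLattice J).map (S.reflHom u) = toLattice J}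

lemma mul_mem_reflSet_iff {J : Ideal (𝓞 F)} (hJ : J ≠ ⊥) {u v : F} (hu : u ∈ S.reflSet J)
    (hv : v ∈ S.U) : v * u ∈ S.reflSet J ↔ v ∈ S.E := by
  rw [← S.map_rotHom_eq_iff_mem_E hJ hv]
  conv_rhs => rw [← hu.2, S.map_reflHom_map_rotHom, hu.2]
  exact ⟨fun h => h.2, fun h => ⟨S.mul_mem_U hv hu.1, h⟩⟩

/-- The quotient of two reflections of `J` is a rotation of `J`, that is, an integral element of
norm one. -/
lemma reflSet_eq_image {J : Ideal (𝓞 F)} (hJ : J ≠ ⊥) {u : F} (hu : u ∈ S.reflSet J) :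
    S.reflSet J = (fun ε => ε * u) '' S.E := by
  have hu0 := S.U_ne_zero hu.1
  ext v
  constructor
  · intro hv
    have h : v = v * u⁻¹ * u := by field_simp
    refine ⟨v * u⁻¹, ?_, h.symm⟩
    rw [← S.mul_mem_reflSet_iff hJ hu (S.mul_mem_U hv.1 (S.inv_mem_U hu.1)), ← h]
    exact hv
  · rintro ⟨ε, hε, rfl⟩
    exact (S.mul_mem_reflSet_iff hJ hu hε.1).2 hε

lemma ncard_reflSet {J : Ideal (𝓞 F)} (hJ : J ≠ ⊥) {u : F} (hu : u ∈ S.reflSet J) :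
    (S.reflSet J).ncard = S.E.ncard := by
  rw [S.reflSet_eq_image hJ hu]
  exact Set.ncard_image_of_injective _ (mul_left_injective₀ (S.U_ne_zero hu.1))

/-- `u J̄ = J` with `N(u) = 1` says that `J` and `J̄`, which have the same norm, are in the same
class; the class of `J̄` is inverse to that of `J`. -/
lemma reflSet_nonempty_iff (J : (Ideal (𝓞 F))⁰) :
    (S.reflSet J).Nonempty ↔ (ClassGroup.mk0 J)⁻¹ = ClassGroup.mk0 J := by
  rw [← S.mk0_eq_inv (J' := ⟨S.cj J, S.cj_mem J⟩) rfl, S.mk0_eq_mk0_iff_exists_U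
    (by exact S.absNorm_cj _)]
  simp only [S.toLattice_cj, ← S.map_reflHom]
  rfl

/-! ### Ramified classes -/

lemma inv_mk0_eq_self {A : (Ideal (𝓞 F))⁰} (h : S.cj A = A) :
    (ClassGroup.mk0 A)⁻¹ = ClassGroup.mk0 A := (S.mk0_eq_inv h.symm).symm

lemma mk0_span_mul (w : 𝓞 F) (J A : (Ideal (𝓞 F))⁰)
    (h : (A : Ideal (𝓞 F)) = Ideal.span {w} * J) : ClassGroup.mk0 A = ClassGroup.mk0 J := by
  rw [ClassGroup.mk0_eq_mk0_iff]
  refine ⟨1, w, one_ne_zero, ?_, by simpa using h⟩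
  rintro rfl
  exact coe_ne_bot A (by rw [h, Ideal.span_singleton_zero, Ideal.bot_mul])

lemma gam_mem (S : QuadData F) {r : ℕ} (hr : r ∈ ramifiedPrimes F) :
    (gam r : Ideal (𝓞 F)) ∈ (Ideal (𝓞 F))⁰ := by
  rw [mem_nonZeroDivisors_iff_ne_zero]
  rintro h
  have := S.absNorm_gam hr
  rw [h, Ideal.zero_eq_bot, Ideal.absNorm_bot] at this
  exact (mem_ramifiedPrimes.1 hr).1.ne_zero this.symm

lemma mk0_amb_mem_ramifiedSubgroup (S : QuadData F) {q : ℕ} (hq : q ≠ 0) {R : Set ℕ}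
    {T : Finset ℕ} (hT : T ⊆ ramifiedPrimes F) (hR : ∀ r ∈ T, r ∈ R) (A : (Ideal (𝓞 F))⁰)
    (hA : (A : Ideal (𝓞 F)) = amb q T) : ClassGroup.mk0 A ∈ ramifiedSubgroup F R := by
  classical
  induction T using Finset.induction_on generalizing A with
  | empty =>
    have h : ClassGroup.mk0 A = 1 := by
      rw [show A = ⟨A.1, A.2⟩ from rfl, ClassGroup.mk0_eq_one_iff]
      rw [amb, Finset.prod_empty, mul_one] at hA
      exact ⟨_, hA⟩
    rw [h]
    exact Subgroup.one_mem _
  | insert r T hr ih =>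
    have hr' := hT (Finset.mem_insert_self r T)
    have hT' := (Finset.subset_insert r T).trans hT
    have hB : (amb q T : Ideal (𝓞 F)) ∈ (Ideal (𝓞 F))⁰ :=
      mem_nonZeroDivisors_iff_ne_zero.2 (S.amb_ne_bot hq hT')
    have h : A = ⟨gam r, S.gam_mem hr'⟩ * ⟨amb q T, hB⟩ := by
      apply Subtype.ext
      rw [hA]
      change amb q (insert r T) = gam r * amb q T
      rw [amb, amb, Finset.prod_insert hr]
      ring
    rw [h, map_mul]
    have h1 : ClassGroup.mk0 ⟨gam r, S.gam_mem hr'⟩ ∈ ramifiedSubgroup F R := by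
      apply Subgroup.subset_closure
      exact ⟨r, hr', hR r (Finset.mem_insert_self r T), ⟨gam r, S.gam_mem hr'⟩,
        S.gam_isPrime hr', S.gam_sq hr', rfl⟩
    have h2 := ih hT' (fun r' h' => hR r' (Finset.mem_insert_of_mem h')) ⟨amb q T, hB⟩ rfl
    exact Subgroup.mul_mem _ h1 h2

/-- The generators are classes of self-conjugate ideals, and inversion fixes such classes, so
products suffice. The predicate `p` carries a multiplicative condition on the norm along: none for
`ramGroup`, an even exponent of 2 for `orthoGroup`. -/
lemma exists_of_mem_ramifiedSubgroup {R : Set ℕ} (p : ℕ → Prop) (h1 : p 1)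
    (hmul : ∀ m n, m ≠ 0 → n ≠ 0 → p m → p n → p (m * n)) (hp : ∀ r ∈ ramifiedPrimes F, r ∈ R → p r)
    {g : ClassGroup (𝓞 F)} (hg : g ∈ ramifiedSubgroup F R) :
    ∃ A : (Ideal (𝓞 F))⁰, S.cj A = A ∧ p (A : Ideal (𝓞 F)).absNorm ∧ g = ClassGroup.mk0 A := by
  induction hg using Subgroup.closure_induction with
  | mem g hg =>
    obtain ⟨r, hr, hrR, γ, hγ, hsq, rfl⟩ := hg
    refine ⟨γ, ?_, ?_, rfl⟩
    · refine eq_of_sq_eq_sq (S.cj_isPrime hγ) hγ ?_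
      rw [pow_two, ← S.cj_mul, ← pow_two, hsq, S.cj_span_natCast]
    · rw [S.absNorm_of_sq_eq hsq]
      exact hp r hr hrR
  | one =>
    refine ⟨1, ?_, ?_, (map_one _).symm⟩
    · have := S.cj_span_natCast 1
      simpa using this
    · simpa using h1
  | mul g g' _ _ ih ih' =>
    obtain ⟨A, hA, hpA, rfl⟩ := ih
    obtain ⟨A', hA', hpA', rfl⟩ := ih'
    refine ⟨A * A', ?_, ?_, (map_mul _ _ _).symm⟩
    · rw [Submonoid.coe_mul, S.cj_mul, hA, hA']
    · rw [Submonoid.coe_mul, map_mul]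
      exact hmul _ _ (absNorm_ne_zero (coe_ne_bot A)) (absNorm_ne_zero (coe_ne_bot A')) hpA hpA'
  | inv g _ ih =>
    obtain ⟨A, hA, hpA, rfl⟩ := ih
    exact ⟨A, hA, hpA, S.inv_mk0_eq_self hA⟩

/-- The ramified classes are the classes of order at most two. -/
lemma mem_ramGroup_iff (S : QuadData F) (g : ClassGroup (𝓞 F)) : g ∈ ramGroup F ↔ g⁻¹ = g := by
  constructor
  · intro hg
    obtain ⟨A, hA, -, rfl⟩ := S.exists_of_mem_ramifiedSubgroup (fun _ => True) trivial
      (fun _ _ _ _ _ _ => trivial) (fun _ _ _ => trivial) hg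
    exact S.inv_mk0_eq_self hA
  · intro hg
    obtain ⟨J, rfl⟩ := ClassGroup.mk0_surjective g
    obtain ⟨u, hu, hJ⟩ := (S.reflSet_nonempty_iff J).2 hg
    obtain ⟨w, hw, h0, hcj, -⟩ := S.exists_amb_of_map_reflHom_eq hu (coe_ne_bot J) hJ
    obtain ⟨q, T, hq, hT, hA⟩ := S.exists_eq_amb h0 hcj
    rw [← mk0_span_mul w J ⟨_, mem_nonZeroDivisors_iff_ne_zero.2 h0⟩ rfl]
    exact S.mk0_amb_mem_ramifiedSubgroup hq hT (fun _ _ => Set.mem_univ _) _ hA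

/-- If `J` is rectangular, scaling it to a self-conjugate ideal gives `(q) ∏ γ_r` without `γ_2`.
Conversely, a class in `orthoGroup` contains a self-conjugate ideal `A` that is rectangular for
conjugation, and `xJ = yA` transports this to a reflection of `J`. It agrees with `u` up to sign by
`hE`, and the sign is harmless by `rect_neg`. -/
lemma rect_iff_mem_orthoGroup (hd : S.d % 4 = 3) (hE : ∀ ε ∈ S.E, ε = 1 ∨ ε = -1)
    {J : (Ideal (𝓞 F))⁰} {u : F} (hu : u ∈ S.reflSet J) :
    S.Rect u (toLattice (J : Ideal (𝓞 F))) ↔ ClassGroup.mk0 J ∈ orthoGroup F := by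
  obtain ⟨hu, hJ⟩ := hu
  constructor
  · intro hR
    obtain ⟨w, hw, h0, hcj, h⟩ := S.exists_amb_of_map_reflHom_eq hu (coe_ne_bot J) hJ
    have h2 := h ⊤
    rw [Ideal.mul_top, Ideal.mul_top] at h2
    rw [h2, S.rect_one_iff_of_emod_eq_three hd h0 hcj] at hR
    obtain ⟨q, T, hq, hT, hA⟩ := S.exists_eq_amb h0 hcj
    rw [hA, S.even_factorization_absNorm_amb hq hT] at hR
    rw [← mk0_span_mul w J ⟨_, mem_nonZeroDivisors_iff_ne_zero.2 h0⟩ rfl]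
    refine S.mk0_amb_mem_ramifiedSubgroup hq hT (fun r hr => ?_) _ hA
    rintro rfl
    exact hR hr
  · intro hg
    obtain ⟨A, hA, hpA, hJA⟩ := S.exists_of_mem_ramifiedSubgroup
      (fun n => Even (n.factorization 2)) (by simp)
      (fun m n hm hn h h' => (even_factorization_mul hm hn 2).2 (iff_of_true h h'))
      (fun r hr hr2 => by
        rw [(mem_ramifiedPrimes.1 hr).1.factorization, Finsupp.single_apply, if_neg hr2]
        exact Even.zero) hg
    rw [← S.rect_one_iff_of_emod_eq_three hd (coe_ne_bot A) hA] at hpA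
    obtain ⟨x, y, hx, hy, hxy⟩ := (ClassGroup.mk0_eq_mk0_iff).1 hJA
    have hx' : algebraMap (𝓞 F) F x ≠ 0 := by simpa using hx
    have hy' : algebraMap (𝓞 F) F y ≠ 0 := by simpa using hy
    have hcx : S.conj (algebraMap (𝓞 F) F x) ≠ 0 := by simpa using hx'
    have hcy : S.conj (algebraMap (𝓞 F) F y) ≠ 0 := by simpa using hy'
    have h1 := congrArg toLattice hxy
    rw [toLattice_span_mul, toLattice_span_mul] at h1
    set x' := algebraMap (𝓞 F) F x
    set y' := algebraMap (𝓞 F) F y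
    have hdiv : ∀ z : F, z ≠ 0 → z / S.conj z ∈ S.U := fun z hz => by
      have : S.conj z ≠ 0 := by simpa using hz
      change _ * _ = _
      rw [map_div₀, S.conj_conj]
      field_simp
    -- On the common ideal `xJ = yA` the reflection `u` becomes `u x / x̄`, and conjugation becomes
    -- `y / ȳ`.
    have e1 : u * (x' / S.conj x') * S.conj x' = u * x' := by field_simp
    have e2 : y' / S.conj y' * S.conj y' = 1 * y' := by field_simp
    have hM0 : Ideal.span {y} * (A : Ideal (𝓞 F)) ≠ ⊥ :=
      mul_ne_zero (span_singleton_ne_bot hy) (coe_ne_bot A)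
    have m1 : u * (x' / S.conj x') ∈ S.reflSet (Ideal.span {y} * (A : Ideal (𝓞 F))) := by
      refine ⟨S.mul_mem_U hu (hdiv _ hx'), ?_⟩
      rw [toLattice_span_mul, ← h1]
      exact (S.map_rotHom_map_reflHom_eq_iff hx' e1 _).2 hJ
    have m2 : y' / S.conj y' ∈ S.reflSet (Ideal.span {y} * (A : Ideal (𝓞 F))) := by
      refine ⟨hdiv _ hy', ?_⟩
      rw [toLattice_span_mul]
      refine (S.map_rotHom_map_reflHom_eq_iff hy' e2 _).2 ?_
      rw [S.map_reflHom, ← S.toLattice_cj, hA, map_rotHom_one]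
    rw [S.reflSet_eq_image hM0 m2] at m1
    obtain ⟨ε, hε, hεu⟩ := m1
    have hR : S.Rect (u * (x' / S.conj x')) ((toLattice (J : Ideal (𝓞 F))).map (rotHom x')) := by
      rw [h1, ← hεu]
      have h3 := (S.rect_map_rotHom hy' e2).2 hpA
      rcases hE ε hε with rfl | rfl
      · simpa using h3
      · simpa using S.rect_neg.2 h3
    exact (S.rect_map_rotHom hx' e1).1 hR

/-- Here `θ = i`. If multiplication by `w` carries `u` to conjugation, then `(1 - i)w` does so for
`iu`. The factor `1 - i` has norm 2 and flips the parity that decides the type. -/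
lemma rect_θ_mul_iff (hd : S.d = -1) {J : Ideal (𝓞 F)} (hJ0 : J ≠ ⊥) {u : F}
    (hu : u ∈ S.reflSet J) :
    S.Rect (S.θ * u) (toLattice J) ↔ ¬ S.Rect u (toLattice J) := by
  obtain ⟨hu, hJ⟩ := hu
  have hd4 : S.d % 4 = 3 := by rw [hd]; rfl
  have hθ2 : S.θ ^ 2 = -1 := by rw [S.sq, hd]; simp
  have hθU : S.θ ∈ S.U := by
    change _ * _ = _
    rw [S.conj_θ]
    linear_combination -hθ2
  have hθE : S.θ ∈ S.E := ⟨hθU, S.isIntegral_θ⟩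
  obtain ⟨w, hw0, hw⟩ := S.exists_conj_eq_mul hu
  have hw' : algebraMap (𝓞 F) F w ≠ 0 := by simpa using hw0
  have hN : Algebra.norm ℤ (1 - S.θInt) = 2 := by
    have h := S.intNorm_eq (1 - S.θInt)
    rw [map_sub (algebraMap (𝓞 F) F), map_sub S.conj, map_one (algebraMap (𝓞 F) F),
      map_one S.conj, S.coe_θInt, S.conj_θ] at h
    have h2 : ((Algebra.norm ℤ (1 - S.θInt) : ℤ) : F) = (2 : ℤ) := by
      rw [h]
      push_cast
      linear_combination -hθ2
    exact_mod_cast h2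
  have h10 : (1 - S.θInt) ≠ 0 := fun h => by
    rw [h, Algebra.norm_zero] at hN
    norm_num at hN
  have hw2 : S.conj (algebraMap (𝓞 F) F ((1 - S.θInt) * w)) =
      S.θ * u * algebraMap (𝓞 F) F ((1 - S.θInt) * w) := by
    rw [map_mul, map_mul, hw, map_sub, map_sub, map_one, map_one, S.coe_θInt, S.conj_θ]
    linear_combination u * algebraMap (𝓞 F) F w * hθ2
  have hw20 : algebraMap (𝓞 F) F ((1 - S.θInt) * w) ≠ 0 :=
    (map_ne_zero_iff _ (FaithfulSMul.algebraMap_injective (𝓞 F) F)).2 (mul_ne_zero h10 hw0)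
  have m2 : S.θ * u ∈ S.reflSet J := (S.mul_mem_reflSet_iff hJ0 ⟨hu, hJ⟩ hθU).2 hθE
  have c1 := S.cj_span_mul_eq hu hJ hw0 hw
  have c2 := S.cj_span_mul_eq m2.1 m2.2 (mul_ne_zero h10 hw0) hw2
  have n1 : Ideal.span {w} * J ≠ ⊥ := mul_ne_zero (span_singleton_ne_bot hw0) hJ0
  have n2 : Ideal.span {(1 - S.θInt) * w} * J ≠ ⊥ :=
    mul_ne_zero (span_singleton_ne_bot (mul_ne_zero h10 hw0)) hJ0
  rw [← S.rect_map_rotHom (u := u) (u' := 1) hw' (by rw [hw, one_mul]),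
    ← S.rect_map_rotHom (u := S.θ * u) (u' := 1) hw20 (by rw [hw2, one_mul]),
    ← toLattice_span_mul, ← toLattice_span_mul, S.rect_one_iff_of_emod_eq_three hd4 n1 c1,
    S.rect_one_iff_of_emod_eq_three hd4 n2 c2, ← Ideal.span_singleton_mul_span_singleton,
    mul_assoc, map_mul, even_factorization_mul (absNorm_ne_zero (span_singleton_ne_bot h10))
      (absNorm_ne_zero n1), Ideal.absNorm_span_singleton, hN]
  simp [Nat.prime_two.factorization]

/-! ### Units and class number -/

/-- With `2ε = m + nθ` the norm condition is `m² - dn² = 4`. It forces `n = 0` if `d ≤ -5`, and also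
if `d = -2`, where `n` is even. -/
lemma E_eq_one_or_neg_one (h1 : S.d ≠ -1) (h3 : S.d ≠ -3) {ε : F} (hε : ε ∈ S.E) :
    ε = 1 ∨ ε = -1 := by
  obtain ⟨p, q, rfl⟩ := S.exists_coord ε
  obtain ⟨m, n, hm, hn, h4⟩ := S.exists_int_eq_two_mul hε.2
  have hN : ((p : F) + q * S.θ) * S.conj (p + q * S.θ) = 1 := hε.1
  rw [S.mul_conj_coord] at hN
  have hN2 : p ^ 2 - S.d * q ^ 2 = 1 := by exact_mod_cast hN
  have hmn : m ^ 2 - S.d * n ^ 2 = 4 := by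
    have : (m : ℚ) ^ 2 - S.d * n ^ 2 = 4 := by
      rw [← hm, ← hn]
      linear_combination 4 * hN2
    exact_mod_cast this
  have hneg := S.neg
  have hd4 := S.d_not_four_dvd
  have hn0 : n = 0 := by
    by_contra hn0
    have hn1 : 1 ≤ n ^ 2 := by
      have : 0 < n ^ 2 := by positivity
      omega
    by_cases hd2 : S.d = -2
    · rcases S.parity_of_dvd h4 with ⟨h, -⟩ | ⟨-, -, h⟩
      · rcases S.t_eq with ⟨-, h'⟩ | ⟨h', -⟩
        · rw [hd2] at h'; norm_num at h'
        · omega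
      · obtain ⟨k, rfl⟩ : (2 : ℤ) ∣ n := Int.dvd_of_emod_eq_zero h
        have : 1 ≤ k ^ 2 := by
          have : k ≠ 0 := by rintro rfl; simp at hn0
          have : 0 < k ^ 2 := by positivity
          omega
        rw [hd2] at hmn
        nlinarith [sq_nonneg m]
    · have hd5 : S.d ≤ -5 := by
        have : S.d ≠ -4 := fun h => hd4 (by rw [h]; decide)
        omega
      nlinarith [sq_nonneg m]
  rw [hn0] at hn hmn
  have hq : q = 0 := by
    have : 2 * q = 0 := by simpa using hn
    linarith
  rw [hq] at hN2 ⊢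
  have hp : p = 1 ∨ p = -1 := by
    have : (p - 1) * (p + 1) = 0 := by linear_combination hN2
    rcases mul_eq_zero.1 this with h | h
    · left; linarith
    · right; linarith
  rcases hp with rfl | rfl
  · left; simp
  · right; simp

/-- The discriminant is at most 4 in absolute value, below Minkowski's bound for class number one.
-/
lemma classGroup_eq_one (h : S.d = -1 ∨ S.d = -3) (g : ClassGroup (𝓞 F)) : g = 1 := by
  have hdisc : |NumberField.discr F| ≤ 4 := by
    rw [S.discr_eq]
    rcases h with h | h <;> rw [h] <;> norm_num
  have hpi := Real.pi_gt_three
  have : IsPrincipalIdealRing (𝓞 F) := by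
    apply RingOfIntegers.isPrincipalIdealRing_of_abs_discr_lt
    have h2 := NumberField.InfinitePlace.card_add_two_mul_card_eq_rank F
    rw [S.finrank] at h2
    rw [S.finrank]
    have h4 : ((|NumberField.discr F| : ℤ) : ℝ) ≤ 4 := by exact_mod_cast hdisc
    refine lt_of_le_of_lt h4 ?_
    -- The inequality holds for either number of complex places, so the signature need not be
    -- determined.
    have h5 : NumberField.InfinitePlace.nrComplexPlaces F = 0 ∨
        NumberField.InfinitePlace.nrComplexPlaces F = 1 := by omega
    rcases h5 with h5 | h5 <;> rw [h5] <;> norm_num [Nat.factorial]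
    nlinarith
  obtain ⟨J, rfl⟩ := ClassGroup.mk0_surjective g
  exact (ClassGroup.mk0_eq_one_iff J.2).2 (IsPrincipalIdealRing.principal _)

end QuadData

end SubformZeta

end


/-! ### The ideal generated by a lattice -/

open scoped NumberField nonZeroDivisors

noncomputable section

namespace SubformZeta

open Module

section Hull

variable {F : Type*} [Field F]

/-- The ideal generated by a lattice of integers. -/
def hull (K : AddSubgroup F) : Ideal (𝓞 F) := Ideal.span {x | algebraMap (𝓞 F) F x ∈ K}

lemma hull_le {K : AddSubgroup F} {J : Ideal (𝓞 F)} (h : K ≤ toLattice J) : hull K ≤ J :=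
  Ideal.span_le.2 fun _ hx => coe_mem_toLattice.1 (h hx)

lemma le_toLattice_hull {K : AddSubgroup F} {J : Ideal (𝓞 F)} (h : K ≤ toLattice J) :
    K ≤ toLattice (hull K) := by
  intro x hx
  obtain ⟨y, -, rfl⟩ := mem_toLattice.1 (h hx)
  exact coe_mem_toLattice.2 (Ideal.subset_span hx)

/-- Semilinear maps send the ideal generated by `K` into every ideal that contains the image
of `K`. -/
lemma forall_mem_hull {K : AddSubgroup F} {I : Ideal (𝓞 F)} {g : F →+ F} (c : 𝓞 F → 𝓞 F)
    (hg : ∀ (r : 𝓞 F) (x : F), g (algebraMap (𝓞 F) F r * x) = algebraMap (𝓞 F) F (c r) * g x)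
    (h : ∀ x ∈ K, g x ∈ toLattice I) : ∀ x ∈ toLattice (hull K), g x ∈ toLattice I := by
  intro x hx
  obtain ⟨y, hy, rfl⟩ := mem_toLattice.1 hx
  induction hy using Submodule.span_induction with
  | mem y hy => exact h _ hy
  | zero => simp
  | add y z hy hz ihy ihz =>
    rw [map_add, map_add]
    exact add_mem (ihy (coe_mem_toLattice.2 hy)) (ihz (coe_mem_toLattice.2 hz))
  | smul r y hy ih =>
    rw [smul_eq_mul, map_mul, hg]
    obtain ⟨z, hz, h2⟩ := mem_toLattice.1 (ih (coe_mem_toLattice.2 hy))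
    exact mem_toLattice.2 ⟨c r * z, I.mul_mem_left _ hz, by rw [map_mul, h2]⟩

/-- Since `I` is stable under `R`, an isometry maps `K` into `I` as soon as it maps the ideal
generated by `K` into `I`. Hence the number of embeddings depends on that ideal only. -/
lemma map_le_iff_hull {K : AddSubgroup F} {I J : Ideal (𝓞 F)} (hK : K ≤ toLattice J) {g : F →+ F}
    (c : 𝓞 F → 𝓞 F)
    (hg : ∀ (r : 𝓞 F) (x : F), g (algebraMap (𝓞 F) F r * x) = algebraMap (𝓞 F) F (c r) * g x) :
    (toLattice (hull K)).map g ≤ toLattice I ↔ K.map g ≤ toLattice I := by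
  refine ⟨fun h => (AddSubgroup.map_mono (le_toLattice_hull hK)).trans h, fun h => ?_⟩
  rintro _ ⟨x, hx, rfl⟩
  exact forall_mem_hull c hg (fun y hy => h ⟨y, hy, rfl⟩) x hx

end Hull

namespace QuadData

variable {F : Type*} [Field F] [NumberField F] (S : QuadData F)

lemma map_rotHom_le_iff_hull {F : Type*} [Field F] {K : AddSubgroup F} {I J : Ideal (𝓞 F)} (hK : K ≤ toLattice J)
    (u : F) : (toLattice (hull K)).map (rotHom u) ≤ toLattice I ↔
      K.map (rotHom u) ≤ toLattice I :=
  map_le_iff_hull hK id fun r x => by simp; ring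

lemma map_reflHom_le_iff_hull {K : AddSubgroup F} {I J : Ideal (𝓞 F)} (hK : K ≤ toLattice J)
    (u : F) : (toLattice (hull K)).map (S.reflHom u) ≤ toLattice I ↔
      K.map (S.reflHom u) ≤ toLattice I :=
  map_le_iff_hull hK S.conjInt fun r x => by
    rw [S.coe_conjInt, S.reflHom_apply, S.reflHom_apply, map_mul]
    ring

lemma map_reflHom_hull {K : AddSubgroup F} {J : Ideal (𝓞 F)} (hK : K ≤ toLattice J) {u : F}
    (hu : u ∈ S.U) (h : K.map (S.reflHom u) = K) :
    (toLattice (hull K)).map (S.reflHom u) = toLattice (hull K) := by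
  rw [S.map_reflHom_eq_iff hu]
  intro x hx
  have h2 := (S.map_reflHom_le_iff_hull hK u (I := hull K)).2 (h.le.trans (le_toLattice_hull hK))
  exact h2 ⟨x, hx, rfl⟩

lemma mem_reflSet_mul {J A : Ideal (𝓞 F)} {u : F} (hu : u ∈ S.reflSet J) (hA : S.cj A = A) :
    u ∈ S.reflSet (J * A) := by
  obtain ⟨hu, hJ⟩ := hu
  refine ⟨hu, ?_⟩
  obtain ⟨w, hw0, hw⟩ := S.exists_conj_eq_mul hu
  have hw' : algebraMap (𝓞 F) F w ≠ 0 := by simpa using hw0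
  rw [← S.map_rotHom_map_reflHom_eq_iff (u' := 1) hw' (by rw [hw, one_mul]),
    ← toLattice_span_mul, S.map_reflHom, ← S.toLattice_cj, map_rotHom_one, ← mul_assoc, S.cj_mul,
    S.cj_span_mul_eq hu hJ hw0 hw, hA]

/-- With `w̄ = uw` both `wJ` and `wJA` are self-conjugate, and `wJ` can be cancelled. Together with
`mem_reflSet_mul`: the multiples of `J` with the same reflection are the `JA` with `A`
self-conjugate. -/
lemma cj_eq_of_mem_reflSet_mul {J A : Ideal (𝓞 F)} (hJ0 : J ≠ ⊥) {u : F} (hu : u ∈ S.reflSet J)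
    (h : u ∈ S.reflSet (J * A)) : S.cj A = A := by
  obtain ⟨w, hw0, hw⟩ := S.exists_conj_eq_mul hu.1
  have h1 := S.cj_span_mul_eq hu.1 hu.2 hw0 hw
  have h2 := S.cj_span_mul_eq h.1 h.2 hw0 hw
  rw [← mul_assoc, S.cj_mul, h1] at h2
  exact mul_left_cancel₀ (mul_ne_zero (span_singleton_ne_bot hw0) hJ0) h2

/-! ### Bases -/

lemma exists_basis_top (S : QuadData F) : ∃ b : Basis (Fin 2) ℚ F,
    toLattice (⊤ : Ideal (𝓞 F)) = latticeOf b := by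
  have ht : (S.t : ℚ) + 1 ≠ 0 := by
    rcases S.t_eq with ⟨h, -⟩ | ⟨h, -⟩ <;> rw [h] <;> norm_num
  obtain ⟨b, h0, h1⟩ := exists_basis_triangular S.basis (α := 1) (β := S.t / (S.t + 1))
    (δ := 1 / (S.t + 1)) one_ne_zero (one_div_ne_zero ht)
  have h0' : b 0 = 1 := by rw [h0, S.basis_zero, one_smul]
  have h1' : b 1 = S.ω := by
    rw [h1, S.basis_zero, S.basis_one, S.ω_coord, Algebra.smul_def, Algebra.smul_def]
    simp
  refine ⟨b, ?_⟩
  ext x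
  rw [mem_latticeOf, mem_toLattice, h0', h1']
  constructor
  · rintro ⟨y, -, rfl⟩
    obtain ⟨m, n, h⟩ := S.exists_ω_coord y.isIntegral_coe
    exact ⟨m, n, by simpa using h⟩
  · rintro ⟨m, n, rfl⟩
    refine ⟨m + n * S.ωInt, Submodule.mem_top, ?_⟩
    rw [map_add, map_mul, map_intCast, map_intCast, S.coe_ωInt]
    simp

lemma exists_basis_toLattice (S : QuadData F) {J : Ideal (𝓞 F)} (hJ : J ≠ ⊥) :
    ∃ b : Basis (Fin 2) ℚ F, toLattice J = latticeOf b := by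
  obtain ⟨b, hb⟩ := S.exists_basis_top
  obtain ⟨-, -, -, b', -, h, -⟩ := exists_basis_hnf b (K := toLattice J)
    (by rw [← hb]; exact toLattice_le_iff.2 le_top)
    (by rw [← hb]; exact relIndex_toLattice_ne_zero hJ le_top)
  exact ⟨b', h⟩

lemma ne_bot_of_relIndex_ne_zero (S : QuadData F) {J : Ideal (𝓞 F)} (hJ : J ≠ ⊥)
    {K : AddSubgroup F} (hK : K ≤ toLattice J) (hi : K.relIndex (toLattice J) ≠ 0) : K ≠ ⊥ := by
  obtain ⟨b, hb⟩ := S.exists_basis_toLattice hJ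
  rw [hb] at hK hi
  obtain ⟨-, -, -, b', -, h, -⟩ := exists_basis_hnf b hK hi
  rintro rfl
  have h2 : b' 0 ∈ latticeOf b' := (mem_latticeOf b').2 ⟨1, 0, by simp⟩
  rw [← h, AddSubgroup.mem_bot] at h2
  exact b'.ne_zero 0 h2

lemma hull_ne_bot (S : QuadData F) {J : Ideal (𝓞 F)} (hJ : J ≠ ⊥)
    {K : AddSubgroup F} (hK : K ≤ toLattice J) (hi : K.relIndex (toLattice J) ≠ 0) :
    hull K ≠ ⊥ := by
  rw [← toLattice_ne_bot_iff]
  intro h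
  have h2 := le_toLattice_hull hK
  rw [h, le_bot_iff] at h2
  exact S.ne_bot_of_relIndex_ne_zero hJ hK hi h2

lemma relIndex_ne_zero_of_nsmul_mem {E : Type*} [AddCommGroup E] [Module ℚ E]
    (b : Basis (Fin 2) ℚ E) {K : AddSubgroup E} {n : ℕ} (hn : n ≠ 0)
    (h : ∀ x ∈ latticeOf b, n • x ∈ K) : K.relIndex (latticeOf b) ≠ 0 := by
  rw [← index_comap_basisHom]
  have h1 : hnf n n 0 ≤ K.comap (basisHom b) := by
    rintro v ⟨i, j, h0, h1⟩
    rw [AddSubgroup.mem_comap]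
    have h2 := h (i • b 0 + j • b 1) ((mem_latticeOf b).2 ⟨i, j, rfl⟩)
    rw [basisHom_apply, h0, h1]
    convert h2 using 1
    rw [smul_add, ← natCast_zsmul, ← natCast_zsmul, smul_smul, smul_smul]
    push_cast
    congr 2 <;> ring
  have h2 := AddSubgroup.index_dvd_of_le h1
  rw [index_hnf 0 hn hn] at h2
  intro h3
  rw [h3, zero_dvd_iff] at h2
  exact mul_ne_zero hn hn h2

/-- A basis of an invariant ideal adapted to the reflection. -/
lemma exists_basis_of_mem_reflSet {J : Ideal (𝓞 F)} (hJ : J ≠ ⊥) {u : F} (hu : u ∈ S.reflSet J) :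
    ∃ (ε : ℤ) (b : Basis (Fin 2) ℚ F), toLattice J = latticeOf b ∧ S.reflHom u (b 0) = b 0 ∧
      S.reflHom u (b 1) = ε • b 0 - b 1 ∧ (ε = 0 ∨ ε = 1) ∧
      (ε = 0 ↔ S.Rect u (toLattice J)) := by
  obtain ⟨w, hw0, hw⟩ := S.exists_conj_eq_mul hu.1
  have hw' : algebraMap (𝓞 F) F w ≠ 0 := by simpa using hw0
  set w' := algebraMap (𝓞 F) F w with hw'def
  have hu0 := S.U_ne_zero hu.1
  -- The reflection fixes `1/(2w)` and negates `θ/(2w)`. The denominator 2 makes their span contain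
  -- `J`, because `wJ` consists of integers, which lie in `½(ℤ + ℤθ)`.
  let f : F ≃ₗ[ℚ] F := LinearEquiv.ofBijective (LinearMap.mulLeft ℚ (2 * w')⁻¹)
    ⟨mul_right_injective₀ (inv_ne_zero (mul_ne_zero two_ne_zero hw')), fun x => ⟨2 * w' * x, by
      simp only [LinearMap.mulLeft_apply]
      field_simp⟩⟩
  let b := S.basis.map f
  have b0 : b 0 = (2 * w')⁻¹ := by
    change (2 * w')⁻¹ * S.basis 0 = _
    rw [S.basis_zero, mul_one]
  have b1 : b 1 = (2 * w')⁻¹ * S.θ := by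
    change (2 * w')⁻¹ * S.basis 1 = _
    rw [S.basis_one]
  have r0 : S.reflHom u (b 0) = b 0 := by
    rw [S.reflHom_apply, b0, map_inv₀, map_mul, hw, map_ofNat]
    field_simp
  have r1 : S.reflHom u (b 1) = -b 1 := by
    rw [S.reflHom_apply, b1, map_mul, map_inv₀, map_mul, hw, map_ofNat, S.conj_θ]
    field_simp
  have hle : toLattice J ≤ latticeOf b := by
    intro x hx
    obtain ⟨y, hy, rfl⟩ := mem_toLattice.1 hx
    obtain ⟨p, q, hpq⟩ := S.exists_coord (algebraMap (𝓞 F) F (w * y))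
    obtain ⟨m, n, hm, hn, -⟩ := S.exists_int_eq_two_mul (p := p) (q := q) (by
      rw [← hpq]
      exact (w * y).isIntegral_coe)
    refine (mem_latticeOf b).2 ⟨m, n, ?_⟩
    rw [b0, b1, zsmul_eq_mul, zsmul_eq_mul]
    have hm' : (m : F) = 2 * p := by exact_mod_cast congrArg (Rat.cast : ℚ → F) hm.symm
    have hn' : (n : F) = 2 * q := by exact_mod_cast congrArg (Rat.cast : ℚ → F) hn.symm
    rw [hm', hn']
    rw [map_mul] at hpq
    field_simp
    linear_combination hpq
  have hi : (toLattice J).relIndex (latticeOf b) ≠ 0 := by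
    -- `2N(w)` clears the denominator in `1/(2w) = w̄ / (2N(w))`, and `N(J) ∈ J` brings the result
    -- into `J`.
    refine relIndex_ne_zero_of_nsmul_mem b (n := J.absNorm * (2 * (Algebra.norm ℤ w).natAbs))
      (mul_ne_zero (absNorm_ne_zero hJ) (mul_ne_zero two_ne_zero (by simpa using hw0))) ?_
    intro x hx
    obtain ⟨m, n, rfl⟩ := (mem_latticeOf b).1 hx
    have hJn : (J.absNorm : 𝓞 F) ∈ J := J.absNorm_mem
    refine mem_toLattice.2 ⟨S.conjInt w * (m + n * S.θInt) * J.absNorm,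
      J.mul_mem_left _ hJn, ?_⟩
    have hN := S.intNorm_eq w
    have hN2 : (((Algebra.norm ℤ w).natAbs : ℕ) : F) = w' * S.conj w' := by
      rw [← hN, ← Int.cast_natCast (R := F), Int.natAbs_of_nonneg (S.intNorm_nonneg w)]
    rw [b0, b1]
    simp only [map_mul, map_add, map_intCast, map_natCast, S.coe_conjInt, S.coe_θInt,
      nsmul_eq_mul, zsmul_eq_mul]
    push_cast
    rw [hN2, ← hw'def]
    field_simp
  obtain ⟨ε, b', h1, h2, h3, h4, h5⟩ := exists_basis_reflection b r0 r1 hle hi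
    (fun x hx => (S.map_reflHom_eq_iff hu.1).1 hu.2 x hx)
  exact ⟨ε, b', h1, h2, h3, h4, h5⟩

/-! ### Regrouping lattices by the ideals they generate -/

lemma relIndex_hull {F : Type*} [Field F] {I J : Ideal (𝓞 F)} {K : AddSubgroup F}
    (hK : K ≤ toLattice J) (h : J ≤ I) : K.relIndex (toLattice I) =
      K.relIndex (toLattice J) * (toLattice J).relIndex (toLattice I) :=
  (AddSubgroup.relIndex_mul_relIndex _ _ _ hK (toLattice_le_iff.2 h)).symm

/-- A lattice in `I` with property `P` belongs to exactly one block, that of the ideal it generates,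
and it has finite index in that ideal too. -/
lemma hasSum_hull {I : Ideal (𝓞 F)} {ι : Type*}
    {𝒥 : ι → Ideal (𝓞 F)} (hinj : Function.Injective 𝒥) (h𝒥 : ∀ i, 𝒥 i ≠ ⊥ ∧ 𝒥 i ≤ I)
    {P : AddSubgroup F → Prop}
    (hP : ∀ K, K ≤ toLattice I → K.relIndex (toLattice I) ≠ 0 → P K → ∃ i, hull K = 𝒥 i)
    {f : AddSubgroup F → ℂ} (hf : Summable fun K : Lat P (toLattice I) => f K) :
    HasSum (fun i => ∑' K : Lat (fun K => hull K = 𝒥 i ∧ P K) (toLattice (𝒥 i)), f K)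
      (∑' K : Lat P (toLattice I), f K) := by
  let e : (Σ i, Lat (fun K => hull K = 𝒥 i ∧ P K) (toLattice (𝒥 i))) ≃ Lat P (toLattice I) := by
    refine Equiv.ofBijective (fun t => ⟨t.2.1, ⟨t.2.2.1.1.trans
      (toLattice_le_iff.2 (h𝒥 t.1).2), ?_⟩, t.2.2.2.2⟩) ⟨?_, ?_⟩
    · rw [relIndex_hull t.2.2.1.1 (h𝒥 t.1).2]
      exact mul_ne_zero t.2.2.1.2 (relIndex_toLattice_ne_zero (h𝒥 t.1).1 (h𝒥 t.1).2)
    · rintro ⟨i, K, hK⟩ ⟨i', K', hK'⟩ h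
      have h1 : K = K' := congrArg Subtype.val h
      subst h1
      have h2 : i = i' := hinj (hK.2.1.symm.trans hK'.2.1)
      subst h2
      rfl
    · rintro ⟨K, ⟨hK, hi⟩, hPK⟩
      obtain ⟨i, h⟩ := hP K hK hi hPK
      have hKi : K ≤ toLattice (𝒥 i) := by
        rw [← h]
        exact le_toLattice_hull hK
      refine ⟨⟨i, ⟨K, ⟨hKi, fun h0 => hi ?_⟩, h, hPK⟩⟩, rfl⟩
      rw [relIndex_hull hKi (h𝒥 i).2, h0, zero_mul]
  have h1 : HasSum (fun t => f (e t)) (∑' K : Lat P (toLattice I), f K) :=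
    e.hasSum_iff.2 hf.hasSum
  exact h1.sigma fun i => (h1.summable.sigma_factor i).hasSum

end QuadData

/-- Coefficients determined by a triangular system depend only on the type of the object. -/
lemma eq_of_hasSum_divisors {X M : Type*} (act : X → M → X) (one : M) (ν : M → ℕ)
    (hν : ∀ A, ν A = 1 ↔ A = one) (hone : ∀ x, act x one = x) {g c : X → ℕ → ℂ}
    (h : ∀ x m, m ≠ 0 → HasSum (fun A => if ν A ∣ m then g (act x A) (m / ν A) else 0) (c x m))
    (R : X → X → Prop) (hR : ∀ x y A, R x y → R (act x A) (act y A))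
    (hc : ∀ x y m, m ≠ 0 → R x y → c x m = c y m) :
    ∀ m, m ≠ 0 → ∀ x y, R x y → g x m = g y m := by
  intro m
  induction m using Nat.strong_induction_on with
  | _ m ih =>
    intro hm x y hxy
    have h1 := (h x m hm).sub (h y m hm)
    rw [hc x y m hm hxy, sub_self] at h1
    -- For `A ≠ one` the argument `m / ν A` is smaller than `m`, so by induction these terms of the
    -- difference vanish.
    have h2 := h1.unique (hasSum_single one fun A hA => by
      split_ifs with hd
      · rw [sub_eq_zero]
        have hν0 : ν A ≠ 0 := by
          rintro h0
          rw [h0, zero_dvd_iff] at hd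
          exact hm hd
        refine ih _ (Nat.div_lt_self (Nat.pos_of_ne_zero hm) ?_) ?_ _ _ (hR x y A hxy)
        · have : ν A ≠ 1 := fun h => hA ((hν A).1 h)
          omega
        · exact (Nat.div_ne_zero_iff_of_dvd hd).2 ⟨hm, hν0⟩
      · exact sub_zero _)
    rw [(hν one).2 rfl, if_pos (one_dvd _), if_pos (one_dvd _), Nat.div_one, hone, hone] at h2
    exact sub_eq_zero.1 h2.symm

end SubformZeta

end


/-! ### The Dirichlet series of the lattices generating a given ideal -/

open scoped NumberField nonZeroDivisors

noncomputable section

namespace SubformZeta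

open Module

section Abstract

variable {E : Type*} [AddCommGroup E] [Module ℚ E]

lemma summable_lat (b : Basis (Fin 2) ℚ E) (P : AddSubgroup E → Prop) {s : ℂ} (hs : 2 < s.re) :
    Summable fun K : Lat P (latticeOf b) => (K.1.relIndex (latticeOf b) : ℂ) ^ (-s) := by
  let i : Lat P (latticeOf b) →
      {K : AddSubgroup E // K ≤ latticeOf b ∧ K.relIndex (latticeOf b) ≠ 0} :=
    fun K => ⟨K.1, K.2.1⟩
  have hi : Function.Injective i := fun K K' h => Subtype.ext (congrArg (fun t => t.1) h)
  have h := (hasSum_relIndex b hs).summable.comp_injective hi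
  exact h

lemma summable_lat_indicator (b : Basis (Fin 2) ℚ E) (P : AddSubgroup E → Prop) {m : ℕ}
    (hm : m ≠ 0) : Summable fun K : Lat P (latticeOf b) =>
      if K.1.relIndex (latticeOf b) = m then (1 : ℂ) else 0 := by
  apply summable_of_hasFiniteSupport
  refine ((finite_sublattices b hm).preimage
    (Subtype.val_injective (p := fun K => (K ≤ latticeOf b ∧ K.relIndex (latticeOf b) ≠ 0) ∧
      P K)).injOn).subset ?_
  intro K hK
  have : K.1.relIndex (latticeOf b) = m := by
    by_contra h
    exact hK (if_neg h)
  exact ⟨K.2.1.1, this⟩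

/-- The Dirichlet series of the indices of a family of lattices is determined by the number of
lattices of each index. -/
lemma LSeriesHasSum_of_indicator {ι : Type*} {n : ι → ℕ} (hn : ∀ i, n i ≠ 0) {s : ℂ}
    (h : Summable fun i => (n i : ℂ) ^ (-s))
    (h1 : ∀ m ≠ 0, Summable fun i => if n i = m then (1 : ℂ) else 0) :
    LSeriesHasSum (fun m => ∑' i, if n i = m then (1 : ℂ) else 0) s (∑' i, (n i : ℂ) ^ (-s)) := by
  have h2 := hasSum_fiberwise_term hn (f := fun _ => 1) (s := s) (by simpa using h)
    (A := fun m => ∑' i, if n i = m then (1 : ℂ) else 0) (fun m hm => by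
      have h3 := (h1 m hm).hasSum
      refine (hasSum_subtype_iff_indicator (f := fun _ : ι => (1 : ℂ)) (s := {i | n i = m})).2 ?_
      refine hasSum_of_eq h3 (fun i => ?_) rfl
      simp [Set.indicator_apply])
  simpa using h2

end Abstract

section System

variable (F : Type*) [Field F] [NumberField F]

/-- A family of ideals `J` with properties `P` of lattices, such that the lattices in `J` with
property `P` generate ideals of the form `J A`, where `A` runs over a monoid of ideals. -/
structure HullSystem (X M : Type*) where
  ideal : X → Ideal (𝓞 F)
  P : X → AddSubgroup F → Prop
  al : M → Ideal (𝓞 F)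
  act : X → M → X
  one : M
  ideal_ne_bot : ∀ x, ideal x ≠ ⊥
  ideal_act : ∀ x A, ideal (act x A) = ideal x * al A
  P_act : ∀ x A, P (act x A) = P x
  al_injective : Function.Injective al
  al_ne_bot : ∀ A, al A ≠ ⊥
  al_one : al one = ⊤
  act_one : ∀ x, act x one = x
  exists_hull : ∀ x K, K ≤ toLattice (ideal x) → K.relIndex (toLattice (ideal x)) ≠ 0 → P x K →
    ∃ A, hull K = ideal x * al A

variable {F} {X M : Type*} (H : HullSystem F X M)

namespace HullSystem

/-- The sum over all lattices with the given property. -/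
def tot (x : X) (φ : ℕ → ℂ) : ℂ :=
  ∑' K : Lat (H.P x) (toLattice (H.ideal x)), φ (K.1.relIndex (toLattice (H.ideal x)))

/-- The sum over the lattices with the given property that generate the given ideal. -/
def prim (x : X) (φ : ℕ → ℂ) : ℂ :=
  ∑' K : Lat (fun K => hull K = H.ideal x ∧ H.P x K) (toLattice (H.ideal x)),
    φ (K.1.relIndex (toLattice (H.ideal x)))

lemma prim_act {F : Type*} [Field F] {X M : Type*} (H : HullSystem F X M) (x : X) (A : M) (φ : ℕ → ℂ) : H.prim (H.act x A) φ =
    ∑' K : Lat (fun K => hull K = H.ideal x * H.al A ∧ H.P x K)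
      (toLattice (H.ideal x * H.al A)),
        φ (K.1.relIndex (toLattice (H.ideal x * H.al A))) := by
  rw [prim, H.ideal_act, H.P_act]

/-- The lattices are grouped by the ideal they generate. The function `φ` is arbitrary so that the
identity yields both the Dirichlet series (`φ` a power) and its coefficients (`φ` an indicator). -/
lemma hasSum_prim_aux (x : X) {φ : ℕ → ℂ} (hφ : Summable fun K : Lat (H.P x)
    (toLattice (H.ideal x)) => φ (K.1.relIndex (toLattice (H.ideal x)))) :
    HasSum (fun A => H.prim (H.act x A) fun m => φ (m * (H.al A).absNorm)) (H.tot x φ) := by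
  have h := QuadData.hasSum_hull (I := H.ideal x) (𝒥 := fun A => H.ideal x * H.al A)
    (fun A A' h => H.al_injective (mul_left_cancel₀ (H.ideal_ne_bot x) h))
    (fun A => ⟨mul_ne_zero (H.ideal_ne_bot x) (H.al_ne_bot A), Ideal.mul_le_left⟩)
    (P := H.P x) (H.exists_hull x)
    (f := fun K => φ (K.relIndex (toLattice (H.ideal x)))) hφ
  refine hasSum_of_eq h (fun A => ?_) rfl
  rw [H.prim_act]
  refine tsum_congr fun K => ?_
  rw [QuadData.relIndex_hull K.2.1.1 Ideal.mul_le_left, relIndex_toLattice_mul (H.ideal_ne_bot x)]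

variable (S : QuadData F)

lemma summable_cpow (S : QuadData F) (P : AddSubgroup F → Prop) {J : Ideal (𝓞 F)} (hJ : J ≠ ⊥)
    {s : ℂ} (hs : 2 < s.re) :
    Summable fun K : Lat P (toLattice J) => (K.1.relIndex (toLattice J) : ℂ) ^ (-s) := by
  obtain ⟨b, hb⟩ := S.exists_basis_toLattice hJ
  rw [hb]
  exact summable_lat b P hs

lemma summable_indicator (S : QuadData F) (P : AddSubgroup F → Prop) {J : Ideal (𝓞 F)}
    (hJ : J ≠ ⊥) {m : ℕ} (hm : m ≠ 0) :
    Summable fun K : Lat P (toLattice J) =>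
      if K.1.relIndex (toLattice J) = m then (1 : ℂ) else 0 := by
  obtain ⟨b, hb⟩ := S.exists_basis_toLattice hJ
  rw [hb]
  exact summable_lat_indicator b P hm

lemma hasSum_prim (S : QuadData F) (x : X) {s : ℂ} (hs : 2 < s.re) :
    HasSum (fun A => ((H.al A).absNorm : ℂ) ^ (-s) *
      H.prim (H.act x A) fun m => (m : ℂ) ^ (-s)) (H.tot x fun m => (m : ℂ) ^ (-s)) := by
  refine hasSum_of_eq (H.hasSum_prim_aux x (φ := fun m => (m : ℂ) ^ (-s))
    (summable_cpow S _ (H.ideal_ne_bot x) hs)) (fun A => ?_) rfl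
  rw [prim, prim, ← tsum_mul_left]
  refine tsum_congr fun K => ?_
  rw [natCast_mul_cpow, mul_comm]

lemma al_absNorm_ne_zero (A : M) : (H.al A).absNorm ≠ 0 := QuadData.absNorm_ne_zero (H.al_ne_bot A)

/-- If `tot` depends only on the type described by `R`, so does `prim`. Comparing coefficients in
the decomposition of `tot` gives a system that is triangular in the index `m`, to which
`eq_of_hasSum_divisors` applies. -/
lemma prim_eq (S : QuadData F) (R : X → X → Prop)
    (hR : ∀ x y A, R x y → R (H.act x A) (H.act y A))
    (hc : ∀ x y, R x y → ∀ φ, H.tot x φ = H.tot y φ) {x y : X} (hxy : R x y) {s : ℂ}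
    (hs : 2 < s.re) :
    H.prim x (fun m => (m : ℂ) ^ (-s)) = H.prim y fun m => (m : ℂ) ^ (-s) := by
  have key := eq_of_hasSum_divisors H.act H.one (fun A => (H.al A).absNorm) (fun A => by
      rw [Ideal.absNorm_eq_one_iff, ← H.al_one]
      exact H.al_injective.eq_iff) H.act_one
    (g := fun x m => H.prim x fun k => if k = m then 1 else 0)
    (c := fun x m => H.tot x fun k => if k = m then 1 else 0) (fun x m hm => by
      refine hasSum_of_eq (H.hasSum_prim_aux x (φ := fun k => if k = m then 1 else 0)
        (summable_indicator S _ (H.ideal_ne_bot x) hm)) (fun A => ?_) rfl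
      have hA := H.al_absNorm_ne_zero A
      split_ifs with hd
      · refine tsum_congr fun K => ?_
        beta_reduce
        congr 1
        rw [eq_iff_iff, Nat.eq_div_iff_mul_eq_left hA hd, eq_comm]
      · rw [prim]
        symm
        convert tsum_zero with K
        rw [if_neg]
        rintro rfl
        exact hd (dvd_mul_left _ _)) R hR (fun x y m _ h => hc x y h _)
  have hL : ∀ x, LSeriesHasSum (fun m => H.prim x fun k => if k = m then 1 else 0) s
      (H.prim x fun m => (m : ℂ) ^ (-s)) := fun x =>
    LSeriesHasSum_of_indicator (n := fun K : Lat (fun K => hull K = H.ideal x ∧ H.P x K)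
      (toLattice (H.ideal x)) => K.1.relIndex (toLattice (H.ideal x))) (fun K => K.2.1.2)
      (summable_cpow S _ (H.ideal_ne_bot x) hs)
      (fun m hm => summable_indicator S _ (H.ideal_ne_bot x) hm)
  rw [← (hL x).LSeries_eq, ← (hL y).LSeries_eq]
  exact LSeries_congr (fun {m} hm => key m hm x y hxy) s

end HullSystem

end System

/-! ### All lattices -/

namespace QuadData

variable {F : Type*} [Field F] [NumberField F] (S : QuadData F)

/-- The nonzero ideals. -/
abbrev NzIdeal (F : Type*) [Field F] [NumberField F] := {J : Ideal (𝓞 F) // J ≠ ⊥}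

/-- The system of all lattices in all ideals. -/
def allSystem : HullSystem F (NzIdeal F) (NzIdeal F) where
  ideal J := J.1
  P _ _ := True
  al A := A.1
  act J A := ⟨J.1 * A.1, mul_ne_zero J.2 A.2⟩
  one := ⟨⊤, top_ne_bot⟩
  ideal_ne_bot J := J.2
  ideal_act _ _ := rfl
  P_act _ _ := rfl
  al_injective := Subtype.val_injective
  al_ne_bot A := A.2
  al_one := rfl
  act_one J := Subtype.ext (Ideal.mul_top J.1)
  exists_hull J K hK hi _ := by
    obtain ⟨A, hA⟩ := Ideal.dvd_iff_le.2 (hull_le hK)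
    refine ⟨⟨A, ?_⟩, hA⟩
    rintro rfl
    exact S.hull_ne_bot J.2 hK hi (by rw [hA, Ideal.mul_bot])

lemma tot_allSystem (J : NzIdeal F) (φ : ℕ → ℂ) : S.allSystem.tot J φ =
    ∑' K : {K : AddSubgroup (Fin 2 → ℤ) // K.index ≠ 0 ∧ True}, φ K.1.index := by
  obtain ⟨b, hb⟩ := S.exists_basis_toLattice J.2
  change ∑' K : Lat (fun _ => True) (toLattice J.1), φ (K.1.relIndex (toLattice J.1)) = _
  rw [hb, ← (latEquiv b (P' := fun _ => True) fun _ => Iff.rfl).tsum_eq]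
  exact tsum_congr fun K => by rw [relIndex_latEquiv]

lemma tot_allSystem_cpow (J : NzIdeal F) {s : ℂ} :
    S.allSystem.tot J (fun m => (m : ℂ) ^ (-s)) = zetaZ2 s := by
  rw [S.tot_allSystem, zetaZ2]
  exact (Equiv.subtypeEquivRight (q := fun K : AddSubgroup (Fin 2 → ℤ) => K.index ≠ 0)
    fun K => by simp).tsum_eq fun K => (K.1.index : ℂ) ^ (-s)

/-- The Dirichlet series of the indices of the lattices that generate the unit ideal. -/
def primSum (s : ℂ) : ℂ :=
  S.allSystem.prim ⟨⊤, top_ne_bot⟩ fun m => (m : ℂ) ^ (-s)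

/-- Every nonzero ideal is isomorphic to `ℤ²`, so all totals agree and `prim_eq` applies with the
trivial relation. -/
lemma prim_allSystem (J : NzIdeal F) {s : ℂ} (hs : 2 < s.re) :
    S.allSystem.prim J (fun m => (m : ℂ) ^ (-s)) = S.primSum s :=
  S.allSystem.prim_eq S (fun _ _ => True) (fun _ _ _ _ => trivial)
    (fun J J' _ φ => by rw [S.tot_allSystem, S.tot_allSystem]) trivial hs

/-- Otherwise the decomposition of `ζ_{ℤ²}(s)` would consist of zeros. -/
lemma primSum_ne_zero {s : ℂ} (hs : 2 < s.re) : S.primSum s ≠ 0 := by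
  intro h
  have h1 := S.allSystem.hasSum_prim S ⟨⊤, top_ne_bot⟩ hs
  simp only [S.prim_allSystem _ hs, h, mul_zero] at h1
  rw [S.tot_allSystem_cpow] at h1
  exact zetaZ2_ne_zero hs (h1.unique hasSum_zero)

/-- The terms `N(A)^{-s}` times the nonzero constant `primSum s` are summable, which yields the
convergence of `ζ_F` with no further input. -/
lemma summable_absNorm (S : QuadData F) {s : ℂ} (hs : 2 < s.re) :
    Summable fun A : NzIdeal F => (A.1.absNorm : ℂ) ^ (-s) := by
  have h1 := (S.allSystem.hasSum_prim S ⟨⊤, top_ne_bot⟩ hs).summable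
  simp only [S.prim_allSystem _ hs] at h1
  exact (summable_mul_right_iff (S.primSum_ne_zero hs)).1 h1

lemma hasSum_dedekindZeta (S : QuadData F) {s : ℂ} (hs : 2 < s.re) :
    HasSum (fun A : NzIdeal F => (A.1.absNorm : ℂ) ^ (-s)) (NumberField.dedekindZeta F s) := by
  have h := hasSum_fiberwise_term (n := fun A : NzIdeal F => A.1.absNorm)
    (fun A => absNorm_ne_zero A.2) (f := fun _ => 1) (s := s)
    (by simpa using S.summable_absNorm hs)
    (A := fun m => (Nat.card {I : Ideal (𝓞 F) // I.absNorm = m} : ℂ)) (fun m hm => by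
      have hfin : Finite {I : Ideal (𝓞 F) // I.absNorm = m} :=
        (Ideal.finite_setOfPred_absNorm_eq m).to_subtype
      let e : {A : NzIdeal F // A.1.absNorm = m} ≃ {I : Ideal (𝓞 F) // I.absNorm = m} :=
        { toFun := fun A => ⟨A.1.1, A.2⟩
          invFun := fun I => ⟨⟨I.1, by
            rintro h
            have := I.2
            rw [h, Ideal.absNorm_bot] at this
            exact hm this.symm⟩, I.2⟩
          left_inv := fun _ => rfl
          right_inv := fun _ => rfl }
      have : Fintype {I : Ideal (𝓞 F) // I.absNorm = m} := Fintype.ofFinite _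
      refine (e.symm.hasSum_iff).1 ?_
      refine hasSum_of_eq (hasSum_fintype_complex fun _ : {I : Ideal (𝓞 F) // I.absNorm = m} => 1)
        (fun _ => rfl) ?_
      rw [Nat.card_eq_fintype_card]
      simp)
  simp only [mul_one] at h
  rw [NumberField.dedekindZeta, h.LSeries_eq]
  exact (S.summable_absNorm hs).hasSum

lemma dedekindZeta_mul_primSum {s : ℂ} (hs : 2 < s.re) :
    NumberField.dedekindZeta F s * S.primSum s = zetaZ2 s := by
  have h1 := S.allSystem.hasSum_prim S ⟨⊤, top_ne_bot⟩ hs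
  simp only [S.prim_allSystem _ hs] at h1
  rw [S.tot_allSystem_cpow] at h1
  exact ((S.hasSum_dedekindZeta hs).mul_right _).unique h1

lemma primSum_eq {s : ℂ} (hs : 2 < s.re) :
    S.primSum s = zetaZ2 s / NumberField.dedekindZeta F s := by
  rw [← S.dedekindZeta_mul_primSum hs, mul_div_cancel_left₀]
  intro h
  apply zetaZ2_ne_zero hs
  rw [← S.dedekindZeta_mul_primSum hs, h, zero_mul]

end QuadData

end SubformZeta

end


/-! ### Invariant lattices generating a given ideal -/

open scoped NumberField nonZeroDivisors

noncomputable section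

namespace SubformZeta

open Module

namespace QuadData

variable {F : Type*} [Field F] [NumberField F] (S : QuadData F)

/-- An ideal together with a reflection that maps it to itself. -/
abbrev ReflPair := {x : Ideal (𝓞 F) × F // x.1 ≠ ⊥ ∧ x.2 ∈ S.reflSet x.1}

/-- The system of all lattices that are invariant under a reflection. -/
def reflSystem : HullSystem F S.ReflPair S.Amb where
  ideal x := x.1.1
  P x K := K.map (S.reflHom x.1.2) = K
  al A := A.1
  act x A := ⟨(x.1.1 * A.1, x.1.2), mul_ne_zero x.2.1 A.2.1, S.mem_reflSet_mul x.2.2 A.2.2⟩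
  one := ⟨⊤, top_ne_bot, by
    have := S.cj_span_natCast 1
    rwa [Nat.cast_one, Ideal.span_singleton_one] at this⟩
  ideal_ne_bot x := x.2.1
  ideal_act _ _ := rfl
  P_act _ _ := rfl
  al_injective := Subtype.val_injective
  al_ne_bot A := A.2.1
  al_one := rfl
  act_one x := Subtype.ext (Prod.ext (Ideal.mul_top x.1.1) rfl)
  exists_hull x K hK hi hP := by
    obtain ⟨A, hA⟩ := Ideal.dvd_iff_le.2 (hull_le hK)
    have h0 : A ≠ ⊥ := by
      rintro rfl
      exact S.hull_ne_bot x.2.1 hK hi (by rw [hA, Ideal.mul_bot])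
    refine ⟨⟨A, h0, S.cj_eq_of_mem_reflSet_mul x.2.1 x.2.2 ⟨x.2.2.1, ?_⟩⟩, hA⟩
    rw [← hA]
    exact S.map_reflHom_hull hK x.2.2.1 hP

/-- The type of an ideal with a reflection. -/
def IsRect (x : S.ReflPair) : Prop := S.Rect x.1.2 (toLattice x.1.1)

lemma tot_reflSystem (x : S.ReflPair) : ∃ ε : ℤ, (ε = 0 ∨ ε = 1) ∧ (ε = 0 ↔ S.IsRect x) ∧
    ∀ φ : ℕ → ℂ, S.reflSystem.tot x φ =
      ∑' K : {K : AddSubgroup (Fin 2 → ℤ) // K.index ≠ 0 ∧ K.map (shear ε) = K},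
        φ K.1.index := by
  obtain ⟨ε, b, hb, h0, h1, hε, hR⟩ := S.exists_basis_of_mem_reflSet x.2.1 x.2.2
  refine ⟨ε, hε, hR, fun φ => ?_⟩
  change ∑' K : Lat (fun K => K.map (S.reflHom x.1.2) = K) (toLattice x.1.1),
    φ (K.1.relIndex (toLattice x.1.1)) = _
  rw [hb, ← (latEquiv b (P' := fun K => K.map (shear ε) = K)
    (map_eq_iff_of_shear b h0 h1)).tsum_eq]
  exact tsum_congr fun K => by rw [relIndex_latEquiv]

lemma tot_reflSystem_congr {x y : S.ReflPair} (h : S.IsRect x ↔ S.IsRect y) (φ : ℕ → ℂ) :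
    S.reflSystem.tot x φ = S.reflSystem.tot y φ := by
  obtain ⟨ε, hε, hεx, h1⟩ := S.tot_reflSystem x
  obtain ⟨ε', hε', hεy, h2⟩ := S.tot_reflSystem y
  have : ε = ε' := by
    rcases hε with rfl | rfl <;> rcases hε' with rfl | rfl <;> simp_all
  rw [h1, h2, this]

lemma tot_reflSystem_cpow (x : S.ReflPair) {s : ℂ} (hs : 2 < s.re) [Decidable (S.IsRect x)] :
    S.reflSystem.tot x (fun m => (m : ℂ) ^ (-s)) =
      (if S.IsRect x then 1 + 2 ^ (-s) else 1 - 2 ^ (-s) + 2 * 2 ^ (-2 * s)) *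
        riemannZeta s ^ 2 := by
  obtain ⟨ε, hε, hεx, h1⟩ := S.tot_reflSystem x
  rw [h1]
  rcases hε with rfl | rfl
  · rw [if_pos (hεx.1 rfl)]
    exact (hasSum_index_shear_zero (by linarith)).tsum_eq
  · rw [if_neg fun h => one_ne_zero (hεx.2 h)]
    exact (hasSum_index_shear_one (by linarith)).tsum_eq

/-- For `d ≡ 1` and `d ≡ 2` modulo 4 only one type exists; for `d ≡ 3` the change of type depends on
`A` alone. This is the compatibility needed in `prim_eq`. -/
lemma isRect_act_congr {x y : S.ReflPair} (h : S.IsRect x ↔ S.IsRect y) (A : S.Amb) :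
    S.IsRect (S.reflSystem.act x A) ↔ S.IsRect (S.reflSystem.act y A) := by
  have hx := (S.reflSystem.act x A).2
  have hy := (S.reflSystem.act y A).2
  have hd4 := S.d_not_four_dvd
  have h4 : S.d % 4 = 1 ∨ S.d % 4 = 2 ∨ S.d % 4 = 3 := by omega
  rcases h4 with h4 | h4 | h4
  · exact iff_of_false (S.not_rect_of_emod_eq_one hx.2.1 hx.1 hx.2.2 h4)
      (S.not_rect_of_emod_eq_one hy.2.1 hy.1 hy.2.2 h4)
  · exact iff_of_true (S.rect_of_emod_eq_two hx.2.1 hx.1 hx.2.2 h4)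
      (S.rect_of_emod_eq_two hy.2.1 hy.1 hy.2.2 h4)
  · have h1 := S.rect_mul_iff_of_emod_eq_three x.2.2.1 x.2.1 x.2.2.2 h4 A.2.1 A.2.2
    have h2 := S.rect_mul_iff_of_emod_eq_three y.2.2.1 y.2.1 y.2.2.2 h4 A.2.1 A.2.2
    exact h1.trans ((iff_congr h Iff.rfl).trans h2.symm)

/-- The Dirichlet series of the indices of the invariant lattices that generate a given ideal. -/
def reflPrim (x : S.ReflPair) (s : ℂ) : ℂ := S.reflSystem.prim x fun m => (m : ℂ) ^ (-s)

lemma reflPrim_congr {x y : S.ReflPair} (h : S.IsRect x ↔ S.IsRect y) {s : ℂ} (hs : 2 < s.re) :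
    S.reflPrim x s = S.reflPrim y s :=
  S.reflSystem.prim_eq S (fun x y => S.IsRect x ↔ S.IsRect y)
    (fun _ _ A h => S.isRect_act_congr h A) (fun _ _ h φ => S.tot_reflSystem_congr h φ) h hs

lemma hasSum_reflPrim (x : S.ReflPair) {s : ℂ} (hs : 2 < s.re) :
    HasSum (fun A : S.Amb => (A.1.absNorm : ℂ) ^ (-s) * S.reflPrim (S.reflSystem.act x A) s)
      (S.reflSystem.tot x fun m => (m : ℂ) ^ (-s)) := S.reflSystem.hasSum_prim S x hs

lemma norm_cpow_lt_one {r : ℕ} (hr : 1 < r) {s : ℂ} (hs : 0 < s.re) :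
    ‖(r : ℂ) ^ (-s)‖ < 1 := by
  rw [Complex.norm_natCast_cpow_of_pos (by omega)]
  exact Real.rpow_lt_one_of_one_lt_of_neg (by exact_mod_cast hr) (by simpa using hs)

lemma one_add_cpow_ne_zero {r : ℕ} (hr : 1 < r) {s : ℂ} (hs : 0 < s.re) :
    1 + (r : ℂ) ^ (-s) ≠ 0 := by
  intro h
  have h1 := norm_cpow_lt_one hr hs
  rw [eq_neg_of_add_eq_zero_right h] at h1
  simp at h1

lemma one_sub_cpow_ne_zero {r : ℕ} (hr : 1 < r) {s : ℂ} (hs : 0 < s.re) :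
    1 - (r : ℂ) ^ (-s) ≠ 0 := by
  intro h
  have h1 := norm_cpow_lt_one hr hs
  rw [← sub_eq_zero.1 h] at h1
  simp at h1

lemma ramifiedProduct_ne_zero (F : Type*) [Field F] [NumberField F] {s : ℂ} (hs : 0 < s.re) :
    ramifiedProduct F s ≠ 0 :=
  Finset.prod_ne_zero_iff.2 fun _ hr =>
    one_add_cpow_ne_zero (mem_ramifiedPrimes.1 hr).1.one_lt hs

lemma zeta_two_mul_ne_zero {s : ℂ} (hs : 2 < s.re) : riemannZeta (2 * s) ≠ 0 :=
  riemannZeta_ne_zero_of_one_lt_re (by simp; linarith)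

lemma hasSum_amb {s : ℂ} (hs : 2 < s.re) :
    HasSum (fun A : S.Amb => (A.1.absNorm : ℂ) ^ (-s))
      (riemannZeta (2 * s) * ramifiedProduct F s) := by
  have h := S.hasSum_amb_aux (s := s) (by simp; linarith) (fun _ => 1) (fun _ => 1) fun _ => rfl
  refine hasSum_of_eq h (fun A => (mul_one _).symm) ?_
  rw [ramifiedProduct, Finset.prod_one_add]
  simp

/-- All terms have the common factor `reflPrim x s`, and `∑ N(A)^{-s} = ζ(2s) P(s)`. -/
lemma reflPrim_eq_of_const (x : S.ReflPair) {s : ℂ} (hs : 2 < s.re)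
    (h : ∀ A, S.IsRect (S.reflSystem.act x A) ↔ S.IsRect x) :
    S.reflPrim x s = S.reflSystem.tot x (fun m => (m : ℂ) ^ (-s)) /
      (riemannZeta (2 * s) * ramifiedProduct F s) := by
  have h1 := S.hasSum_reflPrim x hs
  simp only [S.reflPrim_congr (h _) hs] at h1
  rw [h1.unique ((S.hasSum_amb hs).mul_right _), mul_div_cancel_left₀]
  exact mul_ne_zero (zeta_two_mul_ne_zero hs) (ramifiedProduct_ne_zero F (by linarith))

lemma reflPrim_of_emod_eq_one (hd : S.d % 4 = 1) (x : S.ReflPair) {s : ℂ} (hs : 2 < s.re) :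
    S.reflPrim x s = (1 - 2 ^ (-s) + 2 * 2 ^ (-2 * s)) * riemannZeta s ^ 2 /
      (riemannZeta (2 * s) * ramifiedProduct F s) := by
  classical
  have h : ∀ y : S.ReflPair, ¬ S.IsRect y := fun y =>
    S.not_rect_of_emod_eq_one y.2.2.1 y.2.1 y.2.2.2 hd
  rw [S.reflPrim_eq_of_const x hs fun A => iff_of_false (h _) (h _), S.tot_reflSystem_cpow x hs,
    if_neg (h x)]

lemma reflPrim_of_emod_eq_two (hd : S.d % 4 = 2) (x : S.ReflPair) {s : ℂ} (hs : 2 < s.re) :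
    S.reflPrim x s = (1 + 2 ^ (-s)) * riemannZeta s ^ 2 /
      (riemannZeta (2 * s) * ramifiedProduct F s) := by
  classical
  have h : ∀ y : S.ReflPair, S.IsRect y := fun y =>
    S.rect_of_emod_eq_two y.2.2.1 y.2.1 y.2.2.2 hd
  rw [S.reflPrim_eq_of_const x hs fun A => iff_of_true (h _) (h _), S.tot_reflSystem_cpow x hs,
    if_pos (h x)]

lemma two_mem_ramifiedPrimes (hd : S.d % 4 = 3) : 2 ∈ ramifiedPrimes F := by
  rw [mem_ramifiedPrimes, S.discr_eq, if_neg (by omega)]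
  exact ⟨Nat.prime_two, by push_cast; omega⟩

/-- The product over the odd ramified primes. -/
def oddRamifiedProduct (F : Type*) [Field F] [NumberField F] (s : ℂ) : ℂ :=
  ∏ r ∈ (ramifiedPrimes F).erase 2, (1 + (r : ℂ) ^ (-s))

lemma ramifiedProduct_eq (hd : S.d % 4 = 3) (s : ℂ) :
    ramifiedProduct F s = (1 + 2 ^ (-s)) * oddRamifiedProduct F s := by
  rw [ramifiedProduct, oddRamifiedProduct, ← Finset.mul_prod_erase _ _
    (S.two_mem_ramifiedPrimes hd)]
  simp

/-- The parity records whether `γ_2` occurs in `(q) ∏ γ_r`, so the factor `1 + 2^{-s}` of `P(s)`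
turns into `α + 2^{-s} β`. -/
lemma hasSum_amb_parity (hd : S.d % 4 = 3) {s : ℂ} (hs : 2 < s.re) (α β : ℂ)
    [∀ A : S.Amb, Decidable (Even (A.1.absNorm.factorization 2))] :
    HasSum (fun A : S.Amb => (A.1.absNorm : ℂ) ^ (-s) *
      if Even (A.1.absNorm.factorization 2) then α else β)
      (riemannZeta (2 * s) * oddRamifiedProduct F s * (α + 2 ^ (-s) * β)) := by
  have h := S.hasSum_amb_aux (s := s) (by simp; linarith) (fun T => if 2 ∈ T then β else α)
    (fun A => if Even (A.1.absNorm.factorization 2) then α else β) fun t => by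
      have h1 := S.even_factorization_absNorm_amb t.1.ne_zero (Finset.mem_powerset.1 t.2.2)
      rw [← S.ambEquiv_apply] at h1
      by_cases h2 : 2 ∈ t.2.1
      · rw [if_pos h2, if_neg fun h3 => h1.1 h3 h2]
      · rw [if_neg h2, if_pos (h1.2 h2)]
  refine hasSum_of_eq h (fun A => rfl) ?_
  rw [mul_assoc]
  congr 1
  have h2 := S.two_mem_ramifiedPrimes hd
  conv_rhs => rw [← Finset.insert_erase h2]
  rw [Finset.sum_powerset_insert (Finset.notMem_erase _ _), oddRamifiedProduct,
    Finset.prod_one_add, mul_add, Finset.sum_mul, Finset.sum_mul]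
  congr 1
  · refine Finset.sum_congr rfl fun T hT => ?_
    rw [if_neg fun h => Finset.notMem_erase 2 _ (Finset.mem_powerset.1 hT h)]
  · refine Finset.sum_congr rfl fun T hT => ?_
    rw [if_pos (Finset.mem_insert_self _ _), Finset.prod_insert
      fun h => Finset.notMem_erase 2 _ (Finset.mem_powerset.1 hT h)]
    push_cast
    ring

lemma exists_amb_odd (hd : S.d % 4 = 3) : ∃ A : S.Amb, ¬ Even (A.1.absNorm.factorization 2) := by
  have h2 := S.two_mem_ramifiedPrimes hd
  refine ⟨⟨gam 2, mem_nonZeroDivisors_iff_ne_zero.1 (S.gam_mem h2), S.cj_gam h2⟩, ?_⟩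
  rw [S.absNorm_gam h2, Nat.prime_two.factorization]
  simp

/-- Multiplying by an ideal whose norm has an odd power of 2 gives a pair `y` of the other type. The
decompositions of the totals of `x` and `y` are two linear equations in the two unknown series. -/
lemma reflPrim_of_emod_eq_three (hd : S.d % 4 = 3) (x : S.ReflPair) {s : ℂ} (hs : 2 < s.re)
    [Decidable (S.IsRect x)] :
    S.reflPrim x s = (if S.IsRect x then 1 + 2 ^ (-s) + 2 * 2 ^ (-2 * s) else 1 - 2 ^ (-s)) *
      riemannZeta s ^ 2 / (riemannZeta (2 * s) * ramifiedProduct F s) := by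
  classical
  obtain ⟨A₀, hA₀⟩ := S.exists_amb_odd hd
  set y := S.reflSystem.act x A₀ with hy
  have hact : ∀ (z : S.ReflPair) (A : S.Amb), S.IsRect (S.reflSystem.act z A) ↔
      (S.IsRect z ↔ Even (A.1.absNorm.factorization 2)) := fun z A =>
    S.rect_mul_iff_of_emod_eq_three z.2.2.1 z.2.1 z.2.2.2 hd A.2.1 A.2.2
  have hyx : S.IsRect y ↔ ¬ S.IsRect x := by
    rw [hy, hact]
    tauto
  have e1 : ∀ A : S.Amb, S.reflPrim (S.reflSystem.act x A) s =
      if Even (A.1.absNorm.factorization 2) then S.reflPrim x s else S.reflPrim y s := by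
    intro A
    split_ifs with h
    · exact S.reflPrim_congr (by rw [hact]; tauto) hs
    · exact S.reflPrim_congr (by rw [hact, hyx]; tauto) hs
  have e2 : ∀ A : S.Amb, S.reflPrim (S.reflSystem.act y A) s =
      if Even (A.1.absNorm.factorization 2) then S.reflPrim y s else S.reflPrim x s := by
    intro A
    split_ifs with h
    · exact S.reflPrim_congr (by rw [hact]; tauto) hs
    · exact S.reflPrim_congr (by rw [hact, hyx]; tauto) hs
  have h1 := S.hasSum_reflPrim x hs
  have h2 := S.hasSum_reflPrim y hs
  simp only [e1] at h1
  simp only [e2] at h2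
  have h1 := (S.hasSum_amb_parity hd hs _ _).unique h1
  have h2 := (S.hasSum_amb_parity hd hs _ _).unique h2
  rw [S.tot_reflSystem_cpow _ hs] at h1 h2
  rw [S.ramifiedProduct_eq hd]
  have n1 := zeta_two_mul_ne_zero hs
  have n2 : oddRamifiedProduct F s ≠ 0 := Finset.prod_ne_zero_iff.2 fun r hr =>
    one_add_cpow_ne_zero (mem_ramifiedPrimes.1 (Finset.mem_of_mem_erase hr)).1.one_lt
      (by linarith)
  have n3 : (1 : ℂ) + 2 ^ (-s) ≠ 0 := by
    exact_mod_cast one_add_cpow_ne_zero (r := 2) one_lt_two (s := s) (by linarith)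
  have n4 : (1 : ℂ) - 2 ^ (-s) ≠ 0 := by
    exact_mod_cast one_sub_cpow_ne_zero (r := 2) one_lt_two (s := s) (by linarith)
  have hX : (2 : ℂ) ^ (-2 * s) = 2 ^ (-s) * 2 ^ (-s) := by
    rw [← Complex.cpow_add _ _ two_ne_zero]
    congr 1
    ring
  rw [hX] at h1 h2 ⊢
  set X : ℂ := 2 ^ (-s)
  set D := riemannZeta (2 * s) * oddRamifiedProduct F s with hD
  have hD0 : D ≠ 0 := mul_ne_zero n1 n2
  rw [show riemannZeta (2 * s) * ((1 + X) * oddRamifiedProduct F s) = D * (1 + X) by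
    rw [hD]; ring, eq_div_iff (mul_ne_zero hD0 n3)]
  -- Eliminating `reflPrim y s` leaves the determinant `1 - X²`. Its factor `1 + X` is the part of
  -- `P(s)` at 2, and `1 - X` is cancelled here.
  apply mul_left_cancel₀ n4
  by_cases h : S.IsRect x
  · rw [if_pos h] at h1 ⊢
    rw [if_neg fun h' => hyx.1 h' h] at h2
    linear_combination h1 - X * h2
  · rw [if_neg h] at h1 ⊢
    rw [if_pos (hyx.2 h)] at h2
    linear_combination h1 - X * h2

end QuadData

end SubformZeta

end


/-! ### Counting embeddings by ideal classes -/

open scoped NumberField nonZeroDivisors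

noncomputable section

namespace SubformZeta

open Module

namespace QuadData

variable {F : Type*} [Field F] [NumberField F] (S : QuadData F)

/-! ### Finiteness -/

/-- The norm form is positive definite, so `m² - dn² = 4N` bounds the doubled coordinates `m` and
`n`. -/
lemma finite_norm_eq (S : QuadData F) (N : ℚ) :
    {z : F | IsIntegral ℤ z ∧ Algebra.norm ℚ z = N}.Finite := by
  set B : ℤ := ⌈4 * N⌉
  refine ((Set.finite_Icc (-B) B).prod (Set.finite_Icc (-B) B)).image
    (fun p : ℤ × ℤ => (p.1 : F) / 2 + p.2 / 2 * S.θ) |>.subset ?_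
  rintro z ⟨hz, hN⟩
  obtain ⟨p, q, rfl⟩ := S.exists_coord z
  obtain ⟨m, n, hm, hn, -⟩ := S.exists_int_eq_two_mul hz
  rw [S.norm_coord] at hN
  have hneg : S.d ≤ -1 := by have := S.neg; omega
  have h1 : m ^ 2 - S.d * n ^ 2 ≤ B := by
    have h2 : (m : ℚ) ^ 2 - S.d * n ^ 2 ≤ B := by
      refine le_trans (le_of_eq ?_) (Int.le_ceil (4 * N))
      rw [← hm, ← hn, ← hN]
      ring
    exact_mod_cast h2
  have hn2 : n ^ 2 ≤ -S.d * n ^ 2 := by nlinarith [sq_nonneg n]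
  have hmB : m ^ 2 ≤ B := by nlinarith [sq_nonneg n]
  have hnB : n ^ 2 ≤ B := by nlinarith [sq_nonneg m]
  have key : ∀ k : ℤ, k ^ 2 ≤ B → k ∈ Set.Icc (-B) B := by
    intro k hk
    have h3 : |k| ≤ k ^ 2 := by
      rw [← sq_abs]
      nlinarith [abs_nonneg k, Int.le_self_sq |k|]
    exact abs_le.1 (h3.trans hk)
  refine ⟨(m, n), ⟨key m hmB, key n hnB⟩, ?_⟩
  have hm' : (m : F) = 2 * p := by exact_mod_cast congrArg (Rat.cast : ℚ → F) hm.symm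
  have hn' : (n : F) = 2 * q := by exact_mod_cast congrArg (Rat.cast : ℚ → F) hn.symm
  simp only [hm', hn']
  field_simp

lemma finite_U_mul_mem (I : Ideal (𝓞 F)) {x : F} (hx : x ≠ 0) :
    {u | u ∈ S.U ∧ u * x ∈ toLattice I}.Finite := by
  refine ((S.finite_norm_eq (Algebra.norm ℚ x)).preimage
    (mul_left_injective₀ hx).injOn).subset ?_
  rintro u ⟨hu, h⟩
  obtain ⟨y, -, hy⟩ := mem_toLattice.1 h
  refine ⟨?_, ?_⟩
  · beta_reduce
    rw [← hy]
    exact y.isIntegral_coe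
  · rw [map_mul, S.norm_U hu, one_mul]

lemma finite_E : S.E.Finite := by
  refine (S.finite_U_mul_mem ⊤ one_ne_zero).subset ?_
  rintro ε ⟨h1, h2⟩
  obtain ⟨y, rfl⟩ := exists_coe_eq h2
  exact ⟨h1, by rw [mul_one]; exact coe_mem_toLattice.2 trivial⟩

lemma ncard_E_ne_zero : S.E.ncard ≠ 0 := by
  exact ((Set.ncard_pos S.finite_E).2 ⟨1, S.one_mem_E⟩).ne'

lemma finite_reflSet {J : Ideal (𝓞 F)} (hJ : J ≠ ⊥) : (S.reflSet J).Finite := by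
  rcases (S.reflSet J).eq_empty_or_nonempty with h | ⟨u, hu⟩
  · rw [h]
    exact Set.finite_empty
  · rw [S.reflSet_eq_image hJ hu]
    exact S.finite_E.image _

/-! ### The numbers of embeddings and automorphisms -/

/-- The rotations that map `K` into `I`. -/
def embRot (I : Ideal (𝓞 F)) (K : AddSubgroup F) : Set F :=
  {u | u ∈ S.U ∧ K.map (rotHom u) ≤ toLattice I}

/-- The reflections that map `K` into `I`. -/
def embRefl (I : Ideal (𝓞 F)) (K : AddSubgroup F) : Set F :=
  {u | u ∈ S.U ∧ K.map (S.reflHom u) ≤ toLattice I}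

/-- The rotations that map `K` to itself. -/
def stabRot (K : AddSubgroup F) : Set F := {u | u ∈ S.U ∧ K.map (rotHom u) = K}

/-- The reflections that map `K` to itself. -/
def stabRefl (K : AddSubgroup F) : Set F := {u | u ∈ S.U ∧ K.map (S.reflHom u) = K}

lemma finite_embRot (I : Ideal (𝓞 F)) {K : AddSubgroup F} (hK : K ≠ ⊥) :
    (S.embRot I K).Finite := by
  obtain ⟨x, hx, hx0⟩ := K.bot_or_exists_ne_zero.resolve_left hK
  refine (S.finite_U_mul_mem I hx0).subset ?_
  rintro u ⟨hu, h⟩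
  exact ⟨hu, h ⟨x, hx, rfl⟩⟩

lemma finite_embRefl (I : Ideal (𝓞 F)) {K : AddSubgroup F} (hK : K ≠ ⊥) :
    (S.embRefl I K).Finite := by
  obtain ⟨x, hx, hx0⟩ := K.bot_or_exists_ne_zero.resolve_left hK
  refine (S.finite_U_mul_mem I (x := S.conj x) (by simpa using hx0)).subset ?_
  rintro u ⟨hu, h⟩
  exact ⟨hu, h ⟨x, hx, rfl⟩⟩

lemma stabRot_subset {I : Ideal (𝓞 F)} {K : AddSubgroup F} (hK : K ≤ toLattice I) :
    S.stabRot K ⊆ S.embRot I K := fun _ h => ⟨h.1, h.2.le.trans hK⟩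

lemma stabRefl_subset {I : Ideal (𝓞 F)} {K : AddSubgroup F} (hK : K ≤ toLattice I) :
    S.stabRefl K ⊆ S.embRefl I K := fun _ h => ⟨h.1, h.2.le.trans hK⟩

lemma embRot_hull {I : Ideal (𝓞 F)} {K : AddSubgroup F} (hK : K ≤ toLattice I) :
    S.embRot I (toLattice (hull K)) = S.embRot I K := by
  ext u
  exact and_congr_right fun _ => map_rotHom_le_iff_hull hK u

lemma embRefl_hull {I : Ideal (𝓞 F)} {K : AddSubgroup F} (hK : K ≤ toLattice I) :
    S.embRefl I (toLattice (hull K)) = S.embRefl I K := by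
  ext u
  exact and_congr_right fun _ => S.map_reflHom_le_iff_hull hK u

lemma embRefl_eq_embRot_cj (I J : Ideal (𝓞 F)) :
    S.embRefl I (toLattice J) = S.embRot I (toLattice (S.cj J)) := by
  ext u
  rw [embRefl, embRot, Set.mem_ofPred_eq, Set.mem_ofPred_eq, S.map_reflHom, S.toLattice_cj]

/-- `uJ` is stable under `R` because `J` is, it consists of integers because it lies in `I`, and
`N(u) = 1` keeps the norm. -/
lemma exists_ideal_of_mem_embRot {I J : Ideal (𝓞 F)} (hJ : J ≠ ⊥) {u : F}
    (hu : u ∈ S.embRot I (toLattice J)) : ∃ J' : (Ideal (𝓞 F))⁰,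
      toLattice (J' : Ideal (𝓞 F)) = (toLattice J).map (rotHom u) ∧
      (J' : Ideal (𝓞 F)).absNorm = J.absNorm := by
  obtain ⟨hu, hle⟩ := hu
  have hu0 := S.U_ne_zero hu
  have h1 : toLattice (hull ((toLattice J).map (rotHom u))) = (toLattice J).map (rotHom u) := by
    refine le_antisymm ?_ (le_toLattice_hull hle)
    intro x hx
    rw [mem_map_rotHom hu0]
    refine forall_mem_hull (g := rotHom u⁻¹) id (fun r x => by simp; ring) (fun y hy => ?_) x hx
    rw [mem_map_rotHom hu0] at hy
    exact hy
  set J' := hull ((toLattice J).map (rotHom u)) with hJ'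
  have hJ'0 : J' ≠ ⊥ := by
    rw [← toLattice_ne_bot_iff, h1]
    rw [← toLattice_ne_bot_iff] at hJ
    exact fun h => hJ ((AddSubgroup.map_eq_bot_iff_of_injective _ (rotHom_injective hu0)).1 h)
  refine ⟨⟨J', mem_nonZeroDivisors_iff_ne_zero.2 hJ'0⟩, h1, ?_⟩
  obtain ⟨x, y, hy, rfl⟩ := IsFractionRing.div_surjective (A := 𝓞 F) u
  have hy0 : y ≠ 0 := nonZeroDivisors.ne_zero hy
  have hy' : algebraMap (𝓞 F) F y ≠ 0 := by simpa using hy0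
  have h2 : Ideal.span {x} * J = Ideal.span {y} * J' := by
    apply toLattice_injective
    rw [toLattice_span_mul, toLattice_span_mul, h1, map_rotHom_map_rotHom]
    congr 2
    field_simp
  have h3 := congrArg Ideal.absNorm h2
  rw [map_mul, map_mul, Ideal.absNorm_span_singleton, Ideal.absNorm_span_singleton] at h3
  have h4 : Algebra.norm ℤ x = Algebra.norm ℤ y := by
    have h5 : ((Algebra.norm ℤ x : ℤ) : F) = (Algebra.norm ℤ y : ℤ) := by
      rw [S.intNorm_eq, S.intNorm_eq]
      have h6 : _ * _ = _ := hu
      have hcy : S.conj (algebraMap (𝓞 F) F y) ≠ 0 := by simpa using hy'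
      rw [map_div₀] at h6
      field_simp at h6
      exact h6
    exact_mod_cast h5
  rw [h4] at h3
  exact (mul_left_cancel₀ (by simpa using hy0) h3).symm

/-- The number of ideals of index `n` in `I` in a given class. -/
def classCount (I : Ideal (𝓞 F)) (n : ℕ) (g : ClassGroup (𝓞 F)) : ℕ :=
  {J | J ∈ idealsOfIndex I n ∧ ClassGroup.mk0 J = g}.ncard

lemma mem_idealsOfIndex {I : Ideal (𝓞 F)} (hI : I ≠ ⊥) {n : ℕ} {J : (Ideal (𝓞 F))⁰} :
    J ∈ idealsOfIndex I n ↔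
      (J : Ideal (𝓞 F)) ≤ I ∧ (J : Ideal (𝓞 F)).absNorm = n * I.absNorm := by
  refine and_congr_right fun h => ?_
  have h1 := relIndex_mul_absNorm h
  rw [relIndex_toLattice] at h1
  rw [← h1]
  exact ⟨fun h => by rw [h], fun h => Nat.eq_of_mul_eq_mul_right
    (Nat.pos_of_ne_zero (absNorm_ne_zero hI)) h⟩

lemma finite_idealsOfIndex {I : Ideal (𝓞 F)} (hI : I ≠ ⊥) (n : ℕ) :
    (idealsOfIndex I n).Finite := by
  refine ((Ideal.finite_setOfPred_absNorm_eq (S := 𝓞 F) (n * I.absNorm)).preimage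
    Subtype.val_injective.injOn).subset ?_
  intro J hJ
  exact ((mem_idealsOfIndex hI).1 hJ).2

/-- `u ↦ uJ` maps onto the ideals in `I` with the norm and the class of `J`, and `uJ = vJ` exactly
when `v / u` is an integral element of norm one. -/
lemma ncard_embRot {I : Ideal (𝓞 F)} (hI : I ≠ ⊥) {n : ℕ} (J : (Ideal (𝓞 F))⁰)
    (hN : (J : Ideal (𝓞 F)).absNorm = n * I.absNorm) :
    (S.embRot I (toLattice (J : Ideal (𝓞 F)))).ncard =
      classCount I n (ClassGroup.mk0 J) * S.E.ncard := by
  have hJ := coe_ne_bot J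
  rw [ncard_eq_ncard_image_mul (S.finite_embRot I (toLattice_ne_bot_iff.2 hJ))
    (fun u => (toLattice (J : Ideal (𝓞 F))).map (rotHom u)) (c := S.E.ncard)]
  · congr 1
    rw [classCount, ← Set.ncard_image_of_injective _ (f := fun J : (Ideal (𝓞 F))⁰ =>
      toLattice (J : Ideal (𝓞 F))) (toLattice_injective.comp Subtype.val_injective)]
    congr 1
    ext K
    constructor
    · rintro ⟨u, hu, rfl⟩
      obtain ⟨J', h1, h2⟩ := S.exists_ideal_of_mem_embRot hJ hu
      refine ⟨J', ⟨(mem_idealsOfIndex hI).2 ⟨?_, ?_⟩, ?_⟩, h1⟩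
      · rw [← toLattice_le_iff]
        exact h1.le.trans hu.2
      · exact h2.trans hN
      · symm
        rw [S.mk0_eq_mk0_iff_exists_U h2.symm]
        exact ⟨u, hu.1, h1.symm⟩
    · rintro ⟨J', ⟨h1, h2⟩, rfl⟩
      rw [mem_idealsOfIndex hI] at h1
      obtain ⟨u, hu, h3⟩ := (S.mk0_eq_mk0_iff_exists_U (hN.trans h1.2.symm)).1 h2.symm
      exact ⟨u, ⟨hu, h3.le.trans (toLattice_le_iff.2 h1.1)⟩, h3⟩
  · intro u hu
    have hu0 := S.U_ne_zero hu.1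
    rw [← Set.ncard_image_of_injective S.E (mul_left_injective₀ hu0)]
    congr 1
    ext v
    constructor
    · rintro ⟨hv, h⟩
      refine ⟨v * u⁻¹, ?_, by field_simp⟩
      rw [← S.map_rotHom_eq_iff_mem_E hJ (S.mul_mem_U hv.1 (S.inv_mem_U hu.1)), mul_comm,
        ← map_rotHom_map_rotHom, h, map_rotHom_map_rotHom, inv_mul_cancel₀ hu0, map_rotHom_one]
    · rintro ⟨ε, hε, rfl⟩
      have h : (toLattice (J : Ideal (𝓞 F))).map (rotHom (ε * u)) =
          (toLattice (J : Ideal (𝓞 F))).map (rotHom u) := by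
        rw [mul_comm, ← map_rotHom_map_rotHom, (S.map_rotHom_eq_iff_mem_E hJ hε.1).2 hε]
      exact ⟨⟨S.mul_mem_U hε.1 hu.1, by rw [h]; exact hu.2⟩, h⟩

/-- A reflection maps `J` to `u J̄`, so this is the count of rotations for `J̄`, whose class is
`[J]⁻¹`. -/
lemma ncard_embRefl {I : Ideal (𝓞 F)} (hI : I ≠ ⊥) {n : ℕ} (J : (Ideal (𝓞 F))⁰)
    (hN : (J : Ideal (𝓞 F)).absNorm = n * I.absNorm) :
    (S.embRefl I (toLattice (J : Ideal (𝓞 F)))).ncard =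
      classCount I n (ClassGroup.mk0 J)⁻¹ * S.E.ncard := by
  rw [S.embRefl_eq_embRot_cj, ← S.mk0_eq_inv (J' := ⟨S.cj J, S.cj_mem J⟩) rfl]
  exact S.ncard_embRot hI ⟨S.cj J, S.cj_mem J⟩ (by exact (S.absNorm_cj _).trans hN)

/-! ### Sums over ideals and ideal classes -/

lemma classCount_ne_zero_iff {I : Ideal (𝓞 F)} (hI : I ≠ ⊥) {n : ℕ} {g : ClassGroup (𝓞 F)} :
    classCount I n g ≠ 0 ↔ g ∈ classes I n := by
  rw [classCount, ← Nat.pos_iff_ne_zero, Set.ncard_pos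
    ((finite_idealsOfIndex hI n).subset fun _ h => h.1)]
  rfl

/-- The nonzero ideals contained in `I`. -/
abbrev SubIdeal {F : Type*} [Field F] (I : Ideal (𝓞 F)) := {J : (Ideal (𝓞 F))⁰ // (J : Ideal (𝓞 F)) ≤ I}

/-- The index of an ideal in `I`. -/
def SubIdeal.idx {F : Type*} [Field F] {I : Ideal (𝓞 F)} (J : SubIdeal I) : ℕ :=
  (toLattice (J.1 : Ideal (𝓞 F))).relIndex (toLattice I)

lemma SubIdeal.idx_ne_zero {I : Ideal (𝓞 F)} (J : SubIdeal I) : J.idx ≠ 0 :=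
  relIndex_toLattice_ne_zero (coe_ne_bot J.1) J.2

lemma SubIdeal.absNorm_eq {I : Ideal (𝓞 F)} (J : SubIdeal I) :
    (J.1 : Ideal (𝓞 F)).absNorm = J.idx * I.absNorm := (relIndex_mul_absNorm J.2).symm

lemma SubIdeal.mem_idealsOfIndex {F : Type*} [Field F] {I : Ideal (𝓞 F)} (J : SubIdeal I) :
    J.1 ∈ idealsOfIndex I J.idx := ⟨J.2, (relIndex_toLattice _ _).symm⟩

lemma summable_idx (S : QuadData F) {I : Ideal (𝓞 F)} (hI : I ≠ ⊥) {s : ℂ} (hs : 2 < s.re) :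
    Summable fun J : SubIdeal I => (J.idx : ℂ) ^ (-s) := by
  let i : SubIdeal I → Lat (fun _ => True) (toLattice I) := fun J =>
    ⟨toLattice (J.1 : Ideal (𝓞 F)), ⟨toLattice_le_iff.2 J.2, J.idx_ne_zero⟩, trivial⟩
  have hi : Function.Injective i := fun J J' h =>
    Subtype.ext (Subtype.ext (toLattice_injective (congrArg (fun t => t.1) h)))
  have h := (HullSystem.summable_cpow S (fun _ => True) hI hs).comp_injective hi
  exact h

/-- A class contains `classCount` ideals of the given index, so division by this number makes the
sum over ideals count each class once. -/
lemma LSeriesHasSum_classSum (S : QuadData F) {I : Ideal (𝓞 F)} (hI : I ≠ ⊥) {s : ℂ}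
    (hs : 2 < s.re) {h : ℕ → ClassGroup (𝓞 F) → ℂ} {C : ℝ} (hC : ∀ m g, ‖h m g‖ ≤ C) :
    LSeriesHasSum (fun m => ∑ g ∈ (classes I m).toFinite.toFinset, h m g) s
      (∑' J : SubIdeal I, (J.idx : ℂ) ^ (-s) *
        (h J.idx (ClassGroup.mk0 J.1) / classCount I J.idx (ClassGroup.mk0 J.1))) := by
  classical
  refine hasSum_fiberwise_term SubIdeal.idx_ne_zero ?_ fun m hm => ?_
  · refine Summable.of_norm_bounded ((S.summable_idx hI hs).norm.mul_right C) fun J => ?_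
    rw [norm_mul]
    gcongr
    have h1 : 1 ≤ (classCount I J.idx (ClassGroup.mk0 J.1) : ℝ) := by
      exact_mod_cast Nat.one_le_iff_ne_zero.2
        ((classCount_ne_zero_iff hI).2 ⟨J.1, J.mem_idealsOfIndex, rfl⟩)
    rw [norm_div, Complex.norm_natCast]
    exact (div_le_self (_root_.norm_nonneg _) h1).trans (hC _ _)
  · have hfin := finite_idealsOfIndex hI m
    let e : {J : SubIdeal I // J.idx = m} ≃ {J // J ∈ hfin.toFinset} :=
      { toFun := fun J => ⟨J.1.1, by
          rw [Set.Finite.mem_toFinset]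
          exact ⟨J.1.2, (relIndex_toLattice _ _).symm.trans J.2⟩⟩
        invFun := fun J => ⟨⟨J.1, ((Set.Finite.mem_toFinset _).1 J.2).1⟩,
          (relIndex_toLattice _ _).trans ((Set.Finite.mem_toFinset _).1 J.2).2⟩
        left_inv := fun _ => rfl
        right_inv := fun _ => rfl }
    have h1 := sum_div_ncard_fiber hfin.toFinset ClassGroup.mk0 (h m)
    refine (e.symm.hasSum_iff).1 ?_
    refine hasSum_of_eq (hasSum_fintype_complex fun J : {J // J ∈ hfin.toFinset} =>
      h m (ClassGroup.mk0 J.1) / classCount I m (ClassGroup.mk0 J.1)) (fun J => ?_) ?_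
    · have h2 : (e.symm J).1.idx = m := (e.symm J).2
      simp only [Function.comp_apply, h2]
      rfl
    · rw [Finset.sum_coe_sort hfin.toFinset
        fun J => h m (ClassGroup.mk0 J) / classCount I m (ClassGroup.mk0 J)]
      simp only [Set.Finite.mem_toFinset] at h1
      refine Eq.trans ?_ h1.symm
      refine Finset.sum_congr ?_ fun _ _ => rfl
      ext g
      simp [classes]

end QuadData

end SubformZeta

end


/-! ### The rotational discrepancy and the reflection part as sums over classes -/

open scoped NumberField nonZeroDivisors

noncomputable section

namespace SubformZeta

open Module

/-- If `g` and `g⁻¹` both lie in `A`, their two fractions add up to 1 and the terms cancel. If `g⁻¹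
∉ A`, the fraction is 1 and the term is `½`. -/
lemma sum_div_add_inv {G : Type*} [Group G] [DecidableEq G] {A : Finset G} {ν : G → ℕ}
    (hν : ∀ g, ν g ≠ 0 ↔ g ∈ A) :
    ∑ g ∈ A, ((ν g : ℂ) / (ν g + ν g⁻¹) - 1 / 2) = 1 / 2 * (A.filter fun g => g⁻¹ ∉ A).card := by
  rw [← Finset.sum_filter_add_sum_filter_not A fun g => g⁻¹ ∈ A]
  have h1 : ∑ g ∈ A.filter (fun g => g⁻¹ ∈ A), ((ν g : ℂ) / (ν g + ν g⁻¹) - 1 / 2) = 0 := by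
    have key : ∀ g ∈ A.filter (fun g => g⁻¹ ∈ A), ((ν g : ℂ) / (ν g + ν g⁻¹) - 1 / 2) +
        ((ν g⁻¹ : ℂ) / (ν g⁻¹ + ν g⁻¹⁻¹) - 1 / 2) = 0 := by
      intro g hg
      have h0 : ((ν g : ℂ) + ν g⁻¹) ≠ 0 := by
        have := (hν g).2 (Finset.mem_filter.1 hg).1
        exact_mod_cast (by omega : ν g + ν g⁻¹ ≠ 0)
      rw [inv_inv, add_comm (ν g⁻¹ : ℂ)]
      field_simp
      ring
    refine Finset.sum_involution (fun g _ => g⁻¹) key ?_ ?_ ?_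
    -- For `g = g⁻¹` the relation `key` says that twice the term is zero.
    · intro g hg hne heq
      have h2 := key g hg
      rw [heq] at h2
      rw [heq] at hne
      rw [heq] at h2
      apply hne
      linear_combination h2 / 2
    · intro g hg
      rw [Finset.mem_filter] at hg ⊢
      exact ⟨hg.2, by rw [inv_inv]; exact hg.1⟩
    · intro g _
      exact inv_inv g
  rw [h1, zero_add, Finset.sum_congr rfl fun g hg => ?_, Finset.sum_const, nsmul_eq_mul, mul_comm]
  rw [Finset.mem_filter] at hg
  have h2 : ν g⁻¹ = 0 := by
    by_contra h
    exact hg.2 ((hν _).1 h)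
  have h3 : (ν g : ℂ) ≠ 0 := by exact_mod_cast (hν g).2 hg.1
  rw [h2, Nat.cast_zero, add_zero, div_self h3]
  norm_num

namespace QuadData

variable {F : Type*} [Field F] [NumberField F] (S : QuadData F)

lemma mem_conjClasses {I : Ideal (𝓞 F)} {n : ℕ} {g : ClassGroup (𝓞 F)} :
    g ∈ conjClasses S.conj I n ↔ g⁻¹ ∈ classes I n := by
  constructor
  · rintro ⟨J, hJ, J', hJ', rfl⟩
    rw [S.mk0_eq_inv hJ', inv_inv]
    exact ⟨J, hJ, rfl⟩
  · rintro ⟨J, hJ, h⟩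
    refine ⟨J, hJ, ⟨S.cj J, S.cj_mem J⟩, rfl, ?_⟩
    rw [S.mk0_eq_inv (J' := ⟨S.cj J, S.cj_mem J⟩) rfl, h, inv_inv]

lemma mem_selfConjClasses {I : Ideal (𝓞 F)} {n : ℕ} {g : ClassGroup (𝓞 F)} :
    g ∈ selfConjClasses S.conj I n ↔ g ∈ classes I n ∧ g⁻¹ = g := by
  constructor
  · rintro ⟨J, hJ, J', hJ', h1, h2⟩
    refine ⟨⟨J, hJ, h1.symm⟩, ?_⟩
    rw [S.mk0_eq_inv hJ', ← h1] at h2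
    exact h2.symm
  · rintro ⟨⟨J, hJ, rfl⟩, h⟩
    refine ⟨J, hJ, ⟨S.cj J, S.cj_mem J⟩, rfl, rfl, ?_⟩
    rw [S.mk0_eq_inv (J' := ⟨S.cj J, S.cj_mem J⟩) rfl, h]

lemma tsum_lat_eq (S : QuadData F) {I : Ideal (𝓞 F)} (hI : I ≠ ⊥) {f : AddSubgroup F → ℂ}
    (hf : Summable fun K : Lat (fun _ => True) (toLattice I) => f K) :
    ∑' K : Lat (fun _ => True) (toLattice I), f K = ∑' J : SubIdeal I,
      ∑' K : Lat (fun K => hull K = J.1 ∧ True) (toLattice (J.1 : Ideal (𝓞 F))), f K := by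
  refine (hasSum_hull (𝒥 := fun J : SubIdeal I => (J.1 : Ideal (𝓞 F)))
    (Subtype.val_injective.comp Subtype.val_injective) (fun J => ⟨coe_ne_bot J.1, J.2⟩)
    (fun K hK hi _ => ?_) hf).tsum_eq.symm
  exact ⟨⟨⟨hull K, mem_nonZeroDivisors_iff_ne_zero.2 (S.hull_ne_bot hI hK hi)⟩, hull_le hK⟩, rfl⟩

section

variable {I : Ideal (𝓞 F)}

lemma le_of_mem {F : Type*} [Field F] {I : Ideal (𝓞 F)} {J : SubIdeal I}
    (K : Lat (fun K => hull K = J.1 ∧ True) (toLattice (J.1 : Ideal (𝓞 F)))) :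
    K.1 ≤ toLattice I := K.2.1.1.trans (toLattice_le_iff.2 J.2)

lemma relIndex_cpow {F : Type*} [Field F] {I : Ideal (𝓞 F)} {J : SubIdeal I}
    (K : Lat (fun K => hull K = J.1 ∧ True) (toLattice (J.1 : Ideal (𝓞 F)))) (s : ℂ) :
    (K.1.relIndex (toLattice I) : ℂ) ^ (-s) =
      (K.1.relIndex (toLattice (J.1 : Ideal (𝓞 F))) : ℂ) ^ (-s) * (J.idx : ℂ) ^ (-s) := by
  rw [relIndex_hull K.2.1.1 J.2, natCast_mul_cpow]
  rfl

lemma ncard_embRot_lat (hI : I ≠ ⊥) {J : SubIdeal I}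
    (K : Lat (fun K => hull K = J.1 ∧ True) (toLattice (J.1 : Ideal (𝓞 F)))) :
    (S.embRot I K.1).ncard = classCount I J.idx (ClassGroup.mk0 J.1) * S.E.ncard := by
  rw [← S.embRot_hull (le_of_mem K), K.2.2.1, S.ncard_embRot hI _ J.absNorm_eq]

lemma ncard_embRefl_lat (hI : I ≠ ⊥) {J : SubIdeal I}
    (K : Lat (fun K => hull K = J.1 ∧ True) (toLattice (J.1 : Ideal (𝓞 F)))) :
    (S.embRefl I K.1).ncard = classCount I J.idx (ClassGroup.mk0 J.1)⁻¹ * S.E.ncard := by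
  rw [← S.embRefl_hull (le_of_mem K), K.2.2.1, S.ncard_embRefl hI _ J.absNorm_eq]

/-- A rotation preserving a lattice is integral, and `±1` preserve every lattice. -/
lemma stabRot_eq (hE : ∀ ε ∈ S.E, ε = 1 ∨ ε = -1) {J : Ideal (𝓞 F)} (hJ : J ≠ ⊥)
    (K : Lat (fun _ => True) (toLattice J)) : S.stabRot K.1 = S.E := by
  ext u
  constructor
  · rintro ⟨hu, h⟩
    exact ⟨hu, isIntegral_of_map_rotHom_le K.2.1.1
      (S.ne_bot_of_relIndex_ne_zero hJ K.2.1.1 K.2.1.2) h.le⟩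
  · intro hu
    refine ⟨hu.1, ?_⟩
    rcases hE u hu with rfl | rfl
    · exact map_rotHom_one _
    · ext x
      rw [mem_map_rotHom (by norm_num)]
      simp

/-- The summand of the rotational discrepancy. -/
def rotTerm (I : Ideal (𝓞 F)) (K : AddSubgroup F) : ℂ :=
  ((S.stabRot K).ncard : ℂ) / ((S.embRot I K).ncard + (S.embRefl I K).ncard) -
    1 / 2 * ((S.stabRot K).ncard / (S.embRot I K).ncard)

/-- On the lattices generating `J` the summand `rotTerm` is constant, since the stabilizers have the
full size `w`, which cancels. Each `J` then contributes `primSum s` times a function of `[J]` that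
`sum_div_add_inv` evaluates. -/
lemma tsum_rotTerm (hI : I ≠ ⊥) (hE : ∀ ε ∈ S.E, ε = 1 ∨ ε = -1) {s : ℂ} (hs : 2 < s.re)
    (hsum : Summable fun K : Lat (fun _ => True) (toLattice I) =>
      (K.1.relIndex (toLattice I) : ℂ) ^ (-s) * S.rotTerm I K.1) :
    ∑' K : Lat (fun _ => True) (toLattice I),
      (K.1.relIndex (toLattice I) : ℂ) ^ (-s) * S.rotTerm I K.1 =
      zetaZ2 s / (2 * NumberField.dedekindZeta F s) *
        classSeries (fun n => classes I n \ conjClasses S.conj I n) s := by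
  classical
  rw [S.tsum_lat_eq hI (f := fun K => (K.relIndex (toLattice I) : ℂ) ^ (-s) * S.rotTerm I K) hsum]
  set h : ℕ → ClassGroup (𝓞 F) → ℂ := fun m g =>
    (classCount I m g : ℂ) / (classCount I m g + classCount I m g⁻¹) - 1 / 2 with hh
  have hC : ∀ m g, ‖h m g‖ ≤ 3 / 2 := by
    intro m g
    refine (norm_sub_le _ _).trans ?_
    have h1 := norm_natCast_div_le_one
      (Nat.le_add_right (classCount I m g) (classCount I m g⁻¹))
    rw [Nat.cast_add] at h1
    have h2 : ‖(1 / 2 : ℂ)‖ = 1 / 2 := by simp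
    rw [h2]
    linarith
  have h1 := S.LSeriesHasSum_classSum hI hs hC
  have hW : (S.E.ncard : ℂ) ≠ 0 := by exact_mod_cast S.ncard_E_ne_zero
  have h2 : ∀ J : SubIdeal I,
      ∑' K : Lat (fun K => hull K = J.1 ∧ True) (toLattice (J.1 : Ideal (𝓞 F))),
        (K.1.relIndex (toLattice I) : ℂ) ^ (-s) * S.rotTerm I K.1 =
      S.primSum s * ((J.idx : ℂ) ^ (-s) *
        (h J.idx (ClassGroup.mk0 J.1) / classCount I J.idx (ClassGroup.mk0 J.1))) := by
    intro J
    rw [← S.prim_allSystem ⟨J.1, coe_ne_bot J.1⟩ hs, HullSystem.prim, ← tsum_mul_right]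
    refine tsum_congr fun K => ?_
    have hν : (classCount I J.idx (ClassGroup.mk0 J.1) : ℂ) ≠ 0 := by
      exact_mod_cast (classCount_ne_zero_iff hI).2 ⟨J.1, J.mem_idealsOfIndex, rfl⟩
    have hν2 : (classCount I J.idx (ClassGroup.mk0 J.1) : ℂ) +
        classCount I J.idx (ClassGroup.mk0 J.1)⁻¹ ≠ 0 := by
      have : classCount I J.idx (ClassGroup.mk0 J.1) ≠ 0 := by exact_mod_cast hν
      exact_mod_cast (by omega : classCount I J.idx (ClassGroup.mk0 J.1) +
        classCount I J.idx (ClassGroup.mk0 J.1)⁻¹ ≠ 0)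
    rw [relIndex_cpow, mul_assoc]
    congr 2
    rw [rotTerm, S.ncard_embRot_lat hI K, S.ncard_embRefl_lat hI K,
      S.stabRot_eq hE (coe_ne_bot J.1) ⟨K.1, K.2.1, trivial⟩]
    simp only [hh]
    push_cast
    field_simp
  rw [tsum_congr h2, tsum_mul_left, ← h1.LSeries_eq, S.primSum_eq hs, classSeries]
  have h3 : ∀ m, (((classes I m \ conjClasses S.conj I m).ncard : ℕ) : ℂ) =
      2 * ∑ g ∈ (classes I m).toFinite.toFinset, h m g := by
    intro m
    rw [sum_div_add_inv (ν := classCount I m) fun g => by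
      rw [classCount_ne_zero_iff hI, Set.Finite.mem_toFinset], ← mul_assoc,
      mul_one_div_cancel two_ne_zero, one_mul, ← Set.ncard_coe_finset]
    congr 2
    ext g
    simp [S.mem_conjClasses]
  simp only [h3]
  have h4 : LSeries (fun n => 2 * ∑ g ∈ (classes I n).toFinite.toFinset, h n g) s =
      2 * LSeries (fun n => ∑ g ∈ (classes I n).toFinite.toFinset, h n g) s :=
    LSeries_smul (fun n => ∑ g ∈ (classes I n).toFinite.toFinset, h n g) 2 s
  rw [h4]
  have h5 : NumberField.dedekindZeta F s ≠ 0 := by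
    intro h
    apply zetaZ2_ne_zero hs
    rw [← S.dedekindZeta_mul_primSum hs, h, zero_mul]
  field_simp

/-- Covers `d = -1` and `d = -3`, where further units may fail to preserve a lattice and stabilizers
vary. With one class there are as many rotations as reflections into `I`, so each `rotTerm`
vanishes, and so does the right-hand side. -/
lemma tsum_rotTerm_of_trivial (hI : I ≠ ⊥) (hcl : ∀ g : ClassGroup (𝓞 F), g = 1) {s : ℂ} :
    ∑' K : Lat (fun _ => True) (toLattice I),
      (K.1.relIndex (toLattice I) : ℂ) ^ (-s) * S.rotTerm I K.1 =
      zetaZ2 s / (2 * NumberField.dedekindZeta F s) *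
        classSeries (fun n => classes I n \ conjClasses S.conj I n) s := by
  have h1 : ∀ n, classes I n \ conjClasses S.conj I n = ∅ := by
    intro n
    rw [Set.sdiff_eq_empty]
    intro g hg
    rw [S.mem_conjClasses, hcl g⁻¹, ← hcl g]
    exact hg
  have h2 : classSeries (fun n => classes I n \ conjClasses S.conj I n) s = 0 := by
    simp only [classSeries, h1, Set.ncard_empty, Nat.cast_zero]
    exact congrFun LSeries_zero s
  rw [h2, mul_zero]
  convert tsum_zero with K
  let J : SubIdeal I := ⟨⟨hull K.1, mem_nonZeroDivisors_iff_ne_zero.2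
    (S.hull_ne_bot hI K.2.1.1 K.2.1.2)⟩, hull_le K.2.1.1⟩
  have hK0 : K.1.relIndex (toLattice (J.1 : Ideal (𝓞 F))) ≠ 0 := by
    intro h
    apply K.2.1.2
    rw [relIndex_hull (le_toLattice_hull K.2.1.1) J.2]
    exact mul_eq_zero_of_left h _
  have h3 : (S.embRot I K.1).ncard = (S.embRefl I K.1).ncard := by
    have e1 := S.ncard_embRot_lat hI (J := J) ⟨K.1, ⟨le_toLattice_hull K.2.1.1, hK0⟩, rfl, trivial⟩
    have e2 := S.ncard_embRefl_lat hI (J := J) ⟨K.1, ⟨le_toLattice_hull K.2.1.1, hK0⟩, rfl, trivial⟩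
    rw [hcl (ClassGroup.mk0 J.1)] at e1 e2
    rw [inv_one] at e2
    exact e1.trans e2.symm
  rw [rotTerm, h3, mul_eq_zero]
  right
  ring

/-! ### Reflections -/

lemma tsum_lat_ite {F : Type*} [Field F] {P Q : AddSubgroup F → Prop} [DecidablePred Q] {L : AddSubgroup F}
    (f : AddSubgroup F → ℂ) : ∑' K : Lat (fun K => P K ∧ True) L, (if Q K.1 then f K.1 else 0) =
      ∑' K : Lat (fun K => P K ∧ Q K) L, f K.1 := by
  have h1 := tsum_subtype {K : Lat (fun K => P K ∧ True) L | Q K.1} fun K => f K.1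
  have h2 : ∑' K : Lat (fun K => P K ∧ True) L, (if Q K.1 then f K.1 else 0) =
      ∑' K : Lat (fun K => P K ∧ True) L,
        Set.indicator {K : Lat (fun K => P K ∧ True) L | Q K.1} (fun K => f K.1) K :=
    tsum_congr fun K => by simp [Set.indicator_apply]
  rw [h2, ← h1]
  let e : {K : Lat (fun K => P K ∧ True) L | Q K.1} ≃ Lat (fun K => P K ∧ Q K) L :=
    { toFun := fun K => ⟨K.1.1, K.1.2.1, K.1.2.2.1, K.2⟩
      invFun := fun K => ⟨⟨K.1, K.2.1, K.2.2.1, trivial⟩, K.2.2.2⟩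
      left_inv := fun _ => rfl
      right_inv := fun _ => rfl }
  exact e.tsum_eq fun K => f K.1

/-- The sum of the Dirichlet series of all reflections of an ideal. -/
def reflPrimSum (J : (Ideal (𝓞 F))⁰) (s : ℂ) : ℂ :=
  ∑ u ∈ (S.finite_reflSet (coe_ne_bot J)).toFinset.attach,
    S.reflPrim ⟨(J, u.1), coe_ne_bot J, (Set.Finite.mem_toFinset _).1 u.2⟩ s

/-- Both sides count pairs of a lattice and a reflection preserving it. Such a reflection also
preserves the ideal `J` generated by the lattice, so it lies in the finite set `reflSet J`. -/
lemma tsum_ncard_stabRefl (J : (Ideal (𝓞 F))⁰) {s : ℂ} (hs : 2 < s.re) :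
    ∑' K : Lat (fun K => hull K = J ∧ True) (toLattice (J : Ideal (𝓞 F))),
      (K.1.relIndex (toLattice (J : Ideal (𝓞 F))) : ℂ) ^ (-s) * (S.stabRefl K.1).ncard =
      S.reflPrimSum J s := by
  classical
  set T := (S.finite_reflSet (coe_ne_bot J)).toFinset with hT
  have h1 : ∀ K : Lat (fun K => hull K = J ∧ True) (toLattice (J : Ideal (𝓞 F))),
      (K.1.relIndex (toLattice (J : Ideal (𝓞 F))) : ℂ) ^ (-s) * (S.stabRefl K.1).ncard =
      ∑ u ∈ T.attach, if K.1.map (S.reflHom u.1) = K.1 then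
        (K.1.relIndex (toLattice (J : Ideal (𝓞 F))) : ℂ) ^ (-s) else 0 := by
    intro K
    rw [Finset.sum_attach T (fun u => if K.1.map (S.reflHom u) = K.1 then
        (K.1.relIndex (toLattice (J : Ideal (𝓞 F))) : ℂ) ^ (-s) else 0), ← Finset.sum_filter,
      Finset.sum_const, nsmul_eq_mul, mul_comm, ← Set.ncard_coe_finset]
    congr 3
    ext u
    simp only [stabRefl, hT, Finset.coe_filter, Set.Finite.mem_toFinset, Set.mem_ofPred_eq]
    refine ⟨fun h => ⟨⟨h.1, ?_⟩, h.2⟩, fun h => ⟨h.1.1, h.2⟩⟩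
    have h2 := S.map_reflHom_hull K.2.1.1 h.1 h.2
    rwa [K.2.2.1] at h2
  rw [tsum_congr h1, Summable.tsum_finsetSum, reflPrimSum]
  · refine Finset.sum_congr rfl fun u _ => ?_
    exact tsum_lat_ite (P := fun K => hull K = J) (Q := fun K => K.map (S.reflHom u.1) = K)
      (L := toLattice (J : Ideal (𝓞 F)))
      fun K => (K.relIndex (toLattice (J : Ideal (𝓞 F))) : ℂ) ^ (-s)
  · intro u _
    refine Summable.of_norm_bounded (HullSystem.summable_cpow S (fun K => hull K = J ∧ True)
      (coe_ne_bot J) hs).norm fun K => ?_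
    split_ifs
    · exact le_rfl
    · rw [norm_zero]
      exact _root_.norm_nonneg _

/-- The summand of the reflection part. -/
def reflTerm (I : Ideal (𝓞 F)) (K : AddSubgroup F) : ℂ :=
  ((S.stabRefl K).ncard : ℂ) / ((S.embRot I K).ncard + (S.embRefl I K).ncard)

/-- A contributing class is its own inverse, so the denominator is `2wν`. The `w` cancels against
the number of reflections, `ν` turns ideals into classes, and `½` remains. -/
lemma LSeriesHasSum_reflTerm (hI : I ≠ ⊥) {s : ℂ} (hs : 2 < s.re) {h : ClassGroup (𝓞 F) → ℂ}
    (hh : ∀ J : (Ideal (𝓞 F))⁰, S.reflPrimSum J s = S.E.ncard * h (ClassGroup.mk0 J))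
    (hinv : ∀ g, h g ≠ 0 → g⁻¹ = g)
    (hsum : Summable fun K : Lat (fun _ => True) (toLattice I) =>
      (K.1.relIndex (toLattice I) : ℂ) ^ (-s) * S.reflTerm I K.1) :
    LSeriesHasSum (fun m => ∑ g ∈ (classes I m).toFinite.toFinset, 1 / 2 * h g) s
      (∑' K : Lat (fun _ => True) (toLattice I),
        (K.1.relIndex (toLattice I) : ℂ) ^ (-s) * S.reflTerm I K.1) := by
  rw [S.tsum_lat_eq hI (f := fun K => (K.relIndex (toLattice I) : ℂ) ^ (-s) * S.reflTerm I K) hsum]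
  obtain ⟨C, hC⟩ := (Set.finite_range fun g => ‖1 / 2 * h g‖).bddAbove
  have h1 := S.LSeriesHasSum_classSum hI hs (h := fun _ g => 1 / 2 * h g) (C := C)
    fun _ g => hC ⟨g, rfl⟩
  have hW : (S.E.ncard : ℂ) ≠ 0 := by exact_mod_cast S.ncard_E_ne_zero
  have h2 : ∀ J : SubIdeal I,
      ∑' K : Lat (fun K => hull K = J.1 ∧ True) (toLattice (J.1 : Ideal (𝓞 F))),
        (K.1.relIndex (toLattice I) : ℂ) ^ (-s) * S.reflTerm I K.1 =
      (J.idx : ℂ) ^ (-s) *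
        (1 / 2 * h (ClassGroup.mk0 J.1) / classCount I J.idx (ClassGroup.mk0 J.1)) := by
    intro J
    have e : ∀ K : Lat (fun K => hull K = J.1 ∧ True) (toLattice (J.1 : Ideal (𝓞 F))),
        (K.1.relIndex (toLattice I) : ℂ) ^ (-s) * S.reflTerm I K.1 =
        (K.1.relIndex (toLattice (J.1 : Ideal (𝓞 F))) : ℂ) ^ (-s) * (S.stabRefl K.1).ncard *
          ((J.idx : ℂ) ^ (-s) / (classCount I J.idx (ClassGroup.mk0 J.1) * S.E.ncard +
            classCount I J.idx (ClassGroup.mk0 J.1)⁻¹ * S.E.ncard)) := by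
      intro K
      rw [relIndex_cpow, reflTerm, S.ncard_embRot_lat hI K, S.ncard_embRefl_lat hI K]
      push_cast
      ring
    rw [tsum_congr e, tsum_mul_right, S.tsum_ncard_stabRefl J.1 hs, hh]
    by_cases h0 : h (ClassGroup.mk0 J.1) = 0
    · rw [h0]
      ring
    · rw [hinv _ h0]
      have hν : (classCount I J.idx (ClassGroup.mk0 J.1) : ℂ) ≠ 0 := by
        exact_mod_cast (classCount_ne_zero_iff hI).2 ⟨J.1, J.mem_idealsOfIndex, rfl⟩
      field_simp
      ring
  rw [tsum_congr h2]
  exact h1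

lemma LSeriesHasSum_classSeries (S : QuadData F) (hI : I ≠ ⊥) {s : ℂ} (hs : 2 < s.re)
    (B : Set (ClassGroup (𝓞 F))) :
    LSeriesHasSum (fun n => ((classes I n ∩ B).ncard : ℂ)) s
      (classSeries (fun n => classes I n ∩ B) s) := by
  classical
  have h1 := S.LSeriesHasSum_classSum hI hs (h := fun _ g => if g ∈ B then 1 else 0) (C := 1)
    fun _ g => by split_ifs <;> simp
  have h2 : ∀ m, (∑ g ∈ (classes I m).toFinite.toFinset, if g ∈ B then (1 : ℂ) else 0) =
      ((classes I m ∩ B).ncard : ℂ) := by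
    intro m
    rw [Finset.sum_boole, ← Set.ncard_coe_finset]
    congr 2
    ext g
    simp
  simp only [h2] at h1
  rw [classSeries, h1.LSeries_eq]
  exact h1

end

end QuadData

end SubformZeta

end


/-! ### The reflection part in each residue class of `d` -/

open scoped NumberField nonZeroDivisors

noncomputable section

namespace SubformZeta

open Module

namespace QuadData

variable {F : Type*} [Field F] [NumberField F] (S : QuadData F)

lemma reflPrimSum_of_const (J : (Ideal (𝓞 F))⁰) {s c : ℂ}
    [Decidable ((ClassGroup.mk0 J)⁻¹ = ClassGroup.mk0 J)]
    (hc : ∀ x : S.ReflPair, x.1.1 = J → S.reflPrim x s = c) :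
    S.reflPrimSum J s =
      S.E.ncard * if (ClassGroup.mk0 J)⁻¹ = ClassGroup.mk0 J then c else 0 := by
  rw [reflPrimSum, Finset.sum_congr rfl fun u _ => hc _ rfl, Finset.sum_const, Finset.card_attach,
    nsmul_eq_mul, ← Set.ncard_eq_toFinset_card _ (S.finite_reflSet (coe_ne_bot J))]
  split_ifs with h
  · obtain ⟨u, hu⟩ := (S.reflSet_nonempty_iff J).2 h
    rw [S.ncard_reflSet (coe_ne_bot J) hu]
  · rw [← S.reflSet_nonempty_iff, Set.not_nonempty_iff_eq_empty] at h
    rw [h, Set.ncard_empty]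
    simp

/-- `u ↦ θu` permutes the reflections of `J` and exchanges the two types, so the average of `α` and
`β` appears. -/
lemma reflPrimSum_of_eq_neg_one (hd : S.d = -1) (J : (Ideal (𝓞 F))⁰) {s α β : ℂ}
    [Decidable ((ClassGroup.mk0 J)⁻¹ = ClassGroup.mk0 J)]
    (hα : ∀ x : S.ReflPair, S.IsRect x → S.reflPrim x s = α)
    (hβ : ∀ x : S.ReflPair, ¬ S.IsRect x → S.reflPrim x s = β) :
    S.reflPrimSum J s =
      S.E.ncard * if (ClassGroup.mk0 J)⁻¹ = ClassGroup.mk0 J then (α + β) / 2 else 0 := by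
  classical
  have hJ := coe_ne_bot J
  have hfin := S.finite_reflSet hJ
  set φ : F → ℂ := fun u => if S.Rect u (toLattice (J : Ideal (𝓞 F))) then α else β with hφ
  have h1 : S.reflPrimSum J s = ∑ u ∈ hfin.toFinset, φ u := by
    rw [← Finset.sum_attach hfin.toFinset φ, reflPrimSum]
    refine Finset.sum_congr rfl fun u _ => ?_
    by_cases h : S.Rect u.1 (toLattice (J : Ideal (𝓞 F)))
    · exact (hα ⟨(J, u.1), hJ, (Set.Finite.mem_toFinset _).1 u.2⟩ h).trans (if_pos h).symm
    · exact (hβ ⟨(J, u.1), hJ, (Set.Finite.mem_toFinset _).1 u.2⟩ h).trans (if_neg h).symm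
  have hθ2 : S.θ ^ 2 = -1 := by rw [S.sq, hd]; simp
  have hθU : S.θ ∈ S.U := by
    change _ * _ = _
    rw [S.conj_θ]
    linear_combination -hθ2
  have hθE : S.θ ∈ S.E := ⟨hθU, S.isIntegral_θ⟩
  have h2 : ∑ u ∈ hfin.toFinset, φ u = ∑ u ∈ hfin.toFinset, φ (S.θ * u) := by
    refine Finset.sum_nbij' (fun u => S.θ⁻¹ * u) (fun u => S.θ * u) ?_ ?_ ?_ ?_ ?_
    · intro u hu
      rw [Set.Finite.mem_toFinset] at hu ⊢
      exact (S.mul_mem_reflSet_iff hJ hu (S.inv_mem_U hθU)).2 (S.inv_mem_E hθE)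
    · intro u hu
      rw [Set.Finite.mem_toFinset] at hu ⊢
      exact (S.mul_mem_reflSet_iff hJ hu hθU).2 hθE
    · intro u _
      exact mul_inv_cancel_left₀ S.θ_ne_zero u
    · intro u _
      exact inv_mul_cancel_left₀ S.θ_ne_zero u
    · intro u _
      rw [mul_inv_cancel_left₀ S.θ_ne_zero]
  have h3 : ∀ u ∈ hfin.toFinset, φ u + φ (S.θ * u) = α + β := by
    intro u hu
    rw [Set.Finite.mem_toFinset] at hu
    have h4 := S.rect_θ_mul_iff hd hJ hu
    by_cases h : S.Rect u (toLattice (J : Ideal (𝓞 F)))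
    · simp only [hφ, if_pos h, if_neg fun h' => h4.1 h' h]
    · simp only [hφ, if_neg h, if_pos (h4.2 h)]
      ring
  have h5 : 2 * S.reflPrimSum J s = (S.reflSet J).ncard * (α + β) := by
    rw [Set.ncard_eq_toFinset_card _ hfin, ← nsmul_eq_mul, ← Finset.sum_const,
      ← Finset.sum_congr rfl h3, Finset.sum_add_distrib, ← h2, h1, two_mul]
  split_ifs with h
  · obtain ⟨u, hu⟩ := (S.reflSet_nonempty_iff J).2 h
    rw [S.ncard_reflSet hJ hu] at h5
    linear_combination h5 / 2
  · rw [← S.reflSet_nonempty_iff, Set.not_nonempty_iff_eq_empty] at h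
    rw [h, Set.ncard_empty] at h5
    rw [mul_zero]
    linear_combination h5 / 2

section

variable {I : Ideal (𝓞 F)}

lemma sum_ite_mem {α : Type*} {A : Set α} (hA : A.Finite) (B : Set α) [DecidablePred (· ∈ B)]
    (c : ℂ) : ∑ g ∈ hA.toFinset, (if g ∈ B then c else 0) = c * ((A ∩ B).ncard : ℂ) := by
  classical
  rw [← Finset.sum_filter, Finset.sum_const, nsmul_eq_mul, mul_comm, ← Set.ncard_coe_finset]
  congr 3
  ext g
  simp

lemma selfConjClasses_eq (n : ℕ) :
    selfConjClasses S.conj I n = classes I n ∩ {g | g⁻¹ = g} :=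
  Set.ext fun _ => S.mem_selfConjClasses

/-- The sum of the reflection part over all lattices. -/
def reflTotal (I : Ideal (𝓞 F)) (s : ℂ) : ℂ :=
  ∑' K : Lat (fun _ => True) (toLattice I),
    (K.1.relIndex (toLattice I) : ℂ) ^ (-s) * S.reflTerm I K.1

lemma reflTotal_of_const (hI : I ≠ ⊥) {s : ℂ} (hs : 2 < s.re)
    (hsum : Summable fun K : Lat (fun _ => True) (toLattice I) =>
      (K.1.relIndex (toLattice I) : ℂ) ^ (-s) * S.reflTerm I K.1)
    {c : ℂ} (hc : ∀ (J : (Ideal (𝓞 F))⁰)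
    [Decidable ((ClassGroup.mk0 J)⁻¹ = ClassGroup.mk0 J)], S.reflPrimSum J s =
      S.E.ncard * if (ClassGroup.mk0 J)⁻¹ = ClassGroup.mk0 J then c else 0) :
    S.reflTotal I s = 1 / 2 * c * classSeries (selfConjClasses S.conj I) s := by
  classical
  have h1 := S.LSeriesHasSum_reflTerm hI hs (h := fun g => if g⁻¹ = g then c else 0)
    (fun J => hc J) (fun g hg => by
      by_contra h
      exact hg (if_neg h)) hsum
  have h2 := (S.LSeriesHasSum_classSeries hI hs {g | g⁻¹ = g}).smul (1 / 2 * c)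
  have h3 : (fun m => ∑ g ∈ (classes I m).toFinite.toFinset,
      1 / 2 * (if g⁻¹ = g then c else 0)) =
      (1 / 2 * c) • fun n => ((classes I n ∩ {g | g⁻¹ = g}).ncard : ℂ) := by
    funext m
    rw [Pi.smul_apply, smul_eq_mul, mul_assoc, ← Finset.mul_sum,
      ← sum_ite_mem (classes I m).toFinite {g | g⁻¹ = g} c]
    rfl
  rw [h3] at h1
  rw [reflTotal, ← h1.LSeries_eq, h2.LSeries_eq]
  simp only [funext fun n => S.selfConjClasses_eq (I := I) n]

lemma reflTotal_of_emod_eq_one (hI : I ≠ ⊥) {s : ℂ} (hs : 2 < s.re)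
    (hsum : Summable fun K : Lat (fun _ => True) (toLattice I) =>
      (K.1.relIndex (toLattice I) : ℂ) ^ (-s) * S.reflTerm I K.1)
    (hd : S.d % 4 = 1) :
    S.reflTotal I s = (1 - 2 ^ (-s) + 2 * 2 ^ (-2 * s)) * riemannZeta s ^ 2 /
      (2 * riemannZeta (2 * s) * ramifiedProduct F s) *
        classSeries (selfConjClasses S.conj I) s := by
  rw [S.reflTotal_of_const hI hs hsum fun J _ => S.reflPrimSum_of_const J fun x _ =>
    S.reflPrim_of_emod_eq_one hd x hs]
  have := zeta_two_mul_ne_zero hs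
  have := ramifiedProduct_ne_zero F (s := s) (by linarith)
  field_simp

/-- Both class series coincide, since `ramGroup` consists of the classes equal to their inverse.
With `X = 2^{-s}`, the two coefficients combine by `1 + X = (1 - X + 2X²) + 2(X - X²)`. -/
lemma reflTotal_of_emod_eq_two (hI : I ≠ ⊥) {s : ℂ} (hs : 2 < s.re)
    (hsum : Summable fun K : Lat (fun _ => True) (toLattice I) =>
      (K.1.relIndex (toLattice I) : ℂ) ^ (-s) * S.reflTerm I K.1)
    (hd : S.d % 4 = 2) :
    S.reflTotal I s = (1 - 2 ^ (-s) + 2 * 2 ^ (-2 * s)) * riemannZeta s ^ 2 /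
      (2 * riemannZeta (2 * s) * ramifiedProduct F s) *
        classSeries (selfConjClasses S.conj I) s +
      (2 ^ (-s) - 2 ^ (-2 * s)) * riemannZeta s ^ 2 /
        (riemannZeta (2 * s) * ramifiedProduct F s) *
          classSeries (fun n => classes I n ∩ ramGroup F) s := by
  have h1 : (fun n => classes I n ∩ (ramGroup F : Set (ClassGroup (𝓞 F)))) =
      selfConjClasses S.conj I := by
    funext n
    rw [S.selfConjClasses_eq]
    congr 1
    ext g
    exact S.mem_ramGroup_iff g
  rw [h1, S.reflTotal_of_const hI hs hsum fun J _ => S.reflPrimSum_of_const J fun x _ =>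
    S.reflPrim_of_emod_eq_two hd x hs]
  have := zeta_two_mul_ne_zero hs
  have := ramifiedProduct_ne_zero F (s := s) (by linarith)
  field_simp
  ring

/-- With `X = 2^{-s}`, the constants of the two types, `1 + X + 2X²` and `1 - X`, have average `1 +
X²`. -/
lemma reflTotal_of_eq_neg_one (hI : I ≠ ⊥) {s : ℂ} (hs : 2 < s.re)
    (hsum : Summable fun K : Lat (fun _ => True) (toLattice I) =>
      (K.1.relIndex (toLattice I) : ℂ) ^ (-s) * S.reflTerm I K.1)
    (hd : S.d = -1) :
    S.reflTotal I s = 1 / 2 * (1 + 2 ^ (-2 * s)) * riemannZeta s ^ 2 /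
      (riemannZeta (2 * s) * ramifiedProduct F s) *
        classSeries (selfConjClasses S.conj I) s := by
  classical
  have hd4 : S.d % 4 = 3 := by rw [hd]; rfl
  rw [S.reflTotal_of_const hI hs hsum fun J _ => S.reflPrimSum_of_eq_neg_one hd J
    (fun x hx => (S.reflPrim_of_emod_eq_three hd4 x hs).trans (by rw [if_pos hx]))
    (fun x hx => (S.reflPrim_of_emod_eq_three hd4 x hs).trans (by rw [if_neg hx]))]
  have := zeta_two_mul_ne_zero hs
  have := ramifiedProduct_ne_zero F (s := s) (by linarith)
  field_simp
  ring

/-- With `X = 2^{-s}`, classes in `orthoGroup` carry `1 + X + 2X² = (1 - X + 2X²) + 2X`, and the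
other classes of `ramGroup` carry `1 - X = (1 - X + 2X²) - 2X²`. -/
lemma reflTotal_of_emod_eq_three (hI : I ≠ ⊥) {s : ℂ} (hs : 2 < s.re)
    (hsum : Summable fun K : Lat (fun _ => True) (toLattice I) =>
      (K.1.relIndex (toLattice I) : ℂ) ^ (-s) * S.reflTerm I K.1)
    (hd : S.d % 4 = 3) (hd1 : S.d ≠ -1) :
    S.reflTotal I s = (1 - 2 ^ (-s) + 2 * 2 ^ (-2 * s)) * riemannZeta s ^ 2 /
      (2 * riemannZeta (2 * s) * ramifiedProduct F s) *
        classSeries (selfConjClasses S.conj I) s +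
      2 ^ (-s) * riemannZeta s ^ 2 / (riemannZeta (2 * s) * ramifiedProduct F s) *
        classSeries (fun n => classes I n ∩ orthoGroup F) s -
      2 ^ (-2 * s) * riemannZeta s ^ 2 / (riemannZeta (2 * s) * ramifiedProduct F s) *
        classSeries (fun n => classes I n ∩ (ramGroup F \ orthoGroup F)) s := by
  classical
  have hE := fun ε (hε : ε ∈ S.E) => S.E_eq_one_or_neg_one hd1 (by omega) hε
  set α := (1 + 2 ^ (-s) + 2 * 2 ^ (-2 * s)) * riemannZeta s ^ 2 /
    (riemannZeta (2 * s) * ramifiedProduct F s) with hα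
  set β := (1 - 2 ^ (-s)) * riemannZeta s ^ 2 /
    (riemannZeta (2 * s) * ramifiedProduct F s) with hβ
  have hle : orthoGroup F ≤ ramGroup F := by
    apply Subgroup.closure_mono
    rintro g ⟨r, hr, -, h⟩
    exact ⟨r, hr, Set.mem_univ _, h⟩
  set h : ClassGroup (𝓞 F) → ℂ := fun g => (if g ∈ (orthoGroup F : Set _) then α else 0) +
    if g ∈ ((ramGroup F : Set _) \ (orthoGroup F : Set (ClassGroup (𝓞 F)))) then β else 0 with hh
  have h1 := S.LSeriesHasSum_reflTerm hI hs (h := h) (fun J => by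
      rw [S.reflPrimSum_of_const J (c := if ClassGroup.mk0 J ∈ orthoGroup F then α else β)]
      · congr 1
        rw [← S.mem_ramGroup_iff]
        by_cases h1 : ClassGroup.mk0 J ∈ orthoGroup F
        · simp [hh, h1, hle h1]
        · simp [hh, h1]
      · intro x hx
        have h2 : S.IsRect x ↔ ClassGroup.mk0 J ∈ orthoGroup F := by
          have := S.rect_iff_mem_orthoGroup hd hE (J := J) (u := x.1.2) (hx ▸ x.2.2)
          rw [← hx] at this
          exact this
        rw [S.reflPrim_of_emod_eq_three hd x hs]
        by_cases h3 : ClassGroup.mk0 J ∈ orthoGroup F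
        · rw [if_pos h3, if_pos (h2.2 h3)]
        · rw [if_neg h3, if_neg fun h => h3 (h2.1 h)]) (fun g hg => by
      rw [← S.mem_ramGroup_iff]
      by_contra h3
      apply hg
      have h4 : g ∉ orthoGroup F := fun h => h3 (hle h)
      simp [hh, h3, h4]) hsum
  have h2 := (S.LSeriesHasSum_classSeries hI hs (orthoGroup F)).smul (1 / 2 * α)
  have h3 := (S.LSeriesHasSum_classSeries hI hs
    ((ramGroup F : Set _) \ (orthoGroup F : Set _))).smul (1 / 2 * β)
  have h4 : (fun m => ∑ g ∈ (classes I m).toFinite.toFinset, 1 / 2 * h g) =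
      ((1 / 2 * α) • fun n => ((classes I n ∩ (orthoGroup F : Set _)).ncard : ℂ)) +
      (1 / 2 * β) • fun n => ((classes I n ∩
        ((ramGroup F : Set _) \ (orthoGroup F : Set _))).ncard : ℂ) := by
    funext m
    rw [Pi.add_apply, Pi.smul_apply, Pi.smul_apply, smul_eq_mul, smul_eq_mul, mul_assoc,
      mul_assoc, ← Finset.mul_sum, ← mul_add, ← sum_ite_mem (classes I m).toFinite,
      ← sum_ite_mem (classes I m).toFinite, ← Finset.sum_add_distrib]
  rw [h4] at h1
  have h5 : classSeries (selfConjClasses S.conj I) s =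
      classSeries (fun n => classes I n ∩ orthoGroup F) s +
      classSeries (fun n => classes I n ∩ (ramGroup F \ orthoGroup F)) s := by
    rw [← ((S.LSeriesHasSum_classSeries hI hs (orthoGroup F)).add
      (S.LSeriesHasSum_classSeries hI hs ((ramGroup F : Set _) \ (orthoGroup F : Set _)))).LSeries_eq,
      classSeries]
    congr 1
    funext n
    rw [Pi.add_apply, ← Nat.cast_add, ← Set.ncard_union_eq
      (Set.disjoint_left.2 fun g hg hg' => hg'.2.2 hg.2), ← Set.inter_union_distrib_left,
      Set.union_sdiff_self, Set.union_eq_right.2 (by exact hle), S.selfConjClasses_eq]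
    congr 3
    ext g
    exact (S.mem_ramGroup_iff g).symm
  rw [reflTotal, ← h1.LSeries_eq, (h2.add h3).LSeries_eq, h5, hα, hβ]
  have := zeta_two_mul_ne_zero hs
  have := ramifiedProduct_ne_zero F (s := s) (by linarith)
  field_simp
  ring

end

end QuadData

end SubformZeta

end


/-! ### Norms of ideals and the class series for `d = -1` and `d = -3` -/

open scoped NumberField nonZeroDivisors

noncomputable section

namespace SubformZeta

open Module

lemma prod_val_injective {p : ℕ → Prop} (hp : ∀ r, p r → r.Prime) {T T' : Finset {r // p r}}
    (h : ∏ r ∈ T, (r : ℕ) = ∏ r ∈ T', (r : ℕ)) : T = T' := by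
  have h2 : ∀ T : Finset {r // p r}, ∀ r ∈ T.map (Function.Embedding.subtype p), r.Prime := by
    intro T r hr
    obtain ⟨r', -, rfl⟩ := Finset.mem_map.1 hr
    exact hp _ r'.2
  have h1 := sq_mul_prod_injective one_ne_zero one_ne_zero (h2 T) (h2 T') (by
    rw [Finset.prod_map, Finset.prod_map]
    exact congrArg _ h)
  exact Finset.map_injective _ h1.2

/-- Expansion of the product over the primes congruent to one. -/
lemma hasSum_oneModProduct (k : ℕ) {s : ℂ} (hs : 1 < s.re) :
    HasSum (fun T : Finset {p : ℕ // p.Prime ∧ p ≡ 1 [MOD k]} =>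
      ((∏ p ∈ T, (p : ℕ) : ℕ) : ℂ) ^ (-s)) (oneModProduct k s) := by
  have e : ∀ T : Finset {p : ℕ // p.Prime ∧ p ≡ 1 [MOD k]},
      ((∏ p ∈ T, (p : ℕ) : ℕ) : ℂ) ^ (-s) = ∏ p ∈ T, (p : ℂ) ^ (-s) := by
    classical
    intro T
    induction T using Finset.induction_on with
    | empty => simp
    | insert r T hr ih =>
      rw [Finset.prod_insert hr, Finset.prod_insert hr, natCast_mul_cpow, ih]
  let i : Finset {p : ℕ // p.Prime ∧ p ≡ 1 [MOD k]} → ℕ+ := fun T =>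
    ⟨∏ p ∈ T, (p : ℕ), Finset.prod_pos fun p _ => p.2.1.pos⟩
  have hi : Function.Injective i := fun T T' h =>
    prod_val_injective (fun r hr => hr.1) (congrArg (fun t : ℕ+ => (t : ℕ)) h)
  have h := (summable_pnat_cpow hs).comp_injective hi
  have h2 : Summable fun T : Finset {p : ℕ // p.Prime ∧ p ≡ 1 [MOD k]} =>
      ∏ p ∈ T, (p : ℂ) ^ (-s) := by
    refine h.congr fun T => ?_
    rw [← e]
    rfl
  rw [oneModProduct, tprod_one_add h2]
  exact hasSum_of_eq h2.hasSum e rfl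

namespace QuadData

variable {F : Type*} [Field F] [NumberField F] (S : QuadData F)

/-! ### Norms of ideals -/

/-- The norm of a prime ideal is `r` or `r²` for a prime `r`, and in the first case `r ≠ p`; so
every prime factor contributes an even exponent of `p`. -/
lemma even_factorization_absNorm (S : QuadData F) {p : ℕ} (hp : p.Prime)
    (h : ∀ P : Ideal (𝓞 F), P.absNorm ≠ p) {A : Ideal (𝓞 F)} (hA : A ≠ ⊥) :
    Even (A.absNorm.factorization p) := by
  induction A using UniqueFactorizationMonoid.induction_on_prime with
  | h₁ => exact absurd rfl hA
  | h₂ A hu =>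
    rw [Ideal.isUnit_iff.1 hu, Ideal.absNorm_top]
    simp
  | h₃ A P hA0 hP ih =>
    have h1 : Even (P.absNorm.factorization p) := by
      obtain ⟨r, hr, h2 | h2⟩ := S.prime_cases (Ideal.isPrime_of_prime hP) hP.ne_zero
      · rw [h2, hr.factorization, Finsupp.single_apply, if_neg]
        · exact Even.zero
        · rintro rfl
          exact h _ h2
      · rw [h2, S.absNorm_span_natCast, Nat.factorization_pow]
        exact ⟨r.factorization p, by simp [two_mul]⟩
    rw [map_mul, even_factorization_mul (absNorm_ne_zero hP.ne_zero) (absNorm_ne_zero hA0)]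
    exact iff_of_true h1 (ih hA0)

/-- A prime ideal `M` above `p` contains `(t - θ)(t + θ)`, hence one of the factors. If `M` were
`(p)`, then `(t ± θ)/p` would be integral, which is impossible for odd `p`. -/
lemma exists_absNorm_eq_of_dvd {p : ℕ} (hp : p.Prime) (hp2 : p ≠ 2) {t : ℤ}
    (ht : (p : ℤ) ∣ t ^ 2 - S.d) : ∃ P : Ideal (𝓞 F), P.absNorm = p := by
  have hne : Ideal.span {(p : 𝓞 F)} ≠ ⊤ := by
    intro h
    have h2 := S.absNorm_span_natCast p
    rw [h, Ideal.absNorm_top] at h2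
    have := hp.one_lt
    nlinarith
  obtain ⟨M, hM, hle⟩ := Ideal.exists_le_maximal _ hne
  have hdvd := Ideal.absNorm_dvd_absNorm_of_le hle
  rw [S.absNorm_span_natCast] at hdvd
  have hM0 : M ≠ ⊥ := by
    rintro rfl
    rw [Ideal.absNorm_bot, zero_dvd_iff] at hdvd
    exact pow_ne_zero 2 hp.ne_zero hdvd
  obtain ⟨r, hr, h | h⟩ := S.prime_cases hM.isPrime hM0
  · rw [h] at hdvd
    have := (Nat.prime_dvd_prime_iff_eq hr hp).1 (hr.dvd_of_dvd_pow hdvd)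
    exact ⟨M, by rw [h, this]⟩
  · exfalso
    rw [h, S.absNorm_span_natCast] at hdvd
    have hrp := (Nat.prime_dvd_prime_iff_eq hr hp).1 (hr.dvd_of_dvd_pow
      ((dvd_pow_self r two_ne_zero).trans hdvd))
    rw [hrp] at h
    obtain ⟨c, hc⟩ := ht
    have h1 : ((t : 𝓞 F) - S.θInt) * (t + S.θInt) ∈ M := by
      have h2 : ((t : 𝓞 F) - S.θInt) * (t + S.θInt) = p * c := by
        have h3 := congrArg (Int.cast : ℤ → 𝓞 F) hc
        push_cast at h3
        linear_combination h3 - S.θInt_sq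
      rw [h2]
      exact M.mul_mem_right _ (hle (Ideal.mem_span_singleton_self _))
    have key : ∀ ε : ℚ, ε ^ 2 = 1 → ∀ y : 𝓞 F, (t : F) + ε * S.θ = p * algebraMap (𝓞 F) F y →
        False := by
      intro ε hε y hy
      have hp0 : (p : ℚ) ≠ 0 := by exact_mod_cast hp.ne_zero
      have hp0' : (p : F) ≠ 0 := by exact_mod_cast hp.ne_zero
      obtain ⟨m, n, -, hn, -⟩ := S.exists_int_eq_two_mul (p := t / p) (q := ε / p) (by
        have : ((t / p : ℚ) : F) + ((ε / p : ℚ) : F) * S.θ = algebraMap (𝓞 F) F y := by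
          push_cast
          field_simp
          linear_combination hy
        rw [this]
        exact y.isIntegral_coe)
      -- The doubled `θ`-coordinate `n = ±2/p` is an integer, so `p² n² = 4`.
      have h4 : (p : ℤ) ∣ 4 := by
        have h5 : (4 : ℚ) = p * (p * n ^ 2) := by
          rw [← hn]
          field_simp
          linear_combination -4 * hε
        exact ⟨p * n ^ 2, by exact_mod_cast h5⟩
      have h6 : p ∣ 2 ^ 2 := by exact_mod_cast h4
      exact hp2 ((Nat.prime_dvd_prime_iff_eq hp Nat.prime_two).1 (hp.dvd_of_dvd_pow h6))
    rcases hM.isPrime.mem_or_mem h1 with h2 | h2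
    · rw [h, Ideal.mem_span_singleton] at h2
      obtain ⟨y, hy⟩ := h2
      have h3 := congrArg (algebraMap (𝓞 F) F) hy
      rw [map_sub, map_mul, map_intCast, map_natCast, S.coe_θInt] at h3
      exact key (-1) (by norm_num) y (by push_cast; linear_combination h3)
    · rw [h, Ideal.mem_span_singleton] at h2
      obtain ⟨y, hy⟩ := h2
      have h3 := congrArg (algebraMap (𝓞 F) F) hy
      rw [map_add, map_mul, map_intCast, map_natCast, S.coe_θInt] at h3
      exact key 1 (by norm_num) y (by push_cast; linear_combination h3)

section

variable {k : ℕ}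

/-- The norm attached to a self-conjugate ideal and a finite set of split primes. -/
def splitNorm (k : ℕ) (t : S.Amb × Finset {p : ℕ // p.Prime ∧ p ≡ 1 [MOD k]}) : ℕ :=
  t.1.1.absNorm * ∏ p ∈ t.2, (p : ℕ)

lemma splitNorm_ne_zero (t : S.Amb × Finset {p : ℕ // p.Prime ∧ p ≡ 1 [MOD k]}) :
    S.splitNorm k t ≠ 0 :=
  mul_ne_zero (absNorm_ne_zero t.1.2.1) (Finset.prod_ne_zero_iff.2 fun p _ => p.2.1.ne_zero)

lemma splitNorm_eq (S : QuadData F) [DecidableEq ℕ]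
    (hdisj : ∀ p ∈ ramifiedPrimes F, ¬ p ≡ 1 [MOD k]) (q : ℕ)
    {T : Finset ℕ} (hT : T ⊆ ramifiedPrimes F)
    (T' : Finset {p : ℕ // p.Prime ∧ p ≡ 1 [MOD k]}) :
    (amb q T : Ideal (𝓞 F)).absNorm * ∏ p ∈ T', (p : ℕ) =
      q ^ 2 * ∏ p ∈ T ∪ T'.map (Function.Embedding.subtype _), p := by
  rw [S.absNorm_amb hT, Finset.prod_union, Finset.prod_map, mul_assoc]
  · rfl
  · rw [Finset.disjoint_left]
    intro p hp hp'
    obtain ⟨p', -, rfl⟩ := Finset.mem_map.1 hp'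
    exact hdisj _ (hT hp) p'.2.2

/-- Unique factorization recovers `q` and the set of primes of odd exponent; the residue modulo `k`
separates its ramified members from the others. -/
lemma splitNorm_injective (hdisj : ∀ p ∈ ramifiedPrimes F, ¬ p ≡ 1 [MOD k]) :
    Function.Injective (S.splitNorm k) := by
  classical
  rintro ⟨A, T⟩ ⟨A', T'⟩ h
  obtain ⟨t, rfl⟩ := S.ambEquiv.surjective A
  obtain ⟨t', rfl⟩ := S.ambEquiv.surjective A'
  have ht := Finset.mem_powerset.1 t.2.2
  have ht' := Finset.mem_powerset.1 t'.2.2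
  have h1 := (S.splitNorm_eq hdisj t.1 ht T).symm.trans
    (h.trans (S.splitNorm_eq hdisj t'.1 ht' T'))
  have hprime : ∀ (R : Finset ℕ) (T : Finset {p : ℕ // p.Prime ∧ p ≡ 1 [MOD k]}),
      R ⊆ ramifiedPrimes F → ∀ r ∈ R ∪ T.map (Function.Embedding.subtype _), r.Prime := by
    intro R T hR r hr
    rcases Finset.mem_union.1 hr with hr | hr
    · exact (mem_ramifiedPrimes.1 (hR hr)).1
    · obtain ⟨p, -, rfl⟩ := Finset.mem_map.1 hr
      exact p.2.1
  obtain ⟨h2, h3⟩ := sq_mul_prod_injective t.1.ne_zero t'.1.ne_zero (hprime _ T ht)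
    (hprime _ T' ht') h1
  have key : ∀ (R : Finset ℕ) (T : Finset {p : ℕ // p.Prime ∧ p ≡ 1 [MOD k]}),
      R ⊆ ramifiedPrimes F →
      (R ∪ T.map (Function.Embedding.subtype _)).filter (· ≡ 1 [MOD k]) =
        T.map (Function.Embedding.subtype _) ∧
      (R ∪ T.map (Function.Embedding.subtype _)).filter (¬ · ≡ 1 [MOD k]) = R := by
    intro R T hR
    have e1 : R.filter (· ≡ 1 [MOD k]) = ∅ := Finset.filter_eq_empty_iff.2 fun r hr =>
      hdisj r (hR hr)
    have e2 : ∀ r ∈ T.map (Function.Embedding.subtype _), r ≡ 1 [MOD k] := by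
      intro r hr
      obtain ⟨p, -, rfl⟩ := Finset.mem_map.1 hr
      exact p.2.2
    rw [Finset.filter_union, Finset.filter_union, e1, Finset.filter_true_of_mem e2,
      Finset.filter_true_of_mem fun r hr => hdisj r (hR hr), Finset.empty_union]
    refine ⟨rfl, ?_⟩
    rw [Finset.filter_eq_empty_iff.2 fun r hr => not_not.2 (e2 r hr), Finset.union_empty]
  have h4 : t = t' := by
    refine Prod.ext (PNat.eq h2) (Subtype.ext ?_)
    rw [← (key _ T ht).2, h3, (key _ T' ht').2]
  have h5 : T = T' := by
    apply Finset.map_injective (Function.Embedding.subtype _)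
    rw [← (key _ T ht).1, h3, (key _ T' ht').1]
  rw [h4, h5]

/-- Write a norm as `b² a` with `a` square-free. Primes dividing `a` occur to an odd power, so by
`even_factorization_absNorm` they are norms themselves, hence ramified or `≡ 1`. -/
lemma exists_splitNorm_eq_iff
    (hk : ∀ p : ℕ, p.Prime → ((∃ P : Ideal (𝓞 F), P.absNorm = p) ↔
      p ∈ ramifiedPrimes F ∨ p ≡ 1 [MOD k]))
    (hdisj : ∀ p ∈ ramifiedPrimes F, ¬ p ≡ 1 [MOD k]) {m : ℕ} (hm : m ≠ 0) :
    (∃ t, S.splitNorm k t = m) ↔ ∃ A : Ideal (𝓞 F), A.absNorm = m := by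
  classical
  constructor
  · rintro ⟨⟨A, T⟩, rfl⟩
    choose! P hP using fun (p : ℕ) (hp : p.Prime ∧ p ≡ 1 [MOD k]) => (hk p hp.1).2 (Or.inr hp.2)
    refine ⟨A.1 * ∏ p ∈ T, P p, ?_⟩
    rw [map_mul, map_prod]
    exact congrArg _ (Finset.prod_congr rfl fun p _ => hP _ p.2)
  · rintro ⟨A, rfl⟩
    have hA : A ≠ ⊥ := by
      rintro rfl
      exact hm Ideal.absNorm_bot
    obtain ⟨a, b, ha, hb, hab, hsq⟩ := Nat.sq_mul_squarefree_of_pos (Nat.pos_of_ne_zero hm)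
    have hpr : ∀ r ∈ a.primeFactors, r ∈ ramifiedPrimes F ∨ r ≡ 1 [MOD k] := by
      intro r hr
      have hr' := Nat.prime_of_mem_primeFactors hr
      rw [← hk r hr']
      by_contra h
      have h1 := S.even_factorization_absNorm hr' (by simpa using h) hA
      rw [← hab, ← Nat.prod_primeFactors_of_squarefree hsq, factorization_sq_mul_prod hb.ne'
        fun p hp => Nat.prime_of_mem_primeFactors hp, if_pos hr] at h1
      simp at h1
    let T := a.primeFactors.filter (· ∈ ramifiedPrimes F)
    let T' : Finset {p : ℕ // p.Prime ∧ p ≡ 1 [MOD k]} := a.primeFactors.subtype _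
    have hT : T ⊆ ramifiedPrimes F := fun r hr => (Finset.mem_filter.1 hr).2
    refine ⟨(S.ambEquiv (⟨b, hb⟩, ⟨T, Finset.mem_powerset.2 hT⟩), T'), ?_⟩
    refine (S.splitNorm_eq hdisj b hT T').trans ?_
    rw [← hab]
    congr 1
    conv_rhs => rw [← Nat.prod_primeFactors_of_squarefree hsq]
    refine Finset.prod_congr ?_ fun _ _ => rfl
    ext r
    rw [Finset.mem_union, Finset.subtype_map, Finset.mem_filter, Finset.mem_filter]
    constructor
    · rintro (h | h) <;> exact h.1
    · intro h
      rcases hpr r h with h1 | h1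
      · exact Or.inl ⟨h, h1⟩
      · exact Or.inr ⟨h, Nat.prime_of_mem_primeFactors h, h1⟩

/-- With a single class the coefficient at `m` is 1 or 0 according to whether `m` is the norm of an
ideal. Every norm is `splitNorm` of exactly one pair, and the sum over pairs factors. -/
lemma classSeries_of_trivial {I : Ideal (𝓞 F)} (hI : I ≠ ⊥) (hcl : ∀ g : ClassGroup (𝓞 F), g = 1)
    (hk : ∀ p : ℕ, p.Prime → ((∃ P : Ideal (𝓞 F), P.absNorm = p) ↔
      p ∈ ramifiedPrimes F ∨ p ≡ 1 [MOD k]))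
    (hdisj : ∀ p ∈ ramifiedPrimes F, ¬ p ≡ 1 [MOD k]) {s : ℂ} (hs : 2 < s.re) :
    classSeries (selfConjClasses S.conj I) s =
      riemannZeta (2 * s) * ramifiedProduct F s * oneModProduct k s := by
  classical
  have h1 := hasSum_mul_complex (S.hasSum_amb hs) (hasSum_oneModProduct k (s := s) (by linarith))
  have h2 : HasSum (fun t => (S.splitNorm k t : ℂ) ^ (-s) * 1)
      (riemannZeta (2 * s) * ramifiedProduct F s * oneModProduct k s) := by
    refine hasSum_of_eq h1 (fun t => ?_) rfl
    rw [splitNorm, natCast_mul_cpow, mul_one]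
  rw [← h2.tsum_eq, classSeries]
  refine (hasSum_fiberwise_term S.splitNorm_ne_zero h2.summable fun m hm => ?_).LSeries_eq
  by_cases hA : ∃ A : Ideal (𝓞 F), A.absNorm = m
  · have h3 : selfConjClasses S.conj I m = {1} := by
      rw [S.selfConjClasses_eq]
      ext g
      rw [hcl g]
      simp only [Set.mem_inter_iff, Set.mem_ofPred_eq, inv_one, and_true, Set.mem_singleton_iff,
        iff_true]
      obtain ⟨A, hA⟩ := hA
      have hA0 : A ≠ ⊥ := by
        rintro rfl
        exact hm (hA.symm.trans Ideal.absNorm_bot)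
      refine ⟨⟨I * A, mem_nonZeroDivisors_iff_ne_zero.2 (mul_ne_zero hI hA0)⟩,
        (mem_idealsOfIndex hI).2 ⟨Ideal.mul_le_left, ?_⟩, hcl _⟩
      rw [map_mul, hA, mul_comm]
    rw [h3, Set.ncard_singleton]
    obtain ⟨t, ht⟩ := (S.exists_splitNorm_eq_iff hk hdisj hm).2 hA
    have : Unique {t // S.splitNorm k t = m} :=
      { default := ⟨t, ht⟩
        uniq := fun t' => Subtype.ext (S.splitNorm_injective hdisj (t'.2.trans ht.symm)) }
    rw [Nat.cast_one]
    exact hasSum_unique _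
  · have h3 : selfConjClasses S.conj I m = ∅ := by
      rw [S.selfConjClasses_eq, Set.eq_empty_iff_forall_notMem]
      rintro g ⟨⟨J, hJ, -⟩, -⟩
      apply hA
      obtain ⟨A, h4⟩ := Ideal.dvd_iff_le.2 hJ.1
      refine ⟨A, ?_⟩
      have h5 := ((mem_idealsOfIndex hI).1 hJ).2
      rw [h4, map_mul, mul_comm] at h5
      exact Nat.eq_of_mul_eq_mul_right (Nat.pos_of_ne_zero (absNorm_ne_zero hI)) h5
    rw [h3, Set.ncard_empty, Nat.cast_zero]
    have : IsEmpty {t // S.splitNorm k t = m} :=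
      ⟨fun t => hA ((S.exists_splitNorm_eq_iff hk hdisj hm).1 ⟨t.1, t.2⟩)⟩
    exact hasSum_empty

lemma exists_norm_eq_of_trivial (S : QuadData F) (hcl : ∀ g : ClassGroup (𝓞 F), g = 1) {p : ℕ}
    (hp : p ≠ 0) (h : ∃ P : Ideal (𝓞 F), P.absNorm = p) :
    ∃ x : 𝓞 F, Algebra.norm ℤ x = p := by
  obtain ⟨P, rfl⟩ := h
  have hP : P ≠ ⊥ := by
    rintro rfl
    exact hp Ideal.absNorm_bot
  obtain ⟨x, hx⟩ := (ClassGroup.mk0_eq_one_iff (mem_nonZeroDivisors_iff_ne_zero.2 hP)).1 (hcl _)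
  refine ⟨x, ?_⟩
  rw [hx, Ideal.submodule_span_eq, Ideal.absNorm_span_singleton,
    Int.natAbs_of_nonneg (S.intNorm_nonneg x)]

/-- An ideal of norm `p` is principal, which makes `p` a sum of two squares. Conversely, `-1` is a
square modulo `p ≡ 1`. -/
lemma norm_iff_of_eq_neg_one (hd : S.d = -1) {p : ℕ} (hp : p.Prime) :
    (∃ P : Ideal (𝓞 F), P.absNorm = p) ↔ p ∈ ramifiedPrimes F ∨ p ≡ 1 [MOD 4] := by
  have hcl := S.classGroup_eq_one (Or.inl hd)
  have hfact : Fact p.Prime := ⟨hp⟩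
  constructor
  · intro h
    obtain ⟨x, hx⟩ := S.exists_norm_eq_of_trivial hcl hp.ne_zero h
    obtain ⟨m, n, -, hN⟩ := S.exists_θ_coord (by rw [hd]; decide) x
    rw [hx, hd] at hN
    rcases hp.eq_two_or_odd with rfl | hodd
    · exact Or.inl (S.two_mem_ramifiedPrimes (by rw [hd]; rfl))
    · right
      have h1 := sq_emod_four m
      have h2 := sq_emod_four n
      change p % 4 = 1 % 4
      omega
  · rintro (h | h)
    · exact ⟨gam p, S.absNorm_gam h⟩
    · have h4 : p % 4 = 1 := h
      obtain ⟨y, hy⟩ := ZMod.exists_sq_eq_neg_one_iff.2 (by omega : p % 4 ≠ 3)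
      obtain ⟨t, rfl⟩ := ZMod.intCast_surjective y
      refine S.exists_absNorm_eq_of_dvd hp (by rintro rfl; omega) (t := t) ?_
      rw [← ZMod.intCast_zmod_eq_zero_iff_dvd, hd]
      push_cast
      linear_combination -hy

/-- If `x` is a primitive cube root of unity modulo `p`, then `(2x + 1)² = 4(x² + x + 1) - 3 = -3`.
-/
lemma exists_sq_eq_neg_three {p : ℕ} [Fact p.Prime] (h : p % 3 = 1) :
    ∃ y : ZMod p, y ^ 2 = -3 := by
  have hp : p.Prime := Fact.out
  have h3 : 3 ∣ Nat.card (ZMod p)ˣ := by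
    rw [Nat.card_eq_fintype_card, ZMod.card_units]
    omega
  have : Fact (Nat.Prime 3) := ⟨Nat.prime_three⟩
  obtain ⟨x, hx⟩ := exists_prime_orderOf_dvd_card' 3 h3
  have hx3 : (x : ZMod p) ^ 3 = 1 := by
    rw [← hx, ← Units.val_pow_eq_pow_val, pow_orderOf_eq_one, Units.val_one]
  have hx1 : (x : ZMod p) - 1 ≠ 0 := by
    intro h1
    have h2 : x = 1 := Units.ext (sub_eq_zero.1 h1)
    rw [h2, orderOf_one] at hx
    omega
  refine ⟨2 * x + 1, ?_⟩
  apply mul_left_cancel₀ hx1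
  linear_combination 4 * hx3

/-- A generator of an ideal of norm `p` gives `4p = m² + 3n²`, so `p` is a square modulo 3.
Conversely, `-3` is a square modulo `p ≡ 1`. -/
lemma norm_iff_of_eq_neg_three (hd : S.d = -3) {p : ℕ} (hp : p.Prime) :
    (∃ P : Ideal (𝓞 F), P.absNorm = p) ↔ p ∈ ramifiedPrimes F ∨ p ≡ 1 [MOD 3] := by
  have hcl := S.classGroup_eq_one (Or.inr hd)
  have hfact : Fact p.Prime := ⟨hp⟩
  constructor
  · intro h
    obtain ⟨x, hx⟩ := S.exists_norm_eq_of_trivial hcl hp.ne_zero h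
    obtain ⟨a, b, hab⟩ := S.exists_coord (algebraMap (𝓞 F) F x)
    obtain ⟨m, n, hm, hn, -⟩ := S.exists_int_eq_two_mul (p := a) (q := b) (by
      rw [← hab]
      exact x.isIntegral_coe)
    have hN : 4 * (p : ℤ) = m ^ 2 + 3 * n ^ 2 := by
      have h1 := S.intNorm_eq x
      rw [hab, S.mul_conj_coord, hx, hd] at h1
      have h2 : (p : ℚ) = a ^ 2 - ((-3 : ℤ) : ℚ) * b ^ 2 := by exact_mod_cast h1
      have h3 : 4 * (p : ℚ) = m ^ 2 + 3 * n ^ 2 := by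
        rw [← hm, ← hn, h2]
        push_cast
        ring
      exact_mod_cast h3
    by_cases h3 : p % 3 = 0
    · left
      have := (Nat.prime_dvd_prime_iff_eq Nat.prime_three hp).1 (Nat.dvd_of_mod_eq_zero h3)
      rw [mem_ramifiedPrimes, S.discr_eq, hd, ← this]
      exact ⟨Nat.prime_three, by decide⟩
    · right
      have h4 : m ^ 2 % 3 = 0 ∨ m ^ 2 % 3 = 1 := by
        have : m % 3 = 0 ∨ m % 3 = 1 ∨ m % 3 = 2 := by omega
        rcases this with h | h | h <;> simp [pow_two, Int.mul_emod, h]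
      change p % 3 = 1 % 3
      omega
  · rintro (h | h)
    · exact ⟨gam p, S.absNorm_gam h⟩
    · have h3 : p % 3 = 1 := h
      obtain ⟨y, hy⟩ := exists_sq_eq_neg_three h3
      obtain ⟨t, rfl⟩ := ZMod.intCast_surjective y
      refine S.exists_absNorm_eq_of_dvd hp (by rintro rfl; omega) (t := t) ?_
      rw [← ZMod.intCast_zmod_eq_zero_iff_dvd, hd]
      push_cast
      linear_combination hy

lemma classSeries_of_eq_neg_one (hd : S.d = -1) {I : Ideal (𝓞 F)} (hI : I ≠ ⊥) {s : ℂ}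
    (hs : 2 < s.re) : classSeries (selfConjClasses S.conj I) s =
      riemannZeta (2 * s) * ramifiedProduct F s * oneModProduct 4 s := by
  refine S.classSeries_of_trivial hI (S.classGroup_eq_one (Or.inl hd))
    (fun p hp => S.norm_iff_of_eq_neg_one hd hp) (fun p hp h => ?_) hs
  obtain ⟨hp1, hp2⟩ := mem_ramifiedPrimes.1 hp
  rw [S.discr_eq, hd] at hp2
  have h1 : p ∣ 2 ^ 2 := by
    have : (p : ℤ) ∣ 4 := by simpa using hp2
    exact_mod_cast this
  have h2 := (Nat.prime_dvd_prime_iff_eq hp1 Nat.prime_two).1 (hp1.dvd_of_dvd_pow h1)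
  rw [h2] at h
  exact absurd h (by decide)

lemma classSeries_of_eq_neg_three (hd : S.d = -3) {I : Ideal (𝓞 F)} (hI : I ≠ ⊥) {s : ℂ}
    (hs : 2 < s.re) : classSeries (selfConjClasses S.conj I) s =
      riemannZeta (2 * s) * ramifiedProduct F s * oneModProduct 3 s := by
  refine S.classSeries_of_trivial hI (S.classGroup_eq_one (Or.inr hd))
    (fun p hp => S.norm_iff_of_eq_neg_three hd hp) (fun p hp h => ?_) hs
  obtain ⟨hp1, hp2⟩ := mem_ramifiedPrimes.1 hp
  rw [S.discr_eq, hd] at hp2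
  have h1 : p ∣ 3 := by
    have : (p : ℤ) ∣ 3 := by simpa using hp2
    exact_mod_cast this
  have h2 := (Nat.prime_dvd_prime_iff_eq hp1 Nat.prime_three).1 h1
  rw [h2] at h
  exact absurd h (by decide)

end

end QuadData

end SubformZeta

end


/-! ### Isometries as maps of the field -/

open scoped NumberField nonZeroDivisors

noncomputable section

namespace SubformZeta

open Module

variable {V : Type*} [AddCommGroup V] [Module ℚ V]

lemma mem_orthogonalGroup_iff (Q : QuadraticForm ℚ V) (σ : V ≃ₗ[ℚ] V) :
    σ ∈ orthogonalGroup Q ↔ ∀ v, Q (σ v) = Q v := by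
  constructor
  · intro h v
    have h1 : QuadraticMap.polar Q (σ v) (σ v) / 2 = QuadraticMap.polar Q v v / 2 := h v v
    rw [QuadraticMap.polar_self, QuadraticMap.polar_self] at h1
    simpa using h1
  · intro h x y
    simp only [bil, QuadraticMap.polar, ← map_add, h]

namespace QuadData

variable {F : Type*} [Field F] [NumberField F] (S : QuadData F)

lemma mem_U_iff_norm {u : F} : u ∈ S.U ↔ Algebra.norm ℚ u = 1 := by
  refine ⟨S.norm_U, fun h => ?_⟩
  change u * S.conj u = 1
  rw [← S.norm_eq, h, Rat.cast_one]

lemma det_conj : LinearMap.det S.conj.toLinearMap = -1 := by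
  rw [← LinearMap.det_toMatrix S.basis, Matrix.det_fin_two]
  simp [LinearMap.toMatrix_apply, basis_zero, basis_one, S.conj_θ]
  have h0 := congrArg (fun x => x 0) (S.basis.repr_self 0)
  have h1 := congrArg (fun x => x 1) (S.basis.repr_self 0)
  have h2 := congrArg (fun x => x 1) (S.basis.repr_self 1)
  simp only [basis_zero, basis_one] at h0 h1 h2
  rw [h0, h1, h2]
  simp

/-- A linear map that preserves the norm is a rotation or a reflection. -/
lemma exists_of_norm_map_eq {g : F →ₗ[ℚ] F}
    (hg : ∀ x, Algebra.norm ℚ (g x) = Algebra.norm ℚ x) :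
    ∃ u ∈ S.U, (∀ x, g x = u * x) ∨ ∀ x, g x = u * S.conj x := by
  have hu : g 1 ∈ S.U := by rw [mem_U_iff_norm, hg, map_one]
  have hu0 := S.U_ne_zero hu
  have hinv : Algebra.norm ℚ (g 1)⁻¹ = 1 := S.norm_U (S.inv_mem_U hu)
  have hlin : ∀ p q : ℚ, g (p + q * S.θ) = p * g 1 + q * g S.θ := by
    intro p q
    have : (p : F) + q * S.θ = p • (1 : F) + q • S.θ := by
      rw [Rat.smul_def, Rat.smul_def, mul_one]
    rw [this, map_add, map_smul, map_smul, Rat.smul_def, Rat.smul_def]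
  obtain ⟨p, q, hpq⟩ := S.exists_coord ((g 1)⁻¹ * g S.θ)
  have hgθ : g S.θ = g 1 * (p + q * S.θ) := by
    rw [← hpq, mul_inv_cancel_left₀ hu0]
  -- After division by `g 1`, the norms of the images of `θ` and `1 + θ` give `p² - dq² = -d` and
  -- `(1 + p)² - dq² = 1 - d`, so `p = 0` and `q = ±1`.
  have h1 : Algebra.norm ℚ ((p : F) + q * S.θ) = - S.d := by
    rw [← hpq, map_mul, hinv, one_mul, hg]
    have := S.norm_coord 0 1
    simpa using this
  have h2 : Algebra.norm ℚ (((1 + p : ℚ) : F) + q * S.θ) = 1 - S.d := by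
    have h3 : ((1 + p : ℚ) : F) + q * S.θ = (g 1)⁻¹ * g (((1 : ℚ) : F) + (1 : ℚ) * S.θ) := by
      rw [hlin, hgθ]
      push_cast
      field_simp
      ring
    rw [h3, map_mul, hinv, one_mul, hg, S.norm_coord]
    norm_num
  rw [S.norm_coord] at h1 h2
  have hp : p = 0 := by linarith
  have hd : (S.d : ℚ) ≠ 0 := by exact_mod_cast S.d_ne_zero
  have hq : q ^ 2 = 1 := by
    rw [hp] at h1
    have : (S.d : ℚ) * (q ^ 2 - 1) = 0 := by linarith
    have := (mul_eq_zero.1 this).resolve_left hd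
    linarith
  refine ⟨g 1, hu, ?_⟩
  rcases (sq_eq_sq_iff_eq_or_eq_neg (a := q) (b := 1)).1 (by rw [hq, one_pow]) with h | h
  · left
    intro x
    obtain ⟨m, n, rfl⟩ := S.exists_coord x
    rw [hlin, hgθ, hp, h]
    push_cast
    ring
  · right
    intro x
    obtain ⟨m, n, rfl⟩ := S.exists_coord x
    rw [hlin, hgθ, hp, h, S.conj_coord]
    push_cast
    ring

variable {Q : QuadraticForm ℚ V} (φ : V ≃ₗ[ℚ] F)

lemma det_eq_of_conj {σ : V ≃ₗ[ℚ] V} {g : F →ₗ[ℚ] F} (h : ∀ v, φ (σ v) = g (φ v)) :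
    LinearMap.det (σ : V →ₗ[ℚ] V) = LinearMap.det g := by
  rw [← LinearMap.det_conj (σ : V →ₗ[ℚ] V) φ]
  congr 1
  ext x
  simp [h]

lemma det_of_rot {σ : V ≃ₗ[ℚ] V} {u : F} (hu : u ∈ S.U) (h : ∀ v, φ (σ v) = u * φ v) :
    LinearMap.det (σ : V →ₗ[ℚ] V) = 1 := by
  rw [det_eq_of_conj φ (g := Algebra.lmul ℚ F u) h, ← Algebra.norm_apply, S.norm_U hu]

lemma det_of_refl {σ : V ≃ₗ[ℚ] V} {u : F} (hu : u ∈ S.U)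
    (h : ∀ v, φ (σ v) = u * S.conj (φ v)) : LinearMap.det (σ : V →ₗ[ℚ] V) = -1 := by
  rw [det_eq_of_conj φ (g := Algebra.lmul ℚ F u ∘ₗ S.conj.toLinearMap) h, LinearMap.det_comp,
    ← Algebra.norm_apply, S.norm_U hu, S.det_conj, one_mul]

lemma mem_rotationGroup_iff_det {σ : V ≃ₗ[ℚ] V} : σ ∈ rotationGroup Q ↔
    σ ∈ orthogonalGroup Q ∧ LinearMap.det (σ : V →ₗ[ℚ] V) = 1 := by
  refine and_congr_right fun _ => ?_
  change LinearEquiv.det σ = 1 ↔ _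
  rw [← Units.val_inj, LinearEquiv.coe_det, Units.val_one]

lemma mem_orthogonalGroup_iff_norm {α : ℚ} (hα : α ≠ 0)
    (hφ : ∀ v, Algebra.norm ℚ (φ v) = α * Q v) {σ : V ≃ₗ[ℚ] V} :
    σ ∈ orthogonalGroup Q ↔ ∀ v, Algebra.norm ℚ (φ (σ v)) = Algebra.norm ℚ (φ v) := by
  rw [mem_orthogonalGroup_iff]
  simp only [hφ, mul_right_inj' hα]

lemma mem_orthogonalGroup_of_rot {α : ℚ} (hα : α ≠ 0)
    (hφ : ∀ v, Algebra.norm ℚ (φ v) = α * Q v) {σ : V ≃ₗ[ℚ] V} {u : F} (hu : u ∈ S.U)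
    (h : ∀ v, φ (σ v) = u * φ v) : σ ∈ orthogonalGroup Q := by
  rw [mem_orthogonalGroup_iff_norm φ hα hφ]
  intro v
  rw [h, map_mul, S.norm_U hu, one_mul]

lemma norm_conj (x : F) : Algebra.norm ℚ (S.conj x) = Algebra.norm ℚ x := by
  have h := S.norm_eq (S.conj x)
  rw [S.conj_conj, mul_comm, ← S.norm_eq] at h
  exact_mod_cast h

lemma mem_orthogonalGroup_of_refl {α : ℚ} (hα : α ≠ 0)
    (hφ : ∀ v, Algebra.norm ℚ (φ v) = α * Q v) {σ : V ≃ₗ[ℚ] V} {u : F} (hu : u ∈ S.U)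
    (h : ∀ v, φ (σ v) = u * S.conj (φ v)) : σ ∈ orthogonalGroup Q := by
  rw [mem_orthogonalGroup_iff_norm φ hα hφ]
  intro v
  rw [h, map_mul, S.norm_U hu, one_mul, S.norm_conj]

lemma exists_of_mem_orthogonalGroup {α : ℚ} (hα : α ≠ 0)
    (hφ : ∀ v, Algebra.norm ℚ (φ v) = α * Q v) {σ : V ≃ₗ[ℚ] V} (hσ : σ ∈ orthogonalGroup Q) :
    ∃ u ∈ S.U, (∀ v, φ (σ v) = u * φ v) ∨ ∀ v, φ (σ v) = u * S.conj (φ v) := by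
  rw [mem_orthogonalGroup_iff_norm φ hα hφ] at hσ
  obtain ⟨u, hu, h⟩ := S.exists_of_norm_map_eq
    (g := φ.toLinearMap ∘ₗ σ.toLinearMap ∘ₗ φ.symm.toLinearMap)
    (fun x => by simpa using hσ (φ.symm x))
  refine ⟨u, hu, h.imp (fun h v => ?_) fun h v => ?_⟩ <;> simpa using h (φ v)

lemma mem_rotationGroup_iff {α : ℚ} (hα : α ≠ 0)
    (hφ : ∀ v, Algebra.norm ℚ (φ v) = α * Q v) {σ : V ≃ₗ[ℚ] V} :
    σ ∈ rotationGroup Q ↔ ∃ u ∈ S.U, ∀ v, φ (σ v) = rotHom u (φ v) := by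
  rw [mem_rotationGroup_iff_det]
  constructor
  · rintro ⟨h1, h2⟩
    obtain ⟨u, hu, h | h⟩ := S.exists_of_mem_orthogonalGroup φ hα hφ h1
    · exact ⟨u, hu, h⟩
    · rw [S.det_of_refl φ hu h] at h2
      norm_num at h2
  · rintro ⟨u, hu, h⟩
    exact ⟨S.mem_orthogonalGroup_of_rot φ hα hφ hu h, S.det_of_rot φ hu h⟩

lemma mem_reflectionSet_iff {α : ℚ} (hα : α ≠ 0)
    (hφ : ∀ v, Algebra.norm ℚ (φ v) = α * Q v) {σ : V ≃ₗ[ℚ] V} :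
    σ ∈ reflectionSet Q ↔ ∃ u ∈ S.U, ∀ v, φ (σ v) = S.reflHom u (φ v) := by
  constructor
  · rintro ⟨h1, h2⟩
    obtain ⟨u, hu, h | h⟩ := S.exists_of_mem_orthogonalGroup φ hα hφ h1
    · exact absurd ((S.mem_rotationGroup_iff φ hα hφ).2 ⟨u, hu, h⟩) h2
    · exact ⟨u, hu, h⟩
  · rintro ⟨u, hu, h⟩
    refine ⟨S.mem_orthogonalGroup_of_refl φ hα hφ hu h, fun h2 => ?_⟩
    have h3 := (mem_rotationGroup_iff_det.1 h2).2
    rw [S.det_of_refl φ hu h] at h3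
    norm_num at h3

lemma abs_det_eq_one (S : QuadData F) {α : ℚ} (hα : α ≠ 0) (hφ : ∀ v, Algebra.norm ℚ (φ v) = α * Q v)
    {σ : V ≃ₗ[ℚ] V} (hσ : σ ∈ orthogonalGroup Q) : |LinearMap.det (σ : V →ₗ[ℚ] V)| = 1 := by
  obtain ⟨u, hu, h | h⟩ := S.exists_of_mem_orthogonalGroup φ hα hφ hσ
  · rw [S.det_of_rot φ hu h, abs_one]
  · rw [S.det_of_refl φ hu h, abs_neg, abs_one]

/-! ### Transport of sublattices -/

/-- The image of a lattice under a linear isomorphism. -/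
abbrev transport (φ : V ≃ₗ[ℚ] F) (K : AddSubgroup V) : AddSubgroup F :=
  K.map (φ : V →ₗ[ℚ] F).toAddMonoidHom

lemma transport_injective : Function.Injective (transport φ) :=
  AddSubgroup.map_injective φ.injective

lemma transport_le_iff {K K' : AddSubgroup V} : transport φ K ≤ transport φ K' ↔ K ≤ K' :=
  AddSubgroup.map_le_map_iff_of_injective φ.injective

lemma relIndex_transport (K K' : AddSubgroup V) :
    (transport φ K).relIndex (transport φ K') = K.relIndex K' :=
  AddSubgroup.relIndex_map_map_of_injective _ _ φ.injective

lemma transport_image {σ : V ≃ₗ[ℚ] V} {g : F →+ F} (h : ∀ v, φ (σ v) = g (φ v))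
    (K : AddSubgroup V) : transport φ (image σ K) = (transport φ K).map g := by
  rw [transport, transport, image, AddSubgroup.map_map, AddSubgroup.map_map]
  congr 1
  ext v
  exact h v

/-- Sublattices of `L` correspond to sublattices of its image. -/
def subEquiv (φ : V ≃ₗ[ℚ] F) {L : AddSubgroup V} {M : AddSubgroup F} (h : transport φ L = M) :
    Sub L ≃ Lat (fun _ => True) M where
  toFun K := ⟨transport φ K.1, by
    rw [← h, transport_le_iff, relIndex_transport]
    exact ⟨K.2, trivial⟩⟩
  invFun K := ⟨K.1.comap (φ : V →ₗ[ℚ] F).toAddMonoidHom, by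
    have e := AddSubgroup.map_comap_eq_self_of_surjective
      (f := (φ : V →ₗ[ℚ] F).toAddMonoidHom) φ.surjective K.1
    rw [← transport_le_iff φ, ← relIndex_transport φ, h, transport, e]
    exact K.2.1⟩
  left_inv K := Subtype.ext (AddSubgroup.comap_map_eq_self_of_injective φ.injective K.1)
  right_inv K := Subtype.ext (AddSubgroup.map_comap_eq_self_of_surjective φ.surjective K.1)

lemma relIndex_subEquiv {L : AddSubgroup V} {M : AddSubgroup F} (h : transport φ L = M)
    (K : Sub L) : (subEquiv φ h K).1.relIndex M = K.1.relIndex L := by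
  subst h
  exact relIndex_transport φ _ _

/-- Isometries of one type correspond to elements of norm one. -/
lemma ncard_isometries {P : Set (V ≃ₗ[ℚ] V)} {T : F → F →+ F} (hT : ∀ u, T u 1 = u)
    (hP : ∀ σ, σ ∈ P ↔ ∃ u ∈ S.U, ∀ v, φ (σ v) = T u (φ v))
    (hex : ∀ u ∈ S.U, ∃ σ : V ≃ₗ[ℚ] V, ∀ v, φ (σ v) = T u (φ v))
    {A : AddSubgroup V → Prop} {B : AddSubgroup F → Prop}
    (hAB : ∀ M, A M ↔ B (transport φ M)) (K : AddSubgroup V) :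
    {σ | σ ∈ P ∧ A (image σ K)}.ncard = {u | u ∈ S.U ∧ B ((transport φ K).map (T u))}.ncard ∧
      ({u | u ∈ S.U ∧ B ((transport φ K).map (T u))}.Finite →
        {σ | σ ∈ P ∧ A (image σ K)}.Finite) := by
  -- The parameter `u` is recovered as the image of 1.
  have key : ∀ σ ∈ P, φ (σ (φ.symm 1)) ∈ S.U ∧
      ∀ v, φ (σ v) = T (φ (σ (φ.symm 1))) (φ v) := by
    intro σ hσ
    obtain ⟨u, hu, h⟩ := (hP σ).1 hσ
    have : φ (σ (φ.symm 1)) = u := by rw [h, φ.apply_symm_apply, hT]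
    rw [this]
    exact ⟨hu, h⟩
  have hinj : Set.InjOn (fun σ : V ≃ₗ[ℚ] V => φ (σ (φ.symm 1)))
      {σ | σ ∈ P ∧ A (image σ K)} := by
    intro σ hσ τ hτ h
    ext v
    apply φ.injective
    rw [(key σ hσ.1).2, (key τ hτ.1).2]
    exact congrArg (fun u => T u (φ v)) h
  have himg : (fun σ : V ≃ₗ[ℚ] V => φ (σ (φ.symm 1))) '' {σ | σ ∈ P ∧ A (image σ K)} =
      {u | u ∈ S.U ∧ B ((transport φ K).map (T u))} := by
    ext u
    constructor
    · rintro ⟨σ, ⟨hσ, hA⟩, rfl⟩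
      refine ⟨(key σ hσ).1, ?_⟩
      rw [← transport_image φ (key σ hσ).2, ← hAB]
      exact hA
    · rintro ⟨hu, hB⟩
      obtain ⟨σ, h⟩ := hex u hu
      refine ⟨σ, ⟨(hP σ).2 ⟨u, hu, h⟩, ?_⟩, ?_⟩
      · rwa [hAB, transport_image φ h]
      · simp only [h, φ.apply_symm_apply, hT]
  rw [← himg, hinj.ncard_image]
  exact ⟨rfl, fun h => Set.Finite.of_finite_image h hinj⟩

lemma exists_rot {u : F} (hu : u ∈ S.U) : ∃ σ : V ≃ₗ[ℚ] V, ∀ v, φ (σ v) = rotHom u (φ v) :=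
  ⟨φ.trans (((LinearEquiv.smulOfNeZero F F u (S.U_ne_zero hu)).restrictScalars ℚ).trans φ.symm),
    fun v => by simp⟩

lemma exists_refl {u : F} (hu : u ∈ S.U) :
    ∃ σ : V ≃ₗ[ℚ] V, ∀ v, φ (σ v) = S.reflHom u (φ v) :=
  ⟨(φ.trans S.conj.toLinearEquiv).trans
    (((LinearEquiv.smulOfNeZero F F u (S.U_ne_zero hu)).restrictScalars ℚ).trans φ.symm),
    fun v => by simp [reflHom_apply]⟩

section Counts

variable {L : AddSubgroup V} {I : Ideal (𝓞 F)}

lemma ncard_stabSet_rot {α : ℚ} (hα : α ≠ 0) (hφ : ∀ v, Algebra.norm ℚ (φ v) = α * Q v)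
    (K : AddSubgroup V) : (stabSet (rotationGroup Q : Set (V ≃ₗ[ℚ] V)) K).ncard =
      (S.stabRot (transport φ K)).ncard :=
  (S.ncard_isometries φ (T := rotHom) (fun u => by simp)
    (fun σ => S.mem_rotationGroup_iff φ hα hφ) (fun u hu => S.exists_rot φ hu)
    (A := fun M => M = K) (B := fun M => M = transport φ K)
    (fun M => (transport_injective φ).eq_iff.symm) K).1

lemma ncard_stabSet_refl {α : ℚ} (hα : α ≠ 0) (hφ : ∀ v, Algebra.norm ℚ (φ v) = α * Q v)
    (K : AddSubgroup V) : (stabSet (reflectionSet Q) K).ncard =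
      (S.stabRefl (transport φ K)).ncard :=
  (S.ncard_isometries φ (T := S.reflHom) (fun u => by simp [reflHom_apply])
    (fun σ => S.mem_reflectionSet_iff φ hα hφ) (fun u hu => S.exists_refl φ hu)
    (A := fun M => M = K) (B := fun M => M = transport φ K)
    (fun M => (transport_injective φ).eq_iff.symm) K).1

lemma embSet_rot {α : ℚ} (hα : α ≠ 0) (hφ : ∀ v, Algebra.norm ℚ (φ v) = α * Q v)
    (hLI : transport φ L = toLattice I) (K : AddSubgroup V) :
    (embSet (rotationGroup Q : Set (V ≃ₗ[ℚ] V)) L K).ncard =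
      (S.embRot I (transport φ K)).ncard ∧ ((S.embRot I (transport φ K)).Finite →
        (embSet (rotationGroup Q : Set (V ≃ₗ[ℚ] V)) L K).Finite) :=
  S.ncard_isometries φ (T := rotHom) (fun u => by simp)
    (fun σ => S.mem_rotationGroup_iff φ hα hφ) (fun u hu => S.exists_rot φ hu)
    (A := fun M => M ≤ L) (B := fun M => M ≤ toLattice I)
    (fun M => by rw [← hLI, transport_le_iff]) K

lemma embSet_refl {α : ℚ} (hα : α ≠ 0) (hφ : ∀ v, Algebra.norm ℚ (φ v) = α * Q v)
    (hLI : transport φ L = toLattice I) (K : AddSubgroup V) :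
    (embSet (reflectionSet Q) L K).ncard =
      (S.embRefl I (transport φ K)).ncard ∧ ((S.embRefl I (transport φ K)).Finite →
        (embSet (reflectionSet Q) L K).Finite) :=
  S.ncard_isometries φ (T := S.reflHom) (fun u => by simp [reflHom_apply])
    (fun σ => S.mem_reflectionSet_iff φ hα hφ) (fun u hu => S.exists_refl φ hu)
    (A := fun M => M ≤ L) (B := fun M => M ≤ toLattice I)
    (fun M => by rw [← hLI, transport_le_iff]) K

end Counts

end QuadData

end SubformZeta

end


/-! ### Transfer from `V` to `F`, and the ideal of a quadratic form -/

open scoped NumberField nonZeroDivisors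

noncomputable section

namespace SubformZeta

open Module

namespace QuadData

variable {V : Type*} [AddCommGroup V] [Module ℚ V] {F : Type*} [Field F] [NumberField F]
  (S : QuadData F) {Q : QuadraticForm ℚ V} (φ : V ≃ₗ[ℚ] F) {L : AddSubgroup V}
  {I : Ideal (𝓞 F)} {α : ℚ}

lemma finite_embSet (S : QuadData F) (hα : α ≠ 0) (hφ : ∀ v, Algebra.norm ℚ (φ v) = α * Q v)
    (hLI : transport φ L = toLattice I) (hI : I ≠ ⊥) (K : Sub L) :
    (embSet (orthogonalGroup Q : Set (V ≃ₗ[ℚ] V)) L K.1).Finite := by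
  have hK : transport φ K.1 ≠ ⊥ := by
    refine S.ne_bot_of_relIndex_ne_zero hI (K := transport φ K.1) ?_ ?_
    · rw [← hLI, transport_le_iff]
      exact K.2.1
    · rw [← hLI, relIndex_transport]
      exact K.2.2
  refine (((S.embSet_rot φ hα hφ hLI K.1).2 (S.finite_embRot I hK)).union
    ((S.embSet_refl φ hα hφ hLI K.1).2 (S.finite_embRefl I hK))).subset ?_
  rintro σ ⟨h1, h2⟩
  by_cases h : σ ∈ rotationGroup Q
  · exact Or.inl ⟨h, h2⟩
  · exact Or.inr ⟨⟨h1, h⟩, h2⟩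

lemma ncard_embSet (hα : α ≠ 0) (hφ : ∀ v, Algebra.norm ℚ (φ v) = α * Q v)
    (hLI : transport φ L = toLattice I) (hI : I ≠ ⊥) (K : Sub L) :
    (embSet (orthogonalGroup Q : Set (V ≃ₗ[ℚ] V)) L K.1).ncard =
      (S.embRot I (transport φ K.1)).ncard + (S.embRefl I (transport φ K.1)).ncard := by
  rw [ncard_emb_add Q K (S.finite_embSet φ hα hφ hLI hI K), (S.embSet_rot φ hα hφ hLI K.1).1,
    (S.embSet_refl φ hα hφ hLI K.1).1]

lemma tsum_sub_eq (hLI : transport φ L = toLattice I) (s : ℂ) (f : AddSubgroup F → ℂ) :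
    ∑' K : Sub L, (K.1.relIndex L : ℂ) ^ (-s) * f (transport φ K.1) =
      ∑' K : Lat (fun _ => True) (toLattice I),
        (K.1.relIndex (toLattice I) : ℂ) ^ (-s) * f K.1 := by
  rw [← (subEquiv φ hLI).tsum_eq]
  refine tsum_congr fun K => ?_
  rw [relIndex_subEquiv]
  rfl

lemma summable_sub_iff (hLI : transport φ L = toLattice I) (s : ℂ) (f : AddSubgroup F → ℂ) :
    (Summable fun K : Sub L => (K.1.relIndex L : ℂ) ^ (-s) * f (transport φ K.1)) ↔
      Summable fun K : Lat (fun _ => True) (toLattice I) =>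
        (K.1.relIndex (toLattice I) : ℂ) ^ (-s) * f K.1 := by
  rw [← (subEquiv φ hLI).summable_iff]
  refine summable_congr fun K => ?_
  rw [Function.comp_apply, relIndex_subEquiv]
  rfl

variable {s : ℂ}

lemma hasSum_numClasses_rotationGroup (hα : α ≠ 0)
    (hφ : ∀ v, Algebra.norm ℚ (φ v) = α * Q v)
    (hLI : transport φ L = toLattice I) (hI : I ≠ ⊥)
    (hL : ∀ m ≠ 0, (sublattices L m).Finite)
    (hG : ∀ K : Sub L, ∀ σ ∈ orthogonalGroup Q, image σ K.1 ≤ L →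
      (image σ K.1).relIndex L = K.1.relIndex L)
    (hs : Summable fun K : Sub L => (K.1.relIndex L : ℂ) ^ (-s)) :
    LSeriesHasSum (fun m => (numClasses (rotationGroup Q) L m : ℂ)) s
      (∑' K : Sub L, (K.1.relIndex L : ℂ) ^ (-s) *
        ((S.stabRot (transport φ K.1)).ncard / (S.embRot I (transport φ K.1)).ncard)) := by
  have h := hasSum_numClasses_LSeries (rotationGroup Q) hL
    (fun K => (S.finite_embSet φ hα hφ hLI hI K).subset fun σ h => ⟨rotationGroup_le Q h.1, h.2⟩)
    (fun K σ hσ => hG K σ (rotationGroup_le Q hσ)) hs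
  simp only [S.ncard_stabSet_rot φ hα hφ, (S.embSet_rot φ hα hφ hLI _).1] at h
  exact h

lemma hasSum_numClasses_orthogonalGroup (hα : α ≠ 0)
    (hφ : ∀ v, Algebra.norm ℚ (φ v) = α * Q v)
    (hLI : transport φ L = toLattice I) (hI : I ≠ ⊥)
    (hL : ∀ m ≠ 0, (sublattices L m).Finite)
    (hG : ∀ K : Sub L, ∀ σ ∈ orthogonalGroup Q, image σ K.1 ≤ L →
      (image σ K.1).relIndex L = K.1.relIndex L)
    (hs : Summable fun K : Sub L => (K.1.relIndex L : ℂ) ^ (-s)) :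
    LSeriesHasSum (fun m => (numClasses (orthogonalGroup Q) L m : ℂ)) s
      (∑' K : Sub L, (K.1.relIndex L : ℂ) ^ (-s) *
        (((S.stabRot (transport φ K.1)).ncard + (S.stabRefl (transport φ K.1)).ncard) /
          ((S.embRot I (transport φ K.1)).ncard + (S.embRefl I (transport φ K.1)).ncard))) := by
  have h := hasSum_numClasses_LSeries (orthogonalGroup Q) hL
    (S.finite_embSet φ hα hφ hLI hI) hG hs
  simp only [S.ncard_embSet φ hα hφ hLI hI, ncard_stab_add Q _ (S.finite_embSet φ hα hφ hLI hI _),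
    S.ncard_stabSet_rot φ hα hφ, S.ncard_stabSet_refl φ hα hφ, Nat.cast_add] at h
  exact h

lemma hasSum_zSum_reflectionSet (hα : α ≠ 0) (hφ : ∀ v, Algebra.norm ℚ (φ v) = α * Q v)
    (hLI : transport φ L = toLattice I) (hI : I ≠ ⊥)
    (hs : Summable fun K : Sub L => (K.1.relIndex L : ℂ) ^ (-s)) :
    HasSum (fun ρ : reflectionSet Q => zSum Q L ρ s) (∑' K : Sub L, (K.1.relIndex L : ℂ) ^ (-s) *
      S.reflTerm I (transport φ K.1)) := by
  have h := hasSum_zSum Q hs (S.finite_embSet φ hα hφ hLI hI) (P := reflectionSet Q)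
    (fun _ h => h.1)
  simp only [S.ncard_embSet φ hα hφ hLI hI, S.ncard_stabSet_refl φ hα hφ, Nat.cast_add] at h
  exact h

lemma hasSum_zSum_rotationGroup (hα : α ≠ 0) (hφ : ∀ v, Algebra.norm ℚ (φ v) = α * Q v)
    (hLI : transport φ L = toLattice I) (hI : I ≠ ⊥)
    (hs : Summable fun K : Sub L => (K.1.relIndex L : ℂ) ^ (-s)) :
    HasSum (fun ρ : {ρ : V ≃ₗ[ℚ] V // ρ ∈ rotationGroup Q ∧ IsOfFinOrder ρ} => zSum Q L ρ s)
      (∑' K : Sub L, (K.1.relIndex L : ℂ) ^ (-s) * ((S.stabRot (transport φ K.1)).ncard /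
        ((S.embRot I (transport φ K.1)).ncard + (S.embRefl I (transport φ K.1)).ncard))) := by
  have hfin := S.finite_embSet φ hα hφ hLI hI
  have h := hasSum_zSum Q hs hfin
    (P := {ρ : V ≃ₗ[ℚ] V | ρ ∈ rotationGroup Q ∧ IsOfFinOrder ρ})
    (fun _ h => rotationGroup_le Q h.1)
  -- The restriction to finite order loses nothing: the stabilizer of a lattice is finite.
  have e : ∀ K : Sub L, stabSet {ρ : V ≃ₗ[ℚ] V | ρ ∈ rotationGroup Q ∧ IsOfFinOrder ρ} K.1 =
      stabSet (rotationGroup Q : Set (V ≃ₗ[ℚ] V)) K.1 := by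
    intro K
    ext σ
    refine ⟨fun h => ⟨h.1.1, h.2⟩, fun h => ⟨⟨h.1, ?_⟩, h.2⟩⟩
    exact isOfFinOrder_of_finite_stab (rotationGroup Q) ((hfin K).subset
      fun σ h => ⟨rotationGroup_le Q h.1, h.2.le.trans K.2.1⟩) h.1 h.2
  simp only [e, S.ncard_embSet φ hα hφ hLI hI, S.ncard_stabSet_rot φ hα hφ, Nat.cast_add] at h
  exact h

lemma norm_stabRot_div_le {K : AddSubgroup F} (hK : K ≤ toLattice I) (hK0 : K ≠ ⊥) :
    ‖((S.stabRot K).ncard : ℂ) / (S.embRot I K).ncard‖ ≤ 1 :=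
  norm_natCast_div_le_one (Set.ncard_le_ncard (S.stabRot_subset hK) (S.finite_embRot I hK0))

lemma norm_stabRot_div_add_le {K : AddSubgroup F} (hK : K ≤ toLattice I) (hK0 : K ≠ ⊥) :
    ‖((S.stabRot K).ncard : ℂ) / ((S.embRot I K).ncard + (S.embRefl I K).ncard)‖ ≤ 1 := by
  rw [← Nat.cast_add]
  exact norm_natCast_div_le_one ((Set.ncard_le_ncard (S.stabRot_subset hK)
    (S.finite_embRot I hK0)).trans (Nat.le_add_right _ _))

lemma norm_reflTerm_le {K : AddSubgroup F} (hK : K ≤ toLattice I) (hK0 : K ≠ ⊥) :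
    ‖S.reflTerm I K‖ ≤ 1 := by
  rw [reflTerm, ← Nat.cast_add]
  exact norm_natCast_div_le_one ((Set.ncard_le_ncard (S.stabRefl_subset hK)
    (S.finite_embRefl I hK0)).trans (Nat.le_add_left _ _))

lemma summable_weight_transport (S : QuadData F) (hLI : transport φ L = toLattice I) (hI : I ≠ ⊥)
    (hs : Summable fun K : Sub L => (K.1.relIndex L : ℂ) ^ (-s)) {f : AddSubgroup F → ℂ}
    (hf : ∀ K, K ≤ toLattice I → K ≠ ⊥ → ‖f K‖ ≤ 1) :
    Summable fun K : Sub L => (K.1.relIndex L : ℂ) ^ (-s) * f (transport φ K.1) := by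
  refine summable_weight_mul hs (C := 1) fun K => ?_
  have h : transport φ K.1 ≤ toLattice I := by
    rw [← hLI, transport_le_iff]
    exact K.2.1
  refine hf _ h (S.ne_bot_of_relIndex_ne_zero hI h ?_)
  rw [← hLI, relIndex_transport]
  exact K.2.2

lemma summable_reflTerm (hLI : transport φ L = toLattice I) (hI : I ≠ ⊥)
    (hs : Summable fun K : Sub L => (K.1.relIndex L : ℂ) ^ (-s)) :
    Summable fun K : Lat (fun _ => True) (toLattice I) =>
      (K.1.relIndex (toLattice I) : ℂ) ^ (-s) * S.reflTerm I K.1 :=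
  (summable_sub_iff φ hLI s _).1
    (S.summable_weight_transport φ hLI hI hs fun _ h h0 => S.norm_reflTerm_le h h0)

/-- The first sum is `Rot_L(s)` and the second `ζ_L⁺(s)`, so the series of `rotTerm` measures
`Rot_L(s) - ½ ζ_L⁺(s)`. -/
lemma hasSum_rotTerm (hLI : transport φ L = toLattice I) (hI : I ≠ ⊥)
    (hs : Summable fun K : Sub L => (K.1.relIndex L : ℂ) ^ (-s)) :
    HasSum (fun K : Lat (fun _ => True) (toLattice I) =>
      (K.1.relIndex (toLattice I) : ℂ) ^ (-s) * S.rotTerm I K.1)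
      ((∑' K : Sub L, (K.1.relIndex L : ℂ) ^ (-s) * ((S.stabRot (transport φ K.1)).ncard /
        ((S.embRot I (transport φ K.1)).ncard + (S.embRefl I (transport φ K.1)).ncard))) -
        1 / 2 * ∑' K : Sub L, (K.1.relIndex L : ℂ) ^ (-s) *
          ((S.stabRot (transport φ K.1)).ncard / (S.embRot I (transport φ K.1)).ncard)) := by
  have h1 := S.summable_weight_transport φ hLI hI hs
    (f := fun K => ((S.stabRot K).ncard : ℂ) / ((S.embRot I K).ncard + (S.embRefl I K).ncard))
    fun _ h h0 => S.norm_stabRot_div_add_le h h0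
  have h2 := S.summable_weight_transport φ hLI hI hs
    (f := fun K => ((S.stabRot K).ncard : ℂ) / (S.embRot I K).ncard)
    fun _ h h0 => S.norm_stabRot_div_le h h0
  have h3 := h1.hasSum.sub (h2.hasSum.mul_left (1 / 2))
  rw [← (subEquiv φ hLI).hasSum_iff]
  refine hasSum_of_eq h3 (fun K => ?_) rfl
  rw [Function.comp_apply, relIndex_subEquiv]
  change _ * S.rotTerm I (transport φ K.1) = _
  rw [rotTerm]
  ring

lemma tsum_rotTerm_eq (hI : I ≠ ⊥) (hs : 2 < s.re)
    (hsum : Summable fun K : Lat (fun _ => True) (toLattice I) =>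
      (K.1.relIndex (toLattice I) : ℂ) ^ (-s) * S.rotTerm I K.1) :
    ∑' K : Lat (fun _ => True) (toLattice I),
      (K.1.relIndex (toLattice I) : ℂ) ^ (-s) * S.rotTerm I K.1 =
      zetaZ2 s / (2 * NumberField.dedekindZeta F s) *
        classSeries (fun n => classes I n \ conjClasses S.conj I n) s := by
  by_cases h : S.d = -1 ∨ S.d = -3
  · exact S.tsum_rotTerm_of_trivial hI (S.classGroup_eq_one h)
  · push Not at h
    exact S.tsum_rotTerm hI (fun ε hε => S.E_eq_one_or_neg_one h.1 h.2 hε) hs hsum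

lemma reflTotal_eq_oneModProduct_four (hI : I ≠ ⊥) (hs : 2 < s.re)
    (hsum : Summable fun K : Lat (fun _ => True) (toLattice I) =>
      (K.1.relIndex (toLattice I) : ℂ) ^ (-s) * S.reflTerm I K.1)
    (hd : S.d = -1) : S.reflTotal I s =
      1 / 2 * (1 + 2 ^ (-2 * s)) * riemannZeta s ^ 2 * oneModProduct 4 s := by
  rw [S.reflTotal_of_eq_neg_one hI hs hsum hd, S.classSeries_of_eq_neg_one hd hI hs]
  have := zeta_two_mul_ne_zero hs
  have := ramifiedProduct_ne_zero F (s := s) (by linarith)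
  field_simp

lemma reflTotal_eq_oneModProduct_three (hI : I ≠ ⊥) (hs : 2 < s.re)
    (hsum : Summable fun K : Lat (fun _ => True) (toLattice I) =>
      (K.1.relIndex (toLattice I) : ℂ) ^ (-s) * S.reflTerm I K.1)
    (hd : S.d = -3) : S.reflTotal I s =
      1 / 2 * (1 - 2 ^ (-s) + 2 * 2 ^ (-2 * s)) * riemannZeta s ^ 2 * oneModProduct 3 s := by
  rw [S.reflTotal_of_emod_eq_one hI hs hsum (by rw [hd]; rfl),
    S.classSeries_of_eq_neg_three hd hI hs]
  have := zeta_two_mul_ne_zero hs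
  have := ramifiedProduct_ne_zero F (s := s) (by linarith)
  set z := riemannZeta (2 * s)
  field_simp

/-! ### The ideal of a quadratic form -/

/-- A lattice that is stable under multiplication by `ω` comes from an ideal. -/
lemma exists_ideal {M : AddSubgroup F} (hint : ∀ x ∈ M, IsIntegral ℤ x)
    (hω : ∀ x ∈ M, S.ω * x ∈ M) : ∃ I : Ideal (𝓞 F), toLattice I = M := by
  refine ⟨⟨⟨⟨{x | algebraMap (𝓞 F) F x ∈ M}, ?_⟩, ?_⟩, ?_⟩, ?_⟩
  · intro x y hx hy
    change algebraMap (𝓞 F) F (x + y) ∈ M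
    rw [map_add]
    exact M.add_mem hx hy
  · change algebraMap (𝓞 F) F 0 ∈ M
    rw [map_zero]
    exact M.zero_mem
  · intro r x hx
    change algebraMap (𝓞 F) F (r * x) ∈ M
    obtain ⟨m, n, h⟩ := S.exists_ω_coord r.isIntegral_coe
    have e : algebraMap (𝓞 F) F (r * x) = m • algebraMap (𝓞 F) F x +
        n • (S.ω * algebraMap (𝓞 F) F x) := by
      rw [map_mul, h, zsmul_eq_mul, zsmul_eq_mul]
      ring
    rw [e]
    exact M.add_mem (M.zsmul_mem hx m) (M.zsmul_mem (hω _ hx) n)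
  · ext x
    constructor
    · rintro ⟨y, hy, rfl⟩
      exact hy
    · intro hx
      obtain ⟨y, rfl⟩ := exists_coe_eq (hint x hx)
      exact ⟨y, hx, rfl⟩

lemma sq_ω_sub_conj : (S.ω - S.conj S.ω) ^ 2 = (NumberField.discr F : F) := by
  have h4 := S.t_add_one_ne_zero
  rw [S.ω_coord, S.conj_coord, S.discr_eq]
  push_cast
  rcases S.t_eq with ⟨ht, h⟩ | ⟨ht, h⟩
  · rw [if_pos h, ht]
    push_cast
    field_simp
    linear_combination 4 * S.sq
  · rw [if_neg h, ht]
    push_cast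
    field_simp
    linear_combination 4 * S.sq

lemma discr_neg (S : QuadData F) : NumberField.discr F < 0 := by
  have := S.neg
  rw [S.discr_eq]
  split_ifs <;> omega

lemma sqrt_discr_ne_zero (S : QuadData F) {r : F} (hr : r ^ 2 = (NumberField.discr F : F)) :
    r ≠ 0 := by
  rintro rfl
  have : ((NumberField.discr F : ℤ) : F) = 0 := by rw [← hr]; ring
  exact S.discr_neg.ne (by exact_mod_cast this)

lemma conj_sqrt_discr {r : F} (hr : r ^ 2 = (NumberField.discr F : F)) : S.conj r = -r := by
  have h1 : r ^ 2 = (S.ω - S.conj S.ω) ^ 2 := by rw [hr, S.sq_ω_sub_conj]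
  rcases sq_eq_sq_iff_eq_or_eq_neg.1 h1 with h | h <;> rw [h] <;> simp

section Form

variable {a b c : ℤ} {r : F}

lemma half_sub_add_conj (hr : r ^ 2 = (NumberField.discr F : F)) :
    ((b : F) - r) / 2 + S.conj (((b : F) - r) / 2) = b := by
  rw [map_div₀, map_sub, map_intCast, map_ofNat, S.conj_sqrt_discr hr]
  ring

lemma half_sub_mul_conj (hr : r ^ 2 = (NumberField.discr F : F))
    (hD : NumberField.discr F = b ^ 2 - 4 * a * c) :
    ((b : F) - r) / 2 * S.conj (((b : F) - r) / 2) = a * c := by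
  rw [hD] at hr
  push_cast at hr
  rw [map_div₀, map_sub, map_intCast, map_ofNat, S.conj_sqrt_discr
    (by rw [hr, hD]; push_cast; ring)]
  linear_combination (-1 / 4) * hr

/-- `ω` and `(b - √D) / 2` differ by an integer, up to sign. -/
lemma exists_ω_eq (hr : r ^ 2 = (NumberField.discr F : F))
    (hD : NumberField.discr F = b ^ 2 - 4 * a * c) :
    ∃ m ε : ℤ, S.ω = m + ε * (((b : F) - r) / 2) := by
  have h1 := S.half_sub_add_conj (b := b) hr
  have h2 := S.half_sub_mul_conj hr hD
  obtain ⟨m, n, h⟩ := S.exists_ω_coord (S.isIntegral_of_trace_norm (m := b) (n := a * c) h1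
    (by rw [h2]; push_cast; ring))
  set τ := ((b : F) - r) / 2 with hτ
  -- `ω - ω̄` and `τ - τ̄` both have the discriminant as their square, so `τ = m + nω` has `n = ±1`.
  have h3 : (n : F) ^ 2 * NumberField.discr F = NumberField.discr F := by
    rw [← S.sq_ω_sub_conj, ← mul_pow]
    have h4 : n * (S.ω - S.conj S.ω) = τ - S.conj τ := by
      rw [h, map_add, map_mul, map_intCast, map_intCast]
      ring
    rw [h4, S.sq_ω_sub_conj, ← hr, hτ, map_div₀, map_sub, map_intCast, map_ofNat,
      S.conj_sqrt_discr hr]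
    ring
  have h5 : n ^ 2 = 1 := by
    have h6 : n ^ 2 * NumberField.discr F = NumberField.discr F := by exact_mod_cast h3
    exact (mul_eq_right₀ S.discr_neg.ne).1 h6
  refine ⟨-n * m, n, ?_⟩
  have h7 : (n : F) ^ 2 = 1 := by exact_mod_cast h5
  rw [h]
  push_cast
  linear_combination (-S.ω) * h7

/-- The lattice `ℤ a + ℤ (b - √D) / 2` is an ideal. -/
lemma exists_ideal_of_form (S : QuadData F) (hr : r ^ 2 = (NumberField.discr F : F))
    (hD : NumberField.discr F = b ^ 2 - 4 * a * c) :
    ∃ I : Ideal (𝓞 F), toLattice I = AddSubgroup.closure {(a : F), ((b : F) - r) / 2} := by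
  have h1 := S.half_sub_add_conj (b := b) hr
  have h2 := S.half_sub_mul_conj hr hD
  obtain ⟨m, ε, h⟩ := S.exists_ω_eq hr hD
  have hτ : IsIntegral ℤ (((b : F) - r) / 2) :=
    S.isIntegral_of_trace_norm (m := b) (n := a * c) h1 (by rw [h2]; push_cast; ring)
  set τ := ((b : F) - r) / 2
  have h3 : τ * τ = b * τ - a * c := by linear_combination τ * h1 - h2
  refine S.exists_ideal (fun x hx => ?_) fun x hx => ?_ <;>
    obtain ⟨k, l, rfl⟩ := AddSubgroup.mem_closure_pair.1 hx
  · rw [zsmul_eq_mul, zsmul_eq_mul]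
    have hint : ∀ n : ℤ, IsIntegral ℤ (n : F) := fun n => isIntegral_algebraMap (R := ℤ) (x := n)
    exact ((hint k).mul (hint a)).add ((hint l).mul hτ)
  -- The coefficients come from expanding `(m + ετ)(ka + lτ)` with `τ² = bτ - ac`.
  · refine AddSubgroup.mem_closure_pair.2 ⟨m * k - ε * l * c, m * l + ε * k * a + ε * l * b, ?_⟩
    simp only [zsmul_eq_mul, h]
    push_cast
    linear_combination (-(ε : F) * l) * h3

lemma exists_basis_of_form (S : QuadData F) (ha : a ≠ 0) (hr : r ^ 2 = (NumberField.discr F : F)) :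
    ∃ f : Basis (Fin 2) ℚ F, f 0 = a ∧ f 1 = ((b : F) - r) / 2 := by
  have hli : LinearIndependent ℚ ![(a : F), ((b : F) - r) / 2] := by
    rw [LinearIndependent.pair_iff]
    intro x y h
    rw [Rat.smul_def, Rat.smul_def] at h
    have h1 := congrArg S.conj h
    rw [map_add, map_mul, map_mul, map_ratCast, map_ratCast, map_intCast, map_div₀, map_sub,
      map_intCast, map_ofNat, S.conj_sqrt_discr hr, map_zero] at h1
    have h2 : (y : F) * r = 0 := by linear_combination h1 - h
    have hy : y = 0 := by
      simpa using (mul_eq_zero.1 h2).resolve_right (S.sqrt_discr_ne_zero hr)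
    subst hy
    refine ⟨?_, rfl⟩
    have ha' : (a : F) ≠ 0 := by exact_mod_cast ha
    simpa [ha'] using h
  refine ⟨basisOfLinearIndependentOfCardEqFinrank hli (by simp [S.finrank]), ?_, ?_⟩ <;> simp

/-- For `τ = (b - √D)/2` one has `τ + τ̄ = b` and `τ τ̄ = ac`. -/
lemma norm_of_form (S : QuadData F) (hr : r ^ 2 = (NumberField.discr F : F))
    (hD : NumberField.discr F = b ^ 2 - 4 * a * c) (x y : ℚ) :
    Algebra.norm ℚ ((x : F) * a + y * (((b : F) - r) / 2)) =
      a * (x ^ 2 * a + x * y * b + y ^ 2 * c) := by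
  have h1 := S.half_sub_add_conj (b := b) hr
  have h2 := S.half_sub_mul_conj hr hD
  set τ := ((b : F) - r) / 2
  have h := S.norm_eq ((x : F) * a + y * τ)
  have e : S.conj ((x : F) * a + y * τ) = x * a + y * S.conj τ := by simp
  rw [e] at h
  have h3 : ((Algebra.norm ℚ ((x : F) * a + y * τ) : ℚ) : F) =
      ((a * (x ^ 2 * a + x * y * b + y ^ 2 * c) : ℚ) : F) := by
    rw [h]
    push_cast
    linear_combination (x * y * a : F) * h1 + (y : F) ^ 2 * h2
  exact_mod_cast h3

end Form

end QuadData

section Form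

variable {V : Type*} [AddCommGroup V] [Module ℚ V] {Q : QuadraticForm ℚ V}

lemma apply_smul_add_smul (v w : V) (x y : ℚ) :
    Q (x • v + y • w) = x ^ 2 * Q v + x * y * QuadraticMap.polar Q v w + y ^ 2 * Q w := by
  rw [QuadraticMap.map_add Q, QuadraticMap.map_smul, QuadraticMap.map_smul,
    QuadraticMap.polar_smul_left, QuadraticMap.polar_smul_right]
  simp only [smul_eq_mul]
  ring

lemma four_mul_det_gramMatrix (e : Fin 2 → V) : -4 * (gramMatrix Q e).det =
    QuadraticMap.polar Q (e 0) (e 1) ^ 2 - 4 * Q (e 0) * Q (e 1) := by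
  rw [Matrix.det_fin_two]
  simp only [gramMatrix, Matrix.of_apply, bil, QuadraticMap.polar_self,
    QuadraticMap.polar_comm Q (e 1) (e 0), nsmul_eq_mul]
  push_cast
  ring

end Form

end SubformZeta

end

/-! ### The theorem -/

open SubformZeta in
theorem theorem1p3
    -- `V` is a positive definite quadratic space, `L = ℤe₀ + ℤe₁` is a binary lattice on it,
    -- with `Q(x e₀ + y e₁) = a x² + b x y + c y²`, where `a, b, c` are integers
    {V : Type*} [AddCommGroup V] [Module ℚ V] (Q : QuadraticForm ℚ V) (hQ : Q.PosDef)
    (e : Module.Basis (Fin 2) ℚ V) (L : AddSubgroup V)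
    (hL : L = AddSubgroup.closure (Set.range e))
    (a b c : ℤ) (ha : Q (e 0) = a) (hb : QuadraticMap.polar Q (e 0) (e 1) = b)
    (hc : Q (e 1) = c)
    -- `F = ℚ(√d)` is the imaginary quadratic field of discriminant `D = -4 d_L`
    {F : Type*} [Field F] [NumberField F] (hF : Module.finrank ℚ F = 2)
    (hD : (NumberField.discr F : ℚ) = -4 * (gramMatrix Q e).det)
    (d : ℤ) (hd : Squarefree d) (hd0 : d < 0) (hdF : ∃ θ : F, θ ^ 2 = (d : F))
    -- a square root of `D` in `F`
    (sqrtD : F) (hsqrtD : sqrtD ^ 2 = (NumberField.discr F : F))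
    -- complex conjugation on `F`
    (conj : F ≃ₐ[ℚ] F) (hconj : conj ≠ AlgEquiv.refl) :
    ∃ I : Ideal (𝓞 F),
      toLattice I = AddSubgroup.closure {(a : F), ((b : F) - sqrtD) / 2} ∧
      ∀ s : ℂ, 2 < s.re →
        -- convergence of the series on the left and of the sums of the terms `Z_{L,ρ}(s)`
        LSeriesSummable (fun m => (numClasses (orthogonalGroup Q) L m : ℂ)) s ∧
        LSeriesSummable (fun m => (numClasses (rotationGroup Q) L m : ℂ)) s ∧
        (∀ ρ ∈ orthogonalGroup Q, IsOfFinOrder ρ →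
          Summable fun K : invariantSublattices L ρ => zTerm Q L s K) ∧
        Summable (fun ρ : reflectionSet Q => zSum Q L ρ s) ∧
        -- the decomposition
        glZeta Q L s = rot Q L s + refl Q L s ∧
        -- the rotational terms
        rot Q L s = 1 / 2 * slZeta Q L s +
          zetaZ2 s / (2 * NumberField.dedekindZeta F s) *
            classSeries (fun n => classes I n \ conjClasses conj I n) s ∧
        -- the reflection terms
        (d = -3 → refl Q L s =
          1 / 2 * (1 - 2 ^ (-s) + 2 * 2 ^ (-2 * s)) * riemannZeta s ^ 2 *
            oneModProduct 3 s) ∧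
        (d = -1 → refl Q L s =
          1 / 2 * (1 + 2 ^ (-2 * s)) * riemannZeta s ^ 2 * oneModProduct 4 s) ∧
        (d ≡ 1 [ZMOD 4] → d ≠ -3 → refl Q L s =
          (1 - 2 ^ (-s) + 2 * 2 ^ (-2 * s)) * riemannZeta s ^ 2 /
              (2 * riemannZeta (2 * s) * ramifiedProduct F s) *
            classSeries (selfConjClasses conj I) s) ∧
        (d ≡ 2 [ZMOD 4] → refl Q L s =
          (1 - 2 ^ (-s) + 2 * 2 ^ (-2 * s)) * riemannZeta s ^ 2 /
              (2 * riemannZeta (2 * s) * ramifiedProduct F s) *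
            classSeries (selfConjClasses conj I) s +
          (2 ^ (-s) - 2 ^ (-2 * s)) * riemannZeta s ^ 2 /
              (riemannZeta (2 * s) * ramifiedProduct F s) *
            classSeries (fun n => classes I n ∩ ramGroup F) s) ∧
        (d ≡ 3 [ZMOD 4] → d ≠ -1 → refl Q L s =
          (1 - 2 ^ (-s) + 2 * 2 ^ (-2 * s)) * riemannZeta s ^ 2 /
              (2 * riemannZeta (2 * s) * ramifiedProduct F s) *
            classSeries (selfConjClasses conj I) s +
          2 ^ (-s) * riemannZeta s ^ 2 / (riemannZeta (2 * s) * ramifiedProduct F s) *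
            classSeries (fun n => classes I n ∩ orthoGroup F) s -
          2 ^ (-2 * s) * riemannZeta s ^ 2 / (riemannZeta (2 * s) * ramifiedProduct F s) *
            classSeries (fun n => classes I n ∩ (ramGroup F \ orthoGroup F)) s) := by
  change L = latticeOf e at hL
  subst hL
  obtain ⟨θ, hθ⟩ := hdF
  let S : QuadData F := ⟨d, θ, conj, hd, hd0, hθ, hF, hconj⟩
  have hDab : NumberField.discr F = b ^ 2 - 4 * a * c := by
    rw [four_mul_det_gramMatrix, ha, hb, hc] at hD
    exact_mod_cast hD
  have ha0 : a ≠ 0 := by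
    have h := hQ (e 0) (e.ne_zero 0)
    rw [ha] at h
    exact_mod_cast h.ne'
  have haq : (a : ℚ) ≠ 0 := by exact_mod_cast ha0
  obtain ⟨f, hf0, hf1⟩ := S.exists_basis_of_form (b := b) ha0 hsqrtD
  obtain ⟨I, hI⟩ := S.exists_ideal_of_form hsqrtD hDab
  refine ⟨I, hI, fun s hs => ?_⟩
  -- This identification makes `aQ` the norm form and `L` the ideal `I`. Positive definiteness
  -- enters through `a = Q(e₀) ≠ 0`.
  set φ : V ≃ₗ[ℚ] F := e.equiv f (Equiv.refl _) with hφdef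
  have hφe : ∀ i, φ (e i) = f i := fun i => by simp [hφdef]
  have hφ : ∀ v, Algebra.norm ℚ (φ v) = a * Q v := by
    intro v
    have hv : v = e.repr v 0 • e 0 + e.repr v 1 • e 1 := by
      conv_lhs => rw [← e.sum_repr v, Fin.sum_univ_two]
    rw [hv, apply_smul_add_smul, map_add, map_smul, map_smul, hφe, hφe, hf0, hf1, Rat.smul_def,
      Rat.smul_def, S.norm_of_form hsqrtD hDab, ha, hb, hc]
  have hLI : QuadData.transport φ (latticeOf e) = toLattice I := by
    rw [hI, latticeOf, QuadData.transport, AddMonoidHom.map_closure, ← Set.range_comp]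
    congr 1
    ext x
    rw [Set.mem_range, Fin.exists_fin_two]
    change (φ (e 0) = x ∨ φ (e 1) = x) ↔ _
    rw [hφe, hφe, hf0, hf1, Set.mem_insert_iff, Set.mem_singleton_iff, eq_comm,
      eq_comm (b := x)]
  have hI0 : I ≠ ⊥ := by
    rw [← toLattice_ne_bot_iff, hI]
    intro h
    have h1 : (a : F) ∈ (⊥ : AddSubgroup F) := by
      rw [← h]
      exact AddSubgroup.subset_closure (Or.inl rfl)
    rw [AddSubgroup.mem_bot] at h1
    exact ha0 (by exact_mod_cast h1)
  have hw := (hasSum_relIndex e hs).summable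
  have hfin := fun m (hm : m ≠ 0) => finite_sublattices e hm
  -- Isometries have determinant `±1`, so they preserve the index in `L`.
  have hG : ∀ K : SubformZeta.Sub (latticeOf e), ∀ σ ∈ orthogonalGroup Q, image σ K.1 ≤ latticeOf e →
      (image σ K.1).relIndex (latticeOf e) = K.1.relIndex (latticeOf e) := fun K σ hσ h =>
    relIndex_map_eq e K.2.1 K.2.2 σ (S.abs_det_eq_one φ haq hφ hσ) h
  have hO := S.hasSum_numClasses_orthogonalGroup φ haq hφ hLI hI0 hfin hG hw
  have hSO := S.hasSum_numClasses_rotationGroup φ haq hφ hLI hI0 hfin hG hw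
  have hRefl := S.hasSum_zSum_reflectionSet φ haq hφ hLI hI0 hw
  have hRot := S.hasSum_zSum_rotationGroup φ haq hφ hLI hI0 hw
  have hRT := S.hasSum_rotTerm φ hLI hI0 hw
  have hsum := S.summable_reflTerm φ hLI hI0 hw
  have hrefl : refl Q (latticeOf e) s = S.reflTotal I s :=
    hRefl.tsum_eq.trans (QuadData.tsum_sub_eq φ hLI s _)
  refine ⟨hO.LSeriesSummable, hSO.LSeriesSummable, fun ρ _ _ => summable_zTerm Q hw ρ,
    hRefl.summable, ?_, ?_, fun hd => hrefl.trans ?_, fun hd => hrefl.trans ?_,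
    fun hd _ => hrefl.trans ?_, fun hd => hrefl.trans ?_, fun hd hd1 => hrefl.trans ?_⟩
  · have h1 : rot Q (latticeOf e) s = _ := hRot.tsum_eq
    have h2 : refl Q (latticeOf e) s = _ := hRefl.tsum_eq
    have h3 : glZeta Q (latticeOf e) s = _ := hO.LSeries_eq
    rw [h1, h2, h3, ← Summable.tsum_add]
    · refine tsum_congr fun K => ?_
      rw [QuadData.reflTerm]
      ring
    · exact S.summable_weight_transport φ hLI hI0 hw
        (f := fun K => ((S.stabRot K).ncard : ℂ) / ((S.embRot I K).ncard + (S.embRefl I K).ncard))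
        fun _ h h0 => S.norm_stabRot_div_add_le h h0
    · exact S.summable_weight_transport φ hLI hI0 hw fun _ h h0 => S.norm_reflTerm_le h h0
  · have h1 : rot Q (latticeOf e) s = _ := hRot.tsum_eq
    have h2 : slZeta Q (latticeOf e) s = _ := hSO.LSeries_eq
    have h3 := hRT.tsum_eq
    rw [S.tsum_rotTerm_eq hI0 hs hRT.summable, ← h1, ← h2] at h3
    exact eq_add_of_sub_eq' h3.symm
  · exact S.reflTotal_eq_oneModProduct_three hI0 hs hsum hd
  · exact S.reflTotal_eq_oneModProduct_four hI0 hs hsum hd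
  · exact S.reflTotal_of_emod_eq_one hI0 hs hsum hd
  · exact S.reflTotal_of_emod_eq_two hI0 hs hsum hd
  · exact S.reflTotal_of_emod_eq_three hI0 hs hsum hd hd1
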